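/- **Error estimates for the Godunov method.** Let $d\in\{1,2,3\}$, $\gamma\in(1,2]$, $C_v=1/(\gamma-1)$, and let $\Omega\subset\mathbb R^d$ be a bounded domain (open, connected) with $\Omega=\mathrm{int}\,\overline\Omega$. *Euler system.* For a state $U=(\varrho,m,E)$ put $u=m/\varrho$, $p=(\gamma-1)(E-\frac{|m|^2}{2\varrho})$, $\vartheta=p/\varrho$, $\eta=C_v\varrho\ln(p/\varrho^\gamma)$, $q=\eta u$ and $F(U)n=\big(m\cdot n,\ (u\cdot n)\,m+p\,n,\ (u\cdot n)(E+p)\big)$. As functions of $(\varrho,\eta)$, $p=\varrho^\gamma e^{(\gamma-1)\eta/\varrho}$ and $\varrho e=p/(\gamma-1)$. A strong solution on $(0,T)\times\Omega$ is a triple $(\tilde\varrho,\tilde u,\tilde\eta)$, in $W^{1,\infty}((0,T)\times\Omega)$ and continuous on $[0,T]\times\overline\Omega$, with $\tilde\varrho>0$, $\tilde\vartheta>0$ on $[0,T]\times\overline\Omega$, such that $\tilde U=(\tilde\varrho,\tilde\varrho\tilde u,\frac12\tilde\varrho|\tilde u|^2+\tilde\varrho\tilde e)$ satisfies $\partial_t\tilde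 U+\mathrm{div}_xF(\tilde U)=0$ almost everywhere, and $\tilde u\cdot n=0$ at every point of $\partial\Omega$ that has a $C^1$ neighbourhood in $\partial\Omega$ with outer unit normal $n$. Put $U_0=\tilde U(0,\cdot)$. *Godunov method.* Let $\mathcal T_h$ be a finite mesh of $\Omega$ made of axis-parallel boxes that fit together face to face and whose closures cover $\overline\Omega$; $h$ is the largest cell diameter. A numerical solution is a function $U_h(t)=(\varrho_h,m_h,E_h)(t)$, $t\in[0,T]$, piecewise constant on $\mathcal T_h$, differentiable in $t$, with $\varrho_h>0$ and $p_h>0$, such that $U_h(0)=U_{h0}=\Pi_hU_0$ (cell averages) and, for every piecewise constant $\phi$ and every $t\in[0,T]$, $$\int_\Omega\phi\,\frac{d}{dt}U_h\,dx-\sum_{\sigma\ \mathrm{interior}}\int_\sigma F(U^{RP}_\sigma)n\,[[\phi]]\,dS+\sum_{\sigma\subset\partial\Omega}\int_\sigma F(U^{RP}_\sigma)n\,\phi\,dS=0 .$$ Here $U_\sigma^{RP}$ is the value on $\sigma$ of the exact (self-similar, bounded, entropy) solution of the Riemann problem in the normal direction $n$ between the two adjacent cell values; $[[\phi]]$ is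 the jump in the direction of $n$. On a face $\sigma\subset\partial\Omega$ with outer normal $n$ impermeability is imposed by taking the mirror image $(\varrho,\,m-2(m\cdot n)n,\,E)$ of the cell value as the outer state. *Relative energy.* $$\mathbb E(\varrho,m,\eta\,|\,\tilde\varrho,\tilde u,\tilde\eta)=\tfrac12\varrho\Big|\frac m\varrho-\tilde u\Big|^2+\varrho e-\frac{\partial(\varrho e)}{\partial\varrho}\Big|_{(\tilde\varrho,\tilde\eta)}(\varrho-\tilde\varrho)-\frac{\partial(\varrho e)}{\partial\eta}\Big|_{(\tilde\varrho,\tilde\eta)}(\eta-\tilde\eta)-\tilde\varrho\tilde e .$$ *Theorem.* For all $M\in\mathbb R$ and $\underline r,\underline\theta>0$ there is $c>0$, depending only on $d,\gamma,\Omega,M,\underline r,\underline\theta$, and for all $\underline\varrho,\overline E>0$, $C_0\ge0$ there is $C>0$, depending only on these and on $d,\gamma,\Omega,M,\underline r,\underline\theta$, such that the following holds for every $T>0$. Let $(\tilde\varrho,\tilde u,\tilde\eta)$ be a strong solution on $(0,T)\times\Omega$ with $\|\tilde U\|_{W^{1,\infty}((0,T)\times\Omega)}\le M$, $\tilde\varrho\ge\underline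 r$ and $\tilde\vartheta\ge\underline\theta$, and let $U_h$ be a numerical solution of the Godunov method on a mesh as above with $\|U_{h0}-U_0\|_{L^2(\Omega)}\le C_0h^{1/2}$ and $$\underline\varrho\le\varrho_h,\qquad 0<E_h\le\overline E\qquad\text{for all }t\in[0,T].$$ Then for every $\tau\in(0,T]$ the function $\mathbb E(\varrho_h,m_h,\eta_h\,|\,\tilde\varrho,\tilde u,\tilde\eta)(\tau,\cdot)$ is integrable on $\Omega$ and $$\big\|\mathbb E(\varrho_h,m_h,\eta_h\,|\,\tilde\varrho,\tilde u,\tilde\eta)(\tau,\cdot)\big\|_{L^1(\Omega)}\le C\,e^{c\,\tau}\,h^{1/2}.$$ -/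

import Mathlib

open Set Filter Topology MeasureTheory
open scoped ContDiff

noncomputable section

namespace EulerGodunov

/-- Physical space `ℝ^d` with its Euclidean norm. -/
abbrev Space (d : ℕ) := EuclideanSpace ℝ (Fin d)

/-- Space-time `ℝ × ℝ^d`; a point is `(t, x)`. -/
abbrev SpaceTime (d : ℕ) := ℝ × Space d

/-- Conservative states `U = (ρ, m, E)`: density, momentum, total energy. -/
abbrev State (d : ℕ) := ℝ × Space d × ℝ

/-- The `i`-th unit vector of `ℝ^d`. -/
def unitVec {d : ℕ} (i : Fin d) : Space d := EuclideanSpace.single i (1 : ℝ)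

/-! ### Thermodynamics of a perfect gas -/

/-- Square of the Euclidean length of a conservative state. -/
def stateNormSq {d : ℕ} (U : State d) : ℝ := U.1 ^ 2 + ‖U.2.1‖ ^ 2 + U.2.2 ^ 2

/-- Pressure of a conservative state: `p = (γ - 1) ρ e` with `ρ e = E - |m|² / (2 ρ)`. -/
def pressure {d : ℕ} (γ : ℝ) (U : State d) : ℝ :=
  (γ - 1) * (U.2.2 - ‖U.2.1‖ ^ 2 / (2 * U.1))

/-- Non-vacuum physical states: positive density and positive pressure. -/
def IsPhysical {d : ℕ} (γ : ℝ) (U : State d) : Prop := 0 < U.1 ∧ 0 < pressure γ U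

/-- The flux in direction `n`:
`F(U) n = (m ⬝ n, (u ⬝ n) m + p n, (u ⬝ n) (E + p))` with `u = m / ρ`.
At the vacuum state `U = 0` its value is `0`. -/
def flux {d : ℕ} (γ : ℝ) (n : Space d) (U : State d) : State d :=
  (inner ℝ U.2.1 n,
   (inner ℝ U.2.1 n / U.1) • U.2.1 + pressure γ U • n,
   inner ℝ U.2.1 n / U.1 * (U.2.2 + pressure γ U))

/-- Total physical entropy `η = C_v ρ S`, `C_v = 1 / (γ - 1)`, `S = log (p / ρ ^ γ)`.
At the vacuum state its value is `0`. -/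
def entropy {d : ℕ} (γ : ℝ) (U : State d) : ℝ :=
  1 / (γ - 1) * U.1 * Real.log (pressure γ U / U.1 ^ γ)

/-- Entropy flux in direction `n`: `q ⬝ n = η (u ⬝ n)`. -/
def entropyFlux {d : ℕ} (γ : ℝ) (n : Space d) (U : State d) : ℝ :=
  entropy γ U * (inner ℝ U.2.1 n / U.1)

/-- Pressure as a function of density and total entropy, `p = ρ ^ γ exp S` with
`S = (γ - 1) η / ρ`. -/
def pressureOf (γ ρ η : ℝ) : ℝ := ρ ^ γ * Real.exp ((γ - 1) * η / ρ)

/-- Absolute temperature `ϑ = p / ρ` as a function of density and total entropy. -/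
def temperatureOf (γ ρ η : ℝ) : ℝ := pressureOf γ ρ η / ρ

/-- Internal energy density `ρ e = p / (γ - 1)` as a function of density and total entropy. -/
def internalEnergyOf (γ ρ η : ℝ) : ℝ := pressureOf γ ρ η / (γ - 1)

/-- The conservative state with density `ρ`, velocity `u` and total entropy `η`. -/
def stateOf {d : ℕ} (γ ρ : ℝ) (u : Space d) (η : ℝ) : State d :=
  (ρ, ρ • u, 1 / 2 * ρ * ‖u‖ ^ 2 + internalEnergyOf γ ρ η)

/-- The relative energy `𝔼(ρ, m, η | r, v, s)`, where `(r, v, s)` are the density, the velocity and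
the total entropy of the reference flow. -/
def relativeEnergy {d : ℕ} (γ ρ : ℝ) (m : Space d) (η r : ℝ) (v : Space d) (s : ℝ) : ℝ :=
  1 / 2 * ρ * ‖ρ⁻¹ • m - v‖ ^ 2 + internalEnergyOf γ ρ η
    - deriv (fun a => internalEnergyOf γ a s) r * (ρ - r)
    - deriv (fun b => internalEnergyOf γ r b) s * (η - s)
    - internalEnergyOf γ r s

/-! ### Weak derivatives and `W^{1,∞}` -/

/-- `g` is the weak derivative of `f` on the open set `O` in the direction `v`. -/
def IsWeakDeriv {d : ℕ} (O : Set (SpaceTime d)) (v : SpaceTime d) (f g : SpaceTime d → ℝ) : Prop :=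
  LocallyIntegrableOn f O ∧ LocallyIntegrableOn g O ∧
    ∀ φ : SpaceTime d → ℝ, ContDiff ℝ ∞ φ → HasCompactSupport φ → tsupport φ ⊆ O →
      ∫ z in O, f z * fderiv ℝ φ z v = - ∫ z in O, g z * φ z

/-- The time direction. -/
def timeDir (d : ℕ) : SpaceTime d := (1, 0)

/-- The `i`-th spatial direction. -/
def spaceDir {d : ℕ} (i : Fin d) : SpaceTime d := (0, unitVec i)

/-- `f ∈ W^{1,∞}(O)` and `f`, `∂_t f`, `∂_{x_i} f` are bounded by `M` almost everywhere in `O`,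
that is, `‖f‖_{W^{1,∞}(O)} ≤ M`. -/
def W1infLE {d : ℕ} (O : Set (SpaceTime d)) (f : SpaceTime d → ℝ) (M : ℝ) : Prop :=
  (∀ᵐ z ∂(volume.restrict O), |f z| ≤ M) ∧
    (∃ g, IsWeakDeriv O (timeDir d) f g ∧ ∀ᵐ z ∂(volume.restrict O), |g z| ≤ M) ∧
    ∀ i : Fin d, ∃ g, IsWeakDeriv O (spaceDir i) f g ∧ ∀ᵐ z ∂(volume.restrict O), |g z| ≤ M

/-- `f ∈ W^{1,∞}(O)`. -/
def MemW1inf {d : ℕ} (O : Set (SpaceTime d)) (f : SpaceTime d → ℝ) : Prop := ∃ M, W1infLE O f M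

/-- `‖U‖_{W^{1,∞}(O)} ≤ M` for a field of conservative states (maximum over the components). -/
def StateW1infLE {d : ℕ} (O : Set (SpaceTime d)) (U : SpaceTime d → State d) (M : ℝ) : Prop :=
  W1infLE O (fun z => (U z).1) M ∧ (∀ j : Fin d, W1infLE O (fun z => (U z).2.1 j) M) ∧
    W1infLE O (fun z => (U z).2.2) M

/-- The equation `∂_t f₀ + ∑ᵢ ∂_{x_i} fᵢ = 0` holds almost everywhere in `O`, the derivatives being
weak derivatives. -/
def ConservationLaw {d : ℕ} (O : Set (SpaceTime d)) (f₀ : SpaceTime d → ℝ)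
    (f : Fin d → SpaceTime d → ℝ) : Prop :=
  ∃ (g₀ : SpaceTime d → ℝ) (g : Fin d → SpaceTime d → ℝ),
    IsWeakDeriv O (timeDir d) f₀ g₀ ∧ (∀ i, IsWeakDeriv O (spaceDir i) (f i) (g i)) ∧
      ∀ᵐ z ∂(volume.restrict O), g₀ z + ∑ i, g i z = 0

/-! ### Strong solutions -/

/-- `n` is the outer unit normal to `Ω` at `x`: near `x` the set `Ω` is `{g < 0}` for a `C¹`
function `g` with `g x = 0` whose gradient at `x` is a positive multiple of the unit vector `n`.
(Such an `n` exists exactly at the points of `∂Ω` near which the boundary is of class `C¹`.) -/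
def IsOuterNormal {d : ℕ} (Ω : Set (Space d)) (x n : Space d) : Prop :=
  ‖n‖ = 1 ∧ ∃ g : Space d → ℝ, ContDiffAt ℝ 1 g x ∧ g x = 0 ∧
    (∃ r : ℝ, 0 < r ∧ gradient g x = r • n) ∧ ∀ᶠ y in 𝓝 x, (y ∈ Ω ↔ g y < 0)

/-- The open space-time cylinder `(0,T) × Ω`. -/
def cylinder {d : ℕ} (Ω : Set (Space d)) (T : ℝ) : Set (SpaceTime d) := Ioo 0 T ×ˢ Ω

/-- `[0,T] × closure Ω`. -/
def closedCylinder {d : ℕ} (Ω : Set (Space d)) (T : ℝ) : Set (SpaceTime d) :=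
  Icc 0 T ×ˢ closure Ω

/-- `(ρ, u, η)` is a strong solution of the complete Euler system on `(0,T) × Ω` with impermeable
boundary: `W^{1,∞} ∩ C⁰` regularity, positive density and temperature on `[0,T] × closure Ω`, the
conservation laws of mass, momentum and energy almost everywhere, and `u ⬝ n = 0` on `∂Ω`. -/
structure IsStrongSolution {d : ℕ} (γ : ℝ) (Ω : Set (Space d)) (T : ℝ)
    (ρ : SpaceTime d → ℝ) (u : SpaceTime d → Space d) (η : SpaceTime d → ℝ) : Prop where
  continuousOn_density : ContinuousOn ρ (closedCylinder Ω T)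
  continuousOn_velocity : ContinuousOn u (closedCylinder Ω T)
  continuousOn_entropy : ContinuousOn η (closedCylinder Ω T)
  density_mem : MemW1inf (cylinder Ω T) ρ
  velocity_mem : ∀ j : Fin d, MemW1inf (cylinder Ω T) (fun z => u z j)
  entropy_mem : MemW1inf (cylinder Ω T) η
  density_pos : ∀ z ∈ closedCylinder Ω T, 0 < ρ z
  temperature_pos : ∀ z ∈ closedCylinder Ω T, 0 < temperatureOf γ (ρ z) (η z)
  mass : ConservationLaw (cylinder Ω T) (fun z => (stateOf γ (ρ z) (u z) (η z)).1)
    (fun i z => (flux γ (unitVec i) (stateOf γ (ρ z) (u z) (η z))).1)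
  momentum : ∀ j : Fin d,
    ConservationLaw (cylinder Ω T) (fun z => (stateOf γ (ρ z) (u z) (η z)).2.1 j)
      (fun i z => (flux γ (unitVec i) (stateOf γ (ρ z) (u z) (η z))).2.1 j)
  energy : ConservationLaw (cylinder Ω T) (fun z => (stateOf γ (ρ z) (u z) (η z)).2.2)
    (fun i z => (flux γ (unitVec i) (stateOf γ (ρ z) (u z) (η z))).2.2)
  impermeable : ∀ t ∈ Icc 0 T, ∀ x ∈ frontier Ω, ∀ n, IsOuterNormal Ω x n →
    inner ℝ (u (t, x)) n = 0

/-! ### The Riemann problem -/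

/-- `W` is the profile of the exact solution of the Riemann problem in direction `n` with left state
`UL` and right state `UR`: the self-similar function `U(t, y) = W (y / t)` of the time `t > 0` and
the coordinate `y` along `n` is a bounded entropy solution of `∂_t U + ∂_y (F(U) n) = 0` with these
initial data, where vacuum (`W = 0`) may occur. In the variable `ξ = y / t` the equation reads
`(F(W) n - ξ W)' + W = 0`, the entropy inequality `(q(W) ⬝ n - ξ η(W))' + η(W) ≥ 0`, both in the
sense of distributions, and the initial condition says that `W` equals `UL` far to the left and
`UR` far to the right. -/
structure IsRiemannSolution {d : ℕ} (γ : ℝ) (n : Space d) (UL UR : State d) (W : ℝ → State d) :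
    Prop where
  measurable : Measurable W
  bounded : ∃ B : ℝ, ∀ ξ, ‖W ξ‖ ≤ B
  physical : ∀ ξ, IsPhysical γ (W ξ) ∨ W ξ = 0
  flux_integrable : LocallyIntegrable (fun ξ => flux γ n (W ξ))
  entropy_integrable : LocallyIntegrable (fun ξ => entropy γ (W ξ))
  entropyFlux_integrable : LocallyIntegrable (fun ξ => entropyFlux γ n (W ξ))
  initial : ∃ s : ℝ, (∀ ξ, ξ ≤ -s → W ξ = UL) ∧ ∀ ξ, s ≤ ξ → W ξ = UR
  conservation : ∀ φ : ℝ → ℝ, ContDiff ℝ ∞ φ → HasCompactSupport φ →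
    ∫ ξ, (deriv φ ξ • (flux γ n (W ξ) - ξ • W ξ) - φ ξ • W ξ) = 0
  entropy_ineq : ∀ φ : ℝ → ℝ, ContDiff ℝ ∞ φ → HasCompactSupport φ → (∀ ξ, 0 ≤ φ ξ) →
    ∫ ξ, (deriv φ ξ * (entropyFlux γ n (W ξ) - ξ * entropy γ (W ξ)) - φ ξ * entropy γ (W ξ)) ≤ 0

/-- `V = U^{RP}` is the value along the interface `y = 0` of the exact solution of the Riemann
problem, i.e. a one-sided limit of its profile at `ξ = 0` (if the two one-sided limits differ, the
discontinuity is stationary and both have the same flux in direction `n`). -/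
def IsRiemannState {d : ℕ} (γ : ℝ) (n : Space d) (UL UR V : State d) : Prop :=
  ∃ W : ℝ → State d, IsRiemannSolution γ n UL UR W ∧
    (Tendsto W (𝓝[>] 0) (𝓝 V) ∨ Tendsto W (𝓝[<] 0) (𝓝 V))

/-- The mirror image of a state at a wall with unit normal `n`. -/
def mirror {d : ℕ} (n : Space d) (U : State d) : State d :=
  (U.1, U.2.1 - (2 * inner ℝ U.2.1 n) • n, U.2.2)

/-! ### Rectangular meshes -/

/-- A finite rectangular mesh of `Ω`: pairwise disjoint open axis-parallel boxes whose closures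
cover `closure Ω`, and which fit together face to face (two boxes that meet along a set of
dimension `d - 1` have a whole face in common). -/
structure RectMesh (d : ℕ) (Ω : Set (Space d)) where
  /-- number of cells -/
  N : ℕ
  /-- lower corners -/
  lo : Fin N → Space d
  /-- upper corners -/
  hi : Fin N → Space d
  lo_lt_hi : ∀ K i, lo K i < hi K i
  disjoint : ∀ K L, K ≠ L →
    Disjoint {x : Space d | ∀ i, x i ∈ Ioo (lo K i) (hi K i)}
      {x : Space d | ∀ i, x i ∈ Ioo (lo L i) (hi L i)}
  covers : closure Ω = ⋃ K, {x : Space d | ∀ i, x i ∈ Icc (lo K i) (hi K i)}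
  conforming : ∀ K L i, hi K i = lo L i →
    (∀ j, j ≠ i → max (lo K j) (lo L j) < min (hi K j) (hi L j)) →
      ∀ j, j ≠ i → lo K j = lo L j ∧ hi K j = hi L j

namespace RectMesh

variable {d : ℕ} {Ω : Set (Space d)} (𝒯 : RectMesh d Ω)

/-- The (open) cell `K`. -/
def cell (K : Fin 𝒯.N) : Set (Space d) := {x | ∀ i, x i ∈ Ioo (𝒯.lo K i) (𝒯.hi K i)}

/-- The mesh parameter `h`: the largest cell diameter. -/
def size : ℝ := ⨆ K, Metric.diam (𝒯.cell K)

/-- Lebesgue measure `|K|` of a cell. -/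
def vol (K : Fin 𝒯.N) : ℝ := ∏ i, (𝒯.hi K i - 𝒯.lo K i)

/-- Surface measure `|σ|` of the two faces of `K` orthogonal to the `i`-th direction. -/
def area (K : Fin 𝒯.N) (i : Fin d) : ℝ :=
  ∏ j ∈ Finset.univ.erase i, (𝒯.hi K j - 𝒯.lo K j)

/-- `L` is the neighbour of `K` in the positive `i`-th direction; the triples `(i, K, L)` with this
property enumerate the interior faces, with normal `unitVec i` pointing from `K` to `L`. -/
def Adj (i : Fin d) (K L : Fin 𝒯.N) : Prop :=
  𝒯.hi K i = 𝒯.lo L i ∧ ∀ j, j ≠ i → 𝒯.lo K j = 𝒯.lo L j ∧ 𝒯.hi K j = 𝒯.hi L j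

/-- The face of `K` in the positive (`s = true`) or negative (`s = false`) `i`-th direction lies on
the boundary of the domain: there is no neighbour behind it. -/
def IsWall (K : Fin 𝒯.N) (i : Fin d) (s : Bool) : Prop :=
  ∀ L, ¬ (if s then 𝒯.Adj i K L else 𝒯.Adj i L K)

/-- The piecewise constant function with the values `V`. -/
def pc (V : Fin 𝒯.N → State d) (x : Space d) : State d :=
  ∑ K, (𝒯.cell K).indicator (fun _ => V K) x

/-- The projection `Π_h`: the mean values over the cells. -/
def proj (U₀ : Space d → State d) (K : Fin 𝒯.N) : State d := ⨍ x in 𝒯.cell K, U₀ x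

end RectMesh

/-- The unit vector in the positive (`s = true`) or negative (`s = false`) `i`-th direction. -/
def wallNormal {d : ℕ} (i : Fin d) (s : Bool) : Space d := if s then unitVec i else -unitVec i

/-! ### The Godunov method -/

open Classical in
/-- `U` (the value of the piecewise constant function `U_h(t)` on the cell `K` being `U t K`) is a
solution on `[0,T]` of the semi-discrete Godunov method on the mesh `𝒯` with initial data `U₀`:
for every piecewise constant test function `φ`
`∫_Ω φ dU_h/dt - ∑_{σ interior} ∫_σ F(U_σ^{RP}) n [[φ]] + ∑_{σ ⊂ ∂Ω} ∫_σ F(U_σ^{RP}) n φ = 0`.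
On an interior face between `K` and `L` the state `U_σ^{RP}` comes from the Riemann problem with
the two adjacent cell values, and the jump is `[[φ]] = φ_L - φ_K` with `n` pointing from `K` to `L`.
On a face in `∂Ω` (outer normal `n`) the impermeability of the wall is imposed by the Riemann
problem between the cell value and its mirror image; only the pressure on the wall contributes. -/
structure IsGodunovSolution {d : ℕ} {Ω : Set (Space d)} (γ T : ℝ) (𝒯 : RectMesh d Ω)
    (U₀ : Space d → State d) (U : ℝ → Fin 𝒯.N → State d) : Prop where
  physical : ∀ t ∈ Icc 0 T, ∀ K, IsPhysical γ (U t K)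
  differentiable : ∀ K, DifferentiableOn ℝ (fun t => U t K) (Icc 0 T)
  initial : ∀ K, U 0 K = 𝒯.proj U₀ K
  scheme : ∀ t ∈ Icc 0 T,
    ∃ (V : Fin d → Fin 𝒯.N → Fin 𝒯.N → State d) (Vw : Fin 𝒯.N → Fin d → Bool → State d),
      (∀ i K L, 𝒯.Adj i K L → IsRiemannState γ (unitVec i) (U t K) (U t L) (V i K L)) ∧
      (∀ K i s, 𝒯.IsWall K i s → IsRiemannState γ (wallNormal i s) (U t K)
        (mirror (wallNormal i s) (U t K)) (Vw K i s)) ∧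
      ∀ φ : Fin 𝒯.N → ℝ,
        ∑ K, (𝒯.vol K * φ K) • derivWithin (fun r => U r K) (Icc 0 T) t
          - ∑ i, ∑ K, ∑ L, (if 𝒯.Adj i K L then
              (𝒯.area K i * (φ L - φ K)) • flux γ (unitVec i) (V i K L) else 0)
          + ∑ K, ∑ i, ∑ s : Bool, (if 𝒯.IsWall K i s then
              (𝒯.area K i * φ K) • flux γ (wallNormal i s) (Vw K i s) else 0) = 0

end EulerGodunov

end

open EulerGodunov

open Real (exp log)
open scoped NNReal

namespace EulerGodunov

/-! ### Distributional inequalities on the line -/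

open scoped Convolution in
/-- At almost all pairs of points `a < b`, the indicator function of `[a, b]` is a limit of test
functions against which `f'` and any `g` can be integrated. -/
theorem exists_testFunctions {E : Type*} [NormedAddCommGroup E] [NormedSpace ℝ E]
    [CompleteSpace E] {f : ℝ → E} (hf : LocallyIntegrable f) :
    ∃ s : Set ℝ, (∀ᵐ x, x ∈ s) ∧ ∀ a ∈ s, ∀ b ∈ s, a < b → ∃ φ : ℕ → ℝ → ℝ,
      (∀ k, ContDiff ℝ ∞ (φ k) ∧ HasCompactSupport (φ k) ∧ ∀ x, 0 ≤ φ k x) ∧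
      Tendsto (fun k => ∫ x, deriv (φ k) x • f x) atTop (𝓝 (f a - f b)) ∧
      ∀ g : ℝ → E, LocallyIntegrable g →
        Tendsto (fun k => ∫ x, φ k x • g x) atTop (𝓝 (∫ x in a..b, g x)) := by
  let ψ : ℕ → ContDiffBump (0 : ℝ) := fun k =>
    ⟨1 / (2 * ((k : ℝ) + 1)), 1 / ((k : ℝ) + 1), by positivity, by
      rw [div_lt_div_iff₀ (by positivity) (by positivity)]; nlinarith [(k.cast_nonneg : (0:ℝ) ≤ k)]⟩
  have hψ0 : Tendsto (fun k => (ψ k).rOut) atTop (𝓝 0) := tendsto_one_div_add_atTop_nhds_zero_nat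
  have hψK : ∀ᶠ k in atTop, (ψ k).rOut ≤ 2 * (ψ k).rIn := Eventually.of_forall fun k => by
    change 1 / ((k : ℝ) + 1) ≤ 2 * (1 / (2 * ((k : ℝ) + 1)))
    apply le_of_eq; field_simp
  have hψ1 : ∀ k, (ψ k).rOut ≤ 1 := fun k => by
    change 1 / ((k : ℝ) + 1) ≤ 1
    rw [div_le_one (by positivity)]; linarith [(k.cast_nonneg : (0:ℝ) ≤ k)]
  have key := ContDiffBump.ae_convolution_tendsto_right_of_locallyIntegrable (μ := volume)
    hψ0 hψK hf
  refine ⟨_, key, fun a ha b hb hab => ?_⟩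
  let p : ℕ → ℝ → ℝ := fun k => (ψ k).normed volume
  have hpc : ∀ k, Continuous (p k) := fun k => (ψ k).continuous_normed
  have hpi : ∀ k, Integrable (p k) := fun k => (ψ k).integrable_normed
  have hp0 : ∀ k x, 0 ≤ p k x := fun k x => (ψ k).nonneg_normed x
  have hp1 : ∀ k, ∫ x, p k x = 1 := fun k => (ψ k).integral_normed
  have hps : ∀ k x, (ψ k).rOut ≤ |x| → p k x = 0 := fun k x hx => by
    have : x ∉ Function.support (p k) := by
      rw [(ψ k).support_normed_eq]; simpa using hx
    simpa using this
  let Ψ : ℕ → ℝ → ℝ := fun k x => ∫ y in (0 : ℝ)..x, p k y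
  have hΨ : ∀ k x, HasDerivAt (Ψ k) (p k x) x := fun k x =>
    ((hpc k).integral_hasStrictDerivAt 0 x).hasDerivAt
  let φ : ℕ → ℝ → ℝ := fun k x => Ψ k (x - a) - Ψ k (x - b)
  have hφ' : ∀ k x, HasDerivAt (φ k) (p k (x - a) - p k (x - b)) x := fun k x =>
    ((hΨ k (x - a)).comp_sub_const x a).sub ((hΨ k (x - b)).comp_sub_const x b)
  have hφd : ∀ k, deriv (φ k) = fun x => p k (x - a) - p k (x - b) := fun k =>
    funext fun x => (hφ' k x).deriv
  have hφi : ∀ k x, φ k x = ∫ y in (x - b)..(x - a), p k y := fun k x => by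
    rw [← intervalIntegral.integral_interval_sub_left
      ((hpi k).intervalIntegrable (a := 0)) ((hpi k).intervalIntegrable)]
  have hφ0 : ∀ k x, 0 ≤ φ k x := fun k x => by
    rw [hφi]; exact intervalIntegral.integral_nonneg (by linarith) fun y _ => hp0 k y
  have hφ1 : ∀ k x, φ k x ≤ 1 := fun k x => by
    rw [hφi, intervalIntegral.integral_of_le (by linarith), ← hp1 k]
    exact setIntegral_le_integral (hpi k) (Eventually.of_forall (hp0 k))
  have hφz : ∀ k x, x + (ψ k).rOut ≤ a ∨ b + (ψ k).rOut ≤ x → φ k x = 0 := fun k x hx => by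
    rw [hφi]
    refine intervalIntegral.integral_zero_ae (Eventually.of_forall fun y hy => hps k y ?_)
    rw [uIoc_of_le (by linarith)] at hy
    rcases hx with hx | hx
    · rw [abs_of_nonpos (by linarith [hy.2, (ψ k).rOut_pos])]; linarith [hy.2]
    · rw [abs_of_nonneg (by linarith [hy.1, (ψ k).rOut_pos])]; linarith [hy.1]
  have hφone : ∀ k x, a + (ψ k).rOut ≤ x → x + (ψ k).rOut ≤ b → φ k x = 1 := fun k x h1 h2 => by
    rw [hφi, intervalIntegral.integral_of_le (by linarith), ← hp1 k]
    refine setIntegral_eq_integral_of_forall_compl_eq_zero fun y hy => hps k y ?_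
    by_contra h
    rw [not_le, abs_lt] at h
    exact hy ⟨by linarith [h.1], by linarith [h.2]⟩
  refine ⟨φ, fun k => ⟨?_, ?_, hφ0 k⟩, ?_, fun g hg => ?_⟩
  · rw [show (∞ : WithTop ℕ∞) = ∞ + 1 by rfl, contDiff_succ_iff_deriv]
    refine ⟨fun x => (hφ' k x).differentiableAt, by simp, ?_⟩
    rw [hφd]
    exact ((ψ k).contDiff_normed.comp (contDiff_id.sub contDiff_const)).sub
      ((ψ k).contDiff_normed.comp (contDiff_id.sub contDiff_const))
  · refine HasCompactSupport.of_support_subset_isCompact (isCompact_Icc (a := a - 1) (b := b + 1))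
      fun x hx => ?_
    by_contra h
    rw [mem_Icc, not_and_or, not_le, not_le] at h
    refine hx (hφz k x ?_)
    rcases h with h | h
    · left; linarith [hψ1 k]
    · right; linarith [hψ1 k]
  · have hconv : ∀ k c, ((ψ k).normed volume ⋆[ContinuousLinearMap.lsmul ℝ ℝ, volume] f) c
        = ∫ x, p k (x - c) • f x := fun k c => by
      rw [convolution_eq_swap]
      refine integral_congr_ae (Eventually.of_forall fun x => ?_)
      simp only [ContinuousLinearMap.lsmul_apply]
      congr 1
      rw [← (ψ k).normed_neg, neg_sub]
    have hint : ∀ k c, Integrable fun x => p k (x - c) • f x := fun k c => by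
      refine hf.integrable_smul_left_of_hasCompactSupport
        ((hpc k).comp (continuous_id.sub continuous_const)) ?_
      refine HasCompactSupport.of_support_subset_isCompact
        (isCompact_Icc (a := c - 1) (b := c + 1)) fun x hx => ?_
      by_contra h
      refine hx (hps k _ ((hψ1 k).trans ?_))
      rw [mem_Icc, not_and_or, not_le, not_le] at h
      rcases h with h | h
      · rw [abs_of_nonpos (by linarith)]; linarith
      · rw [abs_of_nonneg (by linarith)]; linarith
    have e : ∀ k, ∫ x, deriv (φ k) x • f x =
        ((ψ k).normed volume ⋆[ContinuousLinearMap.lsmul ℝ ℝ, volume] f) a -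
        ((ψ k).normed volume ⋆[ContinuousLinearMap.lsmul ℝ ℝ, volume] f) b := fun k => by
      rw [hconv, hconv, ← integral_sub (hint k a) (hint k b), hφd]
      simp only [sub_smul]
    simp only [e]
    exact Tendsto.sub ha hb
  · rw [intervalIntegral.integral_of_le hab.le, ← integral_indicator measurableSet_Ioc]
    refine tendsto_integral_of_dominated_convergence
      ((Icc (a - 1) (b + 1)).indicator fun x => ‖g x‖) (fun k => ?_) ?_ (fun k => ?_) ?_
    · exact ((continuous_iff_continuousAt.2 fun x => (hφ' k x).continuousAt).aestronglyMeasurable).smul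
        hg.aestronglyMeasurable
    · exact (integrable_indicator_iff measurableSet_Icc).2
        (hg.integrableOn_isCompact isCompact_Icc).norm
    · refine Eventually.of_forall fun x => ?_
      by_cases hx : x ∈ Icc (a - 1) (b + 1)
      · rw [indicator_of_mem hx, norm_smul, Real.norm_of_nonneg (hφ0 k x)]
        exact mul_le_of_le_one_left (norm_nonneg _) (hφ1 k x)
      · rw [indicator_of_notMem hx, hφz k x, zero_smul, norm_zero]
        rw [mem_Icc, not_and_or, not_le, not_le] at hx
        rcases hx with h | h
        · left; linarith [hψ1 k]
        · right; linarith [hψ1 k]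
    · have hne : ∀ c : ℝ, ∀ᵐ x : ℝ, x ≠ c := fun c => by
        rw [ae_iff]; simp
      filter_upwards [hne a, hne b] with x hxa hxb
      refine tendsto_const_nhds.congr' ?_
      rcases lt_or_gt_of_ne hxa with h | h
      · filter_upwards [hψ0.eventually (gt_mem_nhds (sub_pos.2 h))] with k hk
        rw [indicator_of_notMem (fun h' => by linarith [h'.1]), hφz k x (by left; linarith),
          zero_smul]
      rcases lt_or_gt_of_ne hxb with h' | h'
      · filter_upwards [hψ0.eventually (gt_mem_nhds (sub_pos.2 h)),
          hψ0.eventually (gt_mem_nhds (sub_pos.2 h'))] with k hk hk'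
        rw [indicator_of_mem (show x ∈ Ioc a b from ⟨h, h'.le⟩), hφone k x (by linarith) (by linarith), one_smul]
      · filter_upwards [hψ0.eventually (gt_mem_nhds (sub_pos.2 h'))] with k hk
        rw [indicator_of_notMem (fun h'' => by linarith [h''.2]), hφz k x (by right; linarith),
          zero_smul]

/-- A distributional equation `f' = -g` on the line holds in integrated form. -/
theorem exists_ae_sub_eq_integral {E : Type*} [NormedAddCommGroup E] [NormedSpace ℝ E]
    [CompleteSpace E] {f g : ℝ → E} (hf : LocallyIntegrable f) (hg : LocallyIntegrable g)
    (h : ∀ φ : ℝ → ℝ, ContDiff ℝ ∞ φ → HasCompactSupport φ →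
      ∫ x, (deriv φ x • f x - φ x • g x) = 0) :
    ∃ s : Set ℝ, (∀ᵐ x, x ∈ s) ∧ ∀ a ∈ s, ∀ b ∈ s, f a - f b = ∫ x in a..b, g x := by
  obtain ⟨s, hs, H⟩ := exists_testFunctions hf
  have main : ∀ a ∈ s, ∀ b ∈ s, a < b → f a - f b = ∫ x in a..b, g x := by
    intro a ha b hb hab
    obtain ⟨φ, hφ, h1, h2⟩ := H a ha b hb hab
    refine tendsto_nhds_unique h1 ((h2 g hg).congr fun k => ?_)
    have h0 := h (φ k) (hφ k).1 (hφ k).2.1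
    rw [integral_sub, sub_eq_zero] at h0
    · exact h0.symm
    · exact hf.integrable_smul_left_of_hasCompactSupport
        ((hφ k).1.continuous_deriv (by simp)) (hφ k).2.1.deriv
    · exact hg.integrable_smul_left_of_hasCompactSupport (hφ k).1.continuous (hφ k).2.1
  refine ⟨s, hs, fun a ha b hb => ?_⟩
  rcases lt_trichotomy a b with hab | rfl | hab
  · exact main a ha b hb hab
  · simp
  · rw [intervalIntegral.integral_symm, ← main b hb a ha hab, neg_sub]

/-- A distributional inequality `f' + g ≥ 0` on the line holds in integrated form. -/
theorem exists_ae_sub_le_integral {f g : ℝ → ℝ} (hf : LocallyIntegrable f)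
    (hg : LocallyIntegrable g)
    (h : ∀ φ : ℝ → ℝ, ContDiff ℝ ∞ φ → HasCompactSupport φ → (∀ x, 0 ≤ φ x) →
      ∫ x, (deriv φ x * f x - φ x * g x) ≤ 0) :
    ∃ s : Set ℝ, (∀ᵐ x, x ∈ s) ∧ ∀ a ∈ s, ∀ b ∈ s, a < b → f a - f b ≤ ∫ x in a..b, g x := by
  obtain ⟨s, hs, H⟩ := exists_testFunctions hf
  refine ⟨s, hs, fun a ha b hb hab => ?_⟩
  obtain ⟨φ, hφ, h1, h2⟩ := H a ha b hb hab
  refine le_of_tendsto_of_tendsto' h1 (h2 g hg) fun k => ?_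
  have h0 := h (φ k) (hφ k).1 (hφ k).2.1 (hφ k).2.2
  simp only [← smul_eq_mul] at h0
  rw [integral_sub, sub_nonpos] at h0
  · exact h0
  · exact hf.integrable_smul_left_of_hasCompactSupport
      ((hφ k).1.continuous_deriv (by simp)) (hφ k).2.1.deriv
  · exact hg.integrable_smul_left_of_hasCompactSupport (hφ k).1.continuous (hφ k).2.1

/-! ### Relative energy of conservative states -/

variable {d : ℕ} {γ : ℝ}

/-- The velocity `u = m / ρ`. -/
noncomputable def velocity (U : State d) : Space d := U.1⁻¹ • U.2.1

/-- The temperature `ϑ = p / ρ`. -/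
noncomputable def temperature (γ : ℝ) (U : State d) : ℝ := pressure γ U / U.1

/-- `S = log (p / ρ ^ γ)`. -/
noncomputable def specEntropy (γ : ℝ) (U : State d) : ℝ := log (pressure γ U / U.1 ^ γ)

/-- `|u|² / 2 - μ`, where `μ = ϑ (γ - S) / (γ - 1)` is the chemical potential. -/
noncomputable def densityCoeff (γ : ℝ) (U : State d) : ℝ :=
  1 / 2 * ‖velocity U‖ ^ 2 - temperature γ U / (γ - 1) * (γ - specEntropy γ U)

/-- The derivative of the total entropy at `U`, multiplied by the temperature. -/
noncomputable def pairing (γ : ℝ) (U : State d) : State d →L[ℝ] ℝ :=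
  (ContinuousLinearMap.snd ℝ (Space d) ℝ).comp (ContinuousLinearMap.snd ℝ ℝ (Space d × ℝ))
    - ((innerSL ℝ (velocity U)).comp (ContinuousLinearMap.fst ℝ (Space d) ℝ)).comp
        (ContinuousLinearMap.snd ℝ ℝ (Space d × ℝ))
    + densityCoeff γ U • ContinuousLinearMap.fst ℝ ℝ (Space d × ℝ)

theorem pairing_apply (U W : State d) : pairing γ U W =
    W.2.2 - inner ℝ (velocity U) W.2.1 + densityCoeff γ U * W.1 := by
  simp [pairing]

/-- The relative energy of `W` with respect to `U`. -/
noncomputable def relEnergy (γ : ℝ) (W U : State d) : ℝ :=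
  pairing γ U W - temperature γ U * entropy γ W + pressure γ U

theorem momentum_eq {U : State d} (h : IsPhysical γ U ∨ U = 0) : U.2.1 = U.1 • velocity U := by
  rcases h with h | rfl
  · rw [velocity, smul_smul, mul_inv_cancel₀ h.1.ne', one_smul]
  · simp

theorem pressure_eq {U : State d} (h : IsPhysical γ U ∨ U = 0) :
    pressure γ U = U.1 * temperature γ U := by
  rcases h with h | rfl
  · rw [temperature, mul_div_cancel₀ _ h.1.ne']
  · simp [pressure]

theorem inner_momentum {U : State d} (h : IsPhysical γ U ∨ U = 0) (n : Space d) :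
    inner ℝ U.2.1 n = U.1 * inner ℝ (velocity U) n := by
  conv_lhs => rw [momentum_eq h]
  rw [inner_smul_left]; simp

theorem inner_momentum_div (U : State d) (n : Space d) :
    inner ℝ U.2.1 n / U.1 = inner ℝ (velocity U) n := by
  rw [velocity, inner_smul_left]; simp [div_eq_inv_mul]

theorem energy_eq (hγ : 1 < γ) {U : State d} (h : IsPhysical γ U ∨ U = 0) :
    U.2.2 = 1 / 2 * U.1 * ‖velocity U‖ ^ 2 + 1 / (γ - 1) * (U.1 * temperature γ U) := by
  have hg : γ - 1 ≠ 0 := by linarith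
  rw [← pressure_eq h, pressure, momentum_eq h, norm_smul]
  rcases h with h | rfl
  · have h1 := h.1.ne'
    rw [Real.norm_of_nonneg h.1.le]; field_simp; ring
  · simp

theorem energy_eq_pressure (hγ : 1 < γ) {U : State d} (h : IsPhysical γ U ∨ U = 0) :
    U.2.2 = 1 / 2 * U.1 * ‖velocity U‖ ^ 2 + 1 / (γ - 1) * pressure γ U := by
  rw [pressure_eq h, ← energy_eq hγ h]

theorem temperature_pos {U : State d} (h : IsPhysical γ U) : 0 < temperature γ U :=
  div_pos h.2 h.1

theorem specEntropy_eq {U : State d} (h : IsPhysical γ U) :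
    specEntropy γ U = log (temperature γ U) - (γ - 1) * log U.1 := by
  rw [specEntropy, Real.log_div h.2.ne' (Real.rpow_pos_of_pos h.1 _).ne', Real.log_rpow h.1,
    temperature, Real.log_div h.2.ne' h.1.ne']
  ring

theorem entropy_eq (U : State d) : entropy γ U = 1 / (γ - 1) * U.1 * specEntropy γ U := rfl

theorem entropy_zero : entropy γ (0 : State d) = 0 := by simp [entropy]

theorem relEnergy_eq (hγ : 1 < γ) {W U : State d} (hW : IsPhysical γ W ∨ W = 0)
    (hU : IsPhysical γ U) :
    relEnergy γ W U = 1 / 2 * W.1 * ‖velocity W - velocity U‖ ^ 2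
      + 1 / (γ - 1) * W.1 * (temperature γ W - temperature γ U
          - temperature γ U * log (temperature γ W / temperature γ U))
      + temperature γ U * (W.1 * log (W.1 / U.1) - W.1 + U.1) := by
  have hg : γ - 1 ≠ 0 := by linarith
  have h1 : entropy γ W = 1 / (γ - 1) * W.1 *
      (log (temperature γ W) - (γ - 1) * log W.1) := by
    rcases hW with hW | rfl
    · rw [entropy_eq, specEntropy_eq hW]
    · simp [entropy_zero]
  have h2 : W.1 * log (temperature γ W / temperature γ U) =
      W.1 * (log (temperature γ W) - log (temperature γ U)) := by
    rcases hW with hW | rfl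
    · rw [Real.log_div (temperature_pos hW).ne' (temperature_pos hU).ne']
    · simp
  have h3 : W.1 * log (W.1 / U.1) = W.1 * (log W.1 - log U.1) := by
    rcases hW with hW | rfl
    · rw [Real.log_div hW.1.ne' hU.1.ne']
    · simp
  have h4 : inner ℝ (velocity U) W.2.1 = W.1 * inner ℝ (velocity U) (velocity W) := by
    rw [real_inner_comm, inner_momentum hW, real_inner_comm]
  rw [relEnergy, pairing_apply, h1, h4, energy_eq hγ hW, pressure_eq (Or.inl hU), densityCoeff,
    specEntropy_eq hU, h3, norm_sub_sq_real, real_inner_comm (velocity U) (velocity W)]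
  linear_combination (temperature γ U / (γ - 1)) * h2 +
    W.1 * temperature γ U * (log W.1 - log U.1 - 1) * mul_inv_cancel₀ hg

theorem sq_sqrt_sub_one_le_sub_log {x : ℝ} (hx : 0 < x) :
    (√x - 1) ^ 2 ≤ x - 1 - log x := by
  have h := Real.log_le_sub_one_of_pos (Real.sqrt_pos.2 hx)
  have h2 : log x = 2 * log (√x) := by
    rw [Real.log_sqrt hx.le]; ring
  nlinarith [Real.sq_sqrt hx.le]

theorem sq_sqrt_sub_one_le_mul_log {x : ℝ} (hx : 0 < x) :
    (√x - 1) ^ 2 ≤ x * log x - x + 1 := by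
  have hs := Real.sqrt_pos.2 hx
  have h := Real.one_sub_inv_le_log_of_pos hs
  have h2 : log x = 2 * log (√x) := by
    rw [Real.log_sqrt hx.le]; ring
  have h3 : √x * √x = x := Real.mul_self_sqrt hx.le
  have h4 : x * (1 - (√x)⁻¹) = x - √x := by
    nth_rw 1 3 [← h3]; field_simp
  have h5 := mul_le_mul_of_nonneg_left h hx.le
  nlinarith

theorem sq_sqrt_sub_sqrt_le_sub_log {a b : ℝ} (ha : 0 < a) (hb : 0 < b) :
    (√a - √b) ^ 2 ≤ a - b - b * log (a / b) := by
  have h := mul_le_mul_of_nonneg_left (sq_sqrt_sub_one_le_sub_log (div_pos ha hb)) hb.le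
  have hs := Real.sqrt_pos.2 hb
  rw [Real.sqrt_div ha.le] at h
  have e : b * (√a / √b - 1) ^ 2 = (√a - √b) ^ 2 := by
    nth_rw 1 [← Real.sq_sqrt hb.le]; field_simp
  have e2 : b * (a / b) = a := mul_div_cancel₀ _ hb.ne'
  rw [e] at h; nlinarith

theorem sq_sqrt_sub_sqrt_le_mul_log {a b : ℝ} (ha : 0 < a) (hb : 0 < b) :
    (√a - √b) ^ 2 ≤ a * log (a / b) - a + b := by
  have h := mul_le_mul_of_nonneg_left (sq_sqrt_sub_one_le_mul_log (div_pos ha hb)) hb.le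
  have hs := Real.sqrt_pos.2 hb
  rw [Real.sqrt_div ha.le] at h
  have e : b * (√a / √b - 1) ^ 2 = (√a - √b) ^ 2 := by
    nth_rw 1 [← Real.sq_sqrt hb.le]; field_simp
  have e2 : b * (a / b) = a := mul_div_cancel₀ _ hb.ne'
  have e3 : b * (a / b * log (a / b) - a / b + 1) = (b * (a / b)) * log (a / b)
    - b * (a / b) + b := by ring
  rw [e, e3, e2] at h; exact h

theorem le_relEnergy (hγ : 1 < γ) {W U : State d} (hW : IsPhysical γ W ∨ W = 0)
    (hU : IsPhysical γ U) :
    1 / 2 * W.1 * ‖velocity W - velocity U‖ ^ 2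
      + 1 / (γ - 1) * W.1 * (√(temperature γ W) - √(temperature γ U)) ^ 2
      + temperature γ U * (√W.1 - √U.1) ^ 2 ≤ relEnergy γ W U := by
  have hg : 0 < 1 / (γ - 1) := by have : 0 < γ - 1 := by linarith
                                  positivity
  rw [relEnergy_eq hγ hW hU]
  rcases hW with hW | rfl
  · have := hW.1.le
    gcongr
    · exact sq_sqrt_sub_sqrt_le_sub_log (temperature_pos hW) (temperature_pos hU)
    · exact (temperature_pos hU).le
    · exact sq_sqrt_sub_sqrt_le_mul_log hW.1 hU.1
  · simp [Real.sq_sqrt hU.1.le]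

theorem density_nonneg {W : State d} (hW : IsPhysical γ W ∨ W = 0) : 0 ≤ W.1 := by
  rcases hW with hW | rfl
  · exact hW.1.le
  · simp

theorem temperature_nonneg {W : State d} (hW : IsPhysical γ W ∨ W = 0) :
    0 ≤ temperature γ W := by
  rcases hW with hW | rfl
  · exact (temperature_pos hW).le
  · simp [temperature]

theorem parts_le_relEnergy (hγ : 1 < γ) {W U : State d} (hW : IsPhysical γ W ∨ W = 0)
    (hU : IsPhysical γ U) : 1 / 2 * W.1 * ‖velocity W - velocity U‖ ^ 2 ≤ relEnergy γ W U ∧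
      1 / (γ - 1) * (W.1 * (√(temperature γ W) - √(temperature γ U)) ^ 2) ≤
        relEnergy γ W U ∧
      temperature γ U * (√W.1 - √U.1) ^ 2 ≤ relEnergy γ W U := by
  have h := le_relEnergy hγ hW hU
  have h0 := density_nonneg hW
  have h1 := mul_nonneg (temperature_pos hU).le (sq_nonneg (√W.1 - √U.1))
  have h2 : 0 ≤ 1 / 2 * W.1 * ‖velocity W - velocity U‖ ^ 2 := by positivity
  have hg : 0 < γ - 1 := by linarith
  have h3 : 0 ≤ 1 / (γ - 1) * W.1 *
    (√(temperature γ W) - √(temperature γ U)) ^ 2 := by positivity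
  exact ⟨by linarith, by linarith, by linarith⟩

theorem relEnergy_nonneg (hγ : 1 < γ) {W U : State d} (hW : IsPhysical γ W ∨ W = 0)
    (hU : IsPhysical γ U) : 0 ≤ relEnergy γ W U := by
  refine le_trans ?_ (parts_le_relEnergy hγ hW hU).1
  have := density_nonneg hW
  positivity

theorem relEnergy_self (hγ : 1 < γ) {U : State d} (hU : IsPhysical γ U) :
    relEnergy γ U U = 0 := by
  rw [relEnergy_eq hγ (Or.inl hU) hU, div_self hU.1.ne', div_self (temperature_pos hU).ne']
  simp

/-- The flux of the relative energy. -/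
theorem relEnergy_flux {W : State d} (hW : IsPhysical γ W ∨ W = 0) (U : State d)
    (n : Space d) :
    pairing γ U (flux γ n W) - temperature γ U * entropyFlux γ n W
      + pressure γ U * inner ℝ (velocity U) n =
    inner ℝ (velocity W) n * relEnergy γ W U
      + (pressure γ W - pressure γ U) * inner ℝ (velocity W - velocity U) n := by
  rw [relEnergy, pairing_apply, pairing_apply, flux, entropyFlux]
  simp only [inner_add_right, inner_smul_right, inner_sub_left]
  rw [inner_momentum_div, inner_momentum hW]
  ring

/-- `U` has density and temperature in `[A⁻¹, A]` and velocity at most `A`. -/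
structure StateBdd (γ A : ℝ) (U : State d) : Prop where
  physical : IsPhysical γ U
  density_ge : A⁻¹ ≤ U.1
  density_le : U.1 ≤ A
  temperature_ge : A⁻¹ ≤ temperature γ U
  temperature_le : temperature γ U ≤ A
  velocity_le : ‖velocity U‖ ≤ A

section Bounds

variable {A : ℝ} {W U : State d}

theorem sqrt_density_sub_le (hγ : 1 < γ) (hA : 1 ≤ A) (hW : IsPhysical γ W ∨ W = 0)
    (hU : StateBdd γ A U) :
    |√W.1 - √U.1| ≤ √A * √(relEnergy γ W U) := by
  have hA0 : 0 < A := by linarith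
  rw [← Real.sqrt_mul hA0.le]
  refine Real.abs_le_sqrt ?_
  have h1 := (mul_le_mul_of_nonneg_right hU.temperature_ge (sq_nonneg _)).trans
    (parts_le_relEnergy hγ hW hU.physical).2.2
  rwa [inv_mul_le_iff₀ hA0] at h1

theorem sqrt_density_le (hγ : 1 < γ) (hA : 1 ≤ A) (hW : IsPhysical γ W ∨ W = 0)
    (hU : StateBdd γ A U) :
    √W.1 ≤ √A * (1 + √(relEnergy γ W U)) := by
  have h := (abs_le.1 (sqrt_density_sub_le hγ hA hW hU)).2
  have := Real.sqrt_le_sqrt hU.density_le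
  linarith

theorem abs_density_sub_le (hγ : 1 < γ) (hA : 1 ≤ A) (hW : IsPhysical γ W ∨ W = 0)
    (hU : StateBdd γ A U) :
    |W.1 - U.1| ≤ 2 * A * (√(relEnergy γ W U) + relEnergy γ W U) := by
  have h1 := sqrt_density_sub_le hγ hA hW hU
  have h2 := sqrt_density_le hγ hA hW hU
  have h3 := Real.sqrt_le_sqrt hU.density_le
  have he := relEnergy_nonneg hγ hW hU.physical
  set s := √(relEnergy γ W U)
  have hs : s * s = relEnergy γ W U := Real.mul_self_sqrt he
  have hs0 : 0 ≤ s := Real.sqrt_nonneg _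
  have ha : √A * √A = A := Real.mul_self_sqrt (by linarith)
  have e : W.1 - U.1 = (√W.1 - √U.1) * (√W.1 + √U.1) := by
    have := Real.mul_self_sqrt (density_nonneg hW)
    have := Real.mul_self_sqrt hU.physical.1.le
    linarith
  rw [e, abs_mul, abs_of_nonneg (by positivity : 0 ≤ √W.1 + √U.1)]
  calc _ ≤ (√A * s) * (√A * (2 + s)) := by
        gcongr; linarith
    _ = (√A * √A) * (2 * s + s * s) := by ring
    _ = A * (2 * s + s * s) := by rw [ha]
    _ ≤ _ := by rw [hs]; nlinarith

theorem density_mul_velocity_sub_le (hγ : 1 < γ) (hA : 1 ≤ A) (hW : IsPhysical γ W ∨ W = 0)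
    (hU : StateBdd γ A U) :
    W.1 * ‖velocity W - velocity U‖ ≤
      2 * A * (√(relEnergy γ W U) + relEnergy γ W U) := by
  have h2 := sqrt_density_le hγ hA hW hU
  have he := relEnergy_nonneg hγ hW hU.physical
  have h := (parts_le_relEnergy hγ hW hU.physical).1
  have h0 := density_nonneg hW
  set e := relEnergy γ W U
  set s := √e
  have hs : s * s = e := Real.mul_self_sqrt he
  have hs0 : 0 ≤ s := Real.sqrt_nonneg _
  have h5 : √W.1 * ‖velocity W - velocity U‖ ≤ 2 * s := by
    refine abs_le_of_sq_le_sq' ?_ (by positivity) |>.2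
    rw [mul_pow, Real.sq_sqrt h0]; nlinarith
  have hA1 : √A ≤ A := by
    rw [Real.sqrt_le_left (by linarith)]; nlinarith
  calc W.1 * ‖velocity W - velocity U‖
      = √W.1 * (√W.1 * ‖velocity W - velocity U‖) := by
        rw [← mul_assoc, Real.mul_self_sqrt h0]
    _ ≤ (A * (1 + s)) * (2 * s) := by
        refine mul_le_mul (h2.trans ?_) h5 (by positivity) (by positivity)
        gcongr
    _ = 2 * A * (s + e) := by rw [← hs]; ring

theorem abs_pressure_sub_le (hγ : 1 < γ) (hγ2 : γ ≤ 2) (hA : 1 ≤ A)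
    (hW : IsPhysical γ W ∨ W = 0) (hU : StateBdd γ A U) :
    |pressure γ W - pressure γ U| ≤
      5 * A ^ 2 * (√(relEnergy γ W U) + relEnergy γ W U) := by
  have h1 := abs_density_sub_le hγ hA hW hU
  have h2 := sqrt_density_le hγ hA hW hU
  have he := relEnergy_nonneg hγ hW hU.physical
  have h3 := (parts_le_relEnergy hγ hW hU.physical).2.1
  have hg : 0 < γ - 1 := by linarith
  have h0 := density_nonneg hW
  have hθ := temperature_pos hU.physical
  set e := relEnergy γ W U
  set s := √e
  set X := √(temperature γ W) - √(temperature γ U) with hX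
  have hs : s * s = e := Real.mul_self_sqrt he
  have hs0 : 0 ≤ s := Real.sqrt_nonneg _
  have hX2 : W.1 * X ^ 2 ≤ e := by
    have h4 : 1 ≤ 1 / (γ - 1) := by rw [le_div_iff₀ hg]; linarith
    have h5 : 0 ≤ W.1 * X ^ 2 := by positivity
    nlinarith
  have h5 : √W.1 * |X| ≤ s := by
    refine abs_le_of_sq_le_sq' ?_ (by positivity) |>.2
    rw [mul_pow, Real.sq_sqrt h0, sq_abs]; nlinarith
  have hsA : √A * √A = A := Real.mul_self_sqrt (by linarith)
  have h6 : W.1 * |X| ≤ √A * (s + e) := by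
    calc W.1 * |X| = √W.1 * (√W.1 * |X|) := by
          rw [← mul_assoc, Real.mul_self_sqrt h0]
      _ ≤ (√A * (1 + s)) * s := mul_le_mul h2 h5 (by positivity) (by positivity)
      _ = _ := by rw [← hs]; ring
  have h7 : |W.1 * (temperature γ W - temperature γ U)| ≤ 3 * A * (s + e) := by
    have e1 : W.1 * (temperature γ W - temperature γ U) =
        W.1 * X ^ 2 + 2 * √(temperature γ U) * (W.1 * X) := by
      have a1 := Real.mul_self_sqrt (temperature_nonneg hW)
      have a2 := Real.mul_self_sqrt hθ.le
      rw [hX]; nth_rw 1 [← a1, ← a2]; ring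
    have hθA := Real.sqrt_le_sqrt hU.temperature_le
    rw [e1]
    calc _ ≤ |W.1 * X ^ 2| + |2 * √(temperature γ U) * (W.1 * X)| := abs_add_le _ _
      _ = W.1 * X ^ 2 + 2 * (√(temperature γ U) * (W.1 * |X|)) := by
          rw [abs_of_nonneg (by positivity), abs_mul, abs_mul, abs_mul, abs_of_nonneg h0,
            abs_of_nonneg (Real.sqrt_nonneg _), abs_of_nonneg (by norm_num : (0:ℝ) ≤ 2)]; ring
      _ ≤ e + 2 * (√A * (√A * (s + e))) := by gcongr
      _ = e + 2 * A * (s + e) := by rw [← mul_assoc (√A), hsA]; ring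
      _ ≤ _ := by nlinarith
  rw [pressure_eq hW, pressure_eq (Or.inl hU.physical)]
  have e2 : W.1 * temperature γ W - U.1 * temperature γ U =
      W.1 * (temperature γ W - temperature γ U) + (W.1 - U.1) * temperature γ U := by ring
  rw [e2]
  calc _ ≤ _ := abs_add_le _ _
    _ ≤ 3 * A * (s + e) + 2 * A * (s + e) * A := by
        rw [abs_mul (W.1 - U.1), abs_of_nonneg hθ.le]
        gcongr
        exact hU.temperature_le
    _ ≤ _ := by nlinarith [mul_nonneg (mul_nonneg (by linarith : 0 ≤ A) (by linarith : 0 ≤ A - 1)) (by linarith : 0 ≤ s + e)]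

theorem norm_sub_le_relEnergy (hγ : 1 < γ) (hγ2 : γ ≤ 2) (hA : 1 ≤ A)
    (hW : IsPhysical γ W ∨ W = 0) (hU : StateBdd γ A U) :
    ‖W - U‖ ≤ (8 + 5 / (γ - 1)) * A ^ 3 *
      (√(relEnergy γ W U) + relEnergy γ W U) := by
  have h1 := abs_density_sub_le hγ hA hW hU
  have h2 := density_mul_velocity_sub_le hγ hA hW hU
  have h3 := abs_pressure_sub_le hγ hγ2 hA hW hU
  have he := relEnergy_nonneg hγ hW hU.physical
  have hZ := (parts_le_relEnergy hγ hW hU.physical).1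
  have hg : 0 < γ - 1 := by linarith
  have h0 := density_nonneg hW
  have hv := hU.velocity_le
  set e := relEnergy γ W U
  set s := √e
  have hs0 : 0 ≤ s := Real.sqrt_nonneg _
  have hse : 0 ≤ s + e := by positivity
  have hA3 : 1 ≤ A ^ 3 := one_le_pow₀ hA
  have hA2 : A ^ 2 ≤ A ^ 3 := pow_le_pow_right₀ hA (by norm_num)
  have hA1 : A ≤ A ^ 3 := le_self_pow₀ hA (by norm_num)
  have hA12 : A ≤ A ^ 2 := le_self_pow₀ hA (by norm_num)
  have hg5 : 0 < 5 / (γ - 1) := by positivity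
  rw [Prod.norm_def, Prod.norm_def]
  refine max_le ?_ (max_le ?_ ?_)
  · rw [Real.norm_eq_abs]
    refine h1.trans ?_
    gcongr
    nlinarith
  · have e1 : (W - U).2.1 = W.1 • (velocity W - velocity U) + (W.1 - U.1) • velocity U := by
      change W.2.1 - U.2.1 = _
      rw [momentum_eq hW, momentum_eq (Or.inl hU.physical)]
      module
    rw [e1]
    refine (norm_add_le _ _).trans ?_
    rw [norm_smul, norm_smul, Real.norm_eq_abs, Real.norm_eq_abs, abs_of_nonneg h0]
    calc _ ≤ 2 * A * (s + e) + 2 * A * (s + e) * A := by gcongr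
      _ = (2 * A + 2 * A ^ 2) * (s + e) := by ring
      _ ≤ _ := by gcongr; nlinarith
  · rw [Real.norm_eq_abs]
    have e1 : (W - U).2.2 = 1 / 2 * W.1 * ‖velocity W - velocity U‖ ^ 2
        + inner ℝ (W.1 • (velocity W - velocity U)) (velocity U)
        + 1 / 2 * (W.1 - U.1) * ‖velocity U‖ ^ 2
        + 1 / (γ - 1) * (pressure γ W - pressure γ U) := by
      change W.2.2 - U.2.2 = _
      rw [energy_eq_pressure hγ hW, energy_eq_pressure hγ (Or.inl hU.physical),
        norm_sub_sq_real, inner_smul_left, inner_sub_left, real_inner_self_eq_norm_sq]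
      simp; ring
    have b1 : |inner ℝ (W.1 • (velocity W - velocity U)) (velocity U)| ≤ 2 * A * (s + e) * A := by
      refine (abs_real_inner_le_norm _ _).trans ?_
      rw [norm_smul, Real.norm_of_nonneg h0]
      gcongr
    have b2 : |1 / 2 * (W.1 - U.1) * ‖velocity U‖ ^ 2| ≤ A * (s + e) * A ^ 2 := by
      rw [abs_mul, abs_mul, abs_of_nonneg (by positivity : 0 ≤ ‖velocity U‖ ^ 2)]
      have : |(1 / 2 : ℝ)| * |W.1 - U.1| ≤ A * (s + e) := by
        rw [abs_of_pos (by norm_num)]; linarith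
      gcongr
    have b3 : |1 / (γ - 1) * (pressure γ W - pressure γ U)| ≤
        1 / (γ - 1) * (5 * A ^ 2 * (s + e)) := by
      rw [abs_mul, abs_of_pos (by positivity : 0 < 1 / (γ - 1))]
      gcongr
    have b4 : |1 / 2 * W.1 * ‖velocity W - velocity U‖ ^ 2| ≤ e := by
      rwa [abs_of_nonneg (by positivity)]
    rw [e1]
    calc _ ≤ e + 2 * A * (s + e) * A + A * (s + e) * A ^ 2
          + 1 / (γ - 1) * (5 * A ^ 2 * (s + e)) :=
        (abs_add_le _ _).trans (add_le_add ((abs_add_le _ _).trans (add_le_add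
          ((abs_add_le _ _).trans (add_le_add b4 b1)) b2)) b3)
      _ ≤ (s + e) + 2 * A * (s + e) * A + A * (s + e) * A ^ 2
          + 1 / (γ - 1) * (5 * A ^ 2 * (s + e)) := by linarith
      _ = (1 + 2 * A ^ 2 + A ^ 3 + 5 / (γ - 1) * A ^ 2) * (s + e) := by ring
      _ ≤ _ := by
        gcongr
        nlinarith

/-- Near `U` the relative energy flux is controlled by the relative energy. -/
theorem abs_relEnergy_flux_le (hγ : 1 < γ) (hγ2 : γ ≤ 2) (hA : 1 ≤ A)
    (hW : IsPhysical γ W ∨ W = 0) (hU : StateBdd γ A U) {n : Space d} (hn : ‖n‖ = 1)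
    (hsmall : relEnergy γ W U ≤ 1 / (4 * A ^ 2)) :
    |inner ℝ (velocity W) n * relEnergy γ W U
      + (pressure γ W - pressure γ U) * inner ℝ (velocity W - velocity U) n| ≤
    (33 * A ^ 3) * relEnergy γ W U := by
  have h1 := sqrt_density_sub_le hγ hA hW hU
  have h3 := abs_pressure_sub_le hγ hγ2 hA hW hU
  have he := relEnergy_nonneg hγ hW hU.physical
  have hZ := (parts_le_relEnergy hγ hW hU.physical).1
  have h0 := density_nonneg hW
  have hv := hU.velocity_le
  have hA0 : 0 < A := by linarith
  set e := relEnergy γ W U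
  set s := √e
  set Z := ‖velocity W - velocity U‖
  have hs : s * s = e := Real.mul_self_sqrt he
  have hs0 : 0 ≤ s := Real.sqrt_nonneg _
  have hA2 : 1 ≤ A ^ 2 := one_le_pow₀ hA
  have he1 : e ≤ 1 := hsmall.trans (by rw [div_le_one (by positivity)]; linarith)
  have hes : e ≤ s := by
    have : s ≤ 1 := Real.sqrt_le_one.2 he1
    nlinarith
  have hρ : 1 / (4 * A) ≤ W.1 := by
    have hb : √A * s ≤ √U.1 / 2 := by
      rw [← Real.sqrt_mul hA0.le, show √U.1 / 2 = √(U.1 / 4) by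
        rw [Real.sqrt_div' _ (by norm_num)]; congr 1
        rw [show (4:ℝ) = 2 ^ 2 by norm_num, Real.sqrt_sq (by norm_num)]]
      refine Real.sqrt_le_sqrt ?_
      calc A * e ≤ A * (1 / (4 * A ^ 2)) := by gcongr
        _ = A⁻¹ / 4 := by field_simp
        _ ≤ _ := by linarith [hU.density_ge]
    have hc : √U.1 / 2 ≤ √W.1 := by linarith [(abs_le.1 h1).1]
    have hd : U.1 / 4 ≤ W.1 := by
      have := mul_self_le_mul_self (by positivity) hc
      rw [Real.mul_self_sqrt h0] at this
      have := Real.mul_self_sqrt hU.physical.1.le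
      linarith
    have := hU.density_ge
    have : 1 / (4 * A) = A⁻¹ / 4 := by field_simp
    linarith
  have hZ2 : Z ^ 2 ≤ 8 * A * e := by
    have h4 : 1 / 2 * (1 / (4 * A)) * Z ^ 2 ≤ e := le_trans (by gcongr) hZ
    have : 1 / 2 * (1 / (4 * A)) * Z ^ 2 = Z ^ 2 / (8 * A) := by field_simp; ring
    rw [this, div_le_iff₀ (by positivity)] at h4
    linarith
  have hZ0 : 0 ≤ Z := norm_nonneg _
  have hZs : Z ≤ 3 * A * s := by
    refine abs_le_of_sq_le_sq' ?_ (by positivity) |>.2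
    have : (3 * A * s) ^ 2 = 9 * A ^ 2 * e := by rw [← hs]; ring
    rw [this]
    nlinarith
  have hZ' : Z ≤ 2 := by
    have : e * (4 * A ^ 2) ≤ 1 := by rwa [le_div_iff₀ (by positivity)] at hsmall
    have : A * e ≤ A ^ 2 * e := by gcongr; nlinarith
    nlinarith
  have hun : |inner ℝ (velocity W) n| ≤ A + 2 := by
    refine (abs_real_inner_le_norm _ _).trans ?_
    rw [hn, mul_one]
    calc ‖velocity W‖ = ‖velocity U + (velocity W - velocity U)‖ := by rw [add_sub_cancel]
      _ ≤ ‖velocity U‖ + Z := norm_add_le _ _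
      _ ≤ _ := by linarith
  have hzn : |inner ℝ (velocity W - velocity U) n| ≤ 3 * A * s := by
    refine (abs_real_inner_le_norm _ _).trans ?_
    rw [hn, mul_one]; exact hZs
  refine (abs_add_le _ _).trans ?_
  rw [abs_mul, abs_mul, abs_of_nonneg he]
  calc _ ≤ (A + 2) * e + 5 * A ^ 2 * (s + s) * (3 * A * s) := by
        gcongr
        exact h3.trans (by gcongr)
    _ = (A + 2 + 30 * A ^ 3) * e := by rw [← hs]; ring
    _ ≤ _ := by
      gcongr
      nlinarith

end Bounds

/-! ### Integrated form of the Riemann problem -/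

/-- The integrated form of the conservation laws and of the entropy inequality for the profile `W`
of a Riemann problem; `G` is the continuous representative of `F(W) n - ξ W`. -/
structure IsRiemannProfile (γ : ℝ) (n : Space d) (UL UR : State d) (W : ℝ → State d) (s : ℝ)
    (G : ℝ → State d) : Prop where
  pos : 0 < s
  bounded : ∃ B : ℝ, ∀ ξ, ‖W ξ‖ ≤ B
  physical : ∀ ξ, IsPhysical γ (W ξ) ∨ W ξ = 0
  left : ∀ ξ, ξ ≤ -s → W ξ = UL
  right : ∀ ξ, s ≤ ξ → W ξ = UR
  integrable : ∀ a b, IntervalIntegrable W volume a b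
  integrable_entropy : ∀ a b, IntervalIntegrable (fun ξ => entropy γ (W ξ)) volume a b
  sub_eq : ∀ a b, G b - G a = - ∫ ξ in a..b, W ξ
  eq_left : ∀ ξ, ξ ≤ -s → G ξ = flux γ n UL - ξ • UL
  eq_right : ∀ ξ, s ≤ ξ → G ξ = flux γ n UR - ξ • UR
  ae_eq : ∀ᵐ ξ, flux γ n (W ξ) - ξ • W ξ = G ξ
  entropy_le : ∃ t : Set ℝ, (∀ᵐ ξ, ξ ∈ t) ∧ ∀ a ∈ t, ∀ b ∈ t, a < b →
    (entropyFlux γ n (W a) - a * entropy γ (W a)) - (entropyFlux γ n (W b) - b * entropy γ (W b))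
      ≤ ∫ ξ in a..b, entropy γ (W ξ)

theorem exists_lt_mem_of_ae {t : Set ℝ} (ht : ∀ᵐ ξ, ξ ∈ t) {a b : ℝ} (hab : a < b) :
    ∃ x ∈ t, a < x ∧ x < b := by
  by_contra h
  push Not at h
  have h1 : Ioo a b ⊆ tᶜ := fun x hx hxt => by
    have := h x hxt hx.1; linarith [hx.2]
  have h2 : volume (Ioo a b) = 0 := measure_mono_null h1 ht
  rw [Real.volume_Ioo, ENNReal.ofReal_eq_zero] at h2
  linarith

theorem IsRiemannSolution.exists_profile {n : Space d} {UL UR : State d} {W : ℝ → State d}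
    (h : IsRiemannSolution γ n UL UR W) : ∃ s G, IsRiemannProfile γ n UL UR W s G := by
  obtain ⟨B, hB⟩ := h.bounded
  obtain ⟨s₀, hL, hR⟩ := h.initial
  set s := max s₀ 1 with hs
  have hs0 : s₀ ≤ s := le_max_left _ _
  have hs1 : 1 ≤ s := le_max_right _ _
  have hWi : LocallyIntegrable W := by
    refine (locallyIntegrable_const B).mono h.measurable.aestronglyMeasurable
      (Eventually.of_forall fun ξ => ?_)
    exact (hB ξ).trans (le_abs_self B)
  have hWii : ∀ a b, IntervalIntegrable W volume a b := fun a b =>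
    (hWi.integrableOn_isCompact isCompact_uIcc).intervalIntegrable
  have hξW : LocallyIntegrable (fun ξ => ξ • W ξ) := hWi.continuous_smul continuous_id
  have hX : LocallyIntegrable (fun ξ => flux γ n (W ξ) - ξ • W ξ) := h.flux_integrable.sub hξW
  have hη : LocallyIntegrable (fun ξ => ξ * entropy γ (W ξ)) := by
    simpa only [smul_eq_mul, id] using h.entropy_integrable.continuous_smul continuous_id
  have hQ : LocallyIntegrable (fun ξ => entropyFlux γ n (W ξ) - ξ * entropy γ (W ξ)) :=
    h.entropyFlux_integrable.sub hη
  obtain ⟨t, ht, H⟩ := exists_ae_sub_eq_integral hX hWi h.conservation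
  obtain ⟨t', ht', H'⟩ := exists_ae_sub_le_integral hQ h.entropy_integrable h.entropy_ineq
  let G : ℝ → State d := fun ξ => flux γ n UL + s • UL - ∫ x in (-s)..ξ, W x
  have hconst : ∀ (a b : ℝ) (c : State d), (∀ x ∈ uIoc a b, W x = c) →
      ∫ x in a..b, W x = (b - a) • c := fun a b c hc => by
    rw [intervalIntegral.integral_congr_ae (Eventually.of_forall hc),
      intervalIntegral.integral_const]
  have hleft : ∀ ξ, ξ ≤ -s → G ξ = flux γ n UL - ξ • UL := fun ξ hξ => by
    change _ - _ = _
    rw [hconst _ _ UL fun x hx => hL x ?_]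
    · module
    · rw [uIoc_of_ge hξ] at hx; linarith [hx.2]
  have hsub : ∀ a b, G b - G a = - ∫ ξ in a..b, W ξ := fun a b => by
    change _ - _ - (_ - _) = _
    rw [← intervalIntegral.integral_interval_sub_left (hWii (-s) b) (hWii (-s) a)]
    abel
  have hae : ∀ ξ ∈ t, flux γ n (W ξ) - ξ • W ξ = G ξ := fun ξ hξ => by
    obtain ⟨a, hat, -, ha⟩ := exists_lt_mem_of_ae ht (show -s - 1 < -s by linarith)
    have e := H a hat ξ hξ
    have e2 := hsub a ξ
    rw [hL a (by linarith), ← hleft a ha.le] at e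
    rw [← e] at e2
    have e3 : G ξ = G a - (G a - (flux γ n (W ξ) - ξ • W ξ)) := by
      rw [eq_sub_iff_add_eq, ← sub_eq_zero]
      rw [← sub_eq_zero] at e2
      rw [← e2]; abel
    rw [e3]; abel
  refine ⟨s, G, ⟨by linarith, ⟨B, hB⟩, h.physical, fun ξ hξ => hL ξ (by linarith),
    fun ξ hξ => hR ξ (by linarith), hWii, fun a b =>
    (h.entropy_integrable.integrableOn_isCompact isCompact_uIcc).intervalIntegrable,
    hsub, hleft, fun ξ hξ => ?_, ?_, t', ht', H'⟩⟩
  · obtain ⟨b, hbt, hb, -⟩ := exists_lt_mem_of_ae ht (show s < s + 1 by linarith)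
    have e := hae b hbt
    have e2 := hsub b ξ
    rw [hR b (by linarith)] at e
    rw [hconst _ _ UR fun x hx => hR x ?_, ← e] at e2
    · rw [sub_eq_iff_eq_add] at e2; rw [e2]; module
    · rcases mem_uIoc.1 hx with hx | hx <;> linarith [hx.1]
  · filter_upwards [ht] with ξ hξ using hae ξ hξ

theorem flux_neg (n : Space d) (U : State d) : flux γ (-n) U = -flux γ n U := by
  simp only [flux, inner_neg_right, smul_neg, neg_div, neg_smul, neg_mul]
  ext <;> simp; ring

theorem entropyFlux_neg (n : Space d) (U : State d) :
    entropyFlux γ (-n) U = -entropyFlux γ n U := by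
  simp [entropyFlux, inner_neg_right, neg_div]

theorem ae_comp_neg {p : ℝ → Prop} (h : ∀ᵐ x, p x) : ∀ᵐ x, p (-x) :=
  (Measure.measurePreserving_neg (volume : Measure ℝ)).quasiMeasurePreserving.ae h

/-- The constant in `norm_sub_flux_le`. -/
noncomputable def dissipationConst (γ A : ℝ) : ℝ :=
  (8 + 5 / (γ - 1)) * A ^ 3 * (1 + 2 * A + 33 * A ^ 3)

namespace IsRiemannProfile

variable {n : Space d} {UL UR : State d} {W : ℝ → State d} {s : ℝ} {G : ℝ → State d}

local notation "Profile" => IsRiemannProfile γ n UL UR W s G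

/-- Reflection of a Riemann problem. -/
theorem reflect (h : Profile) :
    IsRiemannProfile γ (-n) UR UL (fun ξ => W (-ξ)) s (fun ξ => -G (-ξ)) where
  pos := h.pos
  bounded := h.bounded.imp fun B hB ξ => hB _
  physical ξ := h.physical _
  left ξ hξ := h.right _ (by linarith)
  right ξ hξ := h.left _ (by linarith)
  integrable a b := by
    simpa using (IntervalIntegrable.iff_comp_neg (by simp)).1 (h.integrable (-a) (-b))
  integrable_entropy a b := by
    simpa using (IntervalIntegrable.iff_comp_neg (by simp)).1 (h.integrable_entropy (-a) (-b))
  sub_eq a b := by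
    rw [intervalIntegral.integral_comp_neg (fun x => W x), ← h.sub_eq]
    abel
  eq_left ξ hξ := by
    rw [h.eq_right _ (by linarith), flux_neg]; module
  eq_right ξ hξ := by
    rw [h.eq_left _ (by linarith), flux_neg]; module
  ae_eq := by
    filter_upwards [ae_comp_neg h.ae_eq] with ξ hξ
    rw [← hξ, flux_neg]; module
  entropy_le := by
    obtain ⟨t, ht, H⟩ := h.entropy_le
    refine ⟨{x | -x ∈ t}, ae_comp_neg ht, fun a ha b hb hab => ?_⟩
    have := H (-b) hb (-a) ha (by linarith)
    rw [intervalIntegral.integral_comp_neg (fun x => entropy γ (W x)), entropyFlux_neg,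
      entropyFlux_neg]
    linarith

theorem integrable_clm (h : Profile) (ℓ : State d →L[ℝ] ℝ) (a b : ℝ) :
    IntervalIntegrable (fun ξ => ℓ (W ξ)) volume a b :=
  ⟨ℓ.integrable_comp (h.integrable a b).1, ℓ.integrable_comp (h.integrable a b).2⟩

theorem integrable_relEnergy (h : Profile) (U : State d) (a b : ℝ) :
    IntervalIntegrable (fun ξ => relEnergy γ (W ξ) U) volume a b :=
  ((h.integrable_clm _ a b).sub ((h.integrable_entropy a b).const_mul _)).add
    intervalIntegrable_const

theorem integral_relEnergy (h : Profile) (U : State d) (a b : ℝ) :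
    ∫ ξ in a..b, relEnergy γ (W ξ) U = pairing γ U (∫ ξ in a..b, W ξ)
      - temperature γ U * (∫ ξ in a..b, entropy γ (W ξ)) + (b - a) * pressure γ U := by
  have h1 := h.integrable_clm (pairing γ U) a b
  have h2 := (h.integrable_entropy a b).const_mul (temperature γ U)
  unfold relEnergy
  rw [intervalIntegral.integral_add (h1.sub h2) intervalIntegrable_const,
    intervalIntegral.integral_sub h1 h2, intervalIntegral.integral_const_mul,
    intervalIntegral.integral_const, ContinuousLinearMap.intervalIntegral_comp_comm _
      (h.integrable a b), smul_eq_mul]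

/-- The relative energy with respect to the left state is transported at least with speed `ξ`. -/
theorem relEnergy_flux_le (hγ : 1 < γ) (h : Profile)
    (hU : IsPhysical γ UL) : ∀ᵐ ξ, inner ℝ (velocity (W ξ)) n * relEnergy γ (W ξ) UL
      + (pressure γ (W ξ) - pressure γ UL) * inner ℝ (velocity (W ξ) - velocity UL) n
        ≤ ξ * relEnergy γ (W ξ) UL := by
  obtain ⟨t, ht, H⟩ := h.entropy_le
  filter_upwards [h.ae_eq, ht] with ξ hξ hξt
  obtain ⟨a, hat, -, ha⟩ := exists_lt_mem_of_ae ht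
    (show min ξ (-s) - 1 < min ξ (-s) by linarith)
  have haξ : a < ξ := ha.trans_le (min_le_left _ _)
  have has : a < -s := ha.trans_le (min_le_right _ _)
  have e1 := relEnergy_flux (h.physical ξ) UL n
  have e2 := relEnergy_flux (Or.inl hU) UL n
  have e3 := h.integral_relEnergy UL a ξ
  have e4 := H a hat ξ hξt haξ
  have e5 := h.sub_eq a ξ
  have e6 : 0 ≤ ∫ x in a..ξ, relEnergy γ (W x) UL :=
    intervalIntegral.integral_nonneg haξ.le fun x _ => relEnergy_nonneg hγ (h.physical x) hU
  rw [h.left a has.le] at e4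
  rw [h.eq_left a has.le, ← hξ] at e5
  rw [relEnergy_self hγ hU] at e2
  have e7 : ∫ x in a..ξ, W x = flux γ n UL - a • UL - (flux γ n (W ξ) - ξ • W ξ) := by
    rw [← neg_eq_iff_eq_neg.2 e5]; abel
  rw [e7] at e3
  simp only [map_sub, map_smul, smul_eq_mul] at e3
  have e8 := relEnergy_self hγ hU
  have e9 := mul_le_mul_of_nonneg_left e4 (temperature_pos hU).le
  rw [← e1]
  simp only [relEnergy] at e6 e8 e3 ⊢
  simp only [sub_self, mul_zero, add_zero, inner_zero_left] at e2
  have e10 := congrArg (a * ·) e8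
  simp only [mul_zero] at e10
  linarith

/-- The entropy dissipation to the left of the interface. -/
theorem integral_relEnergy_left (hγ : 1 < γ) (h : Profile)
    (hU : IsPhysical γ UL) :
    ∫ ξ in (-s)..0, relEnergy γ (W ξ) UL = temperature γ UL *
        (s * entropy γ UL - ∫ ξ in (-s)..0, entropy γ (W ξ))
      - pairing γ UL (G 0 - flux γ n UL) := by
  have e := h.sub_eq (-s) 0
  rw [h.eq_left (-s) le_rfl] at e
  have e7 : ∫ x in (-s)..0, W x = flux γ n UL + s • UL - G 0 := by
    rw [← neg_eq_iff_eq_neg.2 e]; module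
  have e8 := relEnergy_self hγ hU
  rw [relEnergy] at e8
  rw [h.integral_relEnergy, e7]
  simp only [map_sub, map_add, map_smul, smul_eq_mul]
  linear_combination s * e8

/-- The difference of the fluxes at the interface and in the left state is controlled by the
entropy dissipation to the left of the interface. -/
theorem norm_sub_flux_le {A : ℝ} (hγ : 1 < γ) (hγ2 : γ ≤ 2) (hA : 1 ≤ A) (hn : ‖n‖ = 1)
    (h : Profile) (hU : StateBdd γ A UL) {ε : ℝ} (hε : 0 < ε) :
    ‖G 0 - flux γ n UL‖ ≤ dissipationConst γ A *
      (ε + (1 + 1 / ε) * ∫ ξ in (-s)..0, relEnergy γ (W ξ) UL) := by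
  have hg : 0 < γ - 1 := by linarith
  have hA0 : 0 < A := by linarith
  set C := (8 + 5 / (γ - 1)) * A ^ 3 with hC
  have hC0 : 0 < C := by positivity
  set σ := 33 * A ^ 3 with hσ
  have hσ0 : 0 < σ := by positivity
  set I := ∫ ξ in (-s)..0, relEnergy γ (W ξ) UL with hI
  have hs0 : -s ≤ 0 := by linarith [h.pos]
  have hI0 : 0 ≤ I := intervalIntegral.integral_nonneg hs0 fun x _ =>
    relEnergy_nonneg hγ (h.physical x) hU.physical
  have e7 : G 0 - flux γ n UL = ∫ x in (-s)..0, (UL - W x) := by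
    have e := h.sub_eq (-s) 0
    rw [h.eq_left (-s) le_rfl] at e
    rw [intervalIntegral.integral_sub intervalIntegrable_const (h.integrable _ _),
      intervalIntegral.integral_const, sub_eq_add_neg, sub_eq_add_neg, ← e]
    module
  let g : ℝ → ℝ := fun ξ => C * ((1 + 2 * A + 1 / ε) * relEnergy γ (W ξ) UL +
    (Icc (-σ) 0).indicator (fun _ => ε) ξ)
  have hind : ∀ a b, IntervalIntegrable ((Icc (-σ) 0).indicator (fun _ => ε)) volume a b :=
    fun a b => by
      have : Integrable ((Icc (-σ) 0).indicator (fun _ : ℝ => ε)) :=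
        (integrable_indicator_iff measurableSet_Icc).2 (by simp)
      exact this.intervalIntegrable
  have hgi : IntervalIntegrable g volume (-s) 0 :=
    (((h.integrable_relEnergy UL _ _).const_mul _).add (hind _ _)).const_mul C
  have hbound : ∀ᵐ ξ, ξ ∈ Ioc (-s) 0 → ‖UL - W ξ‖ ≤ g ξ := by
    filter_upwards [h.relEnergy_flux_le hγ hU.physical] with ξ hξ hξs
    have h1 := norm_sub_le_relEnergy hγ hγ2 hA (h.physical ξ) hU
    have he := relEnergy_nonneg hγ (h.physical ξ) hU.physical
    rw [norm_sub_rev]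
    refine h1.trans (mul_le_mul_of_nonneg_left ?_ hC0.le)
    set e := relEnergy γ (W ξ) UL
    have hind0 : 0 ≤ (Icc (-σ) 0).indicator (fun _ : ℝ => ε) ξ :=
      indicator_nonneg (fun _ _ => hε.le) _
    have hsq := Real.sq_sqrt he
    have hsq0 := Real.sqrt_nonneg e
    have hee : 0 ≤ 1 / ε * e := by positivity
    rcases le_or_gt e (1 / (4 * A ^ 2)) with hsmall | hbig
    · have h2 := (abs_le.1 (abs_relEnergy_flux_le hγ hγ2 hA (h.physical ξ) hU hn hsmall)).1
      rcases he.eq_or_lt with he0 | he0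
      · rw [← he0]; simpa using hind0
      · have h3 : -σ ≤ ξ := by
          have h4 : (-σ) * e ≤ ξ * e := by linarith
          exact le_of_mul_le_mul_right h4 he0
        rw [indicator_of_mem (show ξ ∈ Icc (-σ) 0 from ⟨h3, hξs.2⟩)]
        have : √e ≤ ε + 1 / ε * e := by
          have h6 : 0 ≤ (√e - ε) ^ 2 / ε + √e := by positivity
          have h7 : (√e - ε) ^ 2 / ε = 1 / ε * e - 2 * √e + ε := by
            rw [sub_sq, hsq]; field_simp
          linarith
        nlinarith
    · have h2 : 1 ≤ 2 * A * √e := by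
        have h3 : √(1 / (4 * A ^ 2)) ≤ √e := Real.sqrt_le_sqrt hbig.le
        have h4 : √(1 / (4 * A ^ 2)) = 1 / (2 * A) := by
          rw [show 1 / (4 * A ^ 2) = (1 / (2 * A)) ^ 2 by field_simp; norm_num]
          exact Real.sqrt_sq (by positivity)
        rw [h4, div_le_iff₀ (by positivity)] at h3
        linarith
      have h3 : √e ≤ 2 * A * e := by nlinarith
      nlinarith
  rw [e7]
  refine (intervalIntegral.norm_integral_le_of_norm_le hs0 hbound hgi).trans ?_
  have e8 : ∫ ξ in (-s)..0, g ξ = C * ((1 + 2 * A + 1 / ε) * I +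
      ∫ ξ in (-s)..0, (Icc (-σ) 0).indicator (fun _ => ε) ξ) := by
    rw [intervalIntegral.integral_const_mul, intervalIntegral.integral_add
      ((h.integrable_relEnergy UL _ _).const_mul _) (hind _ _), intervalIntegral.integral_const_mul]
  have e9 : ∫ ξ in (-s)..0, (Icc (-σ) 0).indicator (fun _ => ε) ξ ≤ σ * ε := by
    rw [intervalIntegral.integral_of_le hs0]
    refine (setIntegral_le_integral ((integrable_indicator_iff measurableSet_Icc).2 (by simp))
      (Eventually.of_forall fun x => indicator_nonneg (fun _ _ => hε.le) _)).trans ?_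
    rw [integral_indicator measurableSet_Icc, setIntegral_const]
    simp [hσ0.le]
  rw [e8, dissipationConst, mul_assoc C]
  refine mul_le_mul_of_nonneg_left ?_ hC0.le
  have : 0 ≤ 1 / ε * I := by positivity
  have h5 : 0 ≤ σ * I := by positivity
  have h6 : 0 ≤ σ * (1 / ε * I) := by positivity
  nlinarith [mul_nonneg hA0.le this]

end IsRiemannProfile

/-! ### Absolutely continuous functions -/

theorem _root_.AbsolutelyContinuousOnInterval.lipschitz_comp {f φ : ℝ → ℝ} {a b : ℝ} {K : ℝ≥0}
    (hf : AbsolutelyContinuousOnInterval f a b) (hφ : LipschitzOnWith K φ (f '' uIcc a b)) :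
    AbsolutelyContinuousOnInterval (fun x => φ (f x)) a b := by
  rw [absolutelyContinuousOnInterval_iff] at hf ⊢
  intro ε hε
  obtain ⟨δ, hδ, H⟩ := hf (ε / (K + 1)) (by positivity)
  refine ⟨δ, hδ, fun E hE hl => ?_⟩
  have h1 := H E hE hl
  calc _ ≤ ∑ i ∈ Finset.range E.1, (K : ℝ) * dist (f (E.2 i).1) (f (E.2 i).2) := by
        refine Finset.sum_le_sum fun i hi => ?_
        exact hφ.dist_le_mul _ (mem_image_of_mem _ (hE.1 i hi).1) _
          (mem_image_of_mem _ (hE.1 i hi).2)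
    _ = K * ∑ i ∈ Finset.range E.1, dist (f (E.2 i).1) (f (E.2 i).2) := by
        rw [Finset.mul_sum]
    _ ≤ K * (ε / (K + 1)) := by gcongr
    _ < (K + 1) * (ε / (K + 1)) := by gcongr; linarith
    _ = ε := by field_simp

theorem _root_.AbsolutelyContinuousOnInterval.contDiffOn_comp {f φ : ℝ → ℝ} {a b : ℝ}
    (hf : AbsolutelyContinuousOnInterval f a b) (hpos : ∀ x ∈ uIcc a b, 0 < f x)
    (hφ : ContDiffOn ℝ 1 φ (Ioi 0)) :
    AbsolutelyContinuousOnInterval (fun x => φ (f x)) a b := by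
  have hc : IsCompact (f '' uIcc a b) := isCompact_uIcc.image_of_continuousOn hf.continuousOn
  have hsub : f '' uIcc a b ⊆ Ioi 0 := by rintro _ ⟨x, hx, rfl⟩; exact hpos x hx
  have hconv : Convex ℝ (f '' uIcc a b) :=
    ((isPreconnected_uIcc.image f hf.continuousOn).ordConnected).convex
  obtain ⟨K, hK⟩ := (hφ.mono hsub).exists_lipschitzOnWith one_ne_zero hconv hc
  exact hf.lipschitz_comp hK

theorem _root_.AbsolutelyContinuousOnInterval.inv_pos {f : ℝ → ℝ} {a b : ℝ}
    (hf : AbsolutelyContinuousOnInterval f a b) (hpos : ∀ x ∈ uIcc a b, 0 < f x) :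
    AbsolutelyContinuousOnInterval (fun x => (f x)⁻¹) a b :=
  hf.contDiffOn_comp hpos (contDiffOn_id.inv fun _ hx => (ne_of_gt hx))

theorem _root_.AbsolutelyContinuousOnInterval.sqrt_pos {f : ℝ → ℝ} {a b : ℝ}
    (hf : AbsolutelyContinuousOnInterval f a b) (hpos : ∀ x ∈ uIcc a b, 0 < f x) :
    AbsolutelyContinuousOnInterval (fun x => √(f x)) a b :=
  hf.contDiffOn_comp hpos fun _ hx => (Real.contDiffAt_sqrt (ne_of_gt hx)).contDiffWithinAt

theorem _root_.AbsolutelyContinuousOnInterval.div_pos {f g : ℝ → ℝ} {a b : ℝ}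
    (hf : AbsolutelyContinuousOnInterval f a b) (hg : AbsolutelyContinuousOnInterval g a b)
    (hpos : ∀ x ∈ uIcc a b, 0 < g x) :
    AbsolutelyContinuousOnInterval (fun x => f x / g x) a b := by
  simpa only [div_eq_mul_inv] using hf.fun_mul (hg.inv_pos hpos)

theorem ae_ne (c : ℝ) : ∀ᵐ x : ℝ, x ≠ c := by rw [ae_iff]; simp

theorem le_of_ac_of_deriv_nonneg {f : ℝ → ℝ} {a b : ℝ} (hab : a ≤ b)
    (hf : AbsolutelyContinuousOnInterval f a b)
    (h : ∀ᵐ x, x ∈ Ioo a b → ∃ c, HasDerivAt f c x ∧ 0 ≤ c) : f a ≤ f b := by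
  rw [← sub_nonneg, ← hf.integral_deriv_eq_sub]
  refine intervalIntegral.integral_nonneg_of_ae_restrict hab ?_
  rw [EventuallyLE, ae_restrict_iff' measurableSet_Icc]
  filter_upwards [h, ae_ne a, ae_ne b] with x hx h1 h2 h3
  obtain ⟨c, hc, hc0⟩ := hx ⟨lt_of_le_of_ne h3.1 (Ne.symm h1), lt_of_le_of_ne h3.2 h2⟩
  rw [hc.deriv]; exact hc0

theorem eq_of_ac_of_deriv_zero {f : ℝ → ℝ} {a b : ℝ} (hab : a ≤ b)
    (hf : AbsolutelyContinuousOnInterval f a b)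
    (h : ∀ᵐ x, x ∈ Ioo a b → HasDerivAt f 0 x) : f a = f b := by
  refine le_antisymm (le_of_ac_of_deriv_nonneg hab hf ?_) ?_
  · filter_upwards [h] with x hx h3 using ⟨0, hx h3, le_rfl⟩
  · have := le_of_ac_of_deriv_nonneg hab hf.neg (by
      filter_upwards [h] with x hx h3 using ⟨0, by simpa using (hx h3).neg, le_rfl⟩)
    simpa using this

/-- `f` is a primitive of the locally integrable function `f'`. -/
structure IsPrimitive (f f' : ℝ → ℝ) : Prop where
  integrable : ∀ a b, IntervalIntegrable f' volume a b
  sub_eq : ∀ a b, f b - f a = ∫ x in a..b, f' x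

namespace IsPrimitive

variable {f f' g g' : ℝ → ℝ}

theorem ac (h : IsPrimitive f f') (a b : ℝ) : AbsolutelyContinuousOnInterval f a b := by
  have h1 := (h.integrable a b).absolutelyContinuousOnInterval_intervalIntegral (c := a) (by simp)
  have h2 : AbsolutelyContinuousOnInterval (fun _ : ℝ => f a) a b :=
    (LipschitzWith.const (f a)).lipschitzOnWith.absolutelyContinuousOnInterval
  have h3 := h2.add h1
  have e : (fun _ : ℝ => f a) + (fun x => ∫ v in a..x, f' v) = f := by
    funext x
    simp [← h.sub_eq]
  rwa [e] at h3

theorem continuous (h : IsPrimitive f f') : Continuous f := by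
  rw [continuous_iff_continuousAt]
  intro x
  have := (h.ac (x - 1) (x + 1)).continuousOn
  rw [uIcc_of_le (by linarith)] at this
  exact this.continuousAt (Icc_mem_nhds (by linarith) (by linarith))

theorem ae_hasDerivAt (h : IsPrimitive f f') : ∀ᵐ x, HasDerivAt f (f' x) x := by
  have key : ∀ N : ℕ, ∀ᵐ x : ℝ, x ∈ Ioo (-(N:ℝ)) N → HasDerivAt f (f' x) x := fun N => by
    filter_upwards [(h.integrable (-N) N).ae_hasDerivAt_integral] with x hx hxN
    have hN : (-(N:ℝ)) ≤ N := by linarith [hxN.1.trans hxN.2]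
    have hx2 : x ∈ uIcc (-(N:ℝ)) N := by rw [uIcc_of_le hN]; exact ⟨hxN.1.le, hxN.2.le⟩
    have h1 := (hx hx2 (-N) (by simp)).const_add (f (-N))
    refine h1.congr_of_eventuallyEq (Eventually.of_forall fun y => ?_)
    simp only [← h.sub_eq]; ring
  filter_upwards [ae_all_iff.2 key] with x hx
  obtain ⟨N, hN⟩ := exists_nat_gt |x|
  exact hx N (abs_lt.1 hN)

/-- A quantity transported with the flow is constant where the mass flux does not vanish. -/
theorem div_eq_of_transport {j ρ k : ℝ → ℝ} (hj : IsPrimitive j (fun x => -ρ x))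
    (hk : IsPrimitive k k') (hk' : ∀ᵐ x, j x ≠ 0 → k' x = -(ρ x * (k x / j x))) {a b : ℝ}
    (hab : a ≤ b) (hpos : ∀ x ∈ Icc a b, 0 < j x) : k a / j a = k b / j b := by
  rw [← uIcc_of_le hab] at hpos
  refine eq_of_ac_of_deriv_zero hab ((hk.ac a b).div_pos (hj.ac a b) hpos) ?_
  filter_upwards [hj.ae_hasDerivAt, hk.ae_hasDerivAt, hk'] with x h1 h2 h3 hx
  have hx0 : j x ≠ 0 := (hpos x (by rw [uIcc_of_le hab]; exact ⟨hx.1.le, hx.2.le⟩)).ne'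
  have := h2.div h1 hx0
  rw [h3 hx0] at this
  convert! this using 1
  field_simp
  ring

end IsPrimitive

/-! ### The mass flux and the minimum entropy principle for the Riemann problem -/

namespace IsRiemannProfile

variable {n : Space d} {UL UR : State d} {W : ℝ → State d} {s : ℝ} {G : ℝ → State d}

local notation "Profile" => IsRiemannProfile γ n UL UR W s G

theorem isPrimitive_clm (h : Profile) (ℓ : State d →L[ℝ] ℝ) :
    IsPrimitive (fun ξ => ℓ (G ξ)) (fun ξ => -ℓ (W ξ)) :=
  ⟨fun a b => (h.integrable_clm ℓ a b).neg, fun a b => by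
      rw [intervalIntegral.integral_neg, ContinuousLinearMap.intervalIntegral_comp_comm _
        (h.integrable a b), ← map_neg, ← h.sub_eq, map_sub]⟩

theorem isPrimitive_fst (h : Profile) :
    IsPrimitive (fun ξ => (G ξ).1) (fun ξ => -(W ξ).1) :=
  h.isPrimitive_clm (ContinuousLinearMap.fst ℝ ℝ (Space d × ℝ))

theorem integrable_fst (h : Profile) (a b : ℝ) :
    IntervalIntegrable (fun ξ => (W ξ).1) volume a b :=
  h.integrable_clm (ContinuousLinearMap.fst ℝ ℝ (Space d × ℝ)) a b

theorem antitone_fst (h : Profile) : Antitone fun ξ => (G ξ).1 := by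
  intro a b hab
  rw [← sub_nonpos, h.isPrimitive_fst.sub_eq, intervalIntegral.integral_neg, neg_nonpos]
  exact intervalIntegral.integral_nonneg hab fun x _ => density_nonneg (h.physical x)

theorem exists_pos_left (h : Profile) (hL : 0 < UL.1) (x : ℝ) :
    ∃ ξ, ξ < x ∧ ξ < -s ∧ 0 < (G ξ).1 := by
  let ξ := min (min x (-s)) (inner ℝ UL.2.1 n / UL.1) - 1
  have h1 : ξ < min x (-s) := by
    have := min_le_left (min x (-s)) (inner ℝ UL.2.1 n / UL.1); simp only [ξ]; linarith
  have h2 : ξ < inner ℝ UL.2.1 n / UL.1 := by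
    have := min_le_right (min x (-s)) (inner ℝ UL.2.1 n / UL.1); simp only [ξ]; linarith
  have h3 := h1.trans_le (min_le_right _ _)
  refine ⟨ξ, h1.trans_le (min_le_left _ _), h3, ?_⟩
  rw [h.eq_left ξ h3.le]
  rw [lt_div_iff₀ hL] at h2
  simpa [flux] using h2

/-- The interval of the speeds with which no mass is transported. -/
theorem exists_contact (h : Profile) (hL : 0 < UL.1) (hR : 0 < UR.1) :
    ∃ a b, a ≤ b ∧ (∀ ξ, ξ < a → 0 < (G ξ).1) ∧ (∀ ξ ∈ Icc a b, (G ξ).1 = 0) ∧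
      ∀ ξ, b < ξ → (G ξ).1 < 0 := by
  obtain ⟨x₁, -, -, hx₁⟩ := h.exists_pos_left hL 0
  obtain ⟨x₂, -, -, hx₂⟩ := h.reflect.exists_pos_left hR 0
  simp only [Prod.fst_neg, Left.neg_pos_iff] at hx₂
  have hc := h.isPrimitive_fst.continuous
  have hanti := h.antitone_fst
  have hlt : x₁ < -x₂ := hanti.reflect_lt (hx₂.trans hx₁)
  let Z : Set ℝ := {ξ | (G ξ).1 = 0}
  have hZb : Z ⊆ Icc x₁ (-x₂) := fun ξ hξ =>
    ⟨le_of_not_gt fun h1 => (hx₁.trans_le (hanti h1.le)).ne' hξ,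
      le_of_not_gt fun h1 => ((hanti h1.le).trans_lt hx₂).ne hξ⟩
  obtain ⟨ξ₀, -, hξ₀⟩ := intermediate_value_Icc' hlt.le hc.continuousOn
    (show (0 : ℝ) ∈ Icc (G (-x₂)).1 (G x₁).1 from ⟨hx₂.le, hx₁.le⟩)
  have hZn : Z.Nonempty := ⟨ξ₀, hξ₀⟩
  have hZk : IsCompact Z := isCompact_Icc.of_isClosed_subset (isClosed_eq hc continuous_const) hZb
  have ha : (G (sInf Z)).1 = 0 := hZk.sInf_mem hZn
  have hb : (G (sSup Z)).1 = 0 := hZk.sSup_mem hZn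
  exact ⟨sInf Z, sSup Z, csInf_le_csSup hZn hZk.bddBelow hZk.bddAbove,
    fun ξ hξ => (ha.ge.trans (hanti hξ.le)).lt_of_ne fun h0 =>
      (csInf_le hZk.bddBelow h0.symm).not_gt hξ,
    fun ξ hξ => le_antisymm ((hanti hξ.1).trans ha.le) (hb.ge.trans (hanti hξ.2)),
    fun ξ hξ => ((hanti hξ.le).trans hb.le).lt_of_ne fun h0 =>
      (le_csSup hZk.bddAbove h0).not_gt hξ⟩

theorem fst_eq (h : Profile) : ∀ᵐ ξ,
    (G ξ).1 = (W ξ).1 * (inner ℝ (velocity (W ξ)) n - ξ) := by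
  filter_upwards [h.ae_eq] with ξ hξ
  rw [← hξ]
  simp only [flux, Prod.fst_sub, Prod.smul_fst, smul_eq_mul,
    inner_momentum (h.physical ξ)]; ring

theorem ae_eq_zero (h : Profile) {a b : ℝ} (hab : a ≤ b)
    (he : (G a).1 = (G b).1) : ∀ᵐ ξ, ξ ∈ Ioc a b → W ξ = 0 := by
  have e : ∫ ξ in a..b, (W ξ).1 = 0 := by
    have := h.isPrimitive_fst.sub_eq a b
    rw [he, intervalIntegral.integral_neg] at this
    linarith
  rw [intervalIntegral.integral_eq_zero_iff_of_le_of_nonneg_ae hab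
    (Eventually.of_forall fun ξ => density_nonneg (h.physical ξ)) (h.integrable_fst a b),
    EventuallyEq, ae_restrict_iff' measurableSet_Ioc] at e
  filter_upwards [e] with ξ h1 h2
  exact (h.physical ξ).resolve_left fun h4 => h4.1.ne' (h1 h2)

theorem ae_vacuum (h : Profile) (hL : 0 < UL.1) (hR : 0 < UR.1) :
    ∀ᵐ ξ, (G ξ).1 = 0 → W ξ = 0 := by
  obtain ⟨a, b, hab, h1, h2, h3⟩ := h.exists_contact hL hR
  filter_upwards [h.ae_eq_zero hab ((h2 a ⟨le_rfl, hab⟩).trans (h2 b ⟨hab, le_rfl⟩).symm), ae_ne a]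
    with ξ hξ hne h0
  exact hξ ⟨lt_of_le_of_ne (le_of_not_gt fun hcon => (h1 ξ hcon).ne' h0) (Ne.symm hne),
    le_of_not_gt fun hcon => (h3 ξ hcon).ne h0⟩

/-- The specific entropy is nondecreasing where the mass flux is positive. -/
theorem specEntropy_mono (hγ : 1 < γ) (h : Profile) :
    ∃ t : Set ℝ, (∀ᵐ ξ, ξ ∈ t) ∧ ∀ a ∈ t, ∀ b ∈ t, a < b → 0 < (G b).1 →
      specEntropy γ (W a) ≤ specEntropy γ (W b) := by
  obtain ⟨t, ht, H⟩ := h.entropy_le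
  have hg : 0 < γ - 1 := by linarith
  have hj := h.isPrimitive_fst
  set j : ℝ → ℝ := fun ξ => (G ξ).1 with hjdef
  set σ : ℝ → ℝ := fun ξ => specEntropy γ (W ξ) with hσ
  set ρ : ℝ → ℝ := fun ξ => (W ξ).1 with hρ
  have hρi : ∀ a b, IntervalIntegrable ρ volume a b := h.integrable_fst
  have hρσ : ∀ ξ, ρ ξ * σ ξ = (γ - 1) * entropy γ (W ξ) := fun ξ => by
    rw [entropy_eq]; field_simp; simp [hρ, hσ]
  have hρσi : ∀ a b, IntervalIntegrable (fun ξ => ρ ξ * σ ξ) volume a b := fun a b => by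
    simp only [hρσ]
    exact (h.integrable_entropy a b).const_mul _
  have hjn : ∀ᵐ ξ, j ξ * σ ξ =
      (γ - 1) * (entropyFlux γ n (W ξ) - ξ * entropy γ (W ξ)) := by
    filter_upwards [h.fst_eq] with ξ hξ
    simp only [hjdef, hξ]
    rw [entropyFlux, inner_momentum_div]
    linear_combination (inner ℝ (velocity (W ξ)) n - ξ) * hρσ ξ
  refine ⟨t ∩ {ξ | j ξ * σ ξ = (γ - 1) * (entropyFlux γ n (W ξ) - ξ * entropy γ (W ξ))}, ?_, ?_⟩
  · filter_upwards [ht, hjn] with ξ h1 h2 using ⟨h1, h2⟩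
  rintro a ⟨hat, haj⟩ b ⟨hbt, hbj⟩ hab hb0
  simp only [mem_ofPred_eq] at haj hbj
  have hanti := h.antitone_fst
  have hpos : ∀ x ∈ uIcc a b, 0 < j x := fun x hx => by
    rw [uIcc_of_le hab.le] at hx
    exact hb0.trans_le (hanti hx.2)
  set k := σ b with hk
  -- the primitive of `ρ (σ - k)` vanishing at `b`
  let g : ℝ → ℝ := fun x => ∫ y in x..b, ρ y * (σ y - k)
  have hfi : ∀ a b, IntervalIntegrable (fun y => ρ y * (σ y - k)) volume a b := fun a b => by
    simpa only [mul_sub] using (hρσi a b).sub ((hρi a b).mul_const k)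
  have hg' : IsPrimitive g (fun x => -(ρ x * (σ x - k))) := ⟨fun a b => (hfi a b).neg,
    fun a' b' => by
      simp only [g]
      rw [intervalIntegral.integral_neg, ← intervalIntegral.integral_add_adjacent_intervals
        (hfi a' b') (hfi b' b)]; ring⟩
  have key : ∀ x ∈ t, j x * σ x = (γ - 1) * (entropyFlux γ n (W x) - x * entropy γ (W x)) →
      x < b → j x * (σ x - k) ≤ g x := by
    intro x hx hxj hxb
    have e1 := mul_le_mul_of_nonneg_left (H x hx b hbt hxb) hg.le
    rw [← intervalIntegral.integral_const_mul, mul_sub, ← hxj, ← hbj] at e1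
    simp only [← hρσ] at e1
    have e2 := hj.sub_eq x b
    rw [intervalIntegral.integral_neg] at e2
    have e3 : g x = (∫ y in x..b, ρ y * σ y) - (∫ y in x..b, ρ y) * k := by
      simp only [g, mul_sub]
      rw [intervalIntegral.integral_sub (hρσi x b) ((hρi x b).mul_const k),
        intervalIntegral.integral_mul_const]
    rw [e3]
    have e4 : ∫ y in x..b, ρ y = j x - j b := by linarith
    rw [e4]
    linarith
  have hmono : g a / j a ≤ g b / j b := by
    refine le_of_ac_of_deriv_nonneg hab.le ((hg'.ac a b).div_pos (hj.ac a b) hpos) ?_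
    filter_upwards [hj.ae_hasDerivAt, hg'.ae_hasDerivAt, ht, hjn] with x h1 h2 h3 h4 hx
    have hx0 : 0 < j x := hpos x (by rw [uIcc_of_le hab.le]; exact ⟨hx.1.le, hx.2.le⟩)
    refine ⟨_, h2.div h1 hx0.ne', div_nonneg ?_ (sq_nonneg _)⟩
    have h5 := mul_le_mul_of_nonneg_left (key x h3 h4 hx.2) (density_nonneg (h.physical x))
    simp only [hρ, hjdef] at h5 ⊢
    nlinarith
  have hgb : g b = 0 := by simp [g]
  have ha0 : 0 < j a := hpos a (by simp)
  rw [hgb, zero_div, div_nonpos_iff] at hmono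
  have hga : g a ≤ 0 := by
    rcases hmono with h1 | h1
    · linarith [h1.2]
    · exact h1.1
  have := (key a hat haj hab).trans hga
  exact sub_nonpos.1 (nonpos_of_mul_nonpos_right this ha0)

theorem specEntropy_left_le (hγ : 1 < γ) (h : Profile) (hL : 0 < UL.1) :
    ∀ᵐ ξ, 0 < (G ξ).1 → specEntropy γ UL ≤ specEntropy γ (W ξ) := by
  obtain ⟨t, ht, H⟩ := h.specEntropy_mono hγ
  filter_upwards [ht] with ξ hξ hpos
  obtain ⟨x, hx1, hx2, -⟩ := h.exists_pos_left hL ξ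
  obtain ⟨a, hat, -, ha⟩ := exists_lt_mem_of_ae ht (show x - 1 < x by linarith)
  have := H a hat ξ hξ (by linarith) hpos
  rwa [h.left a (by linarith)] at this

/-- Minimum entropy principle for the Riemann problem. -/
theorem ae_min_specEntropy_le (hγ : 1 < γ) (h : Profile)
    (hL : 0 < UL.1) (hR : 0 < UR.1) :
    ∀ᵐ ξ, W ξ = 0 ∨ min (specEntropy γ UL) (specEntropy γ UR) ≤ specEntropy γ (W ξ) := by
  have hr := ae_comp_neg (h.reflect.specEntropy_left_le hγ hR)
  filter_upwards [h.specEntropy_left_le hγ hL, hr, h.ae_vacuum hL hR] with ξ h1 h2 h3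
  simp only [neg_neg, Prod.fst_neg, Left.neg_pos_iff] at h2
  rcases lt_trichotomy (G ξ).1 0 with hlt | heq | hgt
  · exact Or.inr ((min_le_right _ _).trans (h2 hlt))
  · exact Or.inl (h3 heq)
  · exact Or.inr ((min_le_left _ _).trans (h1 hgt))

end IsRiemannProfile

/-! ### The flux at the interface -/

theorem flux_zero (n : Space d) : flux γ n (0 : State d) = 0 := by
  simp [flux, pressure]

theorem continuousAt_flux (n : Space d) {V : State d} (hV : V.1 ≠ 0) :
    ContinuousAt (flux γ n) V := by
  have h1 : ContinuousAt (fun U : State d => U.1) V := continuous_fst.continuousAt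
  have h2 : ContinuousAt (fun U : State d => U.2.1) V := by fun_prop
  have h3 : ContinuousAt (fun U : State d => U.2.2) V := by fun_prop
  have h4 : ContinuousAt (fun U : State d => pressure γ U) V := by
    unfold pressure
    exact continuousAt_const.mul (h3.sub ((h2.norm.pow 2).div (h1.const_mul 2)
      (mul_ne_zero two_ne_zero hV)))
  have h5 : ContinuousAt (fun U : State d => inner ℝ U.2.1 n) V := h2.inner continuousAt_const
  exact h5.prodMk ((((h5.div h1 hV).smul h2).add (h4.smul continuousAt_const)).prodMk
    ((h5.div h1 hV).mul (h3.add h4)))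

theorem flux_eq_velocity {W : State d} (hW : IsPhysical γ W ∨ W = 0) (n : Space d) :
    flux γ n W = (W.1 * inner ℝ (velocity W) n,
      inner ℝ (velocity W) n • W.2.1 + pressure γ W • n,
      inner ℝ (velocity W) n * (W.2.2 + pressure γ W)) := by
  rw [flux, inner_momentum_div, inner_momentum hW]

theorem pressure_nonneg {W : State d} (hW : IsPhysical γ W ∨ W = 0) : 0 ≤ pressure γ W := by
  rcases hW with h | rfl
  · exact h.2.le
  · simp [pressure]

instance neBot_nhdsGT_inf_ae : NeBot (𝓝[>] (0 : ℝ) ⊓ ae volume) := by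
  rw [inf_neBot_iff]
  intro s hs t ht
  obtain ⟨u, hu, hus⟩ := mem_nhdsGT_iff_exists_Ioo_subset.1 hs
  obtain ⟨x, hx, h1, h2⟩ := exists_lt_mem_of_ae ht hu
  exact ⟨x, hus ⟨h1, h2⟩, hx⟩

namespace IsRiemannProfile

variable {n : Space d} {UL UR : State d} {W : ℝ → State d} {s : ℝ} {G : ℝ → State d}

theorem continuous (h : IsRiemannProfile γ n UL UR W s G) : Continuous G := by
  have h1 := intervalIntegral.continuous_primitive h.integrable 0
  have e : G = fun ξ => G 0 - ∫ x in (0:ℝ)..ξ, W x := by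
    funext ξ
    have := h.sub_eq 0 ξ
    rw [sub_eq_iff_eq_add] at this
    rw [this]; abel
  rw [e]
  exact continuous_const.sub h1

/-- The part of the velocity which is tangential to the interface is constant to the left of the
contact discontinuity. -/
theorem tangential_eq (hn : ‖n‖ = 1) (h : IsRiemannProfile γ n UL UR W s G)
    (hL : IsPhysical γ UL) {ξ : ℝ} (hξ : 0 < (G ξ).1) :
    (G ξ).2.1 - inner ℝ (G ξ).2.1 n • n =
      (G ξ).1 • (velocity UL - inner ℝ (velocity UL) n • n) := by
  obtain ⟨x, hxξ, hxs, hx⟩ := h.exists_pos_left hL.1 ξ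
  have hnn := inner_self_eq_one_of_norm_eq_one (𝕜 := ℝ) hn
  have hx' : (G x).2.1 - inner ℝ (G x).2.1 n • n =
      (G x).1 • (velocity UL - inner ℝ (velocity UL) n • n) := by
    rw [h.eq_left x hxs.le, flux_eq_velocity (Or.inl hL)]
    simp only [Prod.fst_sub, Prod.snd_sub, Prod.smul_fst, Prod.smul_snd, smul_eq_mul]
    rw [momentum_eq (Or.inl hL)]
    simp only [inner_add_left, inner_sub_left, inner_smul_left, hnn]
    simp only [conj_trivial]
    module
  have key : ∀ w : Space d, inner ℝ n w = (0 : ℝ) →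
      inner ℝ (G ξ).2.1 w / (G ξ).1 = inner ℝ (G x).2.1 w / (G x).1 := by
    intro w hw
    let ℓ : State d →L[ℝ] ℝ := ((innerSL ℝ w).comp (ContinuousLinearMap.fst ℝ (Space d) ℝ)).comp
        (ContinuousLinearMap.snd ℝ ℝ (Space d × ℝ))
    have hℓ : ∀ U, ℓ U = inner ℝ U.2.1 w := fun U => by
      simp [ℓ, real_inner_comm]
    have hk := h.isPrimitive_clm ℓ
    simp only [hℓ] at hk
    refine (IsPrimitive.div_eq_of_transport h.isPrimitive_fst hk ?_ hxξ.le
      fun y hy => hξ.trans_le (h.antitone_fst hy.2)).symm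
    filter_upwards [h.ae_eq, h.fst_eq] with y hy hy' hy0
    have e : inner ℝ (G y).2.1 w = (G y).1 * inner ℝ (velocity (W y)) w := by
      rw [hy', ← hy, flux_eq_velocity (h.physical y)]
      simp only [Prod.snd_sub, Prod.smul_snd, Prod.fst_sub, Prod.smul_fst, inner_add_left,
        inner_sub_left, inner_smul_left, hw]
      rw [inner_momentum (h.physical y)]
      simp only [conj_trivial]
      ring
    rw [e, mul_div_cancel_left₀ _ hy0, inner_momentum (h.physical y)]
  have key2 : ∀ w : Space d, inner ℝ ((G ξ).2.1 - inner ℝ (G ξ).2.1 n • n) w =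
      inner ℝ ((G ξ).1 • (velocity UL - inner ℝ (velocity UL) n • n)) w := by
    intro w
    have hw : inner ℝ n (w - inner ℝ n w • n) = (0 : ℝ) := by
      rw [inner_sub_right, inner_smul_right, hnn]; ring
    have h1 := key _ hw
    have h2 : inner ℝ ((G x).2.1 - inner ℝ (G x).2.1 n • n) w =
      inner ℝ ((G x).1 • (velocity UL - inner ℝ (velocity UL) n • n)) w := by rw [hx']
    rw [div_eq_div_iff hξ.ne' hx.ne'] at h1
    simp only [inner_sub_right, inner_smul_right, inner_sub_left, inner_smul_left,
      conj_trivial] at h1 h2 ⊢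
    have h3 : (G x).1 * (inner ℝ (G ξ).2.1 w - inner ℝ (G ξ).2.1 n * inner ℝ n w) =
        (G ξ).1 * ((G x).1 * (inner ℝ (velocity UL) w - inner ℝ (velocity UL) n * inner ℝ n w)) := by
      rw [← h2]; linarith
    have h4 : (G x).1 * (inner ℝ (G ξ).2.1 w - inner ℝ (G ξ).2.1 n * inner ℝ n w) =
        (G x).1 * ((G ξ).1 * (inner ℝ (velocity UL) w - inner ℝ (velocity UL) n * inner ℝ n w)) := by
      rw [h3]; ring
    exact mul_left_cancel₀ hx.ne' h4
  exact ext_inner_right ℝ key2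

theorem velocity_eq (hn : ‖n‖ = 1) (h : IsRiemannProfile γ n UL UR W s G)
    (hL : IsPhysical γ UL) : ∀ᵐ ξ, 0 < (G ξ).1 → velocity (W ξ) =
      inner ℝ (velocity (W ξ)) n • n + (velocity UL - inner ℝ (velocity UL) n • n) := by
  have hnn := inner_self_eq_one_of_norm_eq_one (𝕜 := ℝ) hn
  filter_upwards [h.ae_eq, h.fst_eq] with ξ hξ hξ' hpos
  have e := h.tangential_eq hn hL hpos
  have e2 : (G ξ).2.1 - inner ℝ (G ξ).2.1 n • n =
      (G ξ).1 • (velocity (W ξ) - inner ℝ (velocity (W ξ)) n • n) := by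
    rw [hξ', ← hξ, flux_eq_velocity (h.physical ξ)]
    simp only [Prod.snd_sub, Prod.smul_snd, Prod.fst_sub, Prod.smul_fst]
    conv_lhs => rw [momentum_eq (h.physical ξ)]
    simp only [inner_add_left, inner_sub_left, inner_smul_left, hnn, conj_trivial]
    module
  rw [e] at e2
  have e3 := smul_right_injective _ hpos.ne' e2
  rw [e3]; abel

theorem flux_eq_of_tendsto_right (hγ : 1 < γ) (hn : ‖n‖ = 1)
    (h : IsRiemannProfile γ n UL UR W s G) (hR : IsPhysical γ UR) {V : State d}
    (hV : Tendsto W (𝓝[>] 0) (𝓝 V)) : flux γ n V = G 0 := by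
  have hg : 0 < γ - 1 := by linarith
  set l : Filter ℝ := 𝓝[>] (0 : ℝ) ⊓ ae volume with hl
  have hl1 : l ≤ 𝓝[>] (0 : ℝ) := inf_le_left
  have hl2 : l ≤ ae volume := inf_le_right
  have hl0 : Tendsto (fun ξ : ℝ => ξ) l (𝓝 0) := hl1.trans nhdsWithin_le_nhds
  have hWV : Tendsto W l (𝓝 V) := hV.mono_left hl1
  have hpos : ∀ᶠ ξ in l, (0 : ℝ) < ξ := hl1 self_mem_nhdsWithin
  have hGl : Tendsto G l (𝓝 (G 0)) := (h.continuous.tendsto 0).comp hl0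
  have hFl : Tendsto (fun ξ => flux γ n (W ξ)) l (𝓝 (G 0)) := by
    have h1 : Tendsto (fun ξ => G ξ + ξ • W ξ) l (𝓝 (G 0 + (0 : ℝ) • V)) :=
      hGl.add (hl0.smul hWV)
    rw [zero_smul, add_zero] at h1
    refine h1.congr' ?_
    filter_upwards [hl2 h.ae_eq] with ξ hξ
    rw [← hξ]; abel
  have hc1 : Tendsto (fun ξ => (W ξ).1) l (𝓝 V.1) := (continuous_fst.tendsto V).comp hWV
  have hc2 : Tendsto (fun ξ => (W ξ).2.1) l (𝓝 V.2.1) :=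
    ((continuous_fst.comp continuous_snd).tendsto V).comp hWV
  have hc3 : Tendsto (fun ξ => (W ξ).2.2) l (𝓝 V.2.2) :=
    ((continuous_snd.comp continuous_snd).tendsto V).comp hWV
  rcases ne_or_eq V.1 0 with hV1 | hV1
  · exact tendsto_nhds_unique ((continuousAt_flux n hV1).tendsto.comp hWV) hFl
  -- the limit is a vacuum
  have hm2 : ∀ ξ, ‖(W ξ).2.1‖ ^ 2 ≤ 2 * (W ξ).1 * (W ξ).2.2 := fun ξ => by
    have e1 := energy_eq_pressure hγ (h.physical ξ)
    have e2 := pressure_nonneg (h.physical ξ)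
    have e3 := density_nonneg (h.physical ξ)
    rw [e1, momentum_eq (h.physical ξ), norm_smul, Real.norm_of_nonneg e3]
    have : 0 ≤ (W ξ).1 * (1 / (γ - 1) * pressure γ (W ξ)) := by positivity
    nlinarith
  have hV2 : V.2.1 = 0 := by
    have h1 := le_of_tendsto_of_tendsto' (hc2.norm.pow 2) ((hc1.const_mul 2).mul hc3) hm2
    rw [hV1, mul_zero, zero_mul] at h1
    exact norm_eq_zero.1 (pow_eq_zero_iff two_ne_zero |>.1 (le_antisymm h1 (by positivity)))
  have hflux : flux γ n V = (0, ((γ - 1) * V.2.2) • n, 0) := by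
    simp [flux, pressure, hV1, hV2]
  have hG1 : (G 0).1 = 0 := by
    have h1 : Tendsto (fun ξ => (flux γ n (W ξ)).1) l (𝓝 (G 0).1) :=
      (continuous_fst.tendsto _).comp hFl
    have h2 : Tendsto (fun ξ => inner ℝ (W ξ).2.1 n) l (𝓝 (inner ℝ V.2.1 n)) :=
      hc2.inner tendsto_const_nhds
    rw [hV2, inner_zero_left] at h2
    exact tendsto_nhds_unique h1 h2
  have hanti := h.antitone_fst
  by_cases hB : ∃ δ, 0 < δ ∧ (G δ).1 = 0
  · obtain ⟨δ, hδ, hδ0⟩ := hB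
    have hW0 : ∀ᶠ ξ in l, W ξ = 0 := by
      filter_upwards [hl2 (h.ae_eq_zero hδ.le (hG1.trans hδ0.symm)), hl1 (Ioo_mem_nhdsGT hδ)]
        with ξ h1 h2 using h1 ⟨h2.1, h2.2.le⟩
    have hV0 : V = 0 := tendsto_nhds_unique (hWV.congr' (hW0.mono fun ξ h1 => h1))
      tendsto_const_nhds
    have hG0 : G 0 = 0 := tendsto_nhds_unique (hFl.congr' (hW0.mono fun ξ h1 => by
      rw [h1, flux_zero])) tendsto_const_nhds
    rw [hV0, hG0, flux_zero]
  push Not at hB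
  have hneg : ∀ ξ, 0 < ξ → (G ξ).1 < 0 := fun ξ hξ =>
    ((hanti hξ.le).trans hG1.le).lt_of_ne (hB ξ hξ)
  set u : ℝ → ℝ := fun ξ => inner ℝ (velocity (W ξ)) n with hu
  have hfreq : ∀ c, 0 < c → ∃ᶠ ξ in l, ξ - u ξ < c := by
    intro c hc hcon
    have hcon' : ∀ᶠ ξ in l, c ≤ ξ - u ξ := hcon.mono fun ξ h1 => not_lt.1 h1
    rw [hl, Filter.Eventually, Filter.mem_inf_iff] at hcon'
    obtain ⟨t₁, ht₁, t₂, ht₂, he⟩ := hcon'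
    obtain ⟨δ, hδ, hδs⟩ := mem_nhdsGT_iff_exists_Ioo_subset.1 ht₁
    have hδ0 : (0 : ℝ) < δ := hδ
    set x := min (δ / 2) (c / 2) with hx
    have hx0 : 0 < x := lt_min (by linarith) (by linarith)
    have hxδ : x < δ := (min_le_left _ _).trans_lt (by linarith)
    have hxc : x ≤ c / 2 := min_le_right _ _
    have e1 := h.isPrimitive_fst.sub_eq 0 x
    rw [hG1, intervalIntegral.integral_neg, sub_zero] at e1
    have e2 : ∫ ξ in (0:ℝ)..x, (W ξ).1 ≤ ∫ _ξ in (0:ℝ)..x, -(G x).1 / c := by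
      refine intervalIntegral.integral_mono_ae_restrict hx0.le (h.integrable_fst 0 x)
        intervalIntegrable_const ?_
      rw [EventuallyLE, ae_restrict_iff' measurableSet_Icc]
      filter_upwards [ht₂, h.fst_eq, ae_ne 0] with ξ h1 h2 hne h3
      have h4 : 0 < ξ := lt_of_le_of_ne h3.1 (Ne.symm hne)
      have h5 : ξ ∈ t₁ ∩ t₂ := ⟨hδs ⟨h4, h3.2.trans_lt hxδ⟩, h1⟩
      rw [← he] at h5
      have h6 : c ≤ ξ - u ξ := h5
      have h7 := hanti h3.2
      simp only at h7
      rw [le_div_iff₀ hc]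
      have h8 := mul_le_mul_of_nonneg_left h6 (density_nonneg (h.physical ξ))
      simp only [hu] at h8
      linarith
    rw [intervalIntegral.integral_const, smul_eq_mul, sub_zero] at e2
    have e3 : x * (-(G x).1 / c) ≤ -(G x).1 / 2 := by
      have h5 := hneg x hx0
      rw [mul_div_assoc', div_le_div_iff₀ hc two_pos]
      nlinarith
    have h5 := hneg x hx0
    linarith
  have hupos : ∀ᶠ ξ in l, 0 < ξ - u ξ := by
    filter_upwards [hl2 h.fst_eq, hpos] with ξ h1 h2
    have h3 := hneg ξ h2
    rw [h1] at h3
    by_contra hcon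
    have := mul_nonneg (density_nonneg (h.physical ξ)) (by linarith : 0 ≤ u ξ - ξ)
    simp only [hu] at this
    linarith
  have hcl : MapClusterPt 0 l u := by
    rw [mapClusterPt_iff_frequently]
    intro t ht
    obtain ⟨ε, hε, hεt⟩ := Metric.mem_nhds_iff.1 ht
    have h1 : ∀ᶠ ξ in l, ξ < ε / 2 := hl0.eventually (gt_mem_nhds (by linarith))
    refine ((hfreq (ε / 2) (by linarith)).and_eventually (hupos.and (h1.and hpos))).mono ?_
    rintro ξ ⟨h2, h3, h4, h5⟩
    refine hεt ?_
    rw [Metric.mem_ball, Real.dist_eq, sub_zero, abs_lt]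
    constructor <;> linarith
  have hne : NeBot (comap u (𝓝 0) ⊓ l) := neBot_inf_comap_iff_map'.2 hcl
  set l' := comap u (𝓝 0) ⊓ l with hl'
  have hl'l : l' ≤ l := inf_le_right
  have hu0 : Tendsto u l' (𝓝 0) := tendsto_comap.mono_left inf_le_left
  have hτ : ∃ τ : Space d, ∀ᶠ ξ in l, velocity (W ξ) = u ξ • n + τ := by
    refine ⟨velocity UR - inner ℝ (velocity UR) n • n, ?_⟩
    filter_upwards [hl2 (ae_comp_neg (h.reflect.velocity_eq (by rwa [norm_neg]) hR)), hpos]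
      with ξ h1 h2
    simp only [neg_neg, Prod.fst_neg, Left.neg_pos_iff] at h1
    have h3 := h1 (hneg ξ h2)
    simp only [inner_neg_right, neg_smul, smul_neg, neg_neg] at h3
    exact h3
  obtain ⟨τ, hτ⟩ := hτ
  have hkin : Tendsto (fun ξ => 1 / 2 * (W ξ).1 * ‖velocity (W ξ)‖ ^ 2) l' (𝓝 0) := by
    have h1 : Tendsto (fun ξ => 1 / 2 * (W ξ).1 * ‖u ξ • n + τ‖ ^ 2) l'
        (𝓝 (1 / 2 * V.1 * ‖(0 : ℝ) • n + τ‖ ^ 2)) :=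
      ((hc1.mono_left hl'l).const_mul _).mul (((hu0.smul_const n).add_const τ).norm.pow 2)
    rw [hV1, mul_zero, zero_mul] at h1
    refine h1.congr' ?_
    filter_upwards [hl'l hτ] with ξ h2
    rw [h2]
  have hp : Tendsto (fun ξ => pressure γ (W ξ)) l' (𝓝 ((γ - 1) * V.2.2)) := by
    have h1 : Tendsto (fun ξ => (γ - 1) * ((W ξ).2.2 - 1 / 2 * (W ξ).1 * ‖velocity (W ξ)‖ ^ 2)) l'
        (𝓝 ((γ - 1) * (V.2.2 - 0))) := ((hc3.mono_left hl'l).sub hkin).const_mul _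
    rw [sub_zero] at h1
    refine h1.congr fun ξ => ?_
    rw [energy_eq_pressure hγ (h.physical ξ)]
    field_simp
    ring
  have hF : Tendsto (fun ξ => flux γ n (W ξ)) l' (𝓝 (0, ((γ - 1) * V.2.2) • n, 0)) := by
    simp only [fun ξ => flux_eq_velocity (h.physical ξ) n]
    have h1 := (hc1.mono_left hl'l).mul hu0
    have h2 := (hu0.smul (hc2.mono_left hl'l)).add (hp.smul_const n)
    have h3 := hu0.mul ((hc3.mono_left hl'l).add hp)
    rw [mul_zero] at h1
    rw [zero_smul, zero_add] at h2
    rw [zero_mul] at h3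
    exact h1.prodMk_nhds (h2.prodMk_nhds h3)
  rw [hflux]
  exact tendsto_nhds_unique hF (hFl.mono_left hl'l)

end IsRiemannProfile

/-! ### Locally absolutely continuous functions on open intervals -/

/-- `f` is locally absolutely continuous on `S` with derivative `f'`. -/
structure IsLocallyAC (S : Set ℝ) (f f' : ℝ → ℝ) : Prop where
  ac : ∀ x y, x ≤ y → Icc x y ⊆ S → AbsolutelyContinuousOnInterval f x y
  deriv : ∀ᵐ x, x ∈ S → HasDerivAt f (f' x) x

namespace IsLocallyAC

variable {S T : Set ℝ} {f f' g g' : ℝ → ℝ}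

theorem mono (h : IsLocallyAC S f f') (hT : T ⊆ S) : IsLocallyAC T f f' :=
  ⟨fun x y hxy hs => h.ac x y hxy (hs.trans hT), h.deriv.mono fun _ hx hxT => hx (hT hxT)⟩

theorem congr_deriv (h : IsLocallyAC S f f') {k : ℝ → ℝ} (hk : ∀ᵐ x, x ∈ S → f' x = k x) :
    IsLocallyAC S f k :=
  ⟨h.ac, by filter_upwards [h.deriv, hk] with x h1 h2 hx using (h2 hx) ▸ h1 hx⟩

theorem mul (h : IsLocallyAC S f f') (k : IsLocallyAC S g g') :
    IsLocallyAC S (fun x => f x * g x) (fun x => f' x * g x + f x * g' x) :=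
  ⟨fun x y hxy hs => (h.ac x y hxy hs).fun_mul (k.ac x y hxy hs), by
    filter_upwards [h.deriv, k.deriv] with x h1 h2 hx using (h1 hx).mul (h2 hx)⟩

theorem add (h : IsLocallyAC S f f') (k : IsLocallyAC S g g') :
    IsLocallyAC S (fun x => f x + g x) (fun x => f' x + g' x) :=
  ⟨fun x y hxy hs => (h.ac x y hxy hs).add (k.ac x y hxy hs), by
    filter_upwards [h.deriv, k.deriv] with x h1 h2 hx using (h1 hx).add (h2 hx)⟩

theorem sub (h : IsLocallyAC S f f') (k : IsLocallyAC S g g') :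
    IsLocallyAC S (fun x => f x - g x) (fun x => f' x - g' x) :=
  ⟨fun x y hxy hs => (h.ac x y hxy hs).sub (k.ac x y hxy hs), by
    filter_upwards [h.deriv, k.deriv] with x h1 h2 hx using (h1 hx).sub (h2 hx)⟩

theorem of_hasDerivAt (h : ∀ x, HasDerivAt f (f' x) x) (hc : Continuous f') :
    IsLocallyAC S f f' :=
  ⟨fun x y _ _ => by
    refine ContDiffOn.absolutelyContinuousOnInterval (ContDiff.contDiffOn ?_)
    rw [contDiff_one_iff_deriv]
    refine ⟨fun x => (h x).differentiableAt, ?_⟩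
    rwa [show _root_.deriv f = f' from funext fun x => (h x).deriv],
  Eventually.of_forall fun x _ => h x⟩

theorem const (c : ℝ) : IsLocallyAC S (fun _ => c) (fun _ => 0) :=
  of_hasDerivAt (fun x => hasDerivAt_const x c) continuous_const

theorem id : IsLocallyAC S (fun x => x) (fun _ => 1) :=
  of_hasDerivAt (fun x => hasDerivAt_id x) continuous_const

theorem const_mul (c : ℝ) (h : IsLocallyAC S f f') :
    IsLocallyAC S (fun x => c * f x) (fun x => c * f' x) := by
  simpa using (const c).mul h

theorem comp_contDiffOn (h : IsLocallyAC S f f') {φ φ' : ℝ → ℝ} (hpos : ∀ x ∈ S, 0 < f x)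
    (hφ : ContDiffOn ℝ 1 φ (Ioi 0)) (hφ' : ∀ x, 0 < x → HasDerivAt φ (φ' x) x) :
    IsLocallyAC S (fun x => φ (f x)) (fun x => φ' (f x) * f' x) :=
  ⟨fun x y hxy hs => (h.ac x y hxy hs).contDiffOn_comp
    (fun z hz => hpos z (hs (by rwa [uIcc_of_le hxy] at hz))) hφ, by
    filter_upwards [h.deriv] with x h1 hx
    exact (hφ' _ (hpos x hx)).comp x (h1 hx)⟩

theorem div (h : IsLocallyAC S f f') (k : IsLocallyAC S g g') (hpos : ∀ x ∈ S, 0 < g x) :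
    IsLocallyAC S (fun x => f x / g x) (fun x => (f' x * g x - f x * g' x) / g x ^ 2) :=
  ⟨fun x y hxy hs => (h.ac x y hxy hs).div_pos (k.ac x y hxy hs)
    (fun z hz => hpos z (hs (by rwa [uIcc_of_le hxy] at hz))), by
    filter_upwards [h.deriv, k.deriv] with x h1 h2 hx
      using (h1 hx).div (h2 hx) (hpos x hx).ne'⟩

theorem sqrt (h : IsLocallyAC S f f') (hpos : ∀ x ∈ S, 0 < f x) :
    IsLocallyAC S (fun x => √(f x)) (fun x => f' x / (2 * √(f x))) :=
  ⟨fun x y hxy hs => (h.ac x y hxy hs).sqrt_pos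
    (fun z hz => hpos z (hs (by rwa [uIcc_of_le hxy] at hz))), by
    filter_upwards [h.deriv] with x h1 hx using (h1 hx).sqrt (hpos x hx).ne'⟩

theorem log (h : IsLocallyAC S f f') (hpos : ∀ x ∈ S, 0 < f x) :
    IsLocallyAC S (fun x => Real.log (f x)) (fun x => f' x / f x) :=
  (h.comp_contDiffOn hpos (φ' := fun x => x⁻¹)
    (fun x hx => (Real.contDiffAt_log.2 (ne_of_gt hx)).contDiffWithinAt)
    (fun x hx => Real.hasDerivAt_log hx.ne')).congr_deriv
    (Eventually.of_forall fun x _ => by rw [div_eq_inv_mul])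

theorem le_of_deriv_nonneg (h : IsLocallyAC S f f') (h0 : ∀ᵐ x, x ∈ S → 0 ≤ f' x) {x y : ℝ}
    (hxy : x ≤ y) (hs : Icc x y ⊆ S) : f x ≤ f y := by
  refine le_of_ac_of_deriv_nonneg hxy (h.ac x y hxy hs) ?_
  filter_upwards [h.deriv, h0] with z h1 h2 hz
  have := hs (Ioo_subset_Icc_self hz)
  exact ⟨_, h1 this, h2 this⟩

theorem ge_of_deriv_nonpos (h : IsLocallyAC S f f') (h0 : ∀ᵐ x, x ∈ S → f' x ≤ 0) {x y : ℝ}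
    (hxy : x ≤ y) (hs : Icc x y ⊆ S) : f y ≤ f x := by
  have := ((const (S := S) 0).sub h).le_of_deriv_nonneg
    (by filter_upwards [h0] with z hz hzS; linarith [hz hzS]) hxy hs
  linarith

theorem eq_of_deriv_zero (h : IsLocallyAC S f f') (h0 : ∀ᵐ x, x ∈ S → f' x = 0) {x y : ℝ}
    (hxy : x ≤ y) (hs : Icc x y ⊆ S) : f x = f y :=
  le_antisymm (h.le_of_deriv_nonneg (by filter_upwards [h0] with z hz hzS using (hz hzS).ge) hxy hs)
    (h.ge_of_deriv_nonpos (by filter_upwards [h0] with z hz hzS using (hz hzS).le) hxy hs)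

theorem continuousOn (h : IsLocallyAC S f f') (hS : IsOpen S) : ContinuousOn f S := by
  intro x hx
  obtain ⟨ε, hε, hs⟩ := Metric.isOpen_iff.1 hS x hx
  have h1 : Icc (x - ε / 2) (x + ε / 2) ⊆ S := fun y hy => hs (by
    rw [Metric.mem_ball, Real.dist_eq, abs_lt]; constructor <;> linarith [hy.1, hy.2])
  have h2 := (h.ac _ _ (by linarith) h1).continuousOn
  rw [uIcc_of_le (by linarith)] at h2
  exact (h2.continuousAt (Icc_mem_nhds (by linarith) (by linarith))).continuousWithinAt

end IsLocallyAC

theorem le_of_ae_le {S : Set ℝ} (hS : IsOpen S) {f g : ℝ → ℝ} (hf : ContinuousOn f S)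
    (hg : ContinuousOn g S) (h : ∀ᵐ x, x ∈ S → f x ≤ g x) : ∀ x ∈ S, f x ≤ g x := by
  intro x hx
  by_contra hcon
  have h1 : ∀ᶠ y in 𝓝 x, g y < f y :=
    ((hg.continuousAt (hS.mem_nhds hx))).eventually_lt (hf.continuousAt (hS.mem_nhds hx))
      (not_le.1 hcon)
  obtain ⟨ε, hε, hs⟩ := Metric.eventually_nhds_iff_ball.1 (h1.and (hS.mem_nhds hx))
  obtain ⟨y, hy, h2, h3⟩ := exists_lt_mem_of_ae h (show x < x + ε by linarith)
  have := hs y (Real.ball_eq_Ioo x ε ▸ ⟨by linarith, by linarith⟩)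
  exact absurd (hy this.2) (not_le.2 this.1)

theorem eq_of_ae_eq {S : Set ℝ} (hS : IsOpen S) {f g : ℝ → ℝ} (hf : ContinuousOn f S)
    (hg : ContinuousOn g S) (h : ∀ᵐ x, x ∈ S → f x = g x) : ∀ x ∈ S, f x = g x := fun x hx =>
  le_antisymm (le_of_ae_le hS hf hg (by filter_upwards [h] with y h1 h2 using (h1 h2).le) x hx)
    (le_of_ae_le hS hg hf (by filter_upwards [h] with y h1 h2 using (h1 h2).ge) x hx)

theorem eq_of_nhdsWithin {s : Set ℝ} {x : ℝ} [(𝓝[s] x).NeBot] {f g : ℝ → ℝ}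
    (hf : ContinuousAt f x) (hg : ContinuousAt g x) (h : ∀ᶠ y in 𝓝[s] x, f y = g y) : f x = g x :=
  tendsto_nhds_unique_of_eventuallyEq (hf.tendsto.mono_left nhdsWithin_le_nhds)
    (hg.tendsto.mono_left nhdsWithin_le_nhds) h

/-! ### Supersonic and subsonic states with given fluxes -/

/-- Of the two states with given fluxes of mass, momentum and energy, the subsonic one has the
larger entropy. -/
theorem entropy_supersonic_lt_subsonic {γ z r : ℝ} (hγ : 1 < γ) (hr : 0 < r) (hrz : r < z) :
    (z / γ - r) * (z + r) ^ γ < (z / γ + r) * (z - r) ^ γ := by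
  have hγ0 : 0 < γ := by linarith
  have hz : 0 < z := hr.trans hrz
  rcases le_or_gt (z / γ) r with h | h
  · have h1 : (z / γ - r) * (z + r) ^ γ ≤ 0 :=
      mul_nonpos_of_nonpos_of_nonneg (by linarith) (by positivity)
    have h2 : 0 < (z / γ + r) * (z - r) ^ γ :=
      mul_pos (by positivity) (Real.rpow_pos_of_pos (by linarith) _)
    linarith
  let f : ℝ → ℝ := fun x => Real.log (z / γ + x) + γ * Real.log (z - x)
    - Real.log (z / γ - x) - γ * Real.log (z + x)
  have hzγ : z / γ < z := div_lt_self hz hγ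
  have hd : ∀ x ∈ Ico 0 (z / γ), HasDerivAt f (1 / (z / γ + x) + γ * ((-1) / (z - x))
      - (-1) / (z / γ - x) - γ * (1 / (z + x))) x := fun x hx => by
    have a1 : z / γ + x ≠ 0 := by have := hx.1; positivity
    have a2 : z - x ≠ 0 := by linarith [hx.2]
    have a3 : z / γ - x ≠ 0 := by linarith [hx.2]
    have a4 : z + x ≠ 0 := by have := hx.1; positivity
    exact (((((hasDerivAt_id x).const_add _).log a1).add
      ((((hasDerivAt_id x).const_sub _).log a2).const_mul γ)).sub
      (((hasDerivAt_id x).const_sub _).log a3)).sub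
      ((((hasDerivAt_id x).const_add _).log a4).const_mul γ)
  have hmono : StrictMonoOn f (Ico 0 (z / γ)) := by
    refine strictMonoOn_of_deriv_pos (convex_Ico _ _)
      (fun x hx => (hd x hx).continuousAt.continuousWithinAt) fun x hx => ?_
    rw [interior_Ico] at hx
    rw [(hd x ⟨hx.1.le, hx.2⟩).deriv]
    have b1 : 0 < z / γ - x := by linarith [hx.2]
    have b2 : 0 < z - x := by linarith [hx.2]
    have b3 : 0 < x := hx.1
    have b4 : 0 < z / γ + x := by positivity
    have b5 : 0 < z + x := by positivity
    have e : 1 / (z / γ + x) + γ * ((-1) / (z - x)) - (-1) / (z / γ - x) - γ * (1 / (z + x)) =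
        2 * (z / γ) * ((γ ^ 2 - 1) * x ^ 2) /
          ((z / γ + x) * (z / γ - x) * ((z - x) * (z + x))) := by
      have : z = γ * (z / γ) := by field_simp
      generalize hy : z / γ = y at *
      subst this
      have c1 : y - x ≠ 0 := b1.ne'
      have c2 : γ * y - x ≠ 0 := b2.ne'
      have c3 : y + x ≠ 0 := b4.ne'
      have c4 : γ * y + x ≠ 0 := b5.ne'
      obtain ⟨A, hA⟩ : ∃ A, γ * y - x = A := ⟨_, rfl⟩
      obtain ⟨B, hB⟩ : ∃ B, γ * y + x = B := ⟨_, rfl⟩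
      rw [hA] at c2 ⊢
      rw [hB] at c4 ⊢
      field_simp
      rw [← hA, ← hB]
      ring
    rw [e]
    have : 0 < γ ^ 2 - 1 := by nlinarith
    positivity
  have h0 := hmono ⟨le_rfl, by positivity⟩ ⟨hr.le, h⟩ hr
  simp only [f, add_zero, sub_zero] at h0
  have b1 : 0 < z / γ - r := by linarith
  have b2 : 0 < z - r := by linarith
  have b4 : 0 < z / γ + r := by positivity
  have b5 : 0 < z + r := by positivity
  have p1 := Real.rpow_pos_of_pos b5 γ
  have p2 := Real.rpow_pos_of_pos b2 γ
  rw [← Real.log_lt_log_iff (mul_pos b1 p1) (mul_pos b4 p2), Real.log_mul b1.ne' p1.ne',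
    Real.log_mul b4.ne' p2.ne', Real.log_rpow b5, Real.log_rpow b2]
  linarith

/-! ### Half fans -/

/-- The part of a self-similar solution of the Euler equations in one space dimension to the left
of the contact discontinuity at `ξ = a`: `j = ρ v` is the mass flux, `v = u - ξ` the relative
velocity, `P = j v + p` the momentum flux, `B` the total specific enthalpy. -/
structure IsHalfFan (γ ρL uL pL a : ℝ) (j P B ρ v p : ℝ → ℝ) : Prop where
  density_pos : 0 < ρL
  pressure_pos : 0 < pL
  acMass : IsLocallyAC (Iio a) j fun ξ => -ρ ξ
  acMomentum : IsLocallyAC (Iio a) P fun ξ => -(2 * j ξ)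
  acEnergy : IsLocallyAC (Iio a) B fun ξ => -v ξ
  continuous_mass : Continuous j
  continuous_momentum : Continuous P
  mass_pos : ∀ ξ, ξ < a → 0 < j ξ
  mass_eq_zero : j a = 0
  bounded : ∃ R, ∀ ξ, ρ ξ ≤ R
  ae_state : ∀ᵐ ξ, ξ < a → 0 < ρ ξ ∧ 0 < v ξ ∧ 0 < p ξ ∧ j ξ = ρ ξ * v ξ ∧
    P ξ = j ξ * v ξ + p ξ ∧ B ξ = 1 / 2 * v ξ ^ 2 + γ / (γ - 1) * (p ξ / ρ ξ)
  entropy_mono : ∃ t : Set ℝ, (∀ᵐ ξ, ξ ∈ t) ∧ ∀ x ∈ t, ∀ y ∈ t, x < y → y < a →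
    p x / ρ x ^ γ ≤ p y / ρ y ^ γ
  left : ∃ x₀, x₀ < a ∧ ∀ ξ, ξ ≤ x₀ → v ξ = uL - ξ ∧ ρ ξ = ρL ∧ p ξ = pL

namespace IsHalfFan

variable {γ ρL uL pL a : ℝ} {j P B ρ v p : ℝ → ℝ}

/-- The mean of the relative velocities of the two states with given fluxes. -/
noncomputable def mid (γ : ℝ) (j P : ℝ → ℝ) (ξ : ℝ) : ℝ := γ / (γ + 1) * (P ξ / j ξ)

/-- The square of half the difference of the relative velocities of the two states. -/
noncomputable def disc (γ : ℝ) (j P B : ℝ → ℝ) (ξ : ℝ) : ℝ :=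
  mid γ j P ξ ^ 2 - 2 * (γ - 1) / (γ + 1) * B ξ

local notation "z" => mid γ j P
local notation "D" => disc γ j P B
local notation "Fan" => IsHalfFan γ ρL uL pL a j P B ρ v p

theorem ae_facts (hγ : 1 < γ) (h : Fan) : ∀ᵐ ξ, ξ < a →
    (v ξ - z ξ) ^ 2 = D ξ ∧ v ξ - z ξ < v ξ / (γ + 1) ∧ 0 < z ξ ∧
      p ξ / ρ ξ ^ γ = j ξ ^ (1 - γ) * ((z ξ / γ - (v ξ - z ξ)) * (v ξ) ^ γ) := by
  filter_upwards [h.ae_state] with ξ hξ hlt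
  obtain ⟨h1, h2, h3, h4, h5, h6⟩ := hξ hlt
  have hj := h.mass_pos ξ hlt
  have hγ1 : 0 < γ + 1 := by linarith
  have hγ2 : γ - 1 ≠ 0 := by linarith
  have hγ0 : 0 < γ := by linarith
  have ez : z ξ = γ / (γ + 1) * (v ξ + p ξ / j ξ) := by
    rw [mid, h5]; field_simp
  refine ⟨?_, ?_, ?_, ?_⟩
  · rw [disc, ez, h6, h4]
    field_simp
    ring
  · rw [ez]
    have h7 : 0 < γ / (γ + 1) * (p ξ / j ξ) := by positivity
    have : v ξ - γ / (γ + 1) * v ξ = v ξ / (γ + 1) := by field_simp; ring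
    linarith
  · rw [ez]; positivity
  · have e1 : p ξ = j ξ * (z ξ / γ - (v ξ - z ξ)) := by
      rw [ez]; field_simp; ring
    have e2 : ρ ξ = j ξ / v ξ := by rw [h4]; field_simp
    rw [e1, e2, Real.div_rpow hj.le h2.le, Real.rpow_sub hj, Real.rpow_one]
    field_simp

theorem acMid (hγ : 1 < γ) (h : Fan) :
    IsLocallyAC (Iio a) z fun ξ => -((γ - 1) / (γ + 1)) - (v ξ - z ξ) / v ξ := by
  have h1 := ((h.acMomentum.div h.acMass fun x hx => h.mass_pos x hx)).const_mul (γ / (γ + 1))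
  refine h1.congr_deriv ?_
  have hγ1 : γ + 1 ≠ 0 := by linarith
  filter_upwards [h.ae_state] with ξ hξ hlt
  obtain ⟨h1, h2, h3, h4, h5, h6⟩ := hξ hlt
  rw [mid, h5, h4]
  field_simp
  ring

theorem acDisc (hγ : 1 < γ) (h : Fan) :
    IsLocallyAC (Iio a) D
      fun ξ => -(2 * (v ξ - z ξ)) * (2 / (γ + 1) - (v ξ - z ξ) / v ξ) := by
  have h1 := ((h.acMid hγ).mul (h.acMid hγ)).sub (h.acEnergy.const_mul (2 * (γ - 1) / (γ + 1)))
  have e : D = fun x => z x * z x - 2 * (γ - 1) / (γ + 1) * B x := by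
    funext x; rw [disc, sq]
  rw [e]
  refine h1.congr_deriv ?_
  have hγ1 : γ + 1 ≠ 0 := by linarith
  filter_upwards [h.ae_state] with ξ hξ hlt
  obtain ⟨h1, h2, h3, h4, h5, h6⟩ := hξ hlt
  field_simp
  ring

theorem continuousAt_mid (hγ : 1 < γ) (h : Fan) {x : ℝ}
    (hx : x < a) : ContinuousAt z x :=
  ((h.acMid hγ).continuousOn isOpen_Iio).continuousAt (Iio_mem_nhds hx)

theorem continuousAt_disc (hγ : 1 < γ) (h : Fan) {x : ℝ}
    (hx : x < a) : ContinuousAt D x :=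
  ((h.acDisc hγ).continuousOn isOpen_Iio).continuousAt (Iio_mem_nhds hx)

theorem deriv_disc_factor_pos (hγ : 1 < γ) (h : Fan) :
    ∀ᵐ ξ, ξ < a → 0 < 2 / (γ + 1) - (v ξ - z ξ) / v ξ := by
  filter_upwards [h.ae_state, h.ae_facts hγ] with ξ hξ hξ' hlt
  obtain ⟨h1, h2, h3, h4, h5, h6⟩ := hξ hlt
  obtain ⟨-, h8, -, -⟩ := hξ' hlt
  have hγ1 : 0 < γ + 1 := by linarith
  have : (v ξ - z ξ) / v ξ < 1 / (γ + 1) := by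
    rw [div_lt_iff₀ h2]
    calc _ < v ξ / (γ + 1) := h8
      _ = _ := by ring
  have h9 : 2 / (γ + 1) = 1 / (γ + 1) + 1 / (γ + 1) := by ring
  have : 0 < 1 / (γ + 1) := by positivity
  linarith

theorem disc_mono (hγ : 1 < γ) (h : Fan) {x y : ℝ} (hxy : x ≤ y)
    (hy : y < a) (hw : ∀ᵐ ξ, ξ ∈ Ioo x y → v ξ < z ξ) : D x ≤ D y := by
  refine le_of_ac_of_deriv_nonneg hxy ((h.acDisc hγ).ac x y hxy fun w hw => hw.2.trans_lt hy) ?_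
  filter_upwards [(h.acDisc hγ).deriv, h.deriv_disc_factor_pos hγ, hw] with ξ h1 h2 h3 h4
  exact ⟨_, h1 (h4.2.trans hy), mul_nonneg (by linarith [h3 h4]) (h2 (h4.2.trans hy)).le⟩

theorem disc_anti (hγ : 1 < γ) (h : Fan) {x y : ℝ} (hxy : x ≤ y)
    (hy : y < a) (hw : ∀ᵐ ξ, ξ ∈ Ioo x y → z ξ ≤ v ξ) : D y ≤ D x := by
  have hac := (IsLocallyAC.const (S := Iio a) 0).sub (h.acDisc hγ)
  have := le_of_ac_of_deriv_nonneg hxy (hac.ac x y hxy fun w hw => hw.2.trans_lt hy) <| by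
    filter_upwards [hac.deriv, h.deriv_disc_factor_pos hγ, hw] with ξ h1 h2 h3 h4
    refine ⟨_, h1 (h4.2.trans hy), ?_⟩
    rw [zero_sub, neg_nonneg]
    exact mul_nonpos_of_nonpos_of_nonneg (by linarith [h3 h4]) (h2 (h4.2.trans hy)).le
  linarith

/-- A fast flow is supersonic. -/
theorem mid_lt_of_sqrt_lt (hγ : 1 < γ) (h : Fan) {w : ℝ}
    (hw : √(γ * pL / ρL) < w) :
    γ / (γ + 1) * ((ρL * w ^ 2 + pL) / (ρL * w)) < w := by
  have hρ := h.density_pos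
  have hp := h.pressure_pos
  have hγ0 : 0 < γ := by linarith
  have hw0 : 0 < w := (Real.sqrt_nonneg _).trans_lt hw
  have h6 := (Real.sqrt_lt' hw0).1 hw
  rw [div_lt_iff₀ hρ] at h6
  rw [div_mul_div_comm, div_lt_iff₀ (by positivity)]
  linarith

theorem disc_nonneg (hγ : 1 < γ) (h : Fan) :
    ∀ ξ < a, 0 ≤ D ξ :=
  le_of_ae_le isOpen_Iio continuousOn_const ((h.acDisc hγ).continuousOn isOpen_Iio) <| by
    filter_upwards [h.ae_facts hγ] with ξ hξ hlt
    rw [← (hξ hlt).1]; positivity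

theorem mid_pos (hγ : 1 < γ) (h : Fan) :
    ∀ ξ < a, 0 ≤ D ξ ∧ √(D ξ) < z ξ := by
  obtain ⟨R, hR⟩ := h.bounded
  have hγ1 : 0 < γ + 1 := by linarith
  have hγ2 : 0 < γ - 1 := by linarith
  have hz : ∀ ξ < a, 0 ≤ z ξ :=
    le_of_ae_le isOpen_Iio continuousOn_const ((h.acMid hγ).continuousOn isOpen_Iio) <| by
      filter_upwards [h.ae_facts hγ] with ξ hξ hlt using (hξ hlt).2.2.1.le
  have hB : ∀ ξ < a, 1 / 2 * (j ξ / (max R 1)) ^ 2 ≤ B ξ := by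
    refine le_of_ae_le isOpen_Iio ?_ (h.acEnergy.continuousOn isOpen_Iio) ?_
    · exact ((h.continuous_mass.div_const _).pow 2).continuousOn.const_mul _ |>.mono subset_rfl
    · filter_upwards [h.ae_state] with ξ hξ hlt
      obtain ⟨h1, h2, h3, h4, h5, h6⟩ := hξ hlt
      have h7 : j ξ / max R 1 ≤ v ξ := by
        rw [div_le_iff₀ (by positivity), h4, mul_comm]
        gcongr
        exact (hR ξ).trans (le_max_left _ _)
      have h8 : 0 ≤ j ξ / max R 1 := by have := (h.mass_pos ξ hlt).le; positivity
      rw [h6]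
      have : 0 ≤ γ / (γ - 1) * (p ξ / ρ ξ) := by have : 0 < γ := by linarith
                                                 positivity
      have := pow_le_pow_left₀ h8 h7 2
      linarith
  intro ξ hξ
  refine ⟨h.disc_nonneg hγ ξ hξ, ?_⟩
  have h1 : 0 < B ξ := by
    refine lt_of_lt_of_le ?_ (hB ξ hξ)
    have := h.mass_pos ξ hξ
    positivity
  have h2 : D ξ < z ξ ^ 2 := by
    rw [disc]
    have : 0 < 2 * (γ - 1) / (γ + 1) * B ξ := by positivity
    linarith
  have h3 := Real.sqrt_lt_sqrt (h.disc_nonneg hγ ξ hξ) h2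
  rwa [Real.sqrt_sq (hz ξ hξ)] at h3

/-- There is no transition from a subsonic to a supersonic state. -/
theorem ae_of_forall_gt {q : ℝ → Prop} {α : ℝ} (h : ∀ c, α < c → ∀ᵐ ξ, c < ξ → q ξ) :
    ∀ᵐ ξ, α < ξ → q ξ := by
  have hk := fun k : ℕ => h (α + 1 / ((k : ℝ) + 1)) (lt_add_of_pos_right _ (by positivity))
  filter_upwards [ae_all_iff.2 hk] with ξ hξ h1
  obtain ⟨k, hk⟩ := exists_nat_one_div_lt (sub_pos.2 h1)
  exact hξ k (by linarith)

theorem ae_of_forall_lt {q : ℝ → Prop} {α : ℝ} (h : ∀ c, c < α → ∀ᵐ ξ, ξ < c → q ξ) :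
    ∀ᵐ ξ, ξ < α → q ξ := by
  have := ae_comp_neg (ae_of_forall_gt (q := fun ξ => q (-ξ)) (α := -α) fun c hc =>
    (ae_comp_neg (h (-c) (by linarith))).mono fun ξ h1 h2 => h1 (by linarith))
  filter_upwards [this] with ξ h1 h2
  simpa using h1 (by linarith)

theorem exists_sign (hγ : 1 < γ) (h : Fan) :
    ∃ t : Set ℝ, (∀ᵐ ξ, ξ ∈ t) ∧ ∀ x₀ < a, 0 < D x₀ → ∃ δ > 0, ∀ x ∈ t, ∀ y ∈ t, x < y →
      x₀ - δ < x → y < x₀ + δ → y < a ∧ (v x < z x → v y < z y) := by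
  obtain ⟨t, ht, hmono⟩ := h.entropy_mono
  refine ⟨t ∩ {ξ | ξ < a → (v ξ - z ξ) ^ 2 = D ξ ∧ v ξ - z ξ < v ξ / (γ + 1) ∧ 0 < z ξ ∧
      p ξ / ρ ξ ^ γ = j ξ ^ (1 - γ) * ((z ξ / γ - (v ξ - z ξ)) * (v ξ) ^ γ)}, ?_, ?_⟩
  · filter_upwards [ht, h.ae_facts hγ] with ξ h1 h2 using ⟨h1, h2⟩
  intro x₀ hx₀ hD
  let f : ℝ → ℝ → ℝ := fun σ ξ => j ξ ^ (1 - γ) *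
    ((z ξ / γ - σ * √(D ξ)) * (z ξ + σ * √(D ξ)) ^ γ)
  have hzc := h.continuousAt_mid hγ hx₀
  have hDc := h.continuousAt_disc hγ hx₀
  have hfc : ∀ σ, ContinuousAt (f σ) x₀ := fun σ => by
    refine (h.continuous_mass.continuousAt.rpow_const (Or.inl (h.mass_pos x₀ hx₀).ne')).mul
      (((hzc.div_const _).sub (hDc.sqrt.const_mul _)).mul ?_)
    exact (hzc.add (hDc.sqrt.const_mul _)).rpow_const (Or.inr (by linarith))
  have hlt : f 1 x₀ < f (-1) x₀ := by
    simp only [f]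
    refine mul_lt_mul_of_pos_left ?_ (Real.rpow_pos_of_pos (h.mass_pos x₀ hx₀) _)
    have := entropy_supersonic_lt_subsonic hγ (Real.sqrt_pos.2 hD) (h.mid_pos hγ x₀ hx₀).2
    convert! this using 2 <;> ring_nf
  obtain ⟨l, hl1, hl2⟩ := exists_between hlt
  have hev : ∀ᶠ x in 𝓝 x₀, (f 1 x < l ∧ l < f (-1) x) ∧ x < a :=
    (((hfc 1).eventually (gt_mem_nhds hl1)).and ((hfc (-1)).eventually (lt_mem_nhds hl2))).and
      (Iio_mem_nhds hx₀)
  obtain ⟨δ, hδ, hs⟩ := Metric.eventually_nhds_iff_ball.1 hev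
  refine ⟨δ, hδ, ?_⟩
  rintro x ⟨hxt, hx⟩ y ⟨hyt, hy⟩ hxy hxδ hyδ
  obtain ⟨⟨-, hx1⟩, hxa⟩ := hs x (Real.ball_eq_Ioo x₀ δ ▸ ⟨by linarith, by linarith⟩)
  obtain ⟨⟨hy1, -⟩, hya⟩ := hs y (Real.ball_eq_Ioo x₀ δ ▸ ⟨by linarith, by linarith⟩)
  refine ⟨hya, fun hv => ?_⟩
  by_contra hcon
  obtain ⟨e1, -, -, e2⟩ := hx hxa
  obtain ⟨e3, -, -, e4⟩ := hy hya
  have r1 : √(D x) = -(v x - z x) := by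
    rw [← e1, Real.sqrt_sq_eq_abs, abs_of_neg (by linarith)]
  have r2 : √(D y) = v y - z y := by
    rw [← e3, Real.sqrt_sq_eq_abs, abs_of_nonneg (by linarith)]
  have f1 : f (-1) x = p x / ρ x ^ γ := by
    simp only [f, r1]; rw [e2]; congr 2 <;> ring_nf
  have f2 : f 1 y = p y / ρ y ^ γ := by
    simp only [f, r2]; rw [e4]; congr 2 <;> ring_nf
  have := hmono x hxt y hyt hxy hya
  rw [← f1, ← f2] at this
  linarith

/-- The flow is supersonic or sonic up to some speed `α`, and subsonic from there on. -/
theorem exists_transition (hγ : 1 < γ) (h : Fan) :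
    ∃ α, α ≤ a ∧ (∀ᵐ ξ, ξ < α → z ξ ≤ v ξ) ∧ ∀ᵐ ξ, α < ξ → ξ < a → v ξ < z ξ := by
  obtain ⟨t₀, ht₀, hsign⟩ := h.exists_sign hγ
  have hae := (h.ae_facts hγ).and ((h.deriv_disc_factor_pos hγ).and h.ae_state)
  set t := t₀ ∩ {ξ | ξ < a → (v ξ - z ξ) ^ 2 = D ξ} with htdef
  have ht : ∀ᵐ ξ, ξ ∈ t := by
    filter_upwards [ht₀, h.ae_facts hγ] with ξ h1 h2 using ⟨h1, fun h3 => (h2 h3).1⟩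
  have hprop : ∀ x ∈ t, x < a → v x < z x → ∀ᵐ ξ, x < ξ → ξ < a → v ξ < z ξ := by
    intro x hx hxa hv
    have hDx : 0 < D x := by
      rw [← hx.2 hxa]; exact sq_pos_of_neg (by linarith)
    let T : Set ℝ := {y | x ≤ y ∧ y ≤ a ∧ ∀ᵐ ξ, x < ξ → ξ < y → v ξ < z ξ}
    have hxT : x ∈ T := ⟨le_rfl, hxa.le, Eventually.of_forall fun ξ h1 h2 => by linarith⟩
    have hTb : BddAbove T := ⟨a, fun y hy => hy.2.1⟩
    set β := sSup T with hβ
    have hxβ : x ≤ β := le_csSup hTb hxT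
    have hβa : β ≤ a := csSup_le ⟨x, hxT⟩ fun y hy => hy.2.1
    have hβT : ∀ᵐ ξ, x < ξ → ξ < β → v ξ < z ξ := by
      have := ae_of_forall_lt (q := fun ξ => x < ξ → v ξ < z ξ) (α := β) fun c hc => by
        obtain ⟨y, hy, hyc⟩ := exists_lt_of_lt_csSup ⟨x, hxT⟩ hc
        filter_upwards [hy.2.2] with ξ h1 h2 h3 using h1 h3 (h2.trans hyc)
      exact this.mono fun ξ h1 h2 h3 => h1 h3 h2
    rcases hβa.eq_or_lt with he | hlt
    · rwa [he] at hβT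
    exfalso
    have hDβ : D x ≤ D β := h.disc_mono hγ hxβ hlt (hβT.mono fun ξ h1 h2 => h1 h2.1 h2.2)
    obtain ⟨δ, hδ, hs⟩ := hsign β hlt (hDx.trans_le hDβ)
    obtain ⟨x', hx't, hx'1, hx'2, hx'3⟩ : ∃ x' ∈ t, β - δ < x' ∧ x' ≤ β ∧ v x' < z x' := by
      rcases hxβ.eq_or_lt with he | hxlt
      · exact ⟨x, hx, by linarith, he.le, hv⟩
      · obtain ⟨y, hy, h1, h2⟩ := exists_lt_mem_of_ae (ht.and hβT)
          (max_lt hxlt (show β - δ < β by linarith))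
        exact ⟨y, hy.1, (le_max_right _ _).trans_lt h1, h2.le,
          hy.2 ((le_max_left _ _).trans_lt h1) h2⟩
    have hmem : min (β + δ) a ∈ T := by
      refine ⟨hxβ.trans (le_min (by linarith) hβa), min_le_right _ _, ?_⟩
      filter_upwards [ht, hβT, ae_ne β] with ξ h1 h2 hne h3 h4
      rcases lt_or_gt_of_ne hne with h5 | h5
      · exact h2 h3 h5
      · exact (hs x' hx't.1 ξ h1.1 (by linarith) hx'1 (h4.trans_le (min_le_left _ _))).2 hx'3
    have := le_csSup hTb hmem
    have h6 : β < min (β + δ) a := lt_min (by linarith) hlt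
    linarith
  let N : Set ℝ := {x | x ∈ t ∧ x < a ∧ v x < z x}
  by_cases hN : N.Nonempty
  · obtain ⟨x₀, hx₀, hleft⟩ := h.left
    have hbdd : BddBelow N := by
      by_contra hcon
      rw [not_bddBelow_iff] at hcon
      -- far to the left the flow is supersonic
      obtain ⟨y, hy, hylt⟩ := hcon (min x₀ (uL - √(γ * pL / ρL)))
      have hall := hprop y hy.1 hy.2.1 hy.2.2
      obtain ⟨ξ, hξ, h1, h2⟩ := exists_lt_mem_of_ae (hall.and h.ae_state) hylt
      have h3 := h2.trans_le (min_le_left _ _)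
      have h4 := h2.trans_le (min_le_right _ _)
      have h5 := hξ.1 h1 (h3.trans hx₀)
      obtain ⟨q1, q2, q3, q4, q5, q6⟩ := hξ.2 (h3.trans hx₀)
      obtain ⟨l1, l2, l3⟩ := hleft ξ h3.le
      have h6 := h.mid_lt_of_sqrt_lt hγ (show √(γ * pL / ρL) < uL - ξ by linarith)
      rw [mid, q5, q4, l2, l3, l1, mul_assoc, ← sq] at h5
      linarith
    refine ⟨sInf N, ?_, ?_, ?_⟩
    · obtain ⟨y, hy⟩ := hN
      exact (csInf_le hbdd hy).trans hy.2.1.le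
    · filter_upwards [ht] with ξ h1 h2
      by_contra hcon
      obtain ⟨y, hy⟩ := hN
      have h3 : ξ ∈ N := ⟨h1, h2.trans_le ((csInf_le hbdd hy).trans hy.2.1.le), not_le.1 hcon⟩
      exact absurd (csInf_le hbdd h3) (not_le.2 h2)
    · refine ae_of_forall_gt fun c hc => ?_
      obtain ⟨y, hy, hyc⟩ := exists_lt_of_csInf_lt hN hc
      filter_upwards [hprop y hy.1 hy.2.1 hy.2.2] with ξ h1 h2 using h1 (hyc.trans h2)
  · refine ⟨a, le_rfl, ?_, Eventually.of_forall fun ξ h1 h2 => by linarith⟩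
    filter_upwards [ht] with ξ h1 h2
    by_contra hcon
    exact hN ⟨ξ, h1, h2, not_le.1 hcon⟩

end IsHalfFan

theorem IsLocallyAC.eq_of_deriv_zero' {S : Set ℝ} {f f' : ℝ → ℝ} (h : IsLocallyAC S f f')
    (hS : S.OrdConnected) (h0 : ∀ᵐ x, x ∈ S → f' x = 0) {x y : ℝ} (hx : x ∈ S) (hy : y ∈ S) :
    f x = f y := by
  rcases le_total x y with hxy | hxy
  · exact h.eq_of_deriv_zero h0 hxy (hS.out hx hy)
  · exact (h.eq_of_deriv_zero h0 hxy (hS.out hy hx)).symm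

/-- The speed of the contact discontinuity behind a wave moving to the left, as a function of the
state in front of the wave and of the pressure `q` behind it. -/
noncomputable def contactSpeed (γ ρL uL pL q : ℝ) : ℝ :=
  if q ≤ pL then
    uL + 2 / (γ - 1) * (√(γ * pL / ρL) * (1 - (q / pL) ^ ((γ - 1) / (2 * γ))))
  else uL - (q - pL) / √(ρL * ((γ + 1) * q + (γ - 1) * pL) / 2)

namespace IsHalfFan

variable {γ ρL uL pL a : ℝ} {j P B ρ v p : ℝ → ℝ}

local notation "z" => mid γ j P
local notation "D" => disc γ j P B
local notation "Fan" => IsHalfFan γ ρL uL pL a j P B ρ v p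

theorem exists_const_state (hγ : 1 < γ) (h : Fan) {S : Set ℝ}
    (hS : S.OrdConnected) (hne : S.Nonempty) (hSa : S ⊆ Iio a) {σ : ℝ} (hσ : σ = 1 ∨ σ = -1)
    (hD : ∀ ξ ∈ S, 0 < D ξ) (hw : ∀ᵐ ξ, ξ ∈ S → v ξ - z ξ = σ * √(D ξ)) :
    ∃ u r q, ∀ ξ ∈ S, z ξ + σ * √(D ξ) = u - ξ ∧ j ξ = r * (u - ξ) ∧
      P ξ = r * (u - ξ) ^ 2 + q := by
  obtain ⟨x, hx⟩ := hne
  have hVpos : ∀ ξ ∈ S, 0 < z ξ + σ * √(D ξ) := fun ξ hξ => by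
    have h1 := (h.mid_pos hγ ξ (hSa hξ)).2
    have h2 := Real.sqrt_nonneg (D ξ)
    rcases hσ with rfl | rfl <;> linarith
  have acV : IsLocallyAC S (fun ξ => z ξ + σ * √(D ξ)) fun _ => -1 := by
    refine (((h.acMid hγ).mono hSa).add ((((h.acDisc hγ).mono hSa).sqrt hD).const_mul σ)).congr_deriv
      ?_
    have hγ1 : γ + 1 ≠ 0 := by linarith
    filter_upwards [h.ae_state, hw] with ξ h1 h2 hξ
    obtain ⟨-, q2, -⟩ := h1 (hSa hξ)
    have h3 := h2 hξ
    have h4 := Real.sqrt_pos.2 (hD ξ hξ)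
    have h5 : σ ^ 2 = 1 := by rcases hσ with rfl | rfl <;> norm_num
    rw [h3]
    generalize √(D ξ) = y at *
    have e : σ * (-(2 * (σ * y)) * (2 / (γ + 1) - σ * y / v ξ) / (2 * y)) =
        -(σ ^ 2 * (2 / (γ + 1) - σ * y / v ξ)) := by field_simp
    rw [e, h5]
    field_simp
    ring
  have acJ := h.acMass.mono hSa
  have acP := h.acMomentum.mono hSa
  have hρ : ∀ᵐ ξ, ξ ∈ S → ρ ξ = j ξ / (z ξ + σ * √(D ξ)) := by
    filter_upwards [h.ae_state, hw] with ξ h1 h2 hξ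
    obtain ⟨-, q2, -, q4, -⟩ := h1 (hSa hξ)
    rw [← h2 hξ, add_sub_cancel, q4]
    field_simp
  have acr := acJ.div acV hVpos
  have acq := acP.sub (acJ.mul acV)
  have cV : ∀ y ∈ S, z y + σ * √(D y) + y = z x + σ * √(D x) + x := fun y hy =>
    (acV.add IsLocallyAC.id).eq_of_deriv_zero' hS (Eventually.of_forall fun _ _ => by ring) hy hx
  have cr : ∀ y ∈ S, j y / (z y + σ * √(D y)) = j x / (z x + σ * √(D x)) :=
    fun y hy => by
      refine acr.eq_of_deriv_zero' hS ?_ hy hx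
      filter_upwards [hρ] with ξ h1 hξ
      have := hVpos ξ hξ
      rw [h1 hξ]
      field_simp
      ring
  have cq : ∀ y ∈ S, P y - j y * (z y + σ * √(D y)) =
      P x - j x * (z x + σ * √(D x)) := fun y hy => by
    refine acq.eq_of_deriv_zero' hS ?_ hy hx
    filter_upwards [hρ] with ξ h1 hξ
    have := hVpos ξ hξ
    rw [h1 hξ]
    field_simp
    ring
  refine ⟨z x + σ * √(D x) + x, j x / (z x + σ * √(D x)),
    P x - j x * (z x + σ * √(D x)), fun y hy => ?_⟩
  have e1 : z y + σ * √(D y) = z x + σ * √(D x) + x - y := by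
    linarith [cV y hy]
  have hy0 := hVpos y hy
  have e2 : j y = j x / (z x + σ * √(D x)) * (z y + σ * √(D y)) := by
    rw [← cr y hy]; field_simp
  refine ⟨e1, by rw [← e1]; exact e2, ?_⟩
  rw [← e1, ← cq y hy]
  linear_combination (z y + σ * √(D y)) * e2

/-- The state far to the left. -/
theorem exists_left (hγ : 1 < γ) (h : Fan) :
    ∃ x₁, x₁ < a ∧ ∀ ξ < x₁, 0 < D ξ ∧ z ξ + √(D ξ) = uL - ξ ∧ j ξ = ρL * (uL - ξ) ∧
      P ξ = ρL * (uL - ξ) ^ 2 + pL := by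
  obtain ⟨x₀, hx₀, hleft⟩ := h.left
  have hsub : Iio x₀ ⊆ Iio a := Iio_subset_Iio hx₀.le
  have ej := eq_of_ae_eq (S := Iio x₀) (g := fun ξ => ρL * (uL - ξ)) isOpen_Iio
    h.continuous_mass.continuousOn (by fun_prop) (by
      filter_upwards [h.ae_state] with ξ h1 h2
      obtain ⟨l1, l2, l3⟩ := hleft ξ h2.le
      rw [(h1 (hsub h2)).2.2.2.1, l1, l2])
  have eP := eq_of_ae_eq (S := Iio x₀) (g := fun ξ => ρL * (uL - ξ) ^ 2 + pL) isOpen_Iio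
    h.continuous_momentum.continuousOn (by fun_prop) (by
      filter_upwards [h.ae_state] with ξ h1 h2
      obtain ⟨l1, l2, l3⟩ := hleft ξ h2.le
      rw [(h1 (hsub h2)).2.2.2.2.1, (h1 (hsub h2)).2.2.2.1, l1, l2, l3]
      ring)
  have hzc := ((h.acMid hγ).continuousOn isOpen_Iio).mono hsub
  have hDc := ((h.acDisc hγ).continuousOn isOpen_Iio).mono hsub
  have eD := eq_of_ae_eq (S := Iio x₀) (f := fun ξ => (uL - ξ - z ξ) ^ 2) (g := D) isOpen_Iio
    (((continuousOn_const.sub continuousOn_id).sub hzc).pow 2) hDc (by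
      filter_upwards [h.ae_facts hγ] with ξ h1 h2
      rw [← (h1 (hsub h2)).1, (hleft ξ h2.le).1])
  refine ⟨min x₀ (uL - √(γ * pL / ρL)), (min_le_left _ _).trans_lt hx₀, fun ξ hξ => ?_⟩
  have h3 := hξ.trans_le (min_le_left _ _)
  have h4 := hξ.trans_le (min_le_right _ _)
  have hz : z ξ < uL - ξ := by
    rw [mid, ej ξ h3, eP ξ h3]
    exact h.mid_lt_of_sqrt_lt hγ (by linarith)
  have hd : D ξ = (uL - ξ - z ξ) ^ 2 := (eD ξ h3).symm
  refine ⟨by rw [hd]; exact pow_pos (by linarith) 2, ?_, ej ξ h3, eP ξ h3⟩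
  rw [hd, Real.sqrt_sq (by linarith)]
  ring

theorem left_state (hγ : 1 < γ) (h : Fan) {β : ℝ} (hβ : β ≤ a)
    (hw : ∀ᵐ ξ, ξ < β → z ξ ≤ v ξ) (hD : ∀ ξ < β, 0 < D ξ) :
    ∀ ξ < β, z ξ + √(D ξ) = uL - ξ ∧ j ξ = ρL * (uL - ξ) ∧
      P ξ = ρL * (uL - ξ) ^ 2 + pL := by
  obtain ⟨x₁, hx₁, hx⟩ := h.exists_left hγ
  obtain ⟨u, r, q, hc⟩ := h.exists_const_state hγ (S := Iio β) ordConnected_Iio ⟨β - 1, by simp⟩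
    (Iio_subset_Iio hβ) (Or.inl rfl) hD (by
      filter_upwards [hw, h.ae_facts hγ] with ξ h1 h2 hξ
      rw [← (h2 (lt_of_lt_of_le hξ hβ)).1, Real.sqrt_sq (by linarith [h1 hξ]), one_mul])
  have hy1 : min β x₁ - 1 < β := by linarith [min_le_left β x₁]
  have hy2 : min β x₁ - 1 < x₁ := by linarith [min_le_right β x₁]
  obtain ⟨-, a1, a2, a3⟩ := hx _ hy2
  obtain ⟨b1, b2, b3⟩ := hc _ hy1
  have hpos := h.mass_pos _ (hy2.trans hx₁)
  rw [one_mul] at b1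
  have e1 : u = uL := by linarith
  subst e1
  have hne : u - (min β x₁ - 1) ≠ 0 := by rintro h0; rw [a2, h0, mul_zero] at hpos; exact hpos.false
  have e2 : r = ρL := mul_right_cancel₀ hne (by rw [← a2, ← b2])
  subst e2
  have e3 : q = pL := by linarith
  subst e3
  intro ξ hξ
  simpa using hc ξ hξ

theorem left_limit (h : Fan) {β : ℝ}
    (hls : ∀ ξ < β, z ξ + √(D ξ) = uL - ξ ∧ j ξ = ρL * (uL - ξ) ∧
      P ξ = ρL * (uL - ξ) ^ 2 + pL) : j β = ρL * (uL - β) ∧ P β = ρL * (uL - β) ^ 2 + pL := by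
  have hn : ∀ᶠ ξ in 𝓝[<] β, ξ < β := self_mem_nhdsWithin
  exact ⟨eq_of_nhdsWithin h.continuous_mass.continuousAt (by fun_prop)
    (hn.mono fun ξ hξ => (hls ξ hξ).2.1), eq_of_nhdsWithin h.continuous_momentum.continuousAt
      (by fun_prop) (hn.mono fun ξ hξ => (hls ξ hξ).2.2)⟩

theorem left_limit_mid (hγ : 1 < γ) (h : Fan) {β : ℝ} (hβ : β < a)
    (hls : ∀ ξ < β, z ξ + √(D ξ) = uL - ξ ∧ j ξ = ρL * (uL - ξ) ∧
      P ξ = ρL * (uL - ξ) ^ 2 + pL) : z β + √(D β) = uL - β :=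
  eq_of_nhdsWithin ((h.continuousAt_mid hγ hβ).add (h.continuousAt_disc hγ hβ).sqrt) (by fun_prop)
    (eventually_nhdsWithin_of_forall (s := Iio β) fun ξ hξ => (hls ξ hξ).1)

/-- The flow is a constant state up to some speed `β ≤ α`, and sonic between `β` and `α`. -/
theorem exists_sonic (hγ : 1 < γ) (h : Fan) {α : ℝ}
    (hw : ∀ᵐ ξ, ξ < α → z ξ ≤ v ξ) :
    (∀ ξ, ξ ≤ α → ξ < a → 0 < D ξ) ∨ ∃ β ≤ α, β < a ∧ (∀ ξ < β, 0 < D ξ) ∧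
      ∀ ξ, β ≤ ξ → ξ ≤ α → ξ < a → D ξ = 0 := by
  have hanti : ∀ x y, x ≤ y → y ≤ α → y < a → D y ≤ D x := fun x y hxy hyα hya =>
    h.disc_anti hγ hxy hya (hw.mono fun ξ h1 h2 => h1 (h2.2.trans_le hyα))
  by_cases hZ : ∃ x, x ≤ α ∧ x < a ∧ D x = 0
  swap
  · left
    intro ξ h1 h2
    exact (h.disc_nonneg hγ ξ h2).lt_of_ne fun h3 => hZ ⟨ξ, h1, h2, h3.symm⟩
  right
  obtain ⟨x₁, hx₁, hx⟩ := h.exists_left hγ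
  set Z : Set ℝ := {x | x ≤ α ∧ x < a ∧ D x = 0} with hZdef
  have hbdd : BddBelow Z := ⟨x₁, fun y hy => by
    by_contra hcon
    have := (hx y (not_le.1 hcon)).1
    rw [hy.2.2] at this
    exact this.false⟩
  obtain ⟨y, hy⟩ := hZ
  have hyZ : sInf Z ≤ y := csInf_le hbdd hy
  have hβa : sInf Z < a := hyZ.trans_lt hy.2.1
  have hβα : sInf Z ≤ α := hyZ.trans hy.1
  have hpos : ∀ ξ < sInf Z, 0 < D ξ := fun ξ hξ =>
    (h.disc_nonneg hγ ξ (hξ.trans hβa)).lt_of_ne fun h3 => (csInf_le hbdd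
      (show ξ ∈ Z from ⟨hξ.le.trans hβα, hξ.trans hβa, h3.symm⟩)).not_gt hξ
  have hzero : D (sInf Z) = 0 := by
    refine le_antisymm (not_lt.1 fun hcon => ?_) (h.disc_nonneg hγ _ hβa)
    have hev := (h.continuousAt_disc hγ hβa).eventually (lt_mem_nhds hcon)
    obtain ⟨ε, hε, hs⟩ := Metric.eventually_nhds_iff_ball.1 hev
    obtain ⟨w, hwZ, hwlt⟩ := exists_lt_of_csInf_lt ⟨y, hy⟩ (show sInf Z < sInf Z + ε by linarith)
    have hge := csInf_le hbdd hwZ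
    have := hs w (Real.ball_eq_Ioo _ ε ▸ ⟨by linarith, by linarith⟩)
    rw [hwZ.2.2] at this
    exact this.false
  refine ⟨sInf Z, hβα, hβa, hpos, fun ξ h1 h2 h3 => le_antisymm ?_ (h.disc_nonneg hγ ξ h3)⟩
  rw [← hzero]
  exact hanti _ _ h1 h2 h3

/-- Behind the wave there is a constant state, up to the contact discontinuity. -/
theorem right_state (hγ : 1 < γ) (h : Fan) {α : ℝ} (hα : α < a)
    (hw : ∀ᵐ ξ, α < ξ → ξ < a → v ξ < z ξ) :
    z α - √(D α) = a - α ∧ P α = j α * (a - α) + P a := by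
  have hmono : ∀ x y, α ≤ x → x ≤ y → y < a → D x ≤ D y := fun x y hαx hxy hya =>
    h.disc_mono hγ hxy hya (hw.mono fun ξ h1 h2 => h1 (hαx.trans_lt h2.1) (h2.2.trans hya))
  have hpos : ∀ ξ ∈ Ioo α a, 0 < D ξ := fun ξ hξ => by
    obtain ⟨y, hy, h1, h2⟩ := exists_lt_mem_of_ae (hw.and (h.ae_facts hγ)) hξ.1
    have h3 := hy.1 h1 (h2.trans hξ.2)
    refine lt_of_lt_of_le ?_ (hmono y ξ h1.le h2.le hξ.2)
    rw [← (hy.2 (h2.trans hξ.2)).1]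
    exact sq_pos_of_neg (by linarith)
  obtain ⟨u, r, q, hc⟩ := h.exists_const_state hγ (S := Ioo α a) ordConnected_Ioo
    (nonempty_Ioo.2 hα) (fun ξ hξ => hξ.2) (Or.inr rfl) hpos (by
      filter_upwards [hw, h.ae_facts hγ] with ξ h1 h2 hξ
      have := h1 hξ.1 hξ.2
      rw [← (h2 hξ.2).1, Real.sqrt_sq_eq_abs, abs_of_neg (by linarith)]
      ring)
  have hnα : ∀ᶠ ξ in 𝓝[>] α, ξ ∈ Ioo α a := Ioo_mem_nhdsGT hα
  have hna : ∀ᶠ ξ in 𝓝[<] a, ξ ∈ Ioo α a := Ioo_mem_nhdsLT hα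
  have e1 : z α + -1 * √(D α) = u - α :=
    eq_of_nhdsWithin ((h.continuousAt_mid hγ hα).add ((h.continuousAt_disc hγ hα).sqrt.const_mul _))
      (by fun_prop) (hnα.mono fun ξ hξ => (hc ξ hξ).1)
  have e2 : j α = r * (u - α) := eq_of_nhdsWithin h.continuous_mass.continuousAt (by fun_prop)
    (hnα.mono fun ξ hξ => (hc ξ hξ).2.1)
  have e3 : P α = r * (u - α) ^ 2 + q := eq_of_nhdsWithin h.continuous_momentum.continuousAt
    (by fun_prop) (hnα.mono fun ξ hξ => (hc ξ hξ).2.2)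
  have e4 : j a = r * (u - a) := eq_of_nhdsWithin h.continuous_mass.continuousAt (by fun_prop)
    (hna.mono fun ξ hξ => (hc ξ hξ).2.1)
  have e5 : P a = r * (u - a) ^ 2 + q := eq_of_nhdsWithin h.continuous_momentum.continuousAt
    (by fun_prop) (hna.mono fun ξ hξ => (hc ξ hξ).2.2)
  have hr : r ≠ 0 := by
    rintro rfl
    have := h.mass_pos α hα
    rw [e2, zero_mul] at this
    exact this.false
  rw [h.mass_eq_zero] at e4
  have hu : u = a := sub_eq_zero.1 ((mul_eq_zero.1 e4.symm).resolve_left hr)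
  subst hu
  refine ⟨by linarith, ?_⟩
  rw [e5, e3, e2]
  ring

/-- Inside a rarefaction wave. -/
theorem rarefaction (hγ : 1 < γ) (h : Fan) {β α : ℝ}
    (hβα : β ≤ α) (hβ : β < a) (hw : ∀ᵐ ξ, ξ < α → z ξ ≤ v ξ)
    (hpos : ∀ ξ < β, 0 < D ξ) (hzero : ∀ ξ, β ≤ ξ → ξ ≤ α → ξ < a → D ξ = 0) :
    z β = √(γ * pL / ρL) ∧ β = uL - z β ∧ j β * z β = γ * pL ∧
      ∀ ξ, β ≤ ξ → ξ ≤ α → ξ < a → z ξ = z β - (γ - 1) / (γ + 1) * (ξ - β) ∧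
        z ξ ^ (2 * γ) * (j β * z β) ^ (γ - 1) = z β ^ (2 * γ) * (j ξ * z ξ) ^ (γ - 1) := by
  have hρ := h.density_pos
  have hp := h.pressure_pos
  have hγ0 : 0 < γ := by linarith
  have hγ1 : 0 < γ + 1 := by linarith
  have hls := h.left_state hγ hβ.le (by filter_upwards [hw] with ξ h1 h2 using h1 (h2.trans_le hβα))
    hpos
  have hDβ := hzero β le_rfl hβα hβ
  have e1 := h.left_limit_mid hγ hβ hls
  obtain ⟨e2, e3⟩ := h.left_limit hls
  rw [hDβ, Real.sqrt_zero, add_zero] at e1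
  have hzβ : 0 < z β := by simpa [hDβ] using (h.mid_pos hγ β hβ).2
  have e4 : z β ^ 2 = γ * pL / ρL := by
    have h1 : z β = γ / (γ + 1) * (P β / j β) := rfl
    rw [e3, e2, ← e1] at h1
    field_simp at h1 ⊢
    linear_combination h1
  have e5 : j β * z β = γ * pL := by
    rw [e2, ← e1, mul_assoc, ← sq, e4]; field_simp
  refine ⟨by rw [← e4, Real.sqrt_sq hzβ.le], by linarith, e5, fun ξ h1 h2 h3 => ?_⟩
  have hsub : Icc β ξ ⊆ Iio a := fun y hy => hy.2.trans_lt h3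
  have hvz : ∀ᵐ y, y ∈ Icc β ξ → v y = z y := by
    filter_upwards [h.ae_facts hγ] with y h4 hy
    have := (h4 (hsub hy)).1
    rw [hzero y hy.1 (hy.2.trans h2) (hsub hy)] at this
    have := pow_eq_zero_iff two_ne_zero |>.1 this
    linarith
  have hz0 : ∀ y ∈ Icc β ξ, 0 < z y := fun y hy => by
    simpa [hzero y hy.1 (hy.2.trans h2) (hsub hy)] using (h.mid_pos hγ y (hsub hy)).2
  have hj0 : ∀ y ∈ Icc β ξ, 0 < j y := fun y hy => h.mass_pos y (hsub hy)
  have acz : IsLocallyAC (Icc β ξ) z fun _ => -((γ - 1) / (γ + 1)) := by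
    refine ((h.acMid hγ).mono hsub).congr_deriv ?_
    filter_upwards [hvz] with y h4 hy
    rw [h4 hy, sub_self, zero_div, sub_zero]
  have c1 := (acz.add (IsLocallyAC.id.const_mul ((γ - 1) / (γ + 1)))).eq_of_deriv_zero
    (Eventually.of_forall fun _ _ => by ring) h1 subset_rfl
  have acl := ((acz.log hz0).const_mul (γ + 1)).sub
    (((h.acMass.mono hsub).log hj0).const_mul (γ - 1))
  have c2 := acl.eq_of_deriv_zero (by
    filter_upwards [hvz, h.ae_state] with y h4 h5 hy
    obtain ⟨q1, q2, q3, q4, q5, q6⟩ := h5 (hsub hy)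
    have := hz0 y hy
    rw [q4, h4 hy]
    field_simp
    ring) h1 subset_rfl
  refine ⟨by linarith, ?_⟩
  have hβm : β ∈ Icc β ξ := left_mem_Icc.2 h1
  have hξm : ξ ∈ Icc β ξ := right_mem_Icc.2 h1
  have p1 := hz0 β hβm
  have p2 := hz0 ξ hξm
  have p3 := hj0 β hβm
  have p4 := hj0 ξ hξm
  refine Real.log_injOn_pos (mem_Ioi.2 (by positivity)) (mem_Ioi.2 (by positivity)) ?_
  rw [Real.log_mul (by positivity) (by positivity), Real.log_mul (by positivity) (by positivity),
    Real.log_rpow p2, Real.log_rpow p1, Real.log_rpow (by positivity),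
    Real.log_rpow (by positivity), Real.log_mul p3.ne' p1.ne', Real.log_mul p4.ne' p2.ne']
  linarith

/-- The speed of the contact discontinuity is determined by the pressure on it. -/
theorem eq_contactSpeed (hγ : 1 < γ) (h : Fan) :
    a = contactSpeed γ ρL uL pL (P a) := by
  have hρ := h.density_pos
  have hp := h.pressure_pos
  have hγ0 : 0 < γ := by linarith
  have hγ1 : 0 < γ + 1 := by linarith
  have hγ2 : 0 < γ - 1 := by linarith
  obtain ⟨α, hα, hw1, hw2⟩ := h.exists_transition hγ
  rcases h.exists_sonic hγ hw1 with hpos | ⟨β, hβα, hβa, hpos, hzero⟩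
  · have hls := h.left_state hγ hα hw1
      fun ξ hξ => hpos ξ hξ.le (hξ.trans_le hα)
    obtain ⟨e2, e3⟩ := h.left_limit hls
    rcases hα.eq_or_lt with rfl | hlt
    · exfalso
      rw [h.mass_eq_zero] at e2
      have h0 : uL - α = 0 := (mul_eq_zero.1 e2.symm).resolve_left hρ.ne'
      have hle : ∀ᶠ ξ in 𝓝[<] α, γ / (γ + 1) * P ξ ≤ j ξ * (uL - ξ) := by
        filter_upwards [self_mem_nhdsWithin] with ξ hξ
        have h1 := (hls ξ hξ).1
        have h2 := Real.sqrt_nonneg (D ξ)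
        have h3 : z ξ ≤ uL - ξ := by linarith
        rw [mid, ← mul_div_assoc, div_le_iff₀ (h.mass_pos ξ hξ)] at h3
        linarith
      have := le_of_tendsto_of_tendsto
        ((h.continuous_momentum.const_mul (γ / (γ + 1))).continuousAt.tendsto.mono_left
          nhdsWithin_le_nhds)
        ((h.continuous_mass.mul (g := fun ξ => uL - ξ) (by fun_prop)).continuousAt.tendsto.mono_left
          nhdsWithin_le_nhds) hle
      rw [Pi.mul_apply, h0, mul_zero, e3, h0] at this
      have : 0 < γ / (γ + 1) * (ρL * 0 ^ 2 + pL) := by simp; positivity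
      linarith
    · have hD := hpos α le_rfl hlt
      have e1 := h.left_limit_mid hγ hlt hls
      obtain ⟨f1, f2⟩ := h.right_state hγ hlt hw2
      have hj := h.mass_pos α hlt
      have hs := Real.sqrt_pos.2 hD
      have hv : 0 < uL - α := by rw [e2] at hj; exact pos_of_mul_pos_right hj hρ.le
      -- the Rankine-Hugoniot conditions
      have r1 : j α * (uL - a) = P a - pL := by
        rw [e3] at f2
        rw [e2] at f2 ⊢
        linear_combination f2
      have hz2 : 2 * z α = (uL - α) + (a - α) := by linarith
      have hz3 : (γ + 1) * (j α * z α) = γ * P α := by rw [mid]; field_simp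
      have r2 : j α ^ 2 = ρL * ((γ + 1) * P a + (γ - 1) * pL) / 2 := by
        have : 2 * (j α * (uL - α)) = (γ + 1) * P a + (γ - 1) * pL := by
          linear_combination 2 * hz3 - (γ + 1) * j α * hz2 + 2 * γ * e3
            + (γ + 1) * r1 - 2 * γ * (uL - α) * e2
        rw [← this, e2]
        ring
      have hq : pL < P a := by
        have : 0 < j α * (uL - a) := mul_pos hj (by linarith)
        linarith
      rw [contactSpeed, if_neg (not_le.2 hq), ← r2, Real.sqrt_sq hj.le, ← r1]
      field_simp
      ring
  · obtain ⟨c1, c2, c3, hr⟩ := h.rarefaction hγ hβα hβa hw1 hpos hzero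
    have hzβ : 0 < z β := by rw [c1]; positivity
    -- a formula for the speed in terms of the sound speed behind the wave
    have key : ∀ c : ℝ, 0 ≤ c → c ≤ z β → 0 ≤ P a →
        c ^ (2 * γ) * (γ * pL) ^ (γ - 1) = z β ^ (2 * γ) * (γ * P a) ^ (γ - 1) →
        a = uL + 2 / (γ - 1) * (z β - c) → a = contactSpeed γ ρL uL pL (P a) := by
      intro c hc hcz hP he ha
      have e1 : (c / z β) ^ (2 * γ) = (P a / pL) ^ (γ - 1) := by
        rw [Real.div_rpow hc hzβ.le, Real.div_rpow hP hp.le, div_eq_div_iff (by positivity)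
          (by positivity)]
        rw [Real.mul_rpow hγ0.le hp.le, Real.mul_rpow hγ0.le hP] at he
        have : γ ^ (γ - 1) ≠ 0 := by positivity
        apply mul_right_cancel₀ this
        linear_combination he
      have e2 : c = z β * (P a / pL) ^ ((γ - 1) / (2 * γ)) := by
        have : (P a / pL) ^ ((γ - 1) / (2 * γ)) = c / z β := by
          rw [div_eq_mul_inv (γ - 1), Real.rpow_mul (by positivity), ← e1,
            ← Real.rpow_mul (by positivity), mul_inv_cancel₀ (by positivity), Real.rpow_one]
        rw [this]
        field_simp
      have hle : P a ≤ pL := by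
        have h1 : (c / z β) ^ (2 * γ) ≤ 1 := Real.rpow_le_one (by positivity)
          (by rw [div_le_one hzβ]; exact hcz) (by positivity)
        rw [e1] at h1
        by_contra hcon
        have : 1 < (P a / pL) ^ (γ - 1) :=
          Real.one_lt_rpow (by rw [one_lt_div hp]; exact not_le.1 hcon) hγ2
        linarith
      rw [contactSpeed, if_pos hle, ← c1]
      rw [e2] at ha
      linear_combination ha
    rcases hα.eq_or_lt with rfl | hlt
    · -- vacuum behind the wave
      have hn : ∀ᶠ ξ in 𝓝[<] α, ξ ∈ Ioo β α := Ioo_mem_nhdsLT hβa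
      have hPz : Tendsto (fun ξ => j ξ * z ξ) (𝓝[<] α) (𝓝 (γ / (γ + 1) * P α)) := by
        refine ((h.continuous_momentum.const_mul (γ / (γ + 1))).continuousAt.tendsto.mono_left
          nhdsWithin_le_nhds).congr' (hn.mono fun ξ hξ => ?_)
        have := h.mass_pos ξ hξ.2
        change _ = j ξ * (γ / (γ + 1) * (P ξ / j ξ))
        field_simp
      have hzt : Tendsto z (𝓝[<] α) (𝓝 (z β - (γ - 1) / (γ + 1) * (α - β))) := by
        refine (Continuous.tendsto (f := fun ξ => z β - (γ - 1) / (γ + 1) * (ξ - β))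
          (by fun_prop) α |>.mono_left nhdsWithin_le_nhds).congr' (hn.mono fun ξ hξ => ?_)
        exact (hr ξ hξ.1.le hξ.2.le hξ.2).1.symm
      have hjt : Tendsto j (𝓝[<] α) (𝓝 0) := by
        have := h.continuous_mass.continuousAt.tendsto.mono_left
          (nhdsWithin_le_nhds (a := α) (s := Iio α))
        rwa [h.mass_eq_zero] at this
      have hP0 : P α = 0 := by
        have h1 := tendsto_nhds_unique hPz (hjt.mul hzt)
        rw [zero_mul] at h1
        exact (mul_eq_zero.1 h1).resolve_left (by positivity)
      rw [hP0, mul_zero] at hPz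
      have hz0 : 0 ≤ z β - (γ - 1) / (γ + 1) * (α - β) :=
        ge_of_tendsto hzt (hn.mono fun ξ hξ =>
          (Real.sqrt_nonneg _).trans (h.mid_pos hγ ξ hξ.2).2.le)
      have hlim := tendsto_nhds_unique_of_eventuallyEq
        ((hzt.rpow_const (p := 2 * γ) (Or.inr (by positivity))).mul_const
          ((j β * z β) ^ (γ - 1)))
        ((hPz.rpow_const (p := γ - 1) (Or.inr hγ2.le)).const_mul (z β ^ (2 * γ)))
        (hn.mono fun ξ hξ => (hr ξ hξ.1.le hξ.2.le hξ.2).2)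
      rw [Real.zero_rpow hγ2.ne', mul_zero] at hlim
      have hc0 : z β - (γ - 1) / (γ + 1) * (α - β) = 0 := by
        have h1 : (j β * z β) ^ (γ - 1) ≠ 0 := by rw [c3]; positivity
        exact (Real.rpow_eq_zero hz0 (by positivity)).1 ((mul_eq_zero.1 hlim).resolve_right h1)
      refine key 0 le_rfl hzβ.le hP0.ge ?_ ?_
      · rw [hP0, mul_zero, Real.zero_rpow hγ2.ne', mul_zero, Real.zero_rpow (by positivity),
          zero_mul]
      · rw [sub_zero]
        field_simp at hc0 ⊢
        linear_combination (-1 : ℝ) * hc0 + (γ - 1) * c2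
    · obtain ⟨f1, f2⟩ := h.right_state hγ hlt hw2
      obtain ⟨g1, g2⟩ := hr α hβα le_rfl hlt
      rw [hzero α hβα le_rfl hlt, Real.sqrt_zero, sub_zero] at f1
      have hj := h.mass_pos α hlt
      have hz3 : (γ + 1) * (j α * z α) = γ * P α := by rw [mid]; field_simp
      have hq : j α * z α = γ * P a := by
        rw [f2, ← f1] at hz3
        linarith
      have hzα : 0 < z α := by linarith
      rw [hq, c3] at g2
      have hle : 0 ≤ (γ - 1) / (γ + 1) * (α - β) :=
        mul_nonneg (by positivity) (by linarith)
      refine key (z α) hzα.le (by linarith) ?_ g2 ?_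
      · have : 0 < γ * P a := by rw [← hq]; positivity
        exact (pos_of_mul_pos_right this hγ0.le).le
      · field_simp at g1 ⊢
        linear_combination (γ - 1) * c2 - (γ - 1) * f1 + g1
end IsHalfFan

theorem IsPrimitive.isLocallyAC {f f' : ℝ → ℝ} (h : IsPrimitive f f') (S : Set ℝ) :
    IsLocallyAC S f f' :=
  ⟨fun x y _ _ => h.ac x y, h.ae_hasDerivAt.mono fun _ hx _ => hx⟩

theorem norm_sq_normal_tangential {n c : Space d} (hn : ‖n‖ = 1) (hc : inner ℝ c n = 0) (y : ℝ) :
    ‖y • n + c‖ ^ 2 = y ^ 2 + ‖c‖ ^ 2 := by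
  rw [norm_add_sq_real, inner_smul_left, real_inner_comm, hc, norm_smul, hn]
  simp

/-! ### The contact discontinuity of a Riemann solution -/

namespace IsRiemannProfile

variable {n : Space d} {UL UR : State d} {W : ℝ → State d} {s : ℝ} {G : ℝ → State d}

theorem isHalfFan (hγ : 1 < γ) (hn : ‖n‖ = 1) (h : IsRiemannProfile γ n UL UR W s G)
    (hL : IsPhysical γ UL) {a : ℝ} (hpos : ∀ ξ, ξ < a → 0 < (G ξ).1) (ha : (G a).1 = 0) :
    ∃ (j P B ρ v p : ℝ → ℝ), IsHalfFan γ UL.1 (inner ℝ (velocity UL) n) (pressure γ UL) a j P B ρ v p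
      ∧ P a = inner ℝ (G a).2.1 n := by
  set c : Space d := velocity UL - inner ℝ (velocity UL) n • n with hc
  have hnn := inner_self_eq_one_of_norm_eq_one (𝕜 := ℝ) hn
  have hcn : inner ℝ c n = (0 : ℝ) := by
    rw [hc, inner_sub_left, inner_smul_left, hnn]; simp
  have hnc : inner ℝ n c = (0 : ℝ) := by rw [real_inner_comm, hcn]
  let ℓ₁ : State d →L[ℝ] ℝ := (innerSL ℝ n) ∘L (ContinuousLinearMap.fst ℝ _ _) ∘L
    (ContinuousLinearMap.snd ℝ _ _)
  let ℓ₂ : State d →L[ℝ] ℝ := (ContinuousLinearMap.snd ℝ _ _) ∘L (ContinuousLinearMap.snd ℝ _ _)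
    - (innerSL ℝ c) ∘L (ContinuousLinearMap.fst ℝ _ _) ∘L (ContinuousLinearMap.snd ℝ _ _)
    + (1 / 2 * ‖c‖ ^ 2) • ContinuousLinearMap.fst ℝ _ _
  have e₁ : ∀ V : State d, ℓ₁ V = inner ℝ n V.2.1 := fun V => rfl
  have e₂ : ∀ V : State d, ℓ₂ V = V.2.2 - inner ℝ c V.2.1 + 1 / 2 * ‖c‖ ^ 2 * V.1 := fun V => rfl
  let v : ℝ → ℝ := fun ξ => inner ℝ (velocity (W ξ)) n - ξ
  let p : ℝ → ℝ := fun ξ => pressure γ (W ξ)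
  let j : ℝ → ℝ := fun ξ => (G ξ).1
  let P : ℝ → ℝ := fun ξ => ℓ₁ (G ξ) - ξ * j ξ
  let J : ℝ → ℝ := fun ξ => ℓ₂ (G ξ) - ξ * ℓ₁ (G ξ) + 1 / 2 * (ξ * ξ) * j ξ
  have acj : IsLocallyAC (Iio a) j fun ξ => -(W ξ).1 := h.isPrimitive_fst.isLocallyAC _
  have ac1 := (h.isPrimitive_clm ℓ₁).isLocallyAC (Iio a)
  have ac2 := (h.isPrimitive_clm ℓ₂).isLocallyAC (Iio a)
  have acid : IsLocallyAC (Iio a) (fun x => x) fun _ => 1 := IsLocallyAC.id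
  -- pointwise relations
  have key : ∀ᵐ ξ, ξ < a → IsPhysical γ (W ξ) ∧ 0 < v ξ ∧ j ξ = (W ξ).1 * v ξ ∧
      ℓ₁ (W ξ) = (W ξ).1 * (v ξ + ξ) ∧ ℓ₁ (G ξ) = j ξ * (v ξ + ξ) + p ξ ∧
      ℓ₂ (W ξ) = 1 / 2 * (W ξ).1 * (v ξ + ξ) ^ 2 + 1 / (γ - 1) * p ξ ∧
      ℓ₂ (G ξ) = v ξ * (1 / 2 * (W ξ).1 * (v ξ + ξ) ^ 2 + 1 / (γ - 1) * p ξ)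
        + (v ξ + ξ) * p ξ := by
    filter_upwards [h.fst_eq, h.velocity_eq hn hL, h.ae_eq] with ξ h1 h2 h3 hξ
    have hj := hpos ξ hξ
    have hv := h2 hj
    rw [← hc] at hv
    have hphys : IsPhysical γ (W ξ) := (h.physical ξ).resolve_right fun h4 => by
      rw [h1, h4] at hj; simp at hj
    have hρ := hphys.1
    have hvpos : 0 < v ξ := by
      rw [h1] at hj; exact pos_of_mul_pos_right hj hρ.le
    have hvn : inner ℝ (velocity (W ξ)) n = v ξ + ξ := by simp [v]
    have hm := momentum_eq (Or.inl hphys)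
    rw [hvn] at hv
    have hE := energy_eq_pressure hγ (Or.inl hphys)
    rw [hv, norm_sq_normal_tangential hn hcn] at hE
    have hmn : inner ℝ n (W ξ).2.1 = (W ξ).1 * (v ξ + ξ) := by
      rw [hm, inner_smul_right, real_inner_comm, hvn]
    have hmc : inner ℝ c (W ξ).2.1 = (W ξ).1 * ‖c‖ ^ 2 := by
      rw [hm, hv, inner_smul_right, inner_add_right, inner_smul_right, hcn,
        real_inner_self_eq_norm_sq]; ring
    have hG1 : (G ξ).2.1 = (v ξ) • (W ξ).2.1 + p ξ • n := by
      rw [← h3, flux_eq_velocity (Or.inl hphys), hvn]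
      simp only [Prod.snd_sub, Prod.fst_sub, Prod.smul_snd, Prod.smul_fst, p]
      module
    have hG2 : (G ξ).2.2 = v ξ * (W ξ).2.2 + (v ξ + ξ) * p ξ := by
      rw [← h3, flux_eq_velocity (Or.inl hphys), hvn]
      simp only [Prod.snd_sub, Prod.smul_snd, smul_eq_mul, p]
      ring
    have hj2 : j ξ = (W ξ).1 * v ξ := h1
    refine ⟨hphys, hvpos, hj2, ?_, ?_, ?_, ?_⟩
    · rw [e₁, hmn]
    · rw [e₁, hG1, inner_add_right, inner_smul_right, inner_smul_right, hmn, hnn, hj2]; ring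
    · rw [e₂, hmc, hE]; ring
    · rw [e₂, hG2, hG1, inner_add_right, inner_smul_right, inner_smul_right, hmc, hcn, hE]
      change _ - _ + _ * j ξ = _
      rw [hj2]; ring
  have acP : IsLocallyAC (Iio a) P fun ξ => -(2 * j ξ) := by
    refine (ac1.sub (acid.mul acj)).congr_deriv ?_
    filter_upwards [key] with ξ h1 hξ
    obtain ⟨k1, k2, k3, k4, k5, k6, k7⟩ := h1 hξ
    rw [k4, k3]; ring
  have acJ : IsLocallyAC (Iio a) J fun ξ => -(1 / 2 * (W ξ).1 * v ξ ^ 2) - j ξ * v ξ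
      - γ / (γ - 1) * p ξ := by
    refine ((ac2.sub (acid.mul ac1)).add (((acid.mul acid).const_mul (1 / 2)).mul acj)).congr_deriv ?_
    filter_upwards [key] with ξ h1 hξ
    obtain ⟨k1, k2, k3, k4, k5, k6, k7⟩ := h1 hξ
    have : γ - 1 ≠ 0 := by linarith
    rw [k4, k5, k6, k3]; field_simp; ring
  have hJ : ∀ᵐ ξ, ξ < a → J ξ = 1 / 2 * j ξ * v ξ ^ 2 + γ / (γ - 1) * (v ξ * p ξ) := by
    filter_upwards [key] with ξ h1 hξ
    obtain ⟨k1, k2, k3, k4, k5, k6, k7⟩ := h1 hξ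
    have : γ - 1 ≠ 0 := by linarith
    simp only [J]
    rw [k5, k7, k3]; field_simp; ring
  refine ⟨j, P, fun ξ => J ξ / j ξ, fun ξ => (W ξ).1, v, p, ?_, ?_⟩
  swap
  · simp only [P, j, ha, e₁, mul_zero, sub_zero]
    exact real_inner_comm _ _
  have hGc := h.continuous
  constructor
  · exact hL.1
  · exact hL.2
  · exact acj
  · exact acP
  · refine (acJ.div acj fun x hx => hpos x hx).congr_deriv ?_
    filter_upwards [key, hJ] with ξ h1 h2 hξ
    obtain ⟨k1, k2, k3, k4, k5, k6, k7⟩ := h1 hξ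
    have hρ := k1.1
    have : γ - 1 ≠ 0 := by linarith
    rw [h2 hξ, k3]; field_simp; ring
  · exact hGc.fst
  · exact (ℓ₁.continuous.comp hGc).sub (continuous_id.mul hGc.fst)
  · exact hpos
  · exact ha
  · obtain ⟨R, hR⟩ := h.bounded
    exact ⟨R, fun ξ => (le_abs_self _).trans ((norm_fst_le (W ξ)).trans (hR ξ))⟩
  · filter_upwards [key, hJ] with ξ h1 h2 hξ
    obtain ⟨k1, k2, k3, k4, k5, k6, k7⟩ := h1 hξ
    have hρ := k1.1
    have : γ - 1 ≠ 0 := by linarith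
    refine ⟨hρ, k2, k1.2, k3, ?_, ?_⟩
    · simp only [P]; rw [k5]; ring
    · rw [h2 hξ, k3]; field_simp
  · obtain ⟨t, ht, hmono⟩ := h.specEntropy_mono hγ
    refine ⟨t ∩ {ξ | ξ < a → IsPhysical γ (W ξ)}, ?_, ?_⟩
    · filter_upwards [ht, key] with ξ h1 h2 using ⟨h1, fun h3 => (h2 h3).1⟩
    · rintro x ⟨hx1, hx2⟩ y ⟨hy1, hy2⟩ hxy hya
      have hx3 := hx2 (hxy.trans hya)
      have hy3 := hy2 hya
      have := hmono x hx1 y hy1 hxy (hpos y hya)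
      rw [specEntropy, specEntropy] at this
      exact (Real.log_le_log_iff (div_pos hx3.2 (Real.rpow_pos_of_pos hx3.1 _))
        (div_pos hy3.2 (Real.rpow_pos_of_pos hy3.1 _))).1 this
  · refine ⟨min (-s) (a - 1), by linarith [min_le_right (-s) (a - 1)], fun ξ hξ => ?_⟩
    have := h.left ξ (hξ.trans (min_le_left _ _))
    simp [v, p, this]

theorem eq_of_fst_eq_zero (h : IsRiemannProfile γ n UL UR W s G) (hL : 0 < UL.1)
    (hR : 0 < UR.1) {a b : ℝ} (hab : a ≤ b) (hz : ∀ ξ ∈ Icc a b, (G ξ).1 = 0) : G a = G b := by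
  have h1 := h.sub_eq a b
  have h2 : ∫ ξ in a..b, W ξ = 0 := by
    refine intervalIntegral.integral_zero_ae ?_
    filter_upwards [h.ae_vacuum hL hR] with ξ h3 h4
    rw [uIoc_of_le hab] at h4
    exact h3 (hz ξ (Ioc_subset_Icc_self h4))
  rw [h2, neg_zero, sub_eq_zero] at h1
  exact h1.symm

end IsRiemannProfile

/-! ### Riemann states and reflection at a wall -/

variable {n : Space d}

theorem inner_mirror (hn : ‖n‖ = 1) (U : State d) :
    inner ℝ (mirror n U).2.1 n = -inner ℝ U.2.1 n := by
  have hnn := inner_self_eq_one_of_norm_eq_one (𝕜 := ℝ) hn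
  simp only [mirror, inner_sub_left, inner_smul_left, hnn]
  simp
  ring

theorem norm_mirror (hn : ‖n‖ = 1) (U : State d) : ‖(mirror n U).2.1‖ = ‖U.2.1‖ := by
  rw [← sq_eq_sq₀ (norm_nonneg _) (norm_nonneg _)]
  simp only [mirror]
  rw [norm_sub_sq_real, inner_smul_right, norm_smul, hn, mul_one, Real.norm_eq_abs, sq_abs]
  ring

theorem pressure_mirror (hn : ‖n‖ = 1) (U : State d) : pressure γ (mirror n U) = pressure γ U := by
  rw [pressure, pressure, norm_mirror hn]; rfl

theorem IsPhysical.mirror (hn : ‖n‖ = 1) {U : State d} (hU : IsPhysical γ U) :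
    IsPhysical γ (mirror n U) := ⟨hU.1, by rw [pressure_mirror hn]; exact hU.2⟩

theorem IsRiemannState.exists_profile (hγ : 1 < γ) (hn : ‖n‖ = 1) {UL UR V : State d}
    (h : IsRiemannState γ n UL UR V) (hL : IsPhysical γ UL) (hR : IsPhysical γ UR) :
    ∃ W s G, IsRiemannProfile γ n UL UR W s G ∧ flux γ n V = G 0 := by
  obtain ⟨W, hW, hlim⟩ := h
  obtain ⟨s, G, hG⟩ := hW.exists_profile
  refine ⟨W, s, G, hG, ?_⟩
  rcases hlim with hlim | hlim
  · exact hG.flux_eq_of_tendsto_right hγ hn hR hlim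
  · have h1 : Tendsto (fun ξ => W (-ξ)) (𝓝[>] 0) (𝓝 V) := by
      refine hlim.comp (tendsto_nhdsWithin_iff.2 ⟨?_, ?_⟩)
      · have : Tendsto (fun x : ℝ => -x) (𝓝[>] 0) (𝓝 (-0)) :=
          (continuous_neg.tendsto 0).mono_left nhdsWithin_le_nhds
        rwa [neg_zero] at this
      · filter_upwards [self_mem_nhdsWithin] with x hx
        simpa using hx
    have h2 := hG.reflect.flux_eq_of_tendsto_right hγ (by rwa [norm_neg]) hL h1
    rw [flux_neg, neg_zero] at h2
    exact neg_injective h2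

/-- At a wall the exact Riemann solution between a state and its mirror image satisfies the
impermeability condition. -/
theorem IsRiemannProfile.fst_eq_zero_of_mirror (hγ : 1 < γ) (hn : ‖n‖ = 1) {U : State d}
    {W : ℝ → State d} {s : ℝ} {G : ℝ → State d} (h : IsRiemannProfile γ n U (mirror n U) W s G)
    (hU : IsPhysical γ U) : (G 0).1 = 0 := by
  have hU' := hU.mirror (n := n) hn
  obtain ⟨a, b, hab, h1, h2, h3⟩ := h.exists_contact hU.1 hU'.1
  obtain ⟨j, P, B, ρ, v, p, hf, hP⟩ := h.isHalfFan hγ hn hU h1 (h2 a (left_mem_Icc.2 hab))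
  obtain ⟨j', P', B', ρ', v', p', hf', hP'⟩ := h.reflect.isHalfFan hγ (by rwa [norm_neg]) hU'
    (a := -b) (fun ξ hξ => by
      have := h3 (-ξ) (by linarith)
      simpa using this) (by simpa using h2 b (right_mem_Icc.2 hab))
  have ha := hf.eq_contactSpeed hγ
  have hb := hf'.eq_contactSpeed hγ
  have e1 : P' (-b) = P a := by
    rw [hP, hP', neg_neg, h.eq_of_fst_eq_zero hU.1 hU'.1 hab h2]
    simp [inner_neg_left, inner_neg_right]
  have e2 : inner ℝ (velocity (mirror n U)) (-n) = inner ℝ (velocity U) n := by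
    rw [velocity, velocity, inner_smul_left, inner_smul_left, inner_neg_right, inner_mirror hn,
      neg_neg]
    rfl
  have e3 : (mirror n U).1 = U.1 := rfl
  rw [e1, e2, e3, pressure_mirror hn, ← ha] at hb
  exact h2 0 ⟨by linarith, by linarith⟩

theorem flux_eq_of_fst_eq_zero {V : State d} (h : (flux γ n V).1 = 0) :
    flux γ n V = (0, pressure γ V • n, 0) := by
  have h1 : inner ℝ V.2.1 n = 0 := h
  rw [flux, h1]
  simp

variable {d : ℕ} {γ : ℝ}

/-! ### Numerical fluxes across a face -/

/-- The properties of a numerical flux `g` across a face with outer normal `n` of a cell with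
value `U`: `Q` is a numerical entropy flux, `D` the entropy production, `k` the specific entropy on
the other side. -/
structure IsFaceFlux (γ : ℝ) (n : Space d) (U : State d) (k : ℝ) (g : State d) (Q D : ℝ) :
    Prop where
  nonneg : 0 ≤ D
  balance : pairing γ U (g - flux γ n U) = temperature γ U * (Q - entropyFlux γ n U - D)
  norm_sub_le : ∀ A, 1 ≤ A → StateBdd γ A U → ∀ ε, 0 < ε →
    ‖g - flux γ n U‖ ≤ dissipationConst γ A * (ε + (1 + 1 / ε) * (2 * A * D))
  min_entropy : specEntropy γ U ≤ k → pairing γ U (g - flux γ n U)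
    ≤ temperature γ U / (γ - 1) * specEntropy γ U * (g - flux γ n U).1

theorem dissipationConst_nonneg {A : ℝ} (hγ : 1 < γ) (hA : 1 ≤ A) :
    0 ≤ dissipationConst γ A := by
  have : 0 < γ - 1 := by linarith
  unfold dissipationConst
  positivity

namespace IsRiemannProfile

variable {n : Space d} {UL UR : State d} {W : ℝ → State d} {s : ℝ} {G : ℝ → State d}

/-- The entropy flux across the interface, computed from the left. -/
noncomputable def entropyFluxLeft (γ : ℝ) (n : Space d) (UL : State d) (W : ℝ → State d) (s : ℝ) :
    ℝ :=
  entropyFlux γ n UL + s * entropy γ UL - ∫ ξ in (-s)..0, entropy γ (W ξ)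

theorem integral_relEnergy_nonneg (hγ : 1 < γ) (h : IsRiemannProfile γ n UL UR W s G)
    (hU : IsPhysical γ UL) : 0 ≤ ∫ ξ in (-s)..0, relEnergy γ (W ξ) UL :=
  intervalIntegral.integral_nonneg_of_forall (by linarith [h.pos])
    fun ξ => relEnergy_nonneg hγ (h.physical ξ) hU

theorem min_entropy_left (hγ : 1 < γ) (h : IsRiemannProfile γ n UL UR W s G)
    (hL : IsPhysical γ UL) (hR : IsPhysical γ UR) (hk : specEntropy γ UL ≤ specEntropy γ UR) :
    pairing γ UL (G 0 - flux γ n UL)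
      ≤ temperature γ UL / (γ - 1) * specEntropy γ UL * (G 0 - flux γ n UL).1 := by
  have hθ := temperature_pos hL
  have hγ1 : 0 < γ - 1 := by linarith
  have h1 := h.integral_relEnergy_left hγ hL
  have h2 := h.integral_relEnergy_nonneg hγ hL
  have h3 : (G 0 - flux γ n UL).1 = s * UL.1 - ∫ ξ in (-s)..0, (W ξ).1 := by
    have e1 : (G 0).1 - (G (-s)).1 = ∫ ξ in (-s)..0, -(W ξ).1 := h.isPrimitive_fst.sub_eq (-s) 0
    rw [intervalIntegral.integral_neg, h.eq_left (-s) le_rfl] at e1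
    simp only [Prod.fst_sub, Prod.smul_fst, smul_eq_mul] at e1 ⊢
    linarith
  have h4 : specEntropy γ UL / (γ - 1) * ∫ ξ in (-s)..0, (W ξ).1 ≤
      ∫ ξ in (-s)..0, entropy γ (W ξ) := by
    rw [← intervalIntegral.integral_const_mul]
    refine intervalIntegral.integral_mono_ae_restrict (by linarith [h.pos])
      ((h.integrable_fst _ _).const_mul _) (h.integrable_entropy _ _) (ae_restrict_of_ae ?_)
    filter_upwards [h.ae_min_specEntropy_le hγ hL.1 hR.1] with ξ hξ
    rcases hξ with hξ | hξ
    · rw [hξ]; simp [entropy_zero]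
    · rw [min_eq_left hk] at hξ
      rw [entropy_eq]
      have := density_nonneg (h.physical ξ)
      calc _ = 1 / (γ - 1) * (W ξ).1 * specEntropy γ UL := by ring
        _ ≤ _ := by gcongr
  rw [h3]
  have h5 : entropy γ UL = 1 / (γ - 1) * UL.1 * specEntropy γ UL := entropy_eq UL
  have h6 := mul_le_mul_of_nonneg_left h4 hθ.le
  rw [h5] at h1
  have e : temperature γ UL / (γ - 1) * specEntropy γ UL *
      (s * UL.1 - ∫ ξ in (-s)..0, (W ξ).1) = temperature γ UL *
        (s * (1 / (γ - 1) * UL.1 * specEntropy γ UL)) - temperature γ UL *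
        (specEntropy γ UL / (γ - 1) * ∫ ξ in (-s)..0, (W ξ).1) := by ring
  rw [e]
  linarith

theorem isFaceFlux (hγ : 1 < γ) (hγ2 : γ ≤ 2) (hn : ‖n‖ = 1)
    (h : IsRiemannProfile γ n UL UR W s G) (hL : IsPhysical γ UL) (hR : IsPhysical γ UR) :
    IsFaceFlux γ n UL (specEntropy γ UR) (G 0) (entropyFluxLeft γ n UL W s)
      ((∫ ξ in (-s)..0, relEnergy γ (W ξ) UL) / temperature γ UL) := by
  have hθ := temperature_pos hL
  have h2 := h.integral_relEnergy_nonneg hγ hL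
  refine ⟨by positivity, ?_, fun A hA hU ε hε => ?_, h.min_entropy_left hγ hL hR⟩
  · rw [h.integral_relEnergy_left hγ hL, entropyFluxLeft]
    field_simp
    ring
  · refine (h.norm_sub_flux_le hγ hγ2 hA hn hU hε).trans ?_
    have h3 := dissipationConst_nonneg hγ hA
    have h4 : (∫ ξ in (-s)..0, relEnergy γ (W ξ) UL) ≤
        2 * A * ((∫ ξ in (-s)..0, relEnergy γ (W ξ) UL) / temperature γ UL) := by
      have h5 := hU.temperature_le
      rw [mul_div_assoc', le_div_iff₀ hθ]
      nlinarith
    gcongr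

theorem entropyFluxLeft_add_le (h : IsRiemannProfile γ n UL UR W s G) :
    entropyFluxLeft γ n UL W s + entropyFluxLeft γ (-n) UR (fun ξ => W (-ξ)) s ≤ 0 := by
  obtain ⟨t, ht, hle⟩ := h.entropy_le
  obtain ⟨a, hat, -, ha⟩ := exists_lt_mem_of_ae ht (show -s - 1 < -s by linarith)
  obtain ⟨b, hbt, hb, -⟩ := exists_lt_mem_of_ae ht (show s < s + 1 by linarith)
  have hs := h.pos
  have h1 := hle a hat b hbt (by linarith)
  rw [h.left a ha.le, h.right b hb.le] at h1
  have i := h.integrable_entropy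
  have e1 : ∫ ξ in a..(-s), entropy γ (W ξ) = (-s - a) * entropy γ UL := by
    rw [intervalIntegral.integral_congr (g := fun _ => entropy γ UL) fun ξ hξ => ?_]
    · simp
    · rw [uIcc_of_le ha.le] at hξ
      simp only [h.left ξ hξ.2]
  have e2 : ∫ ξ in s..b, entropy γ (W ξ) = (b - s) * entropy γ UR := by
    rw [intervalIntegral.integral_congr (g := fun _ => entropy γ UR) fun ξ hξ => ?_]
    · simp
    · rw [uIcc_of_le hb.le] at hξ
      simp only [h.right ξ hξ.1]
  rw [← intervalIntegral.integral_add_adjacent_intervals (i a (-s)) (i (-s) b),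
    ← intervalIntegral.integral_add_adjacent_intervals (i (-s) 0) (i 0 b),
    ← intervalIntegral.integral_add_adjacent_intervals (i 0 s) (i s b), e1, e2] at h1
  have e3 : ∫ ξ in (-s)..0, entropy γ (W (-ξ)) = ∫ ξ in (0:ℝ)..s, entropy γ (W ξ) := by
    rw [intervalIntegral.integral_comp_neg fun ξ => entropy γ (W ξ)]; simp
  rw [entropyFluxLeft, entropyFluxLeft, entropyFlux_neg, e3]
  linarith

end IsRiemannProfile

theorem IsRiemannState.exists_isFaceFlux (hγ : 1 < γ) (hγ2 : γ ≤ 2) {n : Space d} (hn : ‖n‖ = 1)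
    {UL UR V : State d} (h : IsRiemannState γ n UL UR V) (hL : IsPhysical γ UL)
    (hR : IsPhysical γ UR) :
    ∃ Q D Q' D', IsFaceFlux γ n UL (specEntropy γ UR) (flux γ n V) Q D ∧
      IsFaceFlux γ (-n) UR (specEntropy γ UL) (-flux γ n V) Q' D' ∧ Q + Q' ≤ 0 := by
  obtain ⟨W, s, G, hG, hV⟩ := h.exists_profile hγ hn hL hR
  have h2 := hG.reflect.isFaceFlux hγ hγ2 (by rwa [norm_neg]) hR hL
  rw [neg_zero, ← hV] at h2
  have h1 := hG.isFaceFlux hγ hγ2 hn hL hR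
  rw [← hV] at h1
  exact ⟨_, _, _, _, h1, h2, hG.entropyFluxLeft_add_le⟩

theorem velocity_mirror (n : Space d) (U : State d) :
    velocity (mirror n U) = velocity U - (2 * inner ℝ (velocity U) n) • n := by
  simp only [velocity, mirror, smul_sub, inner_smul_left, smul_smul]
  congr 2
  simp
  ring

theorem temperature_mirror {n : Space d} (hn : ‖n‖ = 1) (U : State d) :
    temperature γ (mirror n U) = temperature γ U := by
  rw [temperature, pressure_mirror hn]; rfl

theorem specEntropy_mirror {n : Space d} (hn : ‖n‖ = 1) (U : State d) :
    specEntropy γ (mirror n U) = specEntropy γ U := by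
  rw [specEntropy, pressure_mirror hn]; rfl

theorem entropyFlux_mirror {n : Space d} (hn : ‖n‖ = 1) (U : State d) :
    entropyFlux γ (-n) (mirror n U) = entropyFlux γ n U := by
  rw [entropyFlux, entropyFlux, inner_neg_right, inner_mirror hn, neg_neg, entropy_eq, entropy_eq,
    specEntropy_mirror hn]
  rfl

theorem flux_mirror {n : Space d} (hn : ‖n‖ = 1) (U : State d) :
    flux γ (-n) (mirror n U) = mirror n (flux γ n U) := by
  have hnn := inner_self_eq_one_of_norm_eq_one (𝕜 := ℝ) hn
  have h1 : (mirror n U).1 = U.1 := rfl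
  have h2 : (mirror n U).2.2 = U.2.2 := rfl
  rw [flux, inner_neg_right, inner_mirror hn, neg_neg, pressure_mirror hn, h1, h2]
  refine Prod.ext rfl (Prod.ext ?_ rfl)
  simp only [mirror, flux, inner_add_left, inner_smul_left, hnn]
  simp only [RCLike.conj_to_real]
  module

theorem mirror_sub (n : Space d) (U V : State d) : mirror n (U - V) = mirror n U - mirror n V := by
  refine Prod.ext rfl (Prod.ext ?_ rfl)
  simp only [mirror, Prod.snd_sub, Prod.fst_sub, inner_sub_left]
  module

theorem pairing_mirror {n : Space d} (hn : ‖n‖ = 1) (U W : State d) :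
    pairing γ (mirror n U) (mirror n W) = pairing γ U W := by
  have hnn := inner_self_eq_one_of_norm_eq_one (𝕜 := ℝ) hn
  have h0 : densityCoeff γ (mirror n U) = densityCoeff γ U := by
    have : ‖velocity (mirror n U)‖ = ‖velocity U‖ := by
      rw [velocity, velocity, norm_smul, norm_smul, norm_mirror hn]; rfl
    simp only [densityCoeff, this, temperature_mirror hn, specEntropy_mirror hn]
  have h1 : inner ℝ (velocity (mirror n U)) (mirror n W).2.1 = inner ℝ (velocity U) W.2.1 := by
    rw [velocity_mirror]
    simp only [mirror, inner_sub_left, inner_sub_right, inner_smul_left, inner_smul_right, hnn,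
      RCLike.conj_to_real]
    rw [real_inner_comm W.2.1 n]
    ring
  rw [pairing_apply, pairing_apply, h0, h1]
  rfl

theorem IsRiemannState.exists_isFaceFlux_wall (hγ : 1 < γ) (hγ2 : γ ≤ 2) {n : Space d}
    (hn : ‖n‖ = 1) {U V : State d} (h : IsRiemannState γ n U (mirror n U) V)
    (hU : IsPhysical γ U) :
    ∃ Q D, IsFaceFlux γ n U (specEntropy γ U) (flux γ n V) Q D ∧ Q ≤ 0 ∧
      flux γ n V = (0, pressure γ V • n, 0) := by
  have hU' := hU.mirror (n := n) hn
  obtain ⟨W, s, G, hG, hV⟩ := h.exists_profile hγ hn hU hU'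
  have h0 := hG.fst_eq_zero_of_mirror hγ hn hU
  have hfl := flux_eq_of_fst_eq_zero (γ := γ) (n := n) (V := V) (by rw [hV, h0])
  have h1 := hG.isFaceFlux hγ hγ2 hn hU hU'
  have h2 := hG.reflect.isFaceFlux hγ hγ2 (by rwa [norm_neg]) hU' hU
  have hQ := hG.entropyFluxLeft_add_le
  simp only [neg_zero] at h2
  rw [← hV] at h1 h2
  rw [specEntropy_mirror hn] at h1
  set Q := IsRiemannProfile.entropyFluxLeft γ n U W s
  set Q' := IsRiemannProfile.entropyFluxLeft γ (-n) (mirror n U) (fun ξ => W (-ξ)) s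
  obtain ⟨D, hD⟩ : ∃ D, (∫ ξ in (-s)..0, relEnergy γ (W ξ) U) / temperature γ U = D := ⟨_, rfl⟩
  obtain ⟨D', hD'⟩ : ∃ D', (∫ ξ in (-s)..0, relEnergy γ (W (-ξ)) (mirror n U)) /
    temperature γ (mirror n U) = D' := ⟨_, rfl⟩
  rw [hD] at h1
  rw [hD'] at h2
  have hm : -flux γ n V = mirror n (flux γ n V) := by
    have hnn := inner_self_eq_one_of_norm_eq_one (𝕜 := ℝ) hn
    rw [hfl]
    refine Prod.ext (by simp [mirror]) (Prod.ext ?_ (by simp [mirror]))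
    simp only [mirror, inner_smul_left, hnn, Prod.snd_neg, Prod.fst_neg, RCLike.conj_to_real]
    module
  have hb := h2.balance
  rw [hm, flux_mirror hn, ← mirror_sub, pairing_mirror hn, temperature_mirror hn,
    entropyFlux_mirror hn] at hb
  have hb1 := h1.balance
  have hθ := temperature_pos hU
  have hn1 := h1.nonneg
  have hn2 := h2.nonneg
  refine ⟨(Q + Q') / 2, (D + D') / 2, ⟨by linarith, by linarith, fun A hA hbd ε hε => ?_,
    h1.min_entropy⟩, by linarith, hfl⟩
  have h3 := hG.norm_sub_flux_le hγ hγ2 hA hn hbd hε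
  rw [hV]
  refine h3.trans ?_
  have h4 := dissipationConst_nonneg hγ hA
  have h5 : (∫ ξ in (-s)..0, relEnergy γ (W ξ) U) ≤ 2 * A * ((D + D') / 2) := by
    rw [div_eq_iff hθ.ne'] at hD
    rw [hD]
    have := hbd.temperature_le
    nlinarith [mul_nonneg hn1 (sub_nonneg.2 this), mul_nonneg hn2 (show 0 ≤ A by linarith)]
  gcongr

variable {d : ℕ}

/-! ### Boxes as images of the unit cube -/

/-- The uniform probability measure on the unit cube. -/
noncomputable def cubeMeasure (d : ℕ) : Measure (Fin d → ℝ) :=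
  Measure.pi fun _ => volume.restrict (Ioo (0 : ℝ) 1)

instance : IsProbabilityMeasure (volume.restrict (Ioo (0 : ℝ) 1)) := ⟨by simp⟩

instance : IsProbabilityMeasure (cubeMeasure d) := by
  unfold cubeMeasure; infer_instance

/-- The affine map of the unit cube onto the box with corners `lo` and `hi`. -/
noncomputable def boxMap (lo hi : Space d) (y : Fin d → ℝ) : Space d :=
  WithLp.toLp 2 fun i => lo i + y i * (hi i - lo i)

@[simp] theorem boxMap_apply (lo hi : Space d) (y : Fin d → ℝ) (i : Fin d) :
    boxMap lo hi y i = lo i + y i * (hi i - lo i) := rfl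

theorem ae_cubeMeasure {p : Fin d → ℝ → Prop} (h : ∀ i, ∀ᵐ t ∂(volume.restrict (Ioo (0 : ℝ) 1)),
    p i t) : ∀ᵐ y ∂(cubeMeasure d), ∀ i, p i (y i) :=
  ae_all_iff.2 fun i => Measure.tendsto_eval_ae_ae.eventually (h i)

theorem ae_mem_cube : ∀ᵐ y ∂(cubeMeasure d), ∀ i, y i ∈ Ioo (0 : ℝ) 1 :=
  ae_cubeMeasure fun _ => ae_restrict_mem measurableSet_Ioo

theorem continuous_boxMap (lo hi : Space d) : Continuous (boxMap lo hi) :=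
  (PiLp.continuous_toLp 2 _).comp (by fun_prop)

theorem integrable_cube_of_continuous {f : (Fin d → ℝ) → ℝ} (hf : Continuous f) :
    Integrable f (cubeMeasure d) := by
  obtain ⟨B, hB⟩ := (isCompact_univ_pi fun _ : Fin d => isCompact_Icc (a := (0 : ℝ))
    (b := 1)).exists_bound_of_continuousOn hf.continuousOn
  refine Integrable.of_bound (C := B) hf.aestronglyMeasurable ?_
  filter_upwards [ae_mem_cube] with y hy using hB _ fun j _ => Ioo_subset_Icc_self (hy j)

theorem ofReal_mul_restrict_preimage {a b : ℝ} (hab : a < b) (s : Set ℝ) (hs : MeasurableSet s) :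
    ENNReal.ofReal (b - a) * (volume.restrict (Ioo (0 : ℝ) 1)) ((fun t => a + t * (b - a)) ⁻¹' s) =
      volume.restrict (Ioo a b) s := by
  have hba : 0 < b - a := sub_pos.2 hab
  have hm : Measurable fun t : ℝ => a + t * (b - a) := by fun_prop
  rw [Measure.restrict_apply (hm hs), Measure.restrict_apply hs]
  have e : (fun t => a + t * (b - a)) ⁻¹' s ∩ Ioo 0 1 =
      (fun t => t * (b - a)) ⁻¹' ((fun t => a + t) ⁻¹' (s ∩ Ioo a b)) := by
    ext t
    simp only [mem_inter_iff, mem_preimage, mem_Ioo]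
    refine and_congr_right fun _ => ⟨fun h => ⟨?_, ?_⟩, fun h => ⟨?_, ?_⟩⟩
    · nlinarith [h.1]
    · nlinarith [h.2]
    · by_contra hc; nlinarith [h.1]
    · by_contra hc; nlinarith [h.2]
  rw [e, Real.volume_preimage_mul_right hba.ne', measure_preimage_add, abs_of_pos (by positivity),
    ← mul_assoc, ← ENNReal.ofReal_mul hba.le, mul_inv_cancel₀ hba.ne', ENNReal.ofReal_one, one_mul]

theorem restrict_box_eq {lo hi : Space d} (h : ∀ i, lo i < hi i) :
    volume.restrict {x : Space d | ∀ i, x i ∈ Ioo (lo i) (hi i)} =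
      ENNReal.ofReal (∏ i, (hi i - lo i)) • (cubeMeasure d).map (boxMap lo hi) := by
  have h1 : (Measure.pi fun i => volume.restrict (Ioo (lo i) (hi i))) =
      ENNReal.ofReal (∏ i, (hi i - lo i)) •
        (cubeMeasure d).map (fun y i => lo i + y i * (hi i - lo i)) := by
    refine Measure.pi_eq fun s hs => ?_
    rw [Measure.smul_apply, Measure.map_apply (by fun_prop) (MeasurableSet.univ_pi hs)]
    have e : (fun (y : Fin d → ℝ) i => lo i + y i * (hi i - lo i)) ⁻¹' (univ.pi s) =
        univ.pi fun i => (fun t => lo i + t * (hi i - lo i)) ⁻¹' (s i) := by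
      ext y; simp [Set.mem_pi]
    rw [e, cubeMeasure, Measure.pi_pi, smul_eq_mul,
      ENNReal.ofReal_prod_of_nonneg fun i _ => (sub_pos.2 (h i)).le, ← Finset.prod_mul_distrib]
    exact Finset.prod_congr rfl fun i _ => ofReal_mul_restrict_preimage (h i) _ (hs i)
  have h2 : volume.restrict {x : Space d | ∀ i, x i ∈ Ioo (lo i) (hi i)} =
      (volume.restrict (univ.pi fun i => Ioo (lo i) (hi i))).map (WithLp.toLp 2) := by
    have hmp := PiLp.volume_preserving_toLp (Fin d)
    rw [← hmp.map_eq, Measure.restrict_map hmp.measurable ?_]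
    · congr 2
      ext y; simp [Set.mem_pi]
    · have : {x : Space d | ∀ i, x i ∈ Ioo (lo i) (hi i)} = ⋂ i, {x | x i ∈ Ioo (lo i) (hi i)} := by
        ext; simp
      rw [this]
      exact MeasurableSet.iInter fun i => measurableSet_Ioo.preimage
        (by fun_prop : Measurable fun x : Space d => x i)
  rw [h2, volume_pi, Measure.restrict_pi_pi, h1, Measure.map_smul,
    Measure.map_map (PiLp.continuous_toLp 2 _).measurable (by fun_prop)]
  rfl

theorem boxMap_measurableEmbedding {lo hi : Space d} (h : ∀ i, lo i < hi i) :
    MeasurableEmbedding (boxMap lo hi) := by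
  refine (continuous_boxMap lo hi).measurableEmbedding fun y z hyz => ?_
  funext i
  have h1 := congrArg (fun x : Space d => x i) hyz
  simp only [boxMap_apply] at h1
  have h2 := sub_pos.2 (h i)
  exact mul_right_cancel₀ h2.ne' (by linarith)

theorem setIntegral_box {E : Type*} [NormedAddCommGroup E] [NormedSpace ℝ E] {lo hi : Space d}
    (h : ∀ i, lo i < hi i) (f : Space d → E) :
    ∫ x in {x : Space d | ∀ i, x i ∈ Ioo (lo i) (hi i)}, f x =
      (∏ i, (hi i - lo i)) • ∫ y, f (boxMap lo hi y) ∂(cubeMeasure d) := by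
  rw [restrict_box_eq h, integral_smul_measure, (boxMap_measurableEmbedding h).integral_map,
    ENNReal.toReal_ofReal (Finset.prod_nonneg fun i _ => (sub_pos.2 (h i)).le)]

theorem ae_boxMap {lo hi : Space d} (h : ∀ i, lo i < hi i) {p : Space d → Prop}
    (hp : ∀ᵐ x ∂(volume.restrict {x : Space d | ∀ i, x i ∈ Ioo (lo i) (hi i)}), p x) :
    ∀ᵐ y ∂(cubeMeasure d), p (boxMap lo hi y) := by
  rw [restrict_box_eq h] at hp
  have h0 : ENNReal.ofReal (∏ i, (hi i - lo i)) ≠ 0 := by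
    rw [Ne, ENNReal.ofReal_eq_zero, not_le]
    exact Finset.prod_pos fun i _ => sub_pos.2 (h i)
  rw [Measure.ae_ennreal_smul_measure_iff h0] at hp
  exact ae_of_ae_map (continuous_boxMap lo hi).measurable.aemeasurable hp

theorem measurePreserving_update (i : Fin d) :
    MeasurePreserving (fun p : (Fin d → ℝ) × ℝ => Function.update p.1 i p.2)
      ((cubeMeasure d).prod (volume.restrict (Ioo (0 : ℝ) 1))) (cubeMeasure d) := by
  have hm : Measurable fun p : (Fin d → ℝ) × ℝ => Function.update p.1 i p.2 := by
    refine measurable_pi_iff.2 fun j => ?_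
    by_cases hj : j = i
    · subst hj; simpa using measurable_snd
    · simp only [Function.update_of_ne hj]; fun_prop
  refine ⟨hm, ?_⟩
  refine (Measure.pi_eq fun s hs => ?_).symm
  rw [Measure.map_apply hm (MeasurableSet.univ_pi hs)]
  have e : (fun p : (Fin d → ℝ) × ℝ => Function.update p.1 i p.2) ⁻¹' (univ.pi s) =
      (univ.pi (Function.update s i univ)) ×ˢ (s i) := by
    ext ⟨y, t⟩
    simp only [mem_preimage, Set.mem_pi, mem_univ, forall_true_left, mem_prod]
    constructor
    · refine fun h => ⟨fun j => ?_, by simpa using h i⟩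
      by_cases hj : j = i
      · subst hj; simp
      · simpa [Function.update_of_ne hj] using h j
    · rintro ⟨h1, h2⟩ j
      by_cases hj : j = i
      · subst hj; simpa using h2
      · simpa [Function.update_of_ne hj] using h1 j
  rw [e, Measure.prod_prod, cubeMeasure, Measure.pi_pi, ← Finset.mul_prod_erase _ _ (Finset.mem_univ i),
    ← Finset.mul_prod_erase (a := i) _ (fun j => (volume.restrict (Ioo (0 : ℝ) 1)) (s j))
      (Finset.mem_univ i), Function.update_self, measure_univ, one_mul, mul_comm]
  congr 1
  exact Finset.prod_congr rfl fun j hj => by rw [Function.update_of_ne (Finset.ne_of_mem_erase hj)]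

theorem update_mem_cube {y : Fin d → ℝ} (hy : ∀ j, y j ∈ Ioo (0 : ℝ) 1) (i : Fin d) {t : ℝ}
    (ht : t ∈ Icc (0 : ℝ) 1) : ∀ j, Function.update y i t j ∈ Icc (0 : ℝ) 1 := fun j => by
  by_cases hj : j = i
  · subst hj; simpa using ht
  · simpa [Function.update_of_ne hj] using Ioo_subset_Icc_self (hy j)

theorem boxMap_mem_Icc {lo hi : Space d} (h : ∀ i, lo i < hi i) {y : Fin d → ℝ}
    (hy : ∀ j, y j ∈ Icc (0 : ℝ) 1) (j : Fin d) :
    boxMap lo hi y j ∈ Icc (lo j) (hi j) := by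
  have h1 := h j
  obtain ⟨h2, h3⟩ := hy j
  simp only [boxMap_apply, mem_Icc]
  constructor <;> nlinarith

theorem boxMap_mem_Ioo {lo hi : Space d} (h : ∀ i, lo i < hi i) {y : Fin d → ℝ} {j : Fin d}
    (hy : y j ∈ Ioo (0 : ℝ) 1) : boxMap lo hi y j ∈ Ioo (lo j) (hi j) := by
  have h1 := h j
  obtain ⟨h2, h3⟩ := hy
  simp only [boxMap_apply, mem_Ioo]
  constructor <;> nlinarith

theorem boxMap_update (lo hi : Space d) (y : Fin d → ℝ) (i : Fin d) (t : ℝ) :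
    boxMap lo hi (Function.update y i t) =
      boxMap lo hi y + ((t - y i) * (hi i - lo i)) • unitVec i := by
  ext j
  by_cases hj : j = i
  · subst hj; simp [unitVec]; ring
  · simp [unitVec, hj]

theorem norm_unitVec (i : Fin d) : ‖(unitVec i : Space d)‖ = 1 := by simp [unitVec]

/-- The mean value of a Lipschitz function on the two faces orthogonal to `i`. -/
theorem integral_face_sub {lo hi : Space d} (h : ∀ i, lo i < hi i) {g : Space d → ℝ} {C : ℝ≥0}
    (hg : LipschitzWith C g) (i : Fin d) :
    ∫ y, g (boxMap lo hi (Function.update y i 1)) ∂(cubeMeasure d) -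
      ∫ y, g (boxMap lo hi (Function.update y i 0)) ∂(cubeMeasure d) =
    (hi i - lo i) * ∫ y, lineDeriv ℝ g (boxMap lo hi y) (unitVec i) ∂(cubeMeasure d) := by
  have hmp := measurePreserving_update i
  have hcont : ∀ t, Continuous fun y : Fin d → ℝ => g (boxMap lo hi (Function.update y i t)) :=
    fun t => hg.continuous.comp ((continuous_boxMap lo hi).comp (by fun_prop))
  have hD : ∀ᵐ y ∂(cubeMeasure d), LineDifferentiableAt ℝ g (boxMap lo hi y) (unitVec i) :=
    ae_boxMap h (ae_restrict_of_ae (hg.ae_lineDifferentiableAt _))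
  have hmeas : Measurable fun y => lineDeriv ℝ g (boxMap lo hi y) (unitVec i) :=
    (measurable_lineDeriv hg.continuous).comp (continuous_boxMap lo hi).measurable
  have hint : Integrable (fun y => lineDeriv ℝ g (boxMap lo hi y) (unitVec i)) (cubeMeasure d) :=
    Integrable.of_bound (C := C) hmeas.aestronglyMeasurable (Eventually.of_forall fun y => by
      have := norm_lineDeriv_le_of_lipschitz ℝ (x₀ := boxMap lo hi y) (v := unitVec i) hg
      rwa [norm_unitVec, mul_one] at this)
  -- along lines
  have hline : ∀ᵐ y ∂(cubeMeasure d), g (boxMap lo hi (Function.update y i 1)) -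
      g (boxMap lo hi (Function.update y i 0)) = (hi i - lo i) *
        ∫ t in Ioo (0 : ℝ) 1, lineDeriv ℝ g (boxMap lo hi (Function.update y i t)) (unitVec i) := by
    have h1 := Measure.ae_ae_of_ae_prod (hmp.quasiMeasurePreserving.ae hD)
    filter_upwards [h1] with y hy
    have hL : LipschitzWith (C * Real.toNNReal (hi i - lo i))
        fun t : ℝ => g (boxMap lo hi (Function.update y i t)) := by
      refine LipschitzWith.of_dist_le_mul fun t t' => ?_
      refine (hg.dist_le_mul _ _).trans ?_
      rw [boxMap_update, boxMap_update, dist_add_left, dist_eq_norm, ← sub_smul, norm_smul,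
        norm_unitVec, mul_one, NNReal.coe_mul, mul_assoc]
      gcongr
      rw [← sub_mul, sub_sub_sub_cancel_right, norm_mul, Real.norm_of_nonneg (sub_pos.2 (h i)).le,
        Real.dist_eq, Real.norm_eq_abs, mul_comm, Real.coe_toNNReal _ (sub_pos.2 (h i)).le]
    have hac := (hL.lipschitzOnWith (s := uIcc 0 1)).absolutelyContinuousOnInterval
    rw [← hac.integral_deriv_eq_sub, intervalIntegral.integral_of_le zero_le_one,
      integral_Ioc_eq_integral_Ioo, ← integral_const_mul]
    refine integral_congr_ae ?_
    filter_upwards [hy] with t ht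
    have h2 := ht.hasLineDerivAt
    rw [HasLineDerivAt] at h2
    have h3 : HasDerivAt (fun τ : ℝ => (τ - t) * (hi i - lo i)) (hi i - lo i) t := by
      simpa using ((hasDerivAt_id t).sub_const t).mul_const (hi i - lo i)
    have h2' : HasDerivAt (fun r : ℝ => g (boxMap lo hi (Function.update y i t) + r • unitVec i))
        (lineDeriv ℝ g (boxMap lo hi (Function.update y i t)) (unitVec i))
        ((t - t) * (hi i - lo i)) := by simpa using h2
    have h4 := h2'.comp t h3
    have e : ((fun r : ℝ => g (boxMap lo hi (Function.update y i t) + r • unitVec i)) ∘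
        fun τ : ℝ => (τ - t) * (hi i - lo i)) =
        fun τ => g (boxMap lo hi (Function.update y i τ)) := by
      funext τ
      simp only [Function.comp]
      rw [boxMap_update, boxMap_update, add_assoc, ← add_smul]
      congr 3
      ring
    rw [e] at h4
    rw [h4.deriv, mul_comm]
  rw [← integral_sub (integrable_cube_of_continuous (hcont 1))
    (integrable_cube_of_continuous (hcont 0)), integral_congr_ae hline,
    integral_const_mul]
  congr 1
  have hint2 := (hmp.integrable_comp hmeas.aestronglyMeasurable).2 hint
  rw [← integral_prod (fun p : (Fin d → ℝ) × ℝ => lineDeriv ℝ g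
    (boxMap lo hi (Function.update p.1 i p.2)) (unitVec i)) hint2]
  have := integral_map (μ := (cubeMeasure d).prod (volume.restrict (Ioo (0 : ℝ) 1)))
    hmp.measurable.aemeasurable
    (f := fun y => lineDeriv ℝ g (boxMap lo hi y) (unitVec i))
    (by rw [hmp.map_eq]; exact hmeas.aestronglyMeasurable)
  rw [hmp.map_eq] at this
  exact this.symm

/-! ### Geometry of rectangular meshes -/

namespace RectMesh

variable {d : ℕ} {Ω : Set (Space d)} (𝒯 : RectMesh d Ω)

/-- The affine map of the unit cube onto the cell `K`. -/
noncomputable def map (K : Fin 𝒯.N) (y : Fin d → ℝ) : Space d := boxMap (𝒯.lo K) (𝒯.hi K) y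

/-- The projection of `map K y` to a face of `K`. -/
noncomputable def facePoint (K : Fin 𝒯.N) (i : Fin d) (s : Bool) (y : Fin d → ℝ) : Space d :=
  𝒯.map K (Function.update y i (if s then 1 else 0))

/-- The mean value over a cell. -/
noncomputable def cellMean (K : Fin 𝒯.N) (f : Space d → ℝ) : ℝ :=
  ∫ y, f (𝒯.map K y) ∂(cubeMeasure d)

/-- The mean value over a face. -/
noncomputable def faceMean (K : Fin 𝒯.N) (i : Fin d) (s : Bool) (f : Space d → ℝ) : ℝ :=
  ∫ y, f (𝒯.facePoint K i s y) ∂(cubeMeasure d)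

/-- The closed cell. -/
def closedCell (K : Fin 𝒯.N) : Set (Space d) := {x | ∀ i, x i ∈ Icc (𝒯.lo K i) (𝒯.hi K i)}

theorem continuous_coord (i : Fin d) : Continuous fun x : Space d => x i := by fun_prop

theorem isOpen_cell (K : Fin 𝒯.N) : IsOpen (𝒯.cell K) := by
  have : 𝒯.cell K = ⋂ i, {x | x i ∈ Ioo (𝒯.lo K i) (𝒯.hi K i)} := by ext; simp [cell]
  rw [this]
  exact isOpen_iInter_of_finite fun i => isOpen_Ioo.preimage (continuous_coord i)

theorem isClosed_closedCell (K : Fin 𝒯.N) : IsClosed (𝒯.closedCell K) := by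
  have : 𝒯.closedCell K = ⋂ i, {x | x i ∈ Icc (𝒯.lo K i) (𝒯.hi K i)} := by ext; simp [closedCell]
  rw [this]
  exact isClosed_iInter fun i => isClosed_Icc.preimage (continuous_coord i)

theorem cell_subset_closedCell (K : Fin 𝒯.N) : 𝒯.cell K ⊆ 𝒯.closedCell K :=
  fun _ hx i => Ioo_subset_Icc_self (hx i)

theorem closure_eq : closure Ω = ⋃ K, 𝒯.closedCell K := 𝒯.covers

theorem closedCell_subset (K : Fin 𝒯.N) : 𝒯.closedCell K ⊆ closure Ω := by
  rw [𝒯.closure_eq]; exact subset_iUnion _ K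

theorem cell_subset (hΩ : interior (closure Ω) = Ω) (K : Fin 𝒯.N) : 𝒯.cell K ⊆ Ω := by
  have := interior_maximal ((𝒯.cell_subset_closedCell K).trans (𝒯.closedCell_subset K))
    (𝒯.isOpen_cell K)
  exact this.trans hΩ.subset

theorem map_mem_closedCell (K : Fin 𝒯.N) {y : Fin d → ℝ} (hy : ∀ j, y j ∈ Icc (0 : ℝ) 1) :
    𝒯.map K y ∈ 𝒯.closedCell K := fun j => boxMap_mem_Icc (𝒯.lo_lt_hi K) hy j

theorem map_mem_cell (K : Fin 𝒯.N) {y : Fin d → ℝ} (hy : ∀ j, y j ∈ Ioo (0 : ℝ) 1) :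
    𝒯.map K y ∈ 𝒯.cell K := fun j => boxMap_mem_Ioo (𝒯.lo_lt_hi K) (hy j)

theorem facePoint_mem_closedCell (K : Fin 𝒯.N) (i : Fin d) (s : Bool) {y : Fin d → ℝ}
    (hy : ∀ j, y j ∈ Ioo (0 : ℝ) 1) : 𝒯.facePoint K i s y ∈ 𝒯.closedCell K :=
  𝒯.map_mem_closedCell K (update_mem_cube hy i (by cases s <;> simp))

theorem eq_of_mem_cell {K L : Fin 𝒯.N} {x : Space d} (hK : x ∈ 𝒯.cell K) (hL : x ∈ 𝒯.cell L) :
    K = L := by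
  by_contra hne
  exact Set.disjoint_left.1 (𝒯.disjoint K L hne) hK hL

theorem eq_of_overlap {K L : Fin 𝒯.N}
    (h : ∀ j, max (𝒯.lo K j) (𝒯.lo L j) < min (𝒯.hi K j) (𝒯.hi L j)) : K = L := by
  choose c hc using fun j => exists_between (h j)
  have h1 : ∀ j, (WithLp.toLp 2 c : Space d) j = c j := fun j => rfl
  refine 𝒯.eq_of_mem_cell (x := WithLp.toLp 2 c) (fun j => ?_) (fun j => ?_)
  · rw [h1]; exact ⟨(le_max_left _ _).trans_lt (hc j).1, (hc j).2.trans_le (min_le_left _ _)⟩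
  · rw [h1]; exact ⟨(le_max_right _ _).trans_lt (hc j).1, (hc j).2.trans_le (min_le_right _ _)⟩

theorem adj_unique_right {i : Fin d} {K L L' : Fin 𝒯.N} (h : 𝒯.Adj i K L) (h' : 𝒯.Adj i K L') :
    L = L' := by
  refine 𝒯.eq_of_overlap fun j => ?_
  have h1 := 𝒯.lo_lt_hi L j
  have h2 := 𝒯.lo_lt_hi L' j
  by_cases hj : j = i
  · subst hj
    rw [← h.1, ← h'.1] at *
    simp [h1, h2]
  · rw [← (h.2 j hj).1, ← (h.2 j hj).2, ← (h'.2 j hj).1, ← (h'.2 j hj).2]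
    simp [𝒯.lo_lt_hi K j]

theorem adj_unique_left {i : Fin d} {K K' L : Fin 𝒯.N} (h : 𝒯.Adj i K L) (h' : 𝒯.Adj i K' L) :
    K = K' := by
  refine 𝒯.eq_of_overlap fun j => ?_
  have h1 := 𝒯.lo_lt_hi K j
  have h2 := 𝒯.lo_lt_hi K' j
  by_cases hj : j = i
  · subst hj
    rw [h.1, h'.1] at *
    simp [h1, h2]
  · rw [(h.2 j hj).1, (h.2 j hj).2, (h'.2 j hj).1, (h'.2 j hj).2]
    simp [𝒯.lo_lt_hi L j]

theorem facePoint_adj {i : Fin d} {K L : Fin 𝒯.N} (h : 𝒯.Adj i K L) (y : Fin d → ℝ) :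
    𝒯.facePoint K i true y = 𝒯.facePoint L i false y := by
  ext j
  simp only [facePoint, map, boxMap_apply]
  by_cases hj : j = i
  · subst hj; simp [h.1]
  · simp [Function.update_of_ne hj, (h.2 j hj).1, (h.2 j hj).2]

theorem area_adj {i : Fin d} {K L : Fin 𝒯.N} (h : 𝒯.Adj i K L) : 𝒯.area K i = 𝒯.area L i :=
  Finset.prod_congr rfl fun j hj => by
    rw [(h.2 j (Finset.ne_of_mem_erase hj)).1, (h.2 j (Finset.ne_of_mem_erase hj)).2]

theorem vol_eq (K : Fin 𝒯.N) (i : Fin d) : 𝒯.vol K = (𝒯.hi K i - 𝒯.lo K i) * 𝒯.area K i :=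
  (Finset.mul_prod_erase Finset.univ (fun j => 𝒯.hi K j - 𝒯.lo K j) (Finset.mem_univ i)).symm

theorem vol_pos (K : Fin 𝒯.N) : 0 < 𝒯.vol K :=
  Finset.prod_pos fun i _ => sub_pos.2 (𝒯.lo_lt_hi K i)

theorem area_pos (K : Fin 𝒯.N) (i : Fin d) : 0 < 𝒯.area K i :=
  Finset.prod_pos fun i _ => sub_pos.2 (𝒯.lo_lt_hi K i)

theorem setIntegral_cell {E : Type*} [NormedAddCommGroup E] [NormedSpace ℝ E] (K : Fin 𝒯.N)
    (f : Space d → E) : ∫ x in 𝒯.cell K, f x = 𝒯.vol K • ∫ y, f (𝒯.map K y) ∂(cubeMeasure d) :=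
  setIntegral_box (𝒯.lo_lt_hi K) f

theorem ae_map (K : Fin 𝒯.N) {p : Space d → Prop} (hp : ∀ᵐ x ∂(volume.restrict (𝒯.cell K)), p x) :
    ∀ᵐ y ∂(cubeMeasure d), p (𝒯.map K y) := ae_boxMap (𝒯.lo_lt_hi K) hp

theorem continuous_map (K : Fin 𝒯.N) : Continuous (𝒯.map K) := continuous_boxMap _ _

theorem continuous_facePoint (K : Fin 𝒯.N) (i : Fin d) (s : Bool) :
    Continuous (𝒯.facePoint K i s) := (𝒯.continuous_map K).comp (by fun_prop)

/-! #### Sums over faces -/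

open Classical in
theorem sum_ite_add_ite {ι E : Type*} [Fintype ι] [AddCommMonoid E] {p : ι → Prop} {q : Prop}
    (hp : ∀ {a b}, p a → p b → a = b) (hq : q ↔ ∀ a, ¬ p a) (c : E) :
    (∑ a, if p a then c else 0) + (if q then c else 0) = c := by
  by_cases h : ∃ a, p a
  · obtain ⟨a, ha⟩ := h
    rw [if_neg fun h => hq.1 h a ha, add_zero, Finset.sum_eq_single a, if_pos ha]
    · exact fun b _ hne => if_neg fun h' => hne (hp h' ha)
    · simp
  · rw [if_pos (hq.2 (not_exists.1 h)),
      Finset.sum_eq_zero fun a _ => if_neg (not_exists.1 h a), zero_add]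

open Classical in
theorem sum_faces {E : Type*} [AddCommMonoid E] (H : Fin 𝒯.N → Fin d → Bool → E) :
    ∑ K, ∑ i, ∑ s, H K i s =
      ∑ i, ∑ K, ∑ L, (if 𝒯.Adj i K L then H K i true + H L i false else 0) +
        ∑ K, ∑ i, ∑ s, (if 𝒯.IsWall K i s then H K i s else 0) := by
  have h1 : ∀ K i, ∑ s, H K i s = (∑ L, if 𝒯.Adj i K L then H K i true else 0) +
      (∑ L, if 𝒯.Adj i L K then H K i false else 0) +
      ∑ s, (if 𝒯.IsWall K i s then H K i s else 0) := fun K i => by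
    rw [Fintype.sum_bool, Fintype.sum_bool]
    have h2 := sum_ite_add_ite (p := 𝒯.Adj i K) (q := 𝒯.IsWall K i true)
      𝒯.adj_unique_right (by simp [IsWall]) (H K i true)
    have h3 := sum_ite_add_ite (p := (𝒯.Adj i · K)) (q := 𝒯.IsWall K i false)
      𝒯.adj_unique_left (by simp [IsWall]) (H K i false)
    conv_lhs => rw [← h2, ← h3]
    exact add_add_add_comm _ _ _ _
  simp only [h1, Finset.sum_add_distrib]
  congr 1
  rw [Finset.sum_comm (f := fun K i => ∑ L, if 𝒯.Adj i K L then H K i true else 0),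
    Finset.sum_comm (f := fun K i => ∑ L, if 𝒯.Adj i L K then H K i false else 0),
    ← Finset.sum_add_distrib]
  refine Finset.sum_congr rfl fun i _ => ?_
  rw [Finset.sum_comm (f := fun K L => if 𝒯.Adj i L K then H K i false else 0),
    ← Finset.sum_add_distrib]
  refine Finset.sum_congr rfl fun K _ => ?_
  rw [← Finset.sum_add_distrib]
  refine Finset.sum_congr rfl fun L _ => ?_
  split_ifs <;> simp

theorem sum_faces_nonpos {H : Fin 𝒯.N → Fin d → Bool → ℝ}
    (h1 : ∀ i K L, 𝒯.Adj i K L → H K i true + H L i false ≤ 0)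
    (h2 : ∀ K i s, 𝒯.IsWall K i s → H K i s ≤ 0) : ∑ K, ∑ i, ∑ s, H K i s ≤ 0 := by
  classical
  rw [sum_faces]
  refine add_nonpos (Finset.sum_nonpos fun i _ => Finset.sum_nonpos fun K _ =>
    Finset.sum_nonpos fun L _ => ?_) (Finset.sum_nonpos fun K _ => Finset.sum_nonpos fun i _ =>
    Finset.sum_nonpos fun s _ => ?_)
  · split_ifs with h
    exacts [h1 i K L h, le_rfl]
  · split_ifs with h
    exacts [h2 K i s h, le_rfl]

theorem sum_faces_eq_zero {H : Fin 𝒯.N → Fin d → Bool → ℝ}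
    (h1 : ∀ i K L, 𝒯.Adj i K L → H K i true + H L i false = 0)
    (h2 : ∀ K i s, 𝒯.IsWall K i s → H K i s = 0) : ∑ K, ∑ i, ∑ s, H K i s = 0 := by
  refine le_antisymm (𝒯.sum_faces_nonpos (fun i K L h => (h1 i K L h).le)
    fun K i s h => (h2 K i s h).le) ?_
  have := 𝒯.sum_faces_nonpos (H := fun K i s => -H K i s)
    (fun i K L h => by linarith [h1 i K L h]) fun K i s h => by linarith [h2 K i s h]
  simp only [Finset.sum_neg_distrib] at this
  linarith

/-! #### The boundary -/

theorem exists_outerNormal (hΩo : IsOpen Ω) (hΩ : interior (closure Ω) = Ω) {K : Fin 𝒯.N}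
    {i : Fin d} {s : Bool} (hw : 𝒯.IsWall K i s) {x : Space d}
    (hx : ∀ j, j ≠ i → x j ∈ Ioo (𝒯.lo K j) (𝒯.hi K j))
    (hgen : ∀ L j, j ≠ i → x j ≠ 𝒯.lo L j ∧ x j ≠ 𝒯.hi L j)
    (hxi : x i = if s then 𝒯.hi K i else 𝒯.lo K i) :
    x ∈ frontier Ω ∧ IsOuterNormal Ω x (wallNormal i s) := by
  have hKi := 𝒯.lo_lt_hi K i
  -- no other cell touches `x`
  have honly : ∀ L, x ∈ 𝒯.closedCell L → L = K := by
    intro L hL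
    have hLj : ∀ j, j ≠ i → x j ∈ Ioo (𝒯.lo L j) (𝒯.hi L j) := fun j hj =>
      ⟨lt_of_le_of_ne (hL j).1 (hgen L j hj).1.symm, lt_of_le_of_ne (hL j).2 (hgen L j hj).2⟩
    have hov : ∀ j, j ≠ i → max (𝒯.lo L j) (𝒯.lo K j) < min (𝒯.hi L j) (𝒯.hi K j) := fun j hj =>
      (max_lt (hLj j hj).1 (hx j hj).1).trans (lt_min (hLj j hj).2 (hx j hj).2)
    have hLi := hL i
    rw [hxi] at hLi
    have hLi' := 𝒯.lo_lt_hi L i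
    cases s
    · simp only [Bool.false_eq_true, if_false] at hLi
      rcases hLi.2.eq_or_lt with he | hlt
      · exact absurd (show 𝒯.Adj i L K from ⟨he.symm, 𝒯.conforming L K i he.symm hov⟩)
          (by simpa using hw L)
      · refine 𝒯.eq_of_overlap fun j => ?_
        by_cases hj : j = i
        · subst hj
          rw [max_eq_right hLi.1]; exact lt_min hlt hKi
        · exact hov j hj
    · simp only [if_true] at hLi
      rcases hLi.1.eq_or_lt with he | hlt
      · exact absurd (show 𝒯.Adj i K L from ⟨he.symm, 𝒯.conforming K L i he.symm fun j hj => by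
            rw [max_comm, min_comm]; exact hov j hj⟩)
          (by simpa using hw L)
      · refine 𝒯.eq_of_overlap fun j => ?_
        by_cases hj : j = i
        · subst hj
          rw [min_eq_right hLi.2]; exact max_lt hlt hKi
        · exact hov j hj
  let σ : ℝ := if s then 1 else -1
  have hσ : σ = 1 ∨ σ = -1 := by cases s <;> simp [σ]
  have hσ2 : σ * σ = 1 := by rcases hσ with h | h <;> rw [h] <;> norm_num
  -- near `x` the closure of the domain is a half space
  have hloc : ∀ᶠ y in 𝓝 x, (y ∈ closure Ω ↔ σ * (y i - x i) ≤ 0) := by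
    have h1 : ∀ᶠ y in 𝓝 x, ∀ L, y ∈ 𝒯.closedCell L → L = K := by
      rw [eventually_all]
      intro L
      by_cases hL : x ∈ 𝒯.closedCell L
      · exact Eventually.of_forall fun y _ => honly L hL
      · filter_upwards [(𝒯.isClosed_closedCell L).isOpen_compl.mem_nhds hL] with y hy h'
        exact absurd h' hy
    have h2 : ∀ᶠ y in 𝓝 x, ∀ j, j ≠ i → y j ∈ Ioo (𝒯.lo K j) (𝒯.hi K j) := by
      rw [eventually_all]
      intro j
      by_cases hj : j = i
      · exact Eventually.of_forall fun y h => absurd hj h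
      · filter_upwards [(continuous_coord j).continuousAt.preimage_mem_nhds
          (isOpen_Ioo.mem_nhds (hx j hj))] with y hy _ using hy
    have h3 : ∀ᶠ y in 𝓝 x, |y i - x i| < 𝒯.hi K i - 𝒯.lo K i := by
      have : ContinuousAt (fun y : Space d => |y i - x i|) x := by fun_prop
      refine this.eventually (gt_mem_nhds ?_)
      simpa using hKi
    filter_upwards [h1, h2, h3] with y h1 h2 h3
    have e : y ∈ closure Ω ↔ y ∈ 𝒯.closedCell K := by
      rw [𝒯.closure_eq, mem_iUnion]
      exact ⟨fun ⟨L, hL⟩ => h1 L hL ▸ hL, fun h => ⟨K, h⟩⟩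
    rw [e]
    rw [abs_lt] at h3
    constructor
    · intro h
      have := h i
      cases s
      · simp only [Bool.false_eq_true, if_false, σ] at hxi ⊢
        linarith [this.1]
      · simp only [if_true, σ] at hxi ⊢
        linarith [this.2]
    · intro h j
      by_cases hj : j = i
      · subst hj
        cases s
        · simp only [Bool.false_eq_true, if_false, σ] at hxi h
          constructor <;> linarith
        · simp only [if_true, σ] at hxi h
          constructor <;> linarith
      · exact Ioo_subset_Icc_self (h2 j hj)
  have hcoord : ∀ y : Space d, ∀ τ : ℝ, (y + τ • unitVec i) i = y i + τ := fun y τ => by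
    simp [unitVec]
  have hopen : ∀ᶠ y in 𝓝 x, (y ∈ Ω ↔ σ * (y i - x i) < 0) := by
    filter_upwards [hloc.eventually_nhds] with y hy
    constructor
    · intro hyΩ
      have h1 := hy.self_of_nhds.1 (subset_closure hyΩ)
      refine lt_of_le_of_ne h1 fun h0 => ?_
      have hlim : Tendsto (fun τ : ℝ => y + (σ * τ) • (unitVec i : Space d)) (𝓝[>] 0) (𝓝 y) := by
        have : Continuous fun τ : ℝ => y + (σ * τ) • (unitVec i : Space d) := by fun_prop
        have := this.tendsto 0
        simp only [mul_zero, zero_smul, add_zero] at this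
        exact this.mono_left nhdsWithin_le_nhds
      obtain ⟨τ, ⟨h2, h3⟩, h4⟩ := (((hlim.eventually hy).and
        (hlim.eventually (hΩo.mem_nhds hyΩ))).and self_mem_nhdsWithin).exists
      have h5 := h2.1 (subset_closure h3)
      rw [hcoord] at h5
      have h6 : (0 : ℝ) < τ := h4
      nlinarith
    · intro h
      rw [← hΩ, mem_interior_iff_mem_nhds]
      have : ContinuousAt (fun w : Space d => σ * (w i - x i)) y := by fun_prop
      filter_upwards [hy, this.eventually (gt_mem_nhds h)] with w h1 h2
      exact h1.2 h2.le
  have hxΩ : x ∉ Ω := fun h => by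
    have := hopen.self_of_nhds.1 h
    simp at this
  refine ⟨⟨hloc.self_of_nhds.2 (by simp), by rwa [hΩo.interior_eq]⟩, ?_, ?_⟩
  · cases s <;> simp [wallNormal, norm_unitVec]
  refine ⟨fun y => σ * (y i - x i), by fun_prop, by simp, ⟨1, one_pos, ?_⟩, hopen⟩
  rw [one_smul]
  refine HasGradientAt.gradient ?_
  rw [hasGradientAt_iff_hasFDerivAt]
  have h1 : HasFDerivAt (fun y : Space d => σ * (y i - x i))
      (σ • (EuclideanSpace.proj i : Space d →L[ℝ] ℝ)) x :=
    ((EuclideanSpace.proj (𝕜 := ℝ) i).hasFDerivAt.sub_const (x i)).const_mul σ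
  convert! h1 using 1
  ext w
  cases s <;> simp [wallNormal, unitVec, σ, EuclideanSpace.inner_single_left]

theorem ae_outerNormal (hΩo : IsOpen Ω) (hΩ : interior (closure Ω) = Ω) {K : Fin 𝒯.N}
    {i : Fin d} {s : Bool} (hw : 𝒯.IsWall K i s) : ∀ᵐ y ∂(cubeMeasure d),
      𝒯.facePoint K i s y ∈ frontier Ω ∧
        IsOuterNormal Ω (𝒯.facePoint K i s y) (wallNormal i s) := by
  have hne : ∀ᵐ y ∂(cubeMeasure d), ∀ j, ∀ L, 𝒯.lo K j + y j * (𝒯.hi K j - 𝒯.lo K j) ≠ 𝒯.lo L j ∧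
      𝒯.lo K j + y j * (𝒯.hi K j - 𝒯.lo K j) ≠ 𝒯.hi L j := by
    refine ae_cubeMeasure (p := fun j t => ∀ L, 𝒯.lo K j + t * (𝒯.hi K j - 𝒯.lo K j) ≠ 𝒯.lo L j ∧
      𝒯.lo K j + t * (𝒯.hi K j - 𝒯.lo K j) ≠ 𝒯.hi L j) fun j => ae_restrict_of_ae ?_
    have hpos := sub_pos.2 (𝒯.lo_lt_hi K j)
    refine ae_all_iff.2 fun L => ?_
    filter_upwards [ae_ne ((𝒯.lo L j - 𝒯.lo K j) / (𝒯.hi K j - 𝒯.lo K j)),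
      ae_ne ((𝒯.hi L j - 𝒯.lo K j) / (𝒯.hi K j - 𝒯.lo K j))] with t h1 h2
    rw [Ne, eq_div_iff hpos.ne'] at h1 h2
    exact ⟨fun h => h1 (by linarith), fun h => h2 (by linarith)⟩
  filter_upwards [ae_mem_cube, hne] with y hy hny
  have hc : ∀ j, j ≠ i → 𝒯.facePoint K i s y j = 𝒯.lo K j + y j * (𝒯.hi K j - 𝒯.lo K j) :=
    fun j hj => by simp [facePoint, map, Function.update_of_ne hj]
  refine 𝒯.exists_outerNormal hΩo hΩ hw (fun j hj => ?_) (fun L j hj => ?_) ?_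
  · rw [hc j hj]; exact boxMap_mem_Ioo (𝒯.lo_lt_hi K) (hy j)
  · rw [hc j hj]; exact hny j L
  · cases s <;> simp [facePoint, map]

/-! #### The cells exhaust the domain -/

theorem ae_eq_iUnion_cell (hΩ : interior (closure Ω) = Ω) :
    Ω =ᵐ[volume] ⋃ K, 𝒯.cell K := by
  have hnull : ∀ᵐ x : Space d, ∀ K j, x j ≠ 𝒯.lo K j ∧ x j ≠ 𝒯.hi K j := by
    have h0 : ∀ (j : Fin d) (c : ℝ), ∀ᵐ x : Space d, x j ≠ c := fun j c => by
      have h1 : ∀ᵐ w : Fin d → ℝ, w j ≠ c := by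
        rw [ae_iff]
        simp only [ne_eq, not_not, volume_pi]
        exact Measure.pi_hyperplane (fun _ : Fin d => (volume : Measure ℝ)) j c
      exact (PiLp.volume_preserving_ofLp (Fin d)).quasiMeasurePreserving.ae h1
    refine ae_all_iff.2 fun K => ae_all_iff.2 fun j => (h0 j _).and (h0 j _)
  filter_upwards [hnull] with x hx
  refine propext ⟨fun h => ?_, fun h => ?_⟩
  · have := subset_closure (s := Ω) h
    rw [𝒯.closure_eq] at this
    obtain ⟨K, hK⟩ := mem_iUnion.1 this
    exact mem_iUnion.2 ⟨K, fun j => ⟨lt_of_le_of_ne (hK j).1 (hx K j).1.symm,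
      lt_of_le_of_ne (hK j).2 (hx K j).2⟩⟩
  · obtain ⟨K, hK⟩ := mem_iUnion.1 h
    exact 𝒯.cell_subset hΩ K hK

theorem pairwise_disjoint_cell : Pairwise (Function.onFun Disjoint 𝒯.cell) := 𝒯.disjoint

theorem integrableOn_iff (hΩ : interior (closure Ω) = Ω) {f : Space d → ℝ} :
    IntegrableOn f Ω ↔ ∀ K, IntegrableOn f (𝒯.cell K) := by
  rw [integrableOn_congr_set_ae (𝒯.ae_eq_iUnion_cell hΩ), integrableOn_finite_iUnion]

theorem setIntegral_eq (hΩ : interior (closure Ω) = Ω) {f : Space d → ℝ}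
    (hf : ∀ K, IntegrableOn f (𝒯.cell K)) :
    ∫ x in Ω, f x = ∑ K, 𝒯.vol K * 𝒯.cellMean K f := by
  rw [setIntegral_congr_set (𝒯.ae_eq_iUnion_cell hΩ),
    integral_iUnion_fintype (fun K => (𝒯.isOpen_cell K).measurableSet) 𝒯.pairwise_disjoint_cell hf]
  exact Finset.sum_congr rfl fun K _ => by rw [𝒯.setIntegral_cell, smul_eq_mul]; rfl

theorem pc_eq (V : Fin 𝒯.N → State d) {K : Fin 𝒯.N} {x : Space d} (hx : x ∈ 𝒯.cell K) :
    𝒯.pc V x = V K := by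
  rw [pc, Finset.sum_eq_single K]
  · rw [indicator_of_mem hx]
  · intro L _ hL
    exact indicator_of_notMem (fun h => hL (𝒯.eq_of_mem_cell h hx)) _
  · simp

/-! #### The mesh size -/

theorem isBounded_cell (hb : Bornology.IsBounded Ω) (K : Fin 𝒯.N) :
    Bornology.IsBounded (𝒯.cell K) :=
  hb.closure.subset ((𝒯.cell_subset_closedCell K).trans (𝒯.closedCell_subset K))

theorem side_le_size (hb : Bornology.IsBounded Ω) (K : Fin 𝒯.N) (i : Fin d) :
    𝒯.hi K i - 𝒯.lo K i ≤ 𝒯.size := by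
  have hpos := sub_pos.2 (𝒯.lo_lt_hi K i)
  have h1 : Metric.diam (𝒯.cell K) ≤ 𝒯.size :=
    le_ciSup (f := fun K => Metric.diam (𝒯.cell K)) (finite_range _).bddAbove K
  refine le_trans ?_ h1
  have h2 : ∀ ε ∈ Ioo (0 : ℝ) (1 / 2), (1 - 2 * ε) * (𝒯.hi K i - 𝒯.lo K i) ≤
      Metric.diam (𝒯.cell K) := by
    intro ε hε
    have hm : ∀ t ∈ Ioo (0 : ℝ) 1, 𝒯.map K (Function.update (fun _ => 1 / 2) i t) ∈ 𝒯.cell K :=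
      fun t ht => 𝒯.map_mem_cell K fun j => by
        by_cases hj : j = i
        · subst hj; simpa using ht
        · rw [Function.update_of_ne hj]; norm_num
    have := Metric.dist_le_diam_of_mem (𝒯.isBounded_cell hb K)
      (hm (1 - ε) ⟨by linarith [hε.2], by linarith [hε.1]⟩)
      (hm ε ⟨hε.1, by linarith [hε.2]⟩)
    rw [map, map, boxMap_update, boxMap_update, dist_add_left, dist_eq_norm, ← sub_smul, norm_smul,
      norm_unitVec, mul_one, Real.norm_eq_abs] at this
    refine le_trans ?_ ((le_abs_self _).trans this)
    linarith
  have hlim : Tendsto (fun ε : ℝ => (1 - 2 * ε) * (𝒯.hi K i - 𝒯.lo K i)) (𝓝[>] 0)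
      (𝓝 (𝒯.hi K i - 𝒯.lo K i)) := by
    have : Continuous fun ε : ℝ => (1 - 2 * ε) * (𝒯.hi K i - 𝒯.lo K i) := by fun_prop
    have := this.tendsto 0
    simp only [mul_zero, sub_zero, one_mul] at this
    exact this.mono_left nhdsWithin_le_nhds
  refine le_of_tendsto hlim ?_
  filter_upwards [Ioo_mem_nhdsGT (show (0 : ℝ) < 1 / 2 by norm_num)] with ε hε using h2 ε hε

theorem nonempty_cells (hne : Ω.Nonempty) : Nonempty (Fin 𝒯.N) := by
  obtain ⟨x, hx⟩ := hne
  have := subset_closure (s := Ω) hx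
  rw [𝒯.closure_eq] at this
  obtain ⟨K, -⟩ := mem_iUnion.1 this
  exact ⟨K⟩

theorem size_le (hb : Bornology.IsBounded Ω) (hne : Ω.Nonempty) :
    𝒯.size ≤ Metric.diam (closure Ω) := by
  have := 𝒯.nonempty_cells hne
  exact ciSup_le fun K => Metric.diam_mono
    ((𝒯.cell_subset_closedCell K).trans (𝒯.closedCell_subset K)) hb.closure

theorem size_pos (hd : 0 < d) (hb : Bornology.IsBounded Ω) (hne : Ω.Nonempty) : 0 < 𝒯.size := by
  obtain ⟨K⟩ := 𝒯.nonempty_cells hne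
  exact (sub_pos.2 (𝒯.lo_lt_hi K ⟨0, hd⟩)).trans_le (𝒯.side_le_size hb K _)

/-- Means over cells and faces differ by at most the width of the cell in the direction normal to
the face. -/
theorem abs_cellMean_sub_faceMean_le {f : Space d → ℝ} {C : ℝ≥0} (K : Fin 𝒯.N)
    (hf : LipschitzOnWith C f (𝒯.closedCell K)) (i : Fin d) (s : Bool) :
    |𝒯.cellMean K f - 𝒯.faceMean K i s f| ≤ C * (𝒯.hi K i - 𝒯.lo K i) := by
  obtain ⟨g, hg, hfg⟩ := hf.extend_real
  have hpos := sub_pos.2 (𝒯.lo_lt_hi K i)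
  have e1 : 𝒯.cellMean K f = ∫ y, g (𝒯.map K y) ∂(cubeMeasure d) := by
    refine integral_congr_ae ?_
    filter_upwards [ae_mem_cube] with y hy
    exact hfg (𝒯.map_mem_closedCell K fun j => Ioo_subset_Icc_self (hy j))
  have e2 : 𝒯.faceMean K i s f = ∫ y, g (𝒯.facePoint K i s y) ∂(cubeMeasure d) := by
    refine integral_congr_ae ?_
    filter_upwards [ae_mem_cube] with y hy
    exact hfg (𝒯.facePoint_mem_closedCell K i s hy)
  rw [e1, e2, ← integral_sub, ← Real.norm_eq_abs]
  · refine (norm_integral_le_of_norm_le_const (μ := cubeMeasure d)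
      (C := C * (𝒯.hi K i - 𝒯.lo K i)) ?_).trans (by simp)
    filter_upwards [ae_mem_cube] with y hy
    rw [← dist_eq_norm]
    refine (hg.dist_le_mul _ _).trans ?_
    gcongr
    rw [facePoint, map, map, boxMap_update, dist_self_add_right, norm_smul, norm_unitVec, mul_one,
      norm_mul, Real.norm_of_nonneg hpos.le]
    refine mul_le_of_le_one_left hpos.le ?_
    rw [Real.norm_eq_abs, abs_le]
    obtain ⟨h1, h2⟩ := hy i
    cases s <;> simp <;> constructor <;> linarith
  · exact integrable_cube_of_continuous (hg.continuous.comp (𝒯.continuous_map K))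
  · exact integrable_cube_of_continuous (hg.continuous.comp (𝒯.continuous_facePoint K i s))

end RectMesh

/-! ### Functions with bounded weak derivatives are Lipschitz continuous -/

instance : (volume : Measure (SpaceTime d)).IsAddHaarMeasure :=
  inferInstanceAs (Measure.IsAddHaarMeasure ((volume : Measure ℝ).prod (volume : Measure (Space d))))

theorem spaceTime_eq_sum (e : SpaceTime d) :
    e = e.1 • timeDir d + ∑ i, e.2 i • spaceDir i := by
  refine Prod.ext ?_ ?_
  · simp [timeDir, spaceDir, Prod.fst_sum]
  · simp only [timeDir, spaceDir, Prod.snd_add, Prod.smul_snd, smul_zero, zero_add, Prod.snd_sum]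
    ext j
    simp [unitVec, Finset.sum_apply, Pi.single_apply]

theorem abs_apply_le_of_dirs {ℓ : SpaceTime d →L[ℝ] ℝ} {M : ℝ} (h0 : |ℓ (timeDir d)| ≤ M)
    (h1 : ∀ i, |ℓ (spaceDir i)| ≤ M) : ‖ℓ‖ ≤ (d + 1) * M := by
  have hM : 0 ≤ M := (abs_nonneg _).trans h0
  refine ℓ.opNorm_le_bound (by positivity) fun e => ?_
  have he : ℓ e = e.1 * ℓ (timeDir d) + ∑ i, e.2 i * ℓ (spaceDir i) := by
    conv_lhs => rw [spaceTime_eq_sum e]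
    simp [map_sum]
  have h2 : |e.1 * ℓ (timeDir d)| ≤ ‖e‖ * M := by
    rw [abs_mul]
    exact mul_le_mul (norm_fst_le e) h0 (abs_nonneg _) (norm_nonneg _)
  have h3 : |∑ i, e.2 i * ℓ (spaceDir i)| ≤ d * (‖e‖ * M) := by
    refine (Finset.abs_sum_le_sum_abs _ _).trans ?_
    refine (Finset.sum_le_card_nsmul _ _ (‖e‖ * M) fun i _ => ?_).trans (by simp)
    rw [abs_mul]
    exact mul_le_mul ((PiLp.norm_apply_le e.2 i).trans (norm_snd_le e)) (h1 i) (abs_nonneg _)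
      (norm_nonneg _)
  rw [he, Real.norm_eq_abs]
  calc _ ≤ _ := abs_add_le _ _
    _ ≤ ‖e‖ * M + d * (‖e‖ * M) := add_le_add h2 h3
    _ = _ := by ring

theorem eq_zero_of_notMem_tsupport {φ : SpaceTime d → ℝ} {w : SpaceTime d} (h : w ∉ tsupport φ)
    (e : SpaceTime d) : φ w = 0 ∧ fderiv ℝ φ w e = 0 := by
  refine ⟨image_eq_zero_of_notMem_tsupport h, ?_⟩
  rw [image_eq_zero_of_notMem_tsupport fun h' => h (tsupport_fderiv_subset ℝ h')]; rfl

theorem abs_sub_le_of_W1infLE {Q O : Set (SpaceTime d)} {f : SpaceTime d → ℝ} {M : ℝ}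
    (h : W1infLE Q f M) (hO : IsOpen O) (hOQ : O ⊆ Q) (hc : ContinuousOn f O)
    {x y : SpaceTime d} (hxy : segment ℝ x y ⊆ O) :
    |f y - f x| ≤ (d + 1) * M * ‖y - x‖ := by
  obtain ⟨-, ⟨g₀, hg₀, hb₀⟩, h1⟩ := h
  have hseg : IsCompact (segment ℝ x y) := by
    rw [segment_eq_image]
    exact isCompact_Icc.image (by fun_prop)
  obtain ⟨δ, hδ, hδO⟩ := hseg.exists_cthickening_subset_open hO hxy
  set N := Metric.cthickening δ (segment ℝ x y) with hN
  have hNc : IsCompact N := hseg.cthickening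
  have hball : ∀ z ∈ segment ℝ x y, Metric.closedBall z δ ⊆ N := fun z hz =>
    Metric.closedBall_subset_cthickening hz δ
  have hNm : MeasurableSet N := hNc.isClosed.measurableSet
  set F : SpaceTime d → ℝ := N.indicator f with hF
  have hFint : Integrable F :=
    (integrable_indicator_iff hNm).2 ((hc.mono hδO).integrableOn_compact hNc)
  have hFx : ∀ z ∈ segment ℝ x y, ContinuousAt F z ∧ F z = f z := fun z hz => by
    have hnb : N ∈ 𝓝 z := mem_of_superset (Metric.closedBall_mem_nhds z hδ) (hball z hz)
    refine ⟨?_, indicator_of_mem (mem_of_mem_nhds hnb) _⟩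
    refine ContinuousAt.congr (f := f) (hc.continuousAt (hO.mem_nhds (hxy hz))) ?_
    filter_upwards [hnb] with w hw using (indicator_of_mem hw _).symm
  -- the derivative of the mollified function
  have key : ∀ φ : ContDiffBump (0 : SpaceTime d), φ.rOut < δ → ∀ z ∈ segment ℝ x y,
      ∀ e : SpaceTime d, ∀ g, IsWeakDeriv Q e f g → (∀ᵐ z ∂(volume.restrict Q), |g z| ≤ M) →
        |∫ w, fderiv ℝ (φ.normed volume) (z - w) e * F w| ≤ M := by
    intro φ hφ z hz e g hg hgb
    let ψ : SpaceTime d → ℝ := fun w => φ.normed volume (z - w)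
    have hψc : ContDiff ℝ ∞ ψ := φ.contDiff_normed.comp (contDiff_const.sub contDiff_id)
    have hψs : tsupport ψ ⊆ Metric.closedBall z φ.rOut := by
      refine closure_minimal ?_ Metric.isClosed_closedBall
      intro w hw
      have h2 : z - w ∈ Function.support (φ.normed (volume : Measure (SpaceTime d))) := hw
      rw [φ.support_normed_eq, Metric.mem_ball, dist_zero_right, ← dist_eq_norm'] at h2
      exact h2.le
    have hψN : tsupport ψ ⊆ N := hψs.trans ((Metric.closedBall_subset_closedBall hφ.le).trans
      (hball z hz))
    have hψcomp : HasCompactSupport ψ := hNc.of_isClosed_subset (isClosed_tsupport _) hψN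
    have hfd : ∀ w, fderiv ℝ ψ w e = -fderiv ℝ (φ.normed volume) (z - w) e := fun w => by
      have h2 : HasFDerivAt (φ.normed (volume : Measure (SpaceTime d)))
          (fderiv ℝ (φ.normed volume) (z - w)) (z - w) :=
        ((φ.contDiff_normed (n := 1)).differentiable (by simp) _).hasFDerivAt
      have h3 : HasFDerivAt ψ ((fderiv ℝ (φ.normed volume) (z - w)).comp
          (-ContinuousLinearMap.id ℝ (SpaceTime d))) w :=
        h2.comp w ((hasFDerivAt_id w).const_sub z)
      rw [h3.fderiv]
      simp
    have hzero : ∀ w, w ∉ N → ψ w = 0 ∧ fderiv ℝ ψ w e = 0 := fun w hw =>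
      eq_zero_of_notMem_tsupport (fun h => hw (hψN h)) e
    have h4 := hg.2.2 ψ hψc hψcomp (hψN.trans (hδO.trans hOQ))
    have h5 : ∫ w in Q, f w * fderiv ℝ ψ w e =
        -∫ w, fderiv ℝ (φ.normed volume) (z - w) e * F w := by
      rw [setIntegral_eq_integral_of_forall_compl_eq_zero, ← integral_neg]
      · refine integral_congr_ae (Eventually.of_forall fun w => ?_)
        by_cases hw : w ∈ N
        · simp only [hF, indicator_of_mem hw, hfd]; ring
        · have := (hzero w hw).2
          simp only [hF, indicator_of_notMem hw, this]; ring
      · intro w hw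
        rw [(hzero w fun h => hw (hOQ (hδO h))).2, mul_zero]
    have h6 : ∫ w in Q, ψ w = 1 := by
      rw [setIntegral_eq_integral_of_forall_compl_eq_zero
        fun w hw => (hzero w fun h => hw (hOQ (hδO h))).1]
      have := integral_sub_left_eq_self (φ.normed (volume : Measure (SpaceTime d))) volume z
      rw [φ.integral_normed] at this
      exact this
    rw [h5] at h4
    have h7 : ∫ w, fderiv ℝ (φ.normed volume) (z - w) e * F w = ∫ w in Q, g w * ψ w := by linarith
    rw [h7, ← Real.norm_eq_abs]
    have hψi : Integrable ψ (volume.restrict Q) :=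
      (hψc.continuous.integrable_of_hasCompactSupport hψcomp).restrict
    refine (norm_integral_le_of_norm_le (hψi.const_mul M) ?_).trans ?_
    · filter_upwards [hgb] with w hw
      have : 0 ≤ ψ w := φ.nonneg_normed _
      rw [Real.norm_eq_abs, abs_mul, abs_of_nonneg this]
      gcongr
    · rw [integral_const_mul, h6, mul_one]
  refine le_of_forall_pos_le_add fun ε hε => ?_
  have hcont : ∀ z ∈ segment ℝ x y, ∃ δ' > 0, ∀ w ∈ Metric.ball z δ', dist (F w) (F z) ≤ ε / 2 :=
    fun z hz => by
      obtain ⟨δ', hδ', hs⟩ := Metric.continuousAt_iff.1 (hFx z hz).1 (ε / 2) (by positivity)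
      exact ⟨δ', hδ', fun w hw => (hs hw).le⟩
  obtain ⟨δ₁, hδ₁, hs₁⟩ := hcont x (left_mem_segment ℝ x y)
  obtain ⟨δ₂, hδ₂, hs₂⟩ := hcont y (right_mem_segment ℝ x y)
  have hmin : 0 < min δ (min δ₁ δ₂) / 2 := by positivity
  let φ : ContDiffBump (0 : SpaceTime d) :=
    ⟨min δ (min δ₁ δ₂) / 4, min δ (min δ₁ δ₂) / 2, by positivity, by linarith⟩
  have hφr : φ.rOut = min δ (min δ₁ δ₂) / 2 := rfl
  have hφ : φ.rOut < δ := by rw [hφr]; linarith [min_le_left δ (min δ₁ δ₂)]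
  have hφ1 : φ.rOut ≤ δ₁ := by
    rw [hφr]; linarith [(min_le_right δ (min δ₁ δ₂)).trans (min_le_left δ₁ δ₂)]
  have hφ2 : φ.rOut ≤ δ₂ := by
    rw [hφr]; linarith [(min_le_right δ (min δ₁ δ₂)).trans (min_le_right δ₁ δ₂)]
  let G : SpaceTime d → ℝ :=
    convolution (φ.normed volume) F (ContinuousLinearMap.lsmul ℝ ℝ) volume
  have d1 : dist (G x) (F x) ≤ ε / 2 := φ.dist_normed_convolution_le hFint.aestronglyMeasurable
    fun w hw => hs₁ w (Metric.ball_subset_ball hφ1 hw)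
  have d2 : dist (G y) (F y) ≤ ε / 2 := φ.dist_normed_convolution_le hFint.aestronglyMeasurable
    fun w hw => hs₂ w (Metric.ball_subset_ball hφ2 hw)
  have hG : ∀ z, HasFDerivAt G ((convolution (fderiv ℝ (φ.normed volume)) F
      ((ContinuousLinearMap.lsmul ℝ ℝ).precompL (SpaceTime d)) volume) z) z := fun z =>
    φ.hasCompactSupport_normed.hasFDerivAt_convolution_left _ φ.contDiff_normed
      hFint.locallyIntegrable z
  have hGe : ∀ z e, (convolution (fderiv ℝ (φ.normed volume)) F
      ((ContinuousLinearMap.lsmul ℝ ℝ).precompL (SpaceTime d)) volume) z e =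
      ∫ w, fderiv ℝ (φ.normed volume) (z - w) e * F w := fun z e => by
    rw [convolution_eq_swap, ContinuousLinearMap.integral_apply]
    · rfl
    · have hcs : HasCompactSupport (fderiv ℝ (φ.normed (volume : Measure (SpaceTime d)))) :=
        φ.hasCompactSupport_normed.fderiv ℝ
      have := hcs.convolutionExists_left ((ContinuousLinearMap.lsmul ℝ ℝ).precompL (SpaceTime d))
        ((φ.contDiff_normed (n := 1)).continuous_fderiv (by simp)) hFint.locallyIntegrable z
      exact this.integrable_swap
  have hGb : ∀ z ∈ segment ℝ x y, ‖(convolution (fderiv ℝ (φ.normed volume)) F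
      ((ContinuousLinearMap.lsmul ℝ ℝ).precompL (SpaceTime d)) volume) z‖ ≤ (d + 1) * M := by
    intro z hz
    refine abs_apply_le_of_dirs ?_ fun i => ?_
    · rw [hGe]; exact key φ hφ z hz _ _ hg₀ hb₀
    · obtain ⟨g, hg, hb⟩ := h1 i
      rw [hGe]; exact key φ hφ z hz _ _ hg hb
  have hmv := (convex_segment x y).norm_image_sub_le_of_norm_hasFDerivWithin_le
    (fun z _ => (hG z).hasFDerivWithinAt) hGb (left_mem_segment ℝ x y) (right_mem_segment ℝ x y)
  rw [(hFx x (left_mem_segment ℝ x y)).2] at d1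
  rw [(hFx y (right_mem_segment ℝ x y)).2] at d2
  rw [Real.dist_eq] at d1 d2
  rw [Real.norm_eq_abs] at hmv
  rw [abs_le] at *
  constructor <;> linarith

theorem W1infLE.lipschitzOnWith {Q O : Set (SpaceTime d)} {f : SpaceTime d → ℝ} {M : ℝ}
    (h : W1infLE Q f M) (hM : 0 ≤ M) (hO : IsOpen O) (hconv : Convex ℝ O) (hOQ : O ⊆ Q)
    (hc : ContinuousOn f (closure O)) :
    LipschitzOnWith (Real.toNNReal ((d + 1) * M)) f (closure O) := by
  refine LipschitzOnWith.closure hc (LipschitzOnWith.of_dist_le_mul fun x hx y hy => ?_)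
  rw [Real.coe_toNNReal _ (by positivity), dist_comm, dist_comm x y, Real.dist_eq, dist_eq_norm]
  exact abs_sub_le_of_W1infLE h hO hOQ (hc.mono subset_closure) (hconv.segment_subset hx hy)

theorem abs_le_of_ae {O : Set (SpaceTime d)} {f : SpaceTime d → ℝ} {M : ℝ} (hO : IsOpen O)
    (hc : ContinuousOn f (closure O)) (h : ∀ᵐ z ∂(volume.restrict O), |f z| ≤ M) :
    ∀ z ∈ closure O, |f z| ≤ M := by
  have h1 : EqOn (fun z => max |f z| M) (fun _ => M) O := by
    refine Measure.eqOn_open_of_ae_eq (μ := volume) ?_ hO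
      (ContinuousOn.sup (hc.mono subset_closure).abs continuousOn_const) continuousOn_const
    filter_upwards [h] with z hz using max_eq_right hz
  intro z hz
  have h2 := hc.abs.image_closure (mem_image_of_mem _ hz)
  have h3 : closure ((fun z => |f z|) '' O) ⊆ Iic M := by
    refine closure_minimal ?_ isClosed_Iic
    rintro _ ⟨w, hw, rfl⟩
    exact max_eq_right_iff.1 (h1 hw)
  exact h3 h2

/-- The weak derivatives of a Lipschitz function are its derivatives almost everywhere. -/
theorem IsWeakDeriv.ae_eq_fderiv {Q O : Set (SpaceTime d)} {f g : SpaceTime d → ℝ}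
    {e : SpaceTime d} (h : IsWeakDeriv Q e f g) (hO : IsOpen O) (hOQ : O ⊆ Q) {C : ℝ≥0}
    (hf : LipschitzOnWith C f O) : ∀ᵐ z ∂(volume.restrict O), g z = fderiv ℝ f z e := by
  obtain ⟨F, hF, hfF⟩ := hf.extend_real
  have hFl : ∀ᵐ z, DifferentiableAt ℝ F z := hF.ae_differentiableAt
  have hmeas : Measurable fun z => lineDeriv ℝ F z e := measurable_lineDeriv hF.continuous
  have hLi : LocallyIntegrable fun z => lineDeriv ℝ F z e :=
    (memLp_top_of_bound hmeas.aestronglyMeasurable (C * ‖e‖) (Eventually.of_forall fun z =>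
      norm_lineDeriv_le_of_lipschitz ℝ hF)).locallyIntegrable le_top
  have hgi : LocallyIntegrableOn (fun z => g z - lineDeriv ℝ F z e) O :=
    (h.2.1.mono_set hOQ).sub (hLi.locallyIntegrableOn O)
  have h0 := hO.ae_eq_zero_of_integral_contDiff_smul_eq_zero hgi fun φ hφ hφc hφO => by
    have h1 := h.2.2 φ hφ hφc (hφO.trans hOQ)
    have hz : ∀ w, w ∉ O → φ w = 0 ∧ fderiv ℝ φ w e = 0 := fun w hw =>
      eq_zero_of_notMem_tsupport (fun h => hw (hφO h)) e
    obtain ⟨D, hD⟩ : ∃ D, LipschitzWith D φ :=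
      ⟨_, (ContDiff.lipschitzWith_of_hasCompactSupport hφc hφ (by simp)).choose_spec⟩
    have h4 := hF.integral_lineDeriv_mul_eq (μ := volume) hD hφc e
    have h5 : ∫ z, lineDeriv ℝ φ z (-e) * F z = -∫ z in Q, f z * fderiv ℝ φ z e := by
      rw [setIntegral_eq_integral_of_forall_compl_eq_zero, ← integral_neg]
      · refine integral_congr_ae (Eventually.of_forall fun w => ?_)
        simp only
        rw [((hφ.differentiable (by simp)) w).lineDeriv_eq_fderiv, map_neg]
        by_cases hw : w ∈ O
        · rw [hfF hw]; ring
        · rw [(hz w hw).2]; ring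
      · intro w hw
        rw [(hz w fun h => hw (hOQ h)).2, mul_zero]
    have h6 : ∫ z in Q, g z * φ z = ∫ z, φ z * g z := by
      rw [setIntegral_eq_integral_of_forall_compl_eq_zero]
      · simp only [mul_comm]
      · intro w hw
        rw [(hz w fun h => hw (hOQ h)).1, mul_zero]
    have hK : IsCompact (tsupport φ) := hφc
    have hi : ∀ k : SpaceTime d → ℝ, LocallyIntegrableOn k O →
        Integrable fun z => φ z * k z := fun k hk => by
      have h7 : IntegrableOn (fun z => φ z * k z) (tsupport φ) :=
        (hk.integrableOn_compact_subset hφO hK).continuousOn_mul hφ.continuous.continuousOn hK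
      refine (integrableOn_iff_integrable_of_support_subset fun z hz' => ?_).1 h7
      by_contra hcon
      exact hz' (by simp [image_eq_zero_of_notMem_tsupport hcon])
    simp only [smul_eq_mul, mul_sub]
    rw [integral_sub (hi _ (h.2.1.mono_set hOQ)) (hi _ (hLi.locallyIntegrableOn O)), ← h6]
    have h8 : ∫ z, φ z * lineDeriv ℝ F z e = ∫ z, lineDeriv ℝ F z e * φ z := by
      simp only [mul_comm]
    rw [h8, h4, h5]
    linarith
  rw [ae_restrict_iff' hO.measurableSet]
  filter_upwards [h0, hFl] with z h1 h2 hz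
  have h3 := h1 hz
  have h4 : F =ᶠ[𝓝 z] f := by
    filter_upwards [hO.mem_nhds hz] with w hw using (hfF hw).symm
  rw [h2.lineDeriv_eq_fderiv, h4.fderiv_eq] at h3
  linarith

/-! ### Time slices of Lipschitz functions -/

namespace RectMesh

variable {Ω : Set (Space d)} (𝒯 : RectMesh d Ω)

/-- The open space-time cylinder over a cell. -/
def openCyl (T : ℝ) (K : Fin 𝒯.N) : Set (SpaceTime d) := Ioo 0 T ×ˢ 𝒯.cell K

/-- The closed space-time cylinder over a cell. -/
def closedCyl (T : ℝ) (K : Fin 𝒯.N) : Set (SpaceTime d) := Icc 0 T ×ˢ 𝒯.closedCell K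

theorem isOpen_openCyl (T : ℝ) (K : Fin 𝒯.N) : IsOpen (𝒯.openCyl T K) :=
  isOpen_Ioo.prod (𝒯.isOpen_cell K)

theorem openCyl_subset_closedCyl (T : ℝ) (K : Fin 𝒯.N) : 𝒯.openCyl T K ⊆ 𝒯.closedCyl T K :=
  prod_mono Ioo_subset_Icc_self (𝒯.cell_subset_closedCell K)

theorem closedCyl_subset (T : ℝ) (K : Fin 𝒯.N) : 𝒯.closedCyl T K ⊆ closedCylinder Ω T :=
  prod_mono subset_rfl (𝒯.closedCell_subset K)

theorem openCyl_subset (hΩ : interior (closure Ω) = Ω) (T : ℝ) (K : Fin 𝒯.N) :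
    𝒯.openCyl T K ⊆ cylinder Ω T := prod_mono subset_rfl (𝒯.cell_subset hΩ K)

theorem convex_cell (K : Fin 𝒯.N) : Convex ℝ (𝒯.cell K) := by
  have : 𝒯.cell K = ⋂ i, {x | x i ∈ Ioo (𝒯.lo K i) (𝒯.hi K i)} := by ext; simp [cell]
  rw [this]
  exact convex_iInter fun i => (convex_Ioo _ _).linear_preimage (PiLp.projₗ 2 (fun _ => ℝ) i)

theorem convex_openCyl (T : ℝ) (K : Fin 𝒯.N) : Convex ℝ (𝒯.openCyl T K) :=
  (convex_Ioo 0 T).prod (𝒯.convex_cell K)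

theorem closedCell_subset_closure (K : Fin 𝒯.N) : 𝒯.closedCell K ⊆ closure (𝒯.cell K) := by
  intro x hx
  have hc : 𝒯.map K (fun _ => 1 / 2) ∈ 𝒯.cell K := 𝒯.map_mem_cell K fun _ => by norm_num
  have hlim : Tendsto (fun ε : ℝ => x + ε • (𝒯.map K (fun _ => 1 / 2) - x)) (𝓝[>] 0) (𝓝 x) := by
    have : Continuous fun ε : ℝ => x + ε • (𝒯.map K (fun _ => 1 / 2) - x) := by fun_prop
    have := this.tendsto 0
    simp only [zero_smul, add_zero] at this
    exact this.mono_left nhdsWithin_le_nhds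
  refine mem_closure_of_tendsto hlim ?_
  filter_upwards [Ioo_mem_nhdsGT one_pos] with ε hε i
  obtain ⟨h1, h2⟩ := hx i
  obtain ⟨h3, h4⟩ := hc i
  obtain ⟨h5, h6⟩ := hε
  simp only [PiLp.add_apply, PiLp.smul_apply, PiLp.sub_apply, smul_eq_mul, mem_Ioo]
  constructor <;> nlinarith

theorem closedCyl_subset_closure {T : ℝ} (hT : 0 < T) (K : Fin 𝒯.N) :
    𝒯.closedCyl T K ⊆ closure (𝒯.openCyl T K) := by
  rw [openCyl, closure_prod_eq, closure_Ioo hT.ne]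
  exact prod_mono subset_rfl (𝒯.closedCell_subset_closure K)

theorem closure_openCyl_subset (T : ℝ) (K : Fin 𝒯.N) :
    closure (𝒯.openCyl T K) ⊆ 𝒯.closedCyl T K :=
  closure_minimal (𝒯.openCyl_subset_closedCyl T K)
    (isClosed_Icc.prod (𝒯.isClosed_closedCell K))

theorem ae_slice {T : ℝ} (K : Fin 𝒯.N) {p : SpaceTime d → Prop}
    (hp : ∀ᵐ z ∂(volume.restrict (𝒯.openCyl T K)), p z) :
    ∀ᵐ t ∂(volume.restrict (Ioo 0 T)), ∀ᵐ y ∂(cubeMeasure d), p (t, 𝒯.map K y) := by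
  rw [openCyl, Measure.volume_eq_prod, ← Measure.prod_restrict] at hp
  filter_upwards [Measure.ae_ae_of_ae_prod hp] with t ht using 𝒯.ae_map K ht

theorem map_mem_closedCyl {T : ℝ} {t : ℝ} (ht : t ∈ Icc 0 T) (K : Fin 𝒯.N) {y : Fin d → ℝ}
    (hy : ∀ i, y i ∈ Ioo (0 : ℝ) 1) : (t, 𝒯.map K y) ∈ 𝒯.closedCyl T K :=
  ⟨ht, 𝒯.map_mem_closedCell K fun j => Ioo_subset_Icc_self (hy j)⟩

theorem map_mem_openCyl {T : ℝ} {t : ℝ} (ht : t ∈ Ioo 0 T) (K : Fin 𝒯.N) {y : Fin d → ℝ}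
    (hy : ∀ i, y i ∈ Ioo (0 : ℝ) 1) : (t, 𝒯.map K y) ∈ 𝒯.openCyl T K :=
  ⟨ht, 𝒯.map_mem_cell K hy⟩

theorem facePoint_mem_closedCyl {T : ℝ} {t : ℝ} (ht : t ∈ Icc 0 T) (K : Fin 𝒯.N) (i : Fin d)
    (s : Bool) {y : Fin d → ℝ} (hy : ∀ i, y i ∈ Ioo (0 : ℝ) 1) :
    (t, 𝒯.facePoint K i s y) ∈ 𝒯.closedCyl T K := ⟨ht, 𝒯.facePoint_mem_closedCell K i s hy⟩

variable {T : ℝ} {K : Fin 𝒯.N} {a : SpaceTime d → ℝ} {C : ℝ≥0}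

theorem integrable_cube_of_continuousOn {E : Type*} [NormedAddCommGroup E]
    {f : Space d → E} (hf : ContinuousOn f (𝒯.closedCell K)) :
    Integrable (fun y => f (𝒯.map K y)) (cubeMeasure d) ∧
      ∀ i s, Integrable (fun y => f (𝒯.facePoint K i s y)) (cubeMeasure d) := by
  let S : Set (Fin d → ℝ) := univ.pi fun _ => Icc (0 : ℝ) 1
  have hS : IsCompact S := isCompact_univ_pi fun _ => isCompact_Icc
  have hfS : ContinuousOn (fun y => f (𝒯.map K y)) S :=
    hf.comp (𝒯.continuous_map K).continuousOn fun y hy => 𝒯.map_mem_closedCell K fun j => hy j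
      (mem_univ j)
  obtain ⟨B, hB⟩ := hS.exists_bound_of_continuousOn hfS
  have hcS : ∀ᵐ y ∂(cubeMeasure d), y ∈ S := ae_mem_cube.mono fun y hy j _ =>
    Ioo_subset_Icc_self (hy j)
  have hres : (cubeMeasure d).restrict S = cubeMeasure d := Measure.restrict_eq_self_of_ae_mem hcS
  have hg : ∀ g : (Fin d → ℝ) → (Fin d → ℝ), Continuous g → (∀ y ∈ S, g y ∈ S) →
      Integrable (fun y => f (𝒯.map K (g y))) (cubeMeasure d) := fun g hgc hgS => by
    refine Integrable.of_bound (C := B) ?_ (hcS.mono fun y hy => hB _ (hgS y hy))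
    have := (hfS.comp hgc.continuousOn hgS).aestronglyMeasurable (μ := cubeMeasure d)
      hS.isClosed.measurableSet
    rwa [hres] at this
  refine ⟨hg id continuous_id fun y hy => hy, fun i s => ?_⟩
  refine hg (fun y => Function.update y i (if s then 1 else 0)) (by fun_prop) fun y hy j hj => ?_
  by_cases h : j = i
  · subst h; cases s <;> simp
  · simpa [Function.update_of_ne h] using hy j hj

theorem slice_lipschitz (ha : LipschitzOnWith C a (𝒯.closedCyl T K)) {t : ℝ} (ht : t ∈ Icc 0 T) :
    LipschitzOnWith C (fun x => a (t, x)) (𝒯.closedCell K) := by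
  have h1 : LipschitzWith 1 (fun x : Space d => ((t, x) : SpaceTime d)) :=
    LipschitzWith.of_dist_le_mul fun x y => by simp [Prod.dist_eq]
  have := ha.comp (h1.lipschitzOnWith (s := 𝒯.closedCell K)) fun x hx => ⟨ht, hx⟩
  rwa [mul_one] at this

theorem slice_continuousOn {E : Type*} [TopologicalSpace E] {f : SpaceTime d → E}
    (hf : ContinuousOn f (𝒯.closedCyl T K)) {t : ℝ} (ht : t ∈ Icc 0 T) :
    ContinuousOn (fun x => f (t, x)) (𝒯.closedCell K) :=
  hf.comp (by fun_prop) fun _ hx => ⟨ht, hx⟩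

theorem cellMean_lipschitz (ha : LipschitzOnWith C a (𝒯.closedCyl T K)) :
    LipschitzOnWith C (fun t => 𝒯.cellMean K fun x => a (t, x)) (Icc 0 T) := by
  refine LipschitzOnWith.of_dist_le_mul fun t ht t' ht' => ?_
  have hi := fun t (ht : t ∈ Icc 0 T) =>
    (𝒯.integrable_cube_of_continuousOn (𝒯.slice_lipschitz ha ht).continuousOn).1
  rw [dist_eq_norm, cellMean, cellMean, ← integral_sub (hi t ht) (hi t' ht')]
  refine (norm_integral_le_of_norm_le_const (μ := cubeMeasure d) (C := C * dist t t') ?_).trans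
    (by simp)
  filter_upwards [ae_mem_cube] with y hy
  rw [← dist_eq_norm]
  refine (ha.dist_le_mul _ (𝒯.map_mem_closedCyl ht K hy) _ (𝒯.map_mem_closedCyl ht' K hy)).trans ?_
  simp [Prod.dist_eq]

theorem ae_slice_deriv (ha : LipschitzOnWith C a (𝒯.closedCyl T K)) :
    ∀ᵐ t ∂(volume.restrict (Ioo 0 T)),
      (∀ e, Integrable (fun y => fderiv ℝ a (t, 𝒯.map K y) e) (cubeMeasure d)) ∧
      HasDerivAt (fun t => 𝒯.cellMean K fun x => a (t, x))
        (∫ y, fderiv ℝ a (t, 𝒯.map K y) (timeDir d) ∂(cubeMeasure d)) t ∧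
      ∀ i, 𝒯.faceMean K i true (fun x => a (t, x)) - 𝒯.faceMean K i false (fun x => a (t, x)) =
        (𝒯.hi K i - 𝒯.lo K i) *
          ∫ y, fderiv ℝ a (t, 𝒯.map K y) (spaceDir i) ∂(cubeMeasure d) := by
  obtain ⟨b, hb, hab⟩ := ha.extend_real
  have hbd : ∀ᵐ z ∂(volume.restrict (𝒯.openCyl T K)), DifferentiableAt ℝ b z :=
    ae_restrict_of_ae hb.ae_differentiableAt
  have hfd : ∀ z ∈ 𝒯.openCyl T K, fderiv ℝ a z = fderiv ℝ b z := fun z hz => by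
    refine Filter.EventuallyEq.fderiv_eq ?_
    filter_upwards [(𝒯.isOpen_openCyl T K).mem_nhds hz] with w hw
    exact hab (𝒯.openCyl_subset_closedCyl T K hw)
  filter_upwards [𝒯.ae_slice K hbd, ae_restrict_mem measurableSet_Ioo] with t ht htm
  have hgc : Continuous fun y : Fin d → ℝ => ((t, 𝒯.map K y) : SpaceTime d) :=
    continuous_const.prodMk (𝒯.continuous_map K)
  have hmeas : ∀ e, Measurable fun y => fderiv ℝ b (t, 𝒯.map K y) e := fun e =>
    (measurable_fderiv_apply_const ℝ b e).comp hgc.measurable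
  have hbint : ∀ e, Integrable (fun y => fderiv ℝ b (t, 𝒯.map K y) e) (cubeMeasure d) := fun e =>
    Integrable.of_bound (C := C * ‖e‖) (hmeas e).aestronglyMeasurable
      (Eventually.of_forall fun y => (ContinuousLinearMap.le_opNorm _ _).trans
        (mul_le_mul_of_nonneg_right (norm_fderiv_le_of_lipschitz ℝ hb) (norm_nonneg _)))
  have hae : ∀ e, (fun y => fderiv ℝ a (t, 𝒯.map K y) e) =ᵐ[cubeMeasure d]
      fun y => fderiv ℝ b (t, 𝒯.map K y) e := fun e => by
    filter_upwards [ae_mem_cube] with y hy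
    rw [hfd _ (𝒯.map_mem_openCyl htm K hy)]
  refine ⟨fun e => (hbint e).congr (hae e).symm, ?_, fun i => ?_⟩
  · rw [integral_congr_ae (hae _)]
    have hbc : ∀ τ : ℝ, Continuous fun y : Fin d → ℝ => b (τ, 𝒯.map K y) := fun τ =>
      hb.continuous.comp (continuous_const.prodMk (𝒯.continuous_map K))
    have h0 : HasDerivAt (fun τ => ∫ y, b (τ, 𝒯.map K y) ∂(cubeMeasure d))
        (∫ y, fderiv ℝ b (t, 𝒯.map K y) (timeDir d) ∂(cubeMeasure d)) t := by
      refine (hasDerivAt_integral_of_dominated_loc_of_lip (bound := fun _ => (C : ℝ))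
        (Filter.univ_mem) (Eventually.of_forall fun τ => (hbc τ).aestronglyMeasurable) ?_
        (hmeas _).aestronglyMeasurable (Eventually.of_forall fun y => ?_) (integrable_const _) ?_).2
      · exact (𝒯.integrable_cube_of_continuousOn (f := fun x => b (t, x))
          (hb.continuous.comp (by fun_prop)).continuousOn).1
      · refine (LipschitzWith.of_dist_le_mul fun τ τ' => ?_).lipschitzOnWith
        refine (hb.dist_le_mul _ _).trans ?_
        simp [Prod.dist_eq]
      · filter_upwards [ht] with y hy
        have h1 : HasDerivAt (fun τ : ℝ => ((τ, 𝒯.map K y) : SpaceTime d)) (timeDir d) t :=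
          (hasDerivAt_id t).prodMk (hasDerivAt_const t _)
        exact hy.hasFDerivAt.comp_hasDerivAt t h1
    refine h0.congr_of_eventuallyEq ?_
    filter_upwards [Ioo_mem_nhds htm.1 htm.2] with τ hτ
    refine integral_congr_ae ?_
    filter_upwards [ae_mem_cube] with y hy
    exact hab (𝒯.map_mem_closedCyl (Ioo_subset_Icc_self hτ) K hy)
  · rw [integral_congr_ae (hae _)]
    have hbt : LipschitzWith C fun x : Space d => b (t, x) :=
      LipschitzWith.of_dist_le_mul fun x x' => (hb.dist_le_mul _ _).trans (by simp [Prod.dist_eq])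
    have h1 := integral_face_sub (𝒯.lo_lt_hi K) hbt i
    have e : ∀ s, 𝒯.faceMean K i s (fun x => a (t, x)) =
        ∫ y, b (t, 𝒯.facePoint K i s y) ∂(cubeMeasure d) := fun s => by
      refine integral_congr_ae ?_
      filter_upwards [ae_mem_cube] with y hy
      exact hab (𝒯.facePoint_mem_closedCyl (Ioo_subset_Icc_self htm) K i s hy)
    rw [e, e]
    refine h1.trans ?_
    congr 1
    refine integral_congr_ae ?_
    filter_upwards [ht] with y hy
    have h2 : HasFDerivAt (fun x : Space d => b (t, x))
        ((fderiv ℝ b (t, 𝒯.map K y)).comp (ContinuousLinearMap.inr ℝ ℝ (Space d))) (𝒯.map K y) :=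
      hy.hasFDerivAt.comp (𝒯.map K y) (hasFDerivAt_prodMk_right t _)
    rw [show boxMap (𝒯.lo K) (𝒯.hi K) y = 𝒯.map K y from rfl,
      h2.differentiableAt.lineDeriv_eq_fderiv, h2.fderiv]
    rfl

end RectMesh

variable {d : ℕ} {γ : ℝ}

/-- The conservative state with density `X.1`, velocity `X.2.1` and temperature `X.2.2`. -/
noncomputable def consOf (γ : ℝ) (X : State d) : State d :=
  (X.1, X.1 • X.2.1, 1 / 2 * X.1 * ‖X.2.1‖ ^ 2 + 1 / (γ - 1) * (X.1 * X.2.2))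

theorem stateOf_eq_consOf {r : ℝ} (hr : r ≠ 0) (v : Space d) (s : ℝ) :
    stateOf γ r v s = consOf γ (r, v, temperatureOf γ r s) := by
  refine Prod.ext rfl (Prod.ext rfl ?_)
  simp only [stateOf, consOf, internalEnergyOf, temperatureOf]
  field_simp

theorem velocity_consOf {X : State d} (hr : X.1 ≠ 0) : velocity (consOf γ X) = X.2.1 := by
  simp [velocity, consOf, smul_smul, inv_mul_cancel₀ hr]

theorem pressure_consOf (hγ : 1 < γ) {X : State d} (hr : X.1 ≠ 0) :
    pressure γ (consOf γ X) = X.1 * X.2.2 := by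
  have hg : γ - 1 ≠ 0 := by linarith
  simp only [pressure, consOf, norm_smul, mul_pow, Real.norm_eq_abs, sq_abs]
  field_simp
  ring

theorem temperature_consOf (hγ : 1 < γ) {X : State d} (hr : X.1 ≠ 0) :
    temperature γ (consOf γ X) = X.2.2 := by
  rw [temperature, pressure_consOf hγ hr]
  simp only [consOf]
  field_simp

theorem IsPhysical.consOf (hγ : 1 < γ) {X : State d} (hr : 0 < X.1) (hθ : 0 < X.2.2) :
    IsPhysical γ (consOf γ X) :=
  ⟨hr, by rw [pressure_consOf hγ hr.ne']; positivity⟩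

theorem specEntropy_consOf (hγ : 1 < γ) {X : State d} (hr : 0 < X.1) (hθ : 0 < X.2.2) :
    specEntropy γ (consOf γ X) = log X.2.2 - (γ - 1) * log X.1 := by
  rw [specEntropy_eq (IsPhysical.consOf hγ hr hθ), temperature_consOf hγ hr.ne']
  rfl

theorem densityCoeff_consOf (hγ : 1 < γ) {X : State d} (hr : 0 < X.1) (hθ : 0 < X.2.2) :
    densityCoeff γ (consOf γ X) = 1 / 2 * ‖X.2.1‖ ^ 2
      - X.2.2 / (γ - 1) * (γ - (log X.2.2 - (γ - 1) * log X.1)) := by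
  rw [densityCoeff, velocity_consOf hr.ne', temperature_consOf hγ hr.ne',
    specEntropy_consOf hγ hr hθ]

theorem pressureOf_entropy (hγ : 1 < γ) {W : State d} (hW : IsPhysical γ W) :
    pressureOf γ W.1 (entropy γ W) = pressure γ W := by
  have hg : γ - 1 ≠ 0 := by linarith
  have h1 := hW.1.ne'
  have h2 := Real.rpow_pos_of_pos hW.1 γ
  have : (γ - 1) * entropy γ W / W.1 = log (pressure γ W / W.1 ^ γ) := by
    rw [entropy]; field_simp
  rw [pressureOf, this, Real.exp_log (div_pos hW.2 h2), mul_div_cancel₀ _ h2.ne']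

theorem deriv_internalEnergyOf_right (hγ : 1 < γ) {r : ℝ} (hr : 0 < r) (s : ℝ) :
    deriv (fun b => internalEnergyOf γ r b) s = temperatureOf γ r s := by
  have hg : γ - 1 ≠ 0 := by linarith
  have h : HasDerivAt (fun b => internalEnergyOf γ r b)
      (r ^ γ * (exp ((γ - 1) * s / r) * ((γ - 1) * 1 / r)) / (γ - 1)) s :=
    (((((hasDerivAt_id s).const_mul (γ - 1)).div_const r).exp).const_mul _).div_const _
  rw [h.deriv, temperatureOf, pressureOf]
  field_simp

theorem deriv_internalEnergyOf_left (hγ : 1 < γ) {r : ℝ} (hr : 0 < r) (s : ℝ) :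
    deriv (fun a => internalEnergyOf γ a s) r =
      temperatureOf γ r s / (γ - 1) * (γ - (γ - 1) * s / r) := by
  have hg : γ - 1 ≠ 0 := by linarith
  have h : HasDerivAt (fun a => internalEnergyOf γ a s)
      ((γ * r ^ (γ - 1) * exp ((γ - 1) * s / r) +
        r ^ γ * (exp ((γ - 1) * s / r) * ((γ - 1) * s * -(r ^ 2)⁻¹))) / (γ - 1)) r := by
    have h1 := ((hasDerivAt_inv hr.ne').const_mul ((γ - 1) * s)).exp
    have h2 := ((Real.hasDerivAt_rpow_const (p := γ) (Or.inl hr.ne')).mul h1).div_const (γ - 1)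
    exact h2.congr_of_eventuallyEq (Eventually.of_forall fun a => rfl)
  rw [h.deriv, temperatureOf, pressureOf, Real.rpow_sub_one hr.ne']
  field_simp
  ring

/-- The relative energy in terms of conservative variables. -/
theorem relativeEnergy_eq (hγ : 1 < γ) {W : State d} (hW : IsPhysical γ W) {r : ℝ} (hr : 0 < r)
    (v : Space d) (s : ℝ) :
    relativeEnergy γ W.1 W.2.1 (entropy γ W) r v s = relEnergy γ W (stateOf γ r v s) := by
  have hg : γ - 1 ≠ 0 := by linarith
  have hθ : 0 < temperatureOf γ r s := div_pos
    (mul_pos (Real.rpow_pos_of_pos hr _) (Real.exp_pos _)) hr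
  have hS : log (temperatureOf γ r s) - (γ - 1) * log r = (γ - 1) * s / r := by
    rw [temperatureOf, pressureOf, Real.log_div (by positivity) hr.ne',
      Real.log_mul (by positivity) (Real.exp_pos _).ne', Real.log_exp, Real.log_rpow hr]
    ring
  rw [relativeEnergy, deriv_internalEnergyOf_right hγ hr, deriv_internalEnergyOf_left hγ hr,
    stateOf_eq_consOf hr.ne', relEnergy, pairing_apply, densityCoeff_consOf hγ hr hθ,
    velocity_consOf (X := (r, v, temperatureOf γ r s)) hr.ne',
    temperature_consOf hγ (X := (r, v, temperatureOf γ r s)) hr.ne',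
    pressure_consOf hγ (X := (r, v, temperatureOf γ r s)) hr.ne']
  simp only
  rw [hS, internalEnergyOf, internalEnergyOf, pressureOf_entropy hγ hW,
    energy_eq_pressure hγ (Or.inl hW), momentum_eq (Or.inl hW)]
  have hp : pressureOf γ r s = r * temperatureOf γ r s := by
    rw [temperatureOf, mul_div_cancel₀ _ hr.ne']
  rw [hp, smul_smul, inv_mul_cancel₀ hW.1.ne', one_smul, norm_sub_sq_real, inner_smul_right,
    real_inner_comm v]
  field_simp
  ring

/-- The Euler system in terms of density, velocity and temperature, as a condition on the value
`X` and the derivative `D` of these fields at a point. -/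
structure PrimitiveEuler (γ : ℝ) (X : State d) (D : SpaceTime d →L[ℝ] State d) : Prop where
  mass : (D (1, X.2.1)).1 + X.1 * ∑ i, (D (spaceDir i)).2.1 i = 0
  momentum : ∀ j, X.1 * (D (1, X.2.1)).2.1 j +
    (X.2.2 * (D (spaceDir j)).1 + X.1 * (D (spaceDir j)).2.2) = 0
  energy : (D (1, X.2.1)).2.2 + (γ - 1) * X.2.2 * ∑ i, (D (spaceDir i)).2.1 i = 0

theorem apply_one_vec (D : SpaceTime d →L[ℝ] State d) (v : Space d) :
    D (1, v) = D (timeDir d) + ∑ i, v i • D (spaceDir i) := by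
  conv_lhs => rw [spaceTime_eq_sum ((1, v) : SpaceTime d)]
  simp [map_sum]

theorem flux_consOf (hγ : 1 < γ) {X : State d} (hr : X.1 ≠ 0) (i : Fin d) :
    flux γ (unitVec i) (consOf γ X) =
      (X.1 * X.2.1 i, (X.1 * X.2.1 i) • X.2.1 + (X.1 * X.2.2) • unitVec i,
        X.2.1 i * ((1 / 2 * X.1 * ‖X.2.1‖ ^ 2 + 1 / (γ - 1) * (X.1 * X.2.2)) + X.1 * X.2.2)) := by
  have h1 : inner ℝ X.2.1 (unitVec i) = X.2.1 i := by
    simp [unitVec, EuclideanSpace.inner_single_right]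
  simp only [flux, pressure_consOf hγ hr]
  simp only [consOf, inner_smul_left, h1, smul_smul, conj_trivial]
  refine Prod.ext rfl (Prod.ext ?_ ?_)
  · simp only
    congr 2; field_simp
  · simp only; field_simp

variable {d : ℕ} {γ : ℝ} {X : SpaceTime d → State d} {D : SpaceTime d →L[ℝ] State d}
  {z : SpaceTime d}

theorem _root_.HasFDerivAt.density (h : HasFDerivAt X D z) :
    HasFDerivAt (fun w => (X w).1) ((ContinuousLinearMap.fst ℝ _ _).comp D) z :=
  (ContinuousLinearMap.fst ℝ ℝ (Space d × ℝ)).hasFDerivAt.comp z h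

theorem _root_.HasFDerivAt.velocityField (h : HasFDerivAt X D z) :
    HasFDerivAt (fun w => (X w).2.1)
      (((ContinuousLinearMap.fst ℝ _ _).comp (ContinuousLinearMap.snd ℝ _ _)).comp D) z :=
  ((ContinuousLinearMap.fst ℝ (Space d) ℝ).comp
    (ContinuousLinearMap.snd ℝ ℝ (Space d × ℝ))).hasFDerivAt.comp z h

theorem _root_.HasFDerivAt.velocityCoord (h : HasFDerivAt X D z) (j : Fin d) :
    HasFDerivAt (fun w => (X w).2.1 j) ((PiLp.proj 2 (fun _ : Fin d => ℝ) j).comp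
      (((ContinuousLinearMap.fst ℝ _ _).comp (ContinuousLinearMap.snd ℝ _ _)).comp D)) z :=
  (PiLp.proj (𝕜 := ℝ) 2 (fun _ : Fin d => ℝ) j).hasFDerivAt.comp z h.velocityField

theorem _root_.HasFDerivAt.temperatureField (h : HasFDerivAt X D z) :
    HasFDerivAt (fun w => (X w).2.2)
      (((ContinuousLinearMap.snd ℝ _ _).comp (ContinuousLinearMap.snd ℝ _ _)).comp D) z :=
  ((ContinuousLinearMap.snd ℝ (Space d) ℝ).comp
    (ContinuousLinearMap.snd ℝ ℝ (Space d × ℝ))).hasFDerivAt.comp z h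

/-- The energy of `consOf γ X`. -/
noncomputable def energyOf (γ : ℝ) (X : State d) : ℝ :=
  1 / 2 * X.1 * ‖X.2.1‖ ^ 2 + 1 / (γ - 1) * (X.1 * X.2.2)

theorem fderiv_momentumCoord (h : HasFDerivAt X D z) (j : Fin d) (e : SpaceTime d) :
    fderiv ℝ (fun w => (X w).1 * (X w).2.1 j) z e =
      (X z).1 * (D e).2.1 j + (X z).2.1 j * (D e).1 := by
  refine (DFunLike.congr_fun (h.density.mul (h.velocityCoord j)).fderiv e).trans ?_
  simp

theorem fderiv_momentumFlux (h : HasFDerivAt X D z) (i j : Fin d) (c : ℝ) (e : SpaceTime d) :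
    fderiv ℝ (fun w => (X w).1 * (X w).2.1 i * (X w).2.1 j + (X w).1 * (X w).2.2 * c) z e =
      ((X z).1 * (D e).2.1 i + (X z).2.1 i * (D e).1) * (X z).2.1 j
        + (X z).1 * (X z).2.1 i * (D e).2.1 j
        + ((X z).1 * (D e).2.2 + (X z).2.2 * (D e).1) * c := by
  refine (DFunLike.congr_fun (((h.density.mul (h.velocityCoord i)).mul (h.velocityCoord j)).add
    ((h.density.mul h.temperatureField).mul_const c)).fderiv e).trans ?_
  simp
  ring

theorem hasFDerivAt_energyOf (h : HasFDerivAt X D z) : ∃ E' : SpaceTime d →L[ℝ] ℝ,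
    HasFDerivAt (fun w => energyOf γ (X w)) E' z ∧ ∀ e, E' e =
      1 / 2 * ‖(X z).2.1‖ ^ 2 * (D e).1 + (X z).1 * inner ℝ (X z).2.1 (D e).2.1
        + 1 / (γ - 1) * ((X z).1 * (D e).2.2 + (X z).2.2 * (D e).1) := by
  refine ⟨_, ((h.density.const_mul (1 / 2)).mul h.velocityField.norm_sq).add
    ((h.density.mul h.temperatureField).const_mul (1 / (γ - 1))), fun e => ?_⟩
  simp
  ring

theorem fderiv_energyFlux (h : HasFDerivAt X D z) (i : Fin d) (e : SpaceTime d) :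
    fderiv ℝ (fun w => (X w).2.1 i * (energyOf γ (X w) + (X w).1 * (X w).2.2)) z e =
      (D e).2.1 i * (energyOf γ (X z) + (X z).1 * (X z).2.2) + (X z).2.1 i *
        (1 / 2 * ‖(X z).2.1‖ ^ 2 * (D e).1 + (X z).1 * inner ℝ (X z).2.1 (D e).2.1
        + 1 / (γ - 1) * ((X z).1 * (D e).2.2 + (X z).2.2 * (D e).1)
        + ((X z).1 * (D e).2.2 + (X z).2.2 * (D e).1)) := by
  obtain ⟨E', hE, hE'⟩ := hasFDerivAt_energyOf (γ := γ) h
  refine (DFunLike.congr_fun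
    ((h.velocityCoord i).mul (hE.add (h.density.mul h.temperatureField))).fderiv e).trans ?_
  simp [hE']
  ring

/-- The conservation laws of mass, momentum and energy in primitive variables. -/
theorem PrimitiveEuler.of_conservation (hγ : 1 < γ) (h : HasFDerivAt X D z) (hr : (X z).1 ≠ 0)
    (h1 : fderiv ℝ (fun w => (X w).1) z (timeDir d) +
      ∑ i, fderiv ℝ (fun w => (X w).1 * (X w).2.1 i) z (spaceDir i) = 0)
    (h2 : ∀ j, fderiv ℝ (fun w => (X w).1 * (X w).2.1 j) z (timeDir d) +
      ∑ i, fderiv ℝ (fun w => (X w).1 * (X w).2.1 i * (X w).2.1 j +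
        (X w).1 * (X w).2.2 * if i = j then 1 else 0) z (spaceDir i) = 0)
    (h3 : fderiv ℝ (fun w => energyOf γ (X w)) z (timeDir d) +
      ∑ i, fderiv ℝ (fun w => (X w).2.1 i * (energyOf γ (X w) + (X w).1 * (X w).2.2)) z
        (spaceDir i) = 0) : PrimitiveEuler γ (X z) D := by
  have hg : γ - 1 ≠ 0 := by linarith
  obtain ⟨E', hE, hE'⟩ := hasFDerivAt_energyOf (γ := γ) h
  rw [h.density.fderiv] at h1
  simp only [fderiv_momentumCoord h, fderiv_momentumFlux h, fderiv_energyFlux h, hE.fderiv, hE',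
    ContinuousLinearMap.comp_apply, ContinuousLinearMap.coe_fst'] at h1 h2 h3
  have hR : (D (1, (X z).2.1)).1 = (D (timeDir d)).1 +
      ∑ i, (X z).2.1 i * (D (spaceDir i)).1 := by
    rw [apply_one_vec]; simp [Prod.fst_sum]
  have hV : ∀ j, (D (1, (X z).2.1)).2.1 j = (D (timeDir d)).2.1 j +
      ∑ i, (X z).2.1 i * (D (spaceDir i)).2.1 j := fun j => by
    rw [apply_one_vec]; simp [Prod.fst_sum, Prod.snd_sum]
  have hΘ : (D (1, (X z).2.1)).2.2 = (D (timeDir d)).2.2 +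
      ∑ i, (X z).2.1 i * (D (spaceDir i)).2.2 := by
    rw [apply_one_vec]; simp [Prod.snd_sum]
  have hI : inner ℝ (X z).2.1 (D (1, (X z).2.1)).2.1 = inner ℝ (X z).2.1 (D (timeDir d)).2.1 +
      ∑ i, (X z).2.1 i * inner ℝ (X z).2.1 (D (spaceDir i)).2.1 := by
    rw [apply_one_vec]
    simp [Prod.fst_sum, Prod.snd_sum, inner_add_right, inner_sum, inner_smul_right]
  have hmass : (D (1, (X z).2.1)).1 + (X z).1 * ∑ i, (D (spaceDir i)).2.1 i = 0 := by
    rw [hR, ← h1, Finset.sum_add_distrib, Finset.mul_sum]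
    ring
  have hmom : ∀ j, (X z).1 * (D (1, (X z).2.1)).2.1 j +
      ((X z).2.2 * (D (spaceDir j)).1 + (X z).1 * (D (spaceDir j)).2.2) = 0 := fun j => by
    have e1 : ∑ i, (((X z).1 * (D (spaceDir i)).2.1 i + (X z).2.1 i * (D (spaceDir i)).1) *
          (X z).2.1 j + (X z).1 * (X z).2.1 i * (D (spaceDir i)).2.1 j +
        ((X z).1 * (D (spaceDir i)).2.2 + (X z).2.2 * (D (spaceDir i)).1) *
          (if i = j then 1 else 0)) =
        (X z).2.1 j * ((X z).1 * ∑ i, (D (spaceDir i)).2.1 i +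
          ∑ i, (X z).2.1 i * (D (spaceDir i)).1) +
        (X z).1 * ∑ i, (X z).2.1 i * (D (spaceDir i)).2.1 j +
        ((X z).1 * (D (spaceDir j)).2.2 + (X z).2.2 * (D (spaceDir j)).1) := by
      simp only [Finset.mul_sum, ← Finset.sum_add_distrib, mul_ite, mul_one, mul_zero]
      rw [Finset.sum_add_distrib, Finset.sum_ite_eq' Finset.univ j, if_pos (Finset.mem_univ j)]
      congr 1
      exact Finset.sum_congr rfl fun i _ => by ring
    have e2 := h2 j
    rw [e1] at e2
    rw [hR] at hmass
    rw [hV]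
    linear_combination e2 - (X z).2.1 j * hmass
  refine ⟨hmass, hmom, ?_⟩
  have e1 : ∑ i, ((D (spaceDir i)).2.1 i * (energyOf γ (X z) + (X z).1 * (X z).2.2) +
      (X z).2.1 i * (1 / 2 * ‖(X z).2.1‖ ^ 2 * (D (spaceDir i)).1 +
        (X z).1 * inner ℝ (X z).2.1 (D (spaceDir i)).2.1 +
        1 / (γ - 1) * ((X z).1 * (D (spaceDir i)).2.2 + (X z).2.2 * (D (spaceDir i)).1) +
        ((X z).1 * (D (spaceDir i)).2.2 + (X z).2.2 * (D (spaceDir i)).1))) =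
      (energyOf γ (X z) + (X z).1 * (X z).2.2) * ∑ i, (D (spaceDir i)).2.1 i +
      1 / 2 * ‖(X z).2.1‖ ^ 2 * ∑ i, (X z).2.1 i * (D (spaceDir i)).1 +
      (X z).1 * ∑ i, (X z).2.1 i * inner ℝ (X z).2.1 (D (spaceDir i)).2.1 +
      (1 / (γ - 1) + 1) * ((X z).1 * ∑ i, (X z).2.1 i * (D (spaceDir i)).2.2 +
        (X z).2.2 * ∑ i, (X z).2.1 i * (D (spaceDir i)).1) := by
    simp only [Finset.mul_sum, ← Finset.sum_add_distrib]
    exact Finset.sum_congr rfl fun i _ => by ring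
  have e2 : (X z).1 * inner ℝ (X z).2.1 (D (1, (X z).2.1)).2.1 +
      ((X z).2.2 * ∑ i, (X z).2.1 i * (D (spaceDir i)).1 +
        (X z).1 * ∑ i, (X z).2.1 i * (D (spaceDir i)).2.2) = 0 := by
    simp only [PiLp.inner_apply, Finset.mul_sum, ← Finset.sum_add_distrib]
    refine Finset.sum_eq_zero fun j _ => ?_
    simp only [RCLike.inner_apply, conj_trivial]
    linear_combination (X z).2.1 j * hmom j
  rw [e1] at h3
  rw [hI] at e2
  rw [hR] at hmass
  rw [hΘ]
  have e3 : (X z).1 * (1 / (γ - 1)) * ((D (timeDir d)).2.2 +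
      ∑ i, (X z).2.1 i * (D (spaceDir i)).2.2 +
      (γ - 1) * (X z).2.2 * ∑ i, (D (spaceDir i)).2.1 i) = 0 := by
    rw [energyOf] at h3
    have : (X z).1 * (1 / (γ - 1)) * ((γ - 1) * (X z).2.2 * ∑ i, (D (spaceDir i)).2.1 i) =
      (X z).1 * (X z).2.2 * ∑ i, (D (spaceDir i)).2.1 i := by field_simp
    rw [mul_add, this]
    linear_combination h3 - e2 - (1 / 2 * ‖(X z).2.1‖ ^ 2 + 1 / (γ - 1) * (X z).2.2) * hmass
  have : (X z).1 * (1 / (γ - 1)) ≠ 0 := mul_ne_zero hr (one_div_ne_zero hg)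
  exact (mul_eq_zero.1 e3).resolve_left this

variable {d : ℕ} {γ : ℝ} {Ω : Set (Space d)}

/-- Bounded primitive states away from vacuum. -/
def primBox (d : ℕ) (A : ℝ) : Set (State d) := Icc A⁻¹ A ×ˢ (Metric.closedBall 0 A ×ˢ Icc A⁻¹ A)

theorem mem_primBox {A : ℝ} {X : State d} : X ∈ primBox d A ↔
    (A⁻¹ ≤ X.1 ∧ X.1 ≤ A) ∧ ‖X.2.1‖ ≤ A ∧ A⁻¹ ≤ X.2.2 ∧ X.2.2 ≤ A := by
  simp [primBox, Set.mem_prod]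

theorem convex_primBox (A : ℝ) : Convex ℝ (primBox d A) :=
  (convex_Icc _ _).prod ((convex_closedBall _ _).prod (convex_Icc _ _))

theorem isCompact_primBox (A : ℝ) : IsCompact (primBox d A) :=
  isCompact_Icc.prod ((isCompact_closedBall _ _).prod isCompact_Icc)

theorem exists_lipschitz_comp {E : Type*} [NormedAddCommGroup E] [NormedSpace ℝ E]
    {Φ : State d → E} {B : Set (State d)} (hΦ : ContDiffOn ℝ 1 Φ B) (hB : Convex ℝ B)
    (hB' : IsCompact B) (C : ℝ≥0) : ∃ C' : ℝ≥0, ∀ (S : Set (SpaceTime d)) (X : SpaceTime d → State d),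
      LipschitzOnWith C X S → MapsTo X S B → LipschitzOnWith C' (fun z => Φ (X z)) S := by
  obtain ⟨K, hK⟩ := hΦ.exists_lipschitzOnWith one_ne_zero hB hB'
  exact ⟨K * C, fun S X hX hS => hK.comp hX hS⟩

/-- Density, velocity and temperature solve the Euler system in primitive variables on the cells
of a mesh, are bounded, Lipschitz continuous and satisfy the impermeability condition. -/
structure IsPrimitiveSolution (γ A : ℝ) (C : ℝ≥0) (T : ℝ) (𝒯 : RectMesh d Ω)
    (X : SpaceTime d → State d) : Prop where
  mem_box : ∀ K, MapsTo X (𝒯.closedCyl T K) (primBox d A)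
  lipschitz : ∀ K, LipschitzOnWith C X (𝒯.closedCyl T K)
  euler : ∀ K, ∀ᵐ z ∂(volume.restrict (𝒯.openCyl T K)),
    DifferentiableAt ℝ X z ∧ PrimitiveEuler γ (X z) (fderiv ℝ X z)
  impermeable : ∀ t ∈ Icc 0 T, ∀ K i s, 𝒯.IsWall K i s →
    ∀ᵐ y ∂(cubeMeasure d), (X (t, 𝒯.facePoint K i s y)).2.1 i = 0

theorem norm_le_sum_abs (x : Space d) : ‖x‖ ≤ ∑ j, |x j| := by
  have h : x = ∑ j, x j • unitVec j := by
    ext k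
    simp [unitVec, Finset.sum_apply, Pi.single_apply]
  calc ‖x‖ = ‖∑ j, x j • unitVec j‖ := by rw [← h]
    _ ≤ ∑ j, ‖x j • (unitVec j : Space d)‖ := norm_sum_le _ _
    _ = ∑ j, |x j| := Finset.sum_congr rfl fun j _ => by
      rw [norm_smul, norm_unitVec, mul_one, Real.norm_eq_abs]

theorem W1infLE.mono {O : Set (SpaceTime d)} {f : SpaceTime d → ℝ} {M M' : ℝ}
    (h : W1infLE O f M) (hM : M ≤ M') : W1infLE O f M' := by
  obtain ⟨h1, ⟨g, hg, hgM⟩, h3⟩ := h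
  refine ⟨h1.mono fun z hz => hz.trans hM, ⟨g, hg, hgM.mono fun z hz => hz.trans hM⟩, fun i => ?_⟩
  obtain ⟨g, hg, hgM⟩ := h3 i
  exact ⟨g, hg, hgM.mono fun z hz => hz.trans hM⟩

/-- Primitive variables. -/
noncomputable def primOf (γ : ℝ) (U : State d) : State d :=
  (U.1, U.1⁻¹ • U.2.1, (γ - 1) * (U.2.2 - ‖U.2.1‖ ^ 2 * (2 * U.1)⁻¹) * U.1⁻¹)

theorem primOf_consOf (hγ : 1 < γ) {X : State d} (hr : X.1 ≠ 0) : primOf γ (consOf γ X) = X := by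
  refine Prod.ext rfl (Prod.ext (velocity_consOf (γ := γ) hr) ?_)
  have := temperature_consOf hγ hr
  rwa [temperature, pressure, div_eq_mul_inv, div_eq_mul_inv] at this

theorem contDiffOn_primOf {B : Set (State d)} (hB : ∀ U ∈ B, U.1 ≠ 0) :
    ContDiffOn ℝ 1 (primOf γ) B := by
  have h1 : ContDiffOn ℝ 1 (fun U : State d => U.1⁻¹) B := contDiffOn_fst.inv hB
  have h2 : ContDiffOn ℝ 1 (fun U : State d => (2 * U.1)⁻¹) B :=
    (contDiffOn_const.mul contDiffOn_fst).inv fun U hU => mul_ne_zero two_ne_zero (hB U hU)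
  have h3 : ContDiff ℝ 1 fun U : State d => U.2.1 := contDiff_fst.comp contDiff_snd
  have h4 : ContDiff ℝ 1 fun U : State d => U.2.2 := contDiff_snd.comp contDiff_snd
  exact contDiffOn_fst.prodMk ((h1.smul h3.contDiffOn).prodMk
    ((contDiffOn_const.mul (h4.contDiffOn.sub ((h3.norm_sq ℝ).contDiffOn.mul h2))).mul h1))

theorem contDiff_energyOf : ContDiff ℝ 1 (energyOf (d := d) γ) := by
  have h1 : ContDiff ℝ 1 fun U : State d => U.1 := contDiff_fst
  have h3 : ContDiff ℝ 1 fun U : State d => U.2.1 := contDiff_fst.comp contDiff_snd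
  have h4 : ContDiff ℝ 1 fun U : State d => U.2.2 := contDiff_snd.comp contDiff_snd
  exact ((contDiff_const.mul h1).mul (h3.norm_sq ℝ)).add (contDiff_const.mul (h1.mul h4))

theorem contDiff_velocityCoord (j : Fin d) : ContDiff ℝ 1 fun U : State d => U.2.1 j :=
  (PiLp.proj (𝕜 := ℝ) 2 (fun _ : Fin d => ℝ) j).contDiff.comp (contDiff_fst.comp contDiff_snd)

theorem IsStrongSolution.continuousOn_stateOf {T : ℝ} {ρ : SpaceTime d → ℝ}
    {u : SpaceTime d → Space d} {η : SpaceTime d → ℝ} (h : IsStrongSolution γ Ω T ρ u η) :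
    ContinuousOn (fun z => stateOf γ (ρ z) (u z) (η z)) (closedCylinder Ω T) := by
  have h1 := h.continuousOn_density
  have h2 := h.continuousOn_velocity
  have h3 := h.continuousOn_entropy
  have h4 : ContinuousOn (fun z => ρ z ^ γ) (closedCylinder Ω T) :=
    h1.rpow_const fun z hz => Or.inl (h.density_pos z hz).ne'
  have h5 : ContinuousOn (fun z => exp ((γ - 1) * η z / ρ z)) (closedCylinder Ω T) :=
    ((continuousOn_const.mul h3).div h1 fun z hz => (h.density_pos z hz).ne').rexp
  exact h1.prodMk ((h1.smul h2).prodMk (((continuousOn_const.mul h1).mul (h2.norm.pow 2)).add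
    ((h4.mul h5).div_const _)))

theorem ConservationLaw.fderiv_eq {Q O : Set (SpaceTime d)} {f₀ k₀ : SpaceTime d → ℝ}
    {f k : Fin d → SpaceTime d → ℝ} (h : ConservationLaw Q f₀ f) (hO : IsOpen O) (hOQ : O ⊆ Q)
    (h0 : EqOn f₀ k₀ O) (h1 : ∀ i, EqOn (f i) (k i) O)
    (hk₀ : ∃ C, LipschitzOnWith C k₀ O) (hk : ∀ i, ∃ C, LipschitzOnWith C (k i) O) :
    ∀ᵐ z ∂(volume.restrict O),
      fderiv ℝ k₀ z (timeDir d) + ∑ i, fderiv ℝ (k i) z (spaceDir i) = 0 := by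
  obtain ⟨g₀, g, hg₀, hg, he⟩ := h
  have hcongr : ∀ {a b : SpaceTime d → ℝ}, EqOn a b O → (∃ C, LipschitzOnWith C b O) →
      (∃ C, LipschitzOnWith C a O) ∧ ∀ z ∈ O, fderiv ℝ a z = fderiv ℝ b z := by
    rintro a b hab ⟨C, hC⟩
    refine ⟨⟨C, fun x hx y hy => ?_⟩, fun z hz => Filter.EventuallyEq.fderiv_eq ?_⟩
    · rw [hab hx, hab hy]; exact hC hx hy
    · filter_upwards [hO.mem_nhds hz] with w hw using hab hw
  obtain ⟨⟨C₀, hC₀⟩, e₀⟩ := hcongr h0 hk₀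
  have h2 := hg₀.ae_eq_fderiv hO hOQ hC₀
  have h3 : ∀ᵐ z ∂(volume.restrict O), ∀ i, g i z = fderiv ℝ (f i) z (spaceDir i) :=
    ae_all_iff.2 fun i => by
      obtain ⟨⟨C, hC⟩, -⟩ := hcongr (h1 i) (hk i)
      exact (hg i).ae_eq_fderiv hO hOQ hC
  filter_upwards [h2, h3, ae_restrict_of_ae_restrict_of_subset hOQ he,
    ae_restrict_mem hO.measurableSet] with z hz2 hz3 hz4 hzO
  rw [← hz4, hz2, e₀ z hzO]
  congr 1
  exact Finset.sum_congr rfl fun i _ => by rw [hz3, (hcongr (h1 i) (hk i)).2 z hzO]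

theorem lipschitzOnWith_state {S : Set (SpaceTime d)} {U : SpaceTime d → State d} {L : ℝ≥0}
    (h1 : LipschitzOnWith L (fun z => (U z).1) S)
    (h2 : ∀ j : Fin d, LipschitzOnWith L (fun z => (U z).2.1 j) S)
    (h3 : LipschitzOnWith L (fun z => (U z).2.2) S) : LipschitzOnWith ((1 + d) * L) U S := by
  refine LipschitzOnWith.of_dist_le_mul fun z hz w hw => ?_
  have hD : 0 ≤ L * dist z w := by positivity
  have e1 := h1.dist_le_mul z hz w hw
  have e3 := h3.dist_le_mul z hz w hw
  have e2 : dist (U z).2.1 (U w).2.1 ≤ d * (L * dist z w) := by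
    rw [dist_eq_norm]
    refine (norm_le_sum_abs _).trans ((Finset.sum_le_card_nsmul _ _ (L * dist z w)
      fun j _ => ?_).trans (by simp))
    exact (h2 j).dist_le_mul z hz w hw
  have hd : (0 : ℝ) ≤ d * (L * dist z w) := by positivity
  have e : (((1 + d) * L : ℝ≥0) : ℝ) * dist z w = L * dist z w + d * (L * dist z w) := by
    push_cast; ring
  rw [e, Prod.dist_eq, Prod.dist_eq]
  exact max_le (by linarith) (max_le (by linarith) (by linarith))

theorem exists_isPrimitiveSolution (hγ : 1 < γ) (hΩo : IsOpen Ω) (hΩ : interior (closure Ω) = Ω)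
    (M : ℝ) {r₀ θ₀ : ℝ} (hr₀ : 0 < r₀) (hθ₀ : 0 < θ₀) :
    ∃ A : ℝ, 1 ≤ A ∧ ∃ C : ℝ≥0, ∀ T : ℝ, 0 < T →
      ∀ (ρ : SpaceTime d → ℝ) (u : SpaceTime d → Space d) (η : SpaceTime d → ℝ),
        IsStrongSolution γ Ω T ρ u η →
        StateW1infLE (cylinder Ω T) (fun z => stateOf γ (ρ z) (u z) (η z)) M →
        (∀ z ∈ closedCylinder Ω T, r₀ ≤ ρ z ∧ θ₀ ≤ temperatureOf γ (ρ z) (η z)) →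
        ∀ 𝒯 : RectMesh d Ω, IsPrimitiveSolution γ A C T 𝒯
          (fun z => (ρ z, u z, temperatureOf γ (ρ z) (η z))) := by
  have hg : 0 < γ - 1 := by linarith
  set M' := max M 1 with hM'
  have hM0 : 0 < M' := lt_max_of_lt_right one_pos
  set A := 1 + r₀⁻¹ + θ₀⁻¹ + M' + d * M' / r₀ + (γ - 1) * M' / r₀ with hA
  have a1 : 0 < r₀⁻¹ := inv_pos.2 hr₀
  have a2 : 0 < θ₀⁻¹ := inv_pos.2 hθ₀
  have a3 : 0 ≤ d * M' / r₀ := by positivity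
  have a4 : 0 ≤ (γ - 1) * M' / r₀ := by positivity
  have hA1 : 1 ≤ A := by linarith
  have hA0 : 0 < A := by linarith
  let B : Set (State d) := Icc r₀ M' ×ˢ (Metric.closedBall 0 (d * M') ×ˢ Icc (-M') M')
  have hBc : Convex ℝ B := (convex_Icc _ _).prod ((convex_closedBall _ _).prod (convex_Icc _ _))
  have hBk : IsCompact B := isCompact_Icc.prod ((isCompact_closedBall _ _).prod isCompact_Icc)
  set L : ℝ≥0 := Real.toNNReal ((d + 1) * M')
  obtain ⟨C, hC⟩ := exists_lipschitz_comp (contDiffOn_primOf (γ := γ) (B := B)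
    fun U hU => (hr₀.trans_le hU.1.1).ne') hBc hBk ((1 + d) * L)
  refine ⟨A, hA1, C, fun T hT ρ u η hs hW hlow 𝒯 => ?_⟩
  set X : SpaceTime d → State d := fun z => (ρ z, u z, temperatureOf γ (ρ z) (η z)) with hX
  have hcons : ∀ z ∈ closedCylinder Ω T, stateOf γ (ρ z) (u z) (η z) = consOf γ (X z) :=
    fun z hz => stateOf_eq_consOf (hs.density_pos z hz).ne' _ _
  have hprim : ∀ z ∈ closedCylinder Ω T, primOf γ (stateOf γ (ρ z) (u z) (η z)) = X z :=
    fun z hz => by rw [hcons z hz, primOf_consOf hγ (hs.density_pos z hz).ne']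
  obtain ⟨hW1, hW2, hW3⟩ := hW
  have hM : M ≤ M' := le_max_left _ _
  have hcont := hs.continuousOn_stateOf
  have hcomp : ∀ (K : Fin 𝒯.N) (f : State d → ℝ), Continuous f →
      W1infLE (cylinder Ω T) (fun z => f (stateOf γ (ρ z) (u z) (η z))) M →
      LipschitzOnWith L (fun z => f (stateOf γ (ρ z) (u z) (η z))) (𝒯.closedCyl T K) ∧
        ∀ z ∈ 𝒯.closedCyl T K, |f (stateOf γ (ρ z) (u z) (η z))| ≤ M' := fun K f hf hw => by
    have hcl : ContinuousOn (fun z => f (stateOf γ (ρ z) (u z) (η z))) (closure (𝒯.openCyl T K)) :=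
      hf.comp_continuousOn (hcont.mono
        ((𝒯.closure_openCyl_subset T K).trans (𝒯.closedCyl_subset T K)))
    have hw' := hw.mono hM
    have hOQ := 𝒯.openCyl_subset hΩ T K
    have hsub := 𝒯.closedCyl_subset_closure hT K
    exact ⟨(hw'.lipschitzOnWith hM0.le (𝒯.isOpen_openCyl T K) (𝒯.convex_openCyl T K) hOQ hcl).mono
        hsub, fun z hz => abs_le_of_ae (𝒯.isOpen_openCyl T K) hcl
          (ae_restrict_of_ae_restrict_of_subset hOQ hw'.1) z (hsub hz)⟩
  have hc1 := fun K => hcomp K (fun U => U.1) continuous_fst hW1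
  have hc2 := fun K j => hcomp K (fun U => U.2.1 j)
    (contDiff_velocityCoord j).continuous (hW2 j)
  have hc3 := fun K => hcomp K (fun U => U.2.2) (continuous_snd.comp continuous_snd) hW3
  have hBmem : ∀ K, MapsTo (fun z => stateOf γ (ρ z) (u z) (η z)) (𝒯.closedCyl T K) B :=
    fun K z hz => by
      refine ⟨⟨(hlow z (𝒯.closedCyl_subset T K hz)).1, (abs_le.1 ((hc1 K).2 z hz)).2⟩, ?_,
        abs_le.1 ((hc3 K).2 z hz)⟩
      rw [mem_closedBall_zero_iff]
      exact (norm_le_sum_abs _).trans ((Finset.sum_le_card_nsmul _ _ M'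
        fun j _ => (hc2 K j).2 z hz).trans (by simp))
  have hbox : ∀ K, MapsTo X (𝒯.closedCyl T K) (primBox d A) := fun K z hz => by
    have hz' := 𝒯.closedCyl_subset T K hz
    obtain ⟨h1, h2⟩ := hlow z hz'
    have hρ : 0 < ρ z := hr₀.trans_le h1
    have hθ : 0 < temperatureOf γ (ρ z) (η z) := hθ₀.trans_le h2
    obtain ⟨b1, b2, b3⟩ := hBmem K hz
    simp only [hcons z hz', mem_closedBall_zero_iff] at b1 b2 b3
    simp only [consOf, norm_smul, Real.norm_eq_abs, abs_of_pos hρ, hX] at b1 b2 b3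
    refine mem_primBox.2 ⟨⟨?_, b1.2.trans (by linarith)⟩, ?_, ?_, ?_⟩
    · refine (inv_le_of_inv_le₀ hr₀ ?_).trans h1; linarith
    · have : ‖u z‖ ≤ d * M' / r₀ := by
        rw [le_div_iff₀ hr₀]; nlinarith [norm_nonneg (u z)]
      simp only [hX]; linarith
    · refine (inv_le_of_inv_le₀ hθ₀ ?_).trans h2; linarith
    · have : temperatureOf γ (ρ z) (η z) ≤ (γ - 1) * M' / r₀ := by
        rw [le_div_iff₀ hr₀]
        have e1 := b3.2
        have e2 : 1 / (γ - 1) * (ρ z * temperatureOf γ (ρ z) (η z)) ≤ M' := by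
          have : 0 ≤ 1 / 2 * ρ z * ‖u z‖ ^ 2 := by positivity
          linarith
        rw [one_div, inv_mul_le_iff₀ hg] at e2
        nlinarith
      simp only [hX]; linarith
  have hlip : ∀ K, LipschitzOnWith C X (𝒯.closedCyl T K) := fun K => by
    have := hC _ _ (lipschitzOnWith_state (hc1 K).1 (fun j => (hc2 K j).1) (hc3 K).1) (hBmem K)
    intro z hz w hw
    rw [← hprim z (𝒯.closedCyl_subset T K hz), ← hprim w (𝒯.closedCyl_subset T K hw)]
    exact this hz hw
  refine ⟨hbox, hlip, fun K => ?_, fun t ht K i s hw => ?_⟩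
  · set O := 𝒯.openCyl T K
    have hOc : O ⊆ 𝒯.closedCyl T K := 𝒯.openCyl_subset_closedCyl T K
    have hOo : IsOpen O := 𝒯.isOpen_openCyl T K
    have hOQ : O ⊆ cylinder Ω T := 𝒯.openCyl_subset hΩ T K
    have hpos : ∀ z ∈ O, (X z).1 ≠ 0 := fun z hz =>
      (hs.density_pos z (𝒯.closedCyl_subset T K (hOc hz))).ne'
    have hcO : ∀ z ∈ O, stateOf γ (ρ z) (u z) (η z) = consOf γ (X z) := fun z hz =>
      hcons z (𝒯.closedCyl_subset T K (hOc hz))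
    have hlipc : ∀ Φ : State d → ℝ, ContDiff ℝ 1 Φ →
        ∃ C, LipschitzOnWith C (fun z => Φ (X z)) O := fun Φ hΦ => by
      obtain ⟨C', hC'⟩ := exists_lipschitz_comp hΦ.contDiffOn (convex_primBox A)
        (isCompact_primBox A) C
      exact ⟨C', (hC' _ X (hlip K) (hbox K)).mono hOc⟩
    have p1 : ContDiff ℝ 1 fun X : State d => X.1 := contDiff_fst
    have p2 := fun j => contDiff_velocityCoord (d := d) j
    have p3 : ContDiff ℝ 1 fun X : State d => X.2.2 := contDiff_snd.comp contDiff_snd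
    have p4 := contDiff_energyOf (d := d) (γ := γ)
    have m1 := hs.mass.fderiv_eq hOo hOQ (k₀ := fun w => (X w).1)
      (k := fun i w => (X w).1 * (X w).2.1 i) (fun z _ => rfl)
      (fun i z hz => by simp only [hcO z hz, flux_consOf hγ (hpos z hz)])
      (hlipc _ p1) (fun i => hlipc _ (p1.mul (p2 i)))
    have m2 : ∀ᵐ z ∂(volume.restrict O), ∀ j, _ := ae_all_iff.2 fun j =>
      (hs.momentum j).fderiv_eq hOo hOQ (k₀ := fun w => (X w).1 * (X w).2.1 j)
      (k := fun i w => (X w).1 * (X w).2.1 i * (X w).2.1 j +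
        (X w).1 * (X w).2.2 * if i = j then 1 else 0)
      (fun z hz => by simp only [hcO z hz]; simp [consOf])
      (fun i z hz => by
        simp only [hcO z hz, flux_consOf hγ (hpos z hz)]
        by_cases hij : i = j
        · simp [unitVec, hij]
        · simp [unitVec, hij, Ne.symm hij])
      (hlipc _ (p1.mul (p2 j))) (fun i => hlipc _
        (((p1.mul (p2 i)).mul (p2 j)).add ((p1.mul p3).mul contDiff_const)))
    have m3 := hs.energy.fderiv_eq hOo hOQ (k₀ := fun w => energyOf γ (X w))
      (k := fun i w => (X w).2.1 i * (energyOf γ (X w) + (X w).1 * (X w).2.2))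
      (fun z hz => by simp only [hcO z hz]; rfl)
      (fun i z hz => by simp only [hcO z hz, flux_consOf hγ (hpos z hz)]; rfl)
      (hlipc _ p4) (fun i => hlipc _ ((p2 i).mul (p4.add (p1.mul p3))))
    have m4 := ((hlip K).mono hOc).ae_differentiableWithinAt hOo.measurableSet (μ := volume)
    filter_upwards [m1, m2, m3, m4, ae_restrict_mem hOo.measurableSet] with z h1 h2 h3 h4 hz
    have h5 : DifferentiableAt ℝ X z := h4.differentiableAt (hOo.mem_nhds hz)
    exact ⟨h5, .of_conservation hγ h5.hasFDerivAt (hpos z hz) h1 h2 h3⟩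
  · filter_upwards [𝒯.ae_outerNormal hΩo hΩ hw] with y hy
    have := hs.impermeable t ht _ hy.1 _ hy.2
    rw [wallNormal] at this
    cases s <;> simpa [unitVec, EuclideanSpace.inner_single_right] using this

variable {d : ℕ} {γ : ℝ}

theorem sq_mul_exp_le_sq_exp_sub_one {x y K : ℝ} (hK : 0 ≤ K) (hy : -K ≤ y)
    (h : (0 ≤ y ∧ y / 2 ≤ x) ∨ (y ≤ 0 ∧ x ≤ y / 2)) :
    y ^ 2 ≤ 16 * exp (K / 2) * (exp (x / 2) - 1) ^ 2 := by
  have hE : 1 ≤ exp (K / 2) := Real.one_le_exp (by positivity)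
  rcases h with ⟨h1, h2⟩ | ⟨h1, h2⟩
  · have h3 := Real.add_one_le_exp (x / 2)
    have h4 : y / 4 ≤ exp (x / 2) - 1 := by linarith
    have h5 : (y / 4) ^ 2 ≤ (exp (x / 2) - 1) ^ 2 := by gcongr
    nlinarith [sq_nonneg (exp (x / 2) - 1)]
  · have h3 := Real.add_one_le_exp (-y / 4)
    have h4 : exp (x / 2) ≤ exp (y / 4) := Real.exp_le_exp.2 (by linarith)
    have h5 : exp (-K / 4) ≤ exp (y / 4) := Real.exp_le_exp.2 (by linarith)
    have h6 : exp (y / 4) * exp (-y / 4) = 1 := by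
      rw [← Real.exp_add]; ring_nf; exact Real.exp_zero
    have h7 : exp (K / 2) * exp (-K / 4) ^ 2 = 1 := by
      rw [← Real.exp_nat_mul, ← Real.exp_add]; push_cast; ring_nf; exact Real.exp_zero
    have h8 : -y / 4 * exp (-K / 4) ≤ 1 - exp (x / 2) := by
      have := Real.exp_pos (y / 4)
      nlinarith
    have h9 : (-y / 4 * exp (-K / 4)) ^ 2 ≤ (1 - exp (x / 2)) ^ 2 := by
      refine pow_le_pow_left₀ (mul_nonneg (by linarith) (Real.exp_pos _).le) h8 2
    calc y ^ 2 = 16 * exp (K / 2) * (-y / 4 * exp (-K / 4)) ^ 2 := by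
          linear_combination (-y ^ 2) * h7
      _ ≤ _ := by
          rw [show (exp (x / 2) - 1) ^ 2 = (1 - exp (x / 2)) ^ 2 by ring]
          gcongr

theorem sqrt_eq_mul_exp_log {a b : ℝ} (ha : 0 < a) (hb : 0 < b) :
    √a = √b * exp ((log a - log b) / 2) := by
  rw [sub_div, Real.exp_sub, ← Real.log_sqrt ha.le, ← Real.log_sqrt hb.le,
    Real.exp_log (Real.sqrt_pos.2 ha), Real.exp_log (Real.sqrt_pos.2 hb),
    mul_div_cancel₀ _ (Real.sqrt_pos.2 hb).ne']

/-- The relative energy controls the deviation of the specific entropy, as long as the latter is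
bounded from below. -/
theorem density_mul_specEntropy_sub_sq_le (hγ : 1 < γ) (hγ2 : γ ≤ 2) {A K : ℝ}
    (hK : 0 ≤ K) {W U : State d} (hW : IsPhysical γ W) (hU : StateBdd γ A U)
    (hS : specEntropy γ U - K ≤ specEntropy γ W) :
    W.1 * (specEntropy γ W - specEntropy γ U) ^ 2 ≤
      16 * A * exp (K / 2) * relEnergy γ W U := by
  have hρ := hW.1
  have hr := hU.physical.1
  have hΘ := temperature_pos hW
  have hθ := temperature_pos hU.physical
  have hg : 0 < γ - 1 := by linarith
  have hA : 0 < A := hr.trans_le hU.density_le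
  have hθA : 1 ≤ A * temperature γ U := by
    have := mul_le_mul_of_nonneg_left hU.temperature_ge hA.le
    rwa [mul_inv_cancel₀ hA.ne'] at this
  have hle := le_relEnergy hγ (Or.inl hW) hU.physical
  have hE := Real.exp_pos (K / 2)
  set x := log (temperature γ W) - log (temperature γ U) with hx
  set b := log U.1 - log W.1 with hb
  set y := specEntropy γ W - specEntropy γ U with hy
  have hxy : y = x + (γ - 1) * b := by
    rw [hy, specEntropy_eq hW, specEntropy_eq hU.physical, hx, hb]; ring
  have e1 : (√(temperature γ W) - √(temperature γ U)) ^ 2 =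
      temperature γ U * (exp (x / 2) - 1) ^ 2 := by
    rw [sqrt_eq_mul_exp_log hΘ hθ, ← hx]
    linear_combination (exp (x / 2) - 1) ^ 2 * Real.sq_sqrt hθ.le
  have e2 : (√W.1 - √U.1) ^ 2 = W.1 * (exp (b / 2) - 1) ^ 2 := by
    rw [sqrt_eq_mul_exp_log hr hρ, ← hb]
    linear_combination (exp (b / 2) - 1) ^ 2 * Real.sq_sqrt hρ.le
  rw [e1, e2] at hle
  have n0 : 0 ≤ 1 / 2 * W.1 * ‖velocity W - velocity U‖ ^ 2 := by positivity
  have hcv : 1 ≤ 1 / (γ - 1) := by rw [le_div_iff₀ hg]; linarith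
  have n1 : W.1 * (temperature γ U * (exp (x / 2) - 1) ^ 2) ≤
      1 / (γ - 1) * W.1 * (temperature γ U * (exp (x / 2) - 1) ^ 2) := by
    rw [mul_assoc (1 / (γ - 1))]
    exact le_mul_of_one_le_left (by positivity) hcv
  have n2 : 0 ≤ temperature γ U * (W.1 * (exp (b / 2) - 1) ^ 2) := by positivity
  have n3 : 0 ≤ W.1 * (temperature γ U * (exp (x / 2) - 1) ^ 2) := by positivity
  have fin : ∀ q, y ^ 2 ≤ 16 * exp (K / 2) * q → 0 ≤ q →
      W.1 * (temperature γ U * q) ≤ relEnergy γ W U →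
      W.1 * y ^ 2 ≤ 16 * A * exp (K / 2) * relEnergy γ W U := fun q h1 hq h2 => by
    have h3 : W.1 * q ≤ A * relEnergy γ W U := by
      have := mul_le_mul_of_nonneg_left h2 hA.le
      nlinarith [mul_nonneg hρ.le hq]
    calc W.1 * y ^ 2 ≤ W.1 * (16 * exp (K / 2) * q) := by gcongr
      _ = 16 * exp (K / 2) * (W.1 * q) := by ring
      _ ≤ 16 * exp (K / 2) * (A * relEnergy γ W U) := by gcongr
      _ = _ := by ring
  have hyK : -K ≤ y := by rw [hy]; linarith
  have hcase : ((0 ≤ y ∧ y / 2 ≤ x) ∨ (y ≤ 0 ∧ x ≤ y / 2)) ∨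
      ((0 ≤ y ∧ y / 2 ≤ b) ∨ (y ≤ 0 ∧ b ≤ y / 2)) := by
    rcases le_total 0 y with h0 | h0
    · by_cases h1 : y / 2 ≤ x
      · exact Or.inl (Or.inl ⟨h0, h1⟩)
      · refine Or.inr (Or.inl ⟨h0, ?_⟩)
        push Not at h1
        by_contra h2
        push Not at h2
        nlinarith
    · by_cases h1 : x ≤ y / 2
      · exact Or.inl (Or.inr ⟨h0, h1⟩)
      · refine Or.inr (Or.inr ⟨h0, ?_⟩)
        push Not at h1
        by_contra h2
        push Not at h2
        nlinarith
  rcases hcase with h | h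
  · exact fin _ (sq_mul_exp_le_sq_exp_sub_one hK hyK h) (sq_nonneg _) (by linarith)
  · exact fin _ (sq_mul_exp_le_sq_exp_sub_one hK hyK h) (sq_nonneg _) (by linarith)

variable {d : ℕ} {γ : ℝ} {X : SpaceTime d → State d} {D : SpaceTime d →L[ℝ] State d}
  {z : SpaceTime d}

/-- The coefficient of the density in `pairing γ (consOf γ X)`. -/
noncomputable def dualDensity (γ : ℝ) (X : State d) : ℝ :=
  1 / 2 * ‖X.2.1‖ ^ 2 - X.2.2 / (γ - 1) * (γ - (log X.2.2 - (γ - 1) * log X.1))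

theorem pairing_consOf (hγ : 1 < γ) {X : State d} (hr : 0 < X.1) (hθ : 0 < X.2.2) (W : State d) :
    pairing γ (consOf γ X) W = W.2.2 - inner ℝ X.2.1 W.2.1 + dualDensity γ X * W.1 := by
  rw [pairing_apply, velocity_consOf hr.ne', densityCoeff_consOf hγ hr hθ, dualDensity]

theorem relEnergy_consOf (hγ : 1 < γ) {X : State d} (hr : 0 < X.1) (hθ : 0 < X.2.2)
    (W : State d) : relEnergy γ W (consOf γ X) =
      W.2.2 - inner ℝ X.2.1 W.2.1 + dualDensity γ X * W.1 - X.2.2 * entropy γ W + X.1 * X.2.2 := by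
  rw [relEnergy, pairing_consOf hγ hr hθ, temperature_consOf hγ hr.ne', pressure_consOf hγ hr.ne']

theorem contDiffOn_dualDensity {B : Set (State d)} (hB : ∀ U ∈ B, U.1 ≠ 0 ∧ U.2.2 ≠ 0) :
    ContDiffOn ℝ 1 (dualDensity (d := d) γ) B := by
  have h1 : ContDiff ℝ 1 fun U : State d => U.1 := contDiff_fst
  have h3 : ContDiff ℝ 1 fun U : State d => U.2.1 := contDiff_fst.comp contDiff_snd
  have h4 : ContDiff ℝ 1 fun U : State d => U.2.2 := contDiff_snd.comp contDiff_snd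
  exact (contDiff_const.mul (h3.norm_sq ℝ)).contDiffOn.sub
    ((h4.div_const _).contDiffOn.mul (contDiffOn_const.sub
      ((h4.contDiffOn.log fun U hU => (hB U hU).2).sub
        (contDiffOn_const.mul (h1.contDiffOn.log fun U hU => (hB U hU).1)))))

theorem fderiv_dualDensity (hγ : 1 < γ) (h : HasFDerivAt X D z) (hr : (X z).1 ≠ 0)
    (hθ : (X z).2.2 ≠ 0) (e : SpaceTime d) :
    fderiv ℝ (fun w => dualDensity γ (X w)) z e = inner ℝ (X z).2.1 (D e).2.1
      - ((X z).2.2 * (D e).1 + (X z).1 * (D e).2.2) / (X z).1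
      + (log (X z).2.2 - (γ - 1) * log (X z).1) / (γ - 1) * (D e).2.2 := by
  have hg : γ - 1 ≠ 0 := by linarith
  refine (DFunLike.congr_fun ((h.velocityField.norm_sq.const_mul (1 / 2)).sub
    ((h.temperatureField.mul_const (γ - 1)⁻¹).mul (((h.temperatureField.log hθ).sub
      ((h.density.log hr).const_mul (γ - 1))).const_sub γ))).fderiv e).trans ?_
  simp
  field_simp
  ring

theorem fderiv_pressure (h : HasFDerivAt X D z) (e : SpaceTime d) :
    fderiv ℝ (fun w => (X w).1 * (X w).2.2) z e =
      (X z).2.2 * (D e).1 + (X z).1 * (D e).2.2 := by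
  refine (DFunLike.congr_fun (h.density.mul h.temperatureField).fderiv e).trans ?_
  simp
  ring

theorem fderiv_pressure_mul_velocity (h : HasFDerivAt X D z) (i : Fin d) (e : SpaceTime d) :
    fderiv ℝ (fun w => (X w).1 * (X w).2.2 * (X w).2.1 i) z e =
      ((X z).2.2 * (D e).1 + (X z).1 * (D e).2.2) * (X z).2.1 i
        + (X z).1 * (X z).2.2 * (D e).2.1 i := by
  refine (DFunLike.congr_fun ((h.density.mul h.temperatureField).mul
    (h.velocityCoord i)).fderiv e).trans ?_
  simp
  ring

/-- The derivative in direction `e` of `pairing γ (consOf γ X) G`. -/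
noncomputable def dualDeriv (γ : ℝ) (X : SpaceTime d → State d) (z e : SpaceTime d)
    (G : State d) : ℝ :=
  -∑ j, fderiv ℝ (fun w => (X w).2.1 j) z e * G.2.1 j +
    fderiv ℝ (fun w => dualDensity γ (X w)) z e * G.1

/-- The residual of the relative energy identity. -/
noncomputable def residual (γ : ℝ) (W : State d) (X : SpaceTime d → State d)
    (z : SpaceTime d) : ℝ :=
  dualDeriv γ X z (timeDir d) W - fderiv ℝ (fun w => (X w).2.2) z (timeDir d) * entropy γ W
    + fderiv ℝ (fun w => (X w).1 * (X w).2.2) z (timeDir d)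
    + ∑ i, (dualDeriv γ X z (spaceDir i) (flux γ (unitVec i) W)
      - fderiv ℝ (fun w => (X w).2.2) z (spaceDir i) * entropyFlux γ (unitVec i) W
      + fderiv ℝ (fun w => (X w).1 * (X w).2.2 * (X w).2.1 i) z (spaceDir i))

theorem sum_fderiv_velocity (h : HasFDerivAt X D z) (e : SpaceTime d) (m : Space d) :
    ∑ j, fderiv ℝ (fun w => (X w).2.1 j) z e * m j = inner ℝ m (D e).2.1 := by
  simp only [PiLp.inner_apply, RCLike.inner_apply, conj_trivial]
  refine Finset.sum_congr rfl fun j _ => ?_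
  rw [(h.velocityCoord j).fderiv]
  simp

theorem residual_eq (hγ : 1 < γ) (h : HasFDerivAt X D z) (hr : 0 < (X z).1) (hθ : 0 < (X z).2.2)
    (hE : PrimitiveEuler γ (X z) D) {W : State d} (hW : IsPhysical γ W) :
    residual γ W X z =
      -(W.1 * inner ℝ (velocity W - (X z).2.1) (D (0, velocity W - (X z).2.1)).2.1)
      - (entropy γ W - W.1 * ((log (X z).2.2 - (γ - 1) * log (X z).1) / (γ - 1))) *
          (D (0, velocity W - (X z).2.1)).2.2
      - (γ - 1) * (∑ i, (D (spaceDir i)).2.1 i) * (relEnergy γ W (consOf γ (X z))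
          - 1 / 2 * W.1 * ‖velocity W - (X z).2.1‖ ^ 2) := by
  have hg : γ - 1 ≠ 0 := by linarith
  set v := (X z).2.1 with hv
  set u := velocity W with hu
  set s := (log (X z).2.2 - (γ - 1) * log (X z).1) / (γ - 1) with hs
  have hm : W.2.1 = W.1 • u := momentum_eq (Or.inl hW)
  have hdd := fun e => fderiv_dualDensity hγ h hr.ne' hθ.ne' e
  have hun : ∀ (i : Fin d) (x : Space d), inner ℝ x (unitVec i) = x i := fun i x => by
    simp [unitVec, EuclideanSpace.inner_single_right]
  have hun' : ∀ (i : Fin d) (x : Space d), inner ℝ (unitVec i) x = x i := fun i x => by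
    rw [real_inner_comm, hun]
  have hq : ∀ i : Fin d, entropyFlux γ (unitVec i) W = entropy γ W * u i := fun i => by
    rw [entropyFlux, hm, inner_smul_left, hun, conj_trivial, mul_div_cancel_left₀ _ hW.1.ne']
  -- the directional derivative along `(1, u)`
  have hsum : residual γ W X z = -(W.1 * inner ℝ u (D (1, u)).2.1) + (inner ℝ v (D (1, u)).2.1
      - ((X z).2.2 * (D (1, u)).1 + (X z).1 * (D (1, u)).2.2) / (X z).1
      + s * (D (1, u)).2.2) * W.1 - (D (1, u)).2.2 * entropy γ W
      + ((X z).2.2 * (D (1, v)).1 + (X z).1 * (D (1, v)).2.2)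
      + ((X z).1 * (X z).2.2 - pressure γ W) * ∑ i, (D (spaceDir i)).2.1 i := by
    have hΘ : ∀ e, fderiv ℝ (fun w => (X w).2.2) z e = (D e).2.2 := fun e => by
      rw [h.temperatureField.fderiv]; rfl
    simp only [residual, dualDeriv, sum_fderiv_velocity h, hdd, hΘ, fderiv_pressure h,
      fderiv_pressure_mul_velocity h, hq, flux_eq_velocity (Or.inl hW), hun, inner_add_left,
      inner_smul_left, hun', conj_trivial, ← hu, ← hv, ← hs]
    rw [apply_one_vec D u, apply_one_vec D v, hm]
    simp only [Prod.fst_add, Prod.snd_add, Prod.fst_sum, Prod.snd_sum, Prod.smul_fst,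
      Prod.smul_snd, inner_add_right, inner_sum, inner_smul_right, inner_smul_left, smul_eq_mul,
      conj_trivial]
    set R := fun i => (D (spaceDir i)).1
    set Θ := fun i => (D (spaceDir i)).2.2
    set I := fun i => inner ℝ u (D (spaceDir i)).2.1
    set J := fun i => inner ℝ v (D (spaceDir i)).2.1
    have : ∀ i, -(u i * (W.1 * inner ℝ u (D (spaceDir i)).2.1) +
        pressure γ W * (D (spaceDir i)).2.1 i) +
      (inner ℝ v (D (spaceDir i)).2.1 - ((X z).2.2 * (D (spaceDir i)).1 +
        (X z).1 * (D (spaceDir i)).2.2) / (X z).1 + s * (D (spaceDir i)).2.2) * (W.1 * u i) -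
      (D (spaceDir i)).2.2 * (entropy γ W * u i) +
      (((X z).2.2 * (D (spaceDir i)).1 + (X z).1 * (D (spaceDir i)).2.2) * v i +
        (X z).1 * (X z).2.2 * (D (spaceDir i)).2.1 i) =
      -W.1 * (u i * I i) + W.1 * (u i * J i) - (X z).2.2 / (X z).1 * W.1 * (u i * R i) -
      W.1 * (u i * Θ i) + s * W.1 * (u i * Θ i) - entropy γ W * (u i * Θ i) +
      (X z).2.2 * (v i * R i) + (X z).1 * (v i * Θ i) +
      ((X z).1 * (X z).2.2 - pressure γ W) * (D (spaceDir i)).2.1 i := fun i => by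
      simp only [I, J, R, Θ]
      field_simp
      ring
    rw [Finset.sum_congr rfl fun i _ => this i]
    simp only [Finset.sum_add_distrib, Finset.sum_sub_distrib, ← Finset.mul_sum]
    simp only [I, J, R, Θ]
    field_simp
    ring
  have hsplit : D (1, u) = D (1, v) + D (0, u - v) := by
    rw [← map_add]; simp
  have hI : (X z).1 * inner ℝ (u - v) (D (1, v)).2.1 + ((X z).2.2 * (D (0, u - v)).1 +
      (X z).1 * (D (0, u - v)).2.2) = 0 := by
    have e0 : D (0, u - v) = ∑ i, (u - v) i • D (spaceDir i) := by
      conv_lhs => rw [spaceTime_eq_sum ((0, u - v) : SpaceTime d)]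
      simp [map_sum]
    rw [e0]
    simp only [PiLp.inner_apply, RCLike.inner_apply, conj_trivial, Prod.fst_sum, Prod.snd_sum,
      Prod.smul_fst, Prod.smul_snd, smul_eq_mul, Finset.mul_sum, ← Finset.sum_add_distrib]
    refine Finset.sum_eq_zero fun j _ => ?_
    linear_combination (u - v) j * hE.momentum j
  have h1 := hE.mass
  have h3 := hE.energy
  rw [hsum, relEnergy_consOf hγ hr hθ, energy_eq_pressure hγ (Or.inl hW), hm, hsplit, dualDensity,
    norm_sub_sq_real, inner_smul_right, real_inner_comm u (X z).2.1]
  simp only [Prod.fst_add, Prod.snd_add, inner_add_right, ← hu, ← hv]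
  set a := ∑ i, (D (spaceDir i)).2.1 i
  have hS : log (X z).2.2 - (γ - 1) * log (X z).1 = (γ - 1) * s := by
    rw [hs]; field_simp
  rw [hS]
  rw [inner_sub_left] at hI ⊢
  have h1' : (D (1, v)).1 = -(X z).1 * a := by linarith
  have h3' : (D (1, v)).2.2 = -(γ - 1) * (X z).2.2 * a := by linarith
  have hI' : inner ℝ u (D (1, v)).2.1 = inner ℝ v (D (1, v)).2.1
      - ((X z).2.2 * (D (0, u - v)).1 + (X z).1 * (D (0, u - v)).2.2) / (X z).1 := by
    field_simp
    linarith
  rw [h1', h3', hI']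
  field_simp
  ring

variable {d : ℕ} {γ : ℝ} {X : SpaceTime d → State d} {D : SpaceTime d →L[ℝ] State d}
  {z : SpaceTime d}

theorem stateBdd_consOf (hγ : 1 < γ) {A : ℝ} (hA : 1 ≤ A) {X : State d} (hX : X ∈ primBox d A) :
    StateBdd γ A (consOf γ X) := by
  obtain ⟨⟨h1, h2⟩, h3, h4, h5⟩ := mem_primBox.1 hX
  have hA0 : 0 < A⁻¹ := inv_pos.2 (by linarith)
  have hr : 0 < X.1 := by linarith
  have hθ : 0 < X.2.2 := by linarith
  refine ⟨IsPhysical.consOf hγ hr hθ, h1, h2, ?_, ?_, ?_⟩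
  · rwa [temperature_consOf hγ hr.ne']
  · rwa [temperature_consOf hγ hr.ne']
  · rwa [velocity_consOf hr.ne']

theorem abs_specEntropy_le (hγ : 1 < γ) {A : ℝ} (hA : 1 ≤ A) {U : State d}
    (hU : StateBdd γ A U) : |specEntropy γ U| ≤ γ * log A := by
  have hA0 : 0 < A := by linarith
  have hA1 : 0 < A⁻¹ := inv_pos.2 hA0
  have h0 := Real.log_nonneg hA
  have h1 := Real.log_le_log hA1 hU.density_ge
  have h2 := Real.log_le_log hU.physical.1 hU.density_le
  have h3 := Real.log_le_log hA1 hU.temperature_ge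
  have h4 := Real.log_le_log (temperature_pos hU.physical) hU.temperature_le
  rw [Real.log_inv] at h1 h3
  rw [specEntropy_eq hU.physical, abs_le]
  constructor <;> nlinarith

/-- The constant in the estimate of the residual. -/
noncomputable def residualConst (d : ℕ) (γ A L : ℝ) : ℝ :=
  L * (2 + 1 / (γ - 1) * (8 * A * exp (γ * log A) + 1) + (γ - 1) * d)

theorem residual_le (hγ : 1 < γ) (hγ2 : γ ≤ 2) {A L : ℝ} (hA : 1 ≤ A) (h : HasFDerivAt X D z)
    (hX : X z ∈ primBox d A) (hD : ‖D‖ ≤ L) (hE : PrimitiveEuler γ (X z) D) {W : State d}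
    (hW : IsPhysical γ W) (hS : -(γ * log A) ≤ specEntropy γ W) :
    residual γ W X z ≤ residualConst d γ A L * relEnergy γ W (consOf γ (X z)) := by
  have hg : 0 < γ - 1 := by linarith
  have hL : 0 ≤ L := (norm_nonneg _).trans hD
  have hB := stateBdd_consOf hγ hA hX
  obtain ⟨⟨h1, h2⟩, h3, h4, h5⟩ := mem_primBox.1 hX
  have hA0 : 0 < A⁻¹ := inv_pos.2 (by linarith)
  have hr : 0 < (X z).1 := by linarith
  have hθ : 0 < (X z).2.2 := by linarith
  have hDe : ∀ e, ‖D e‖ ≤ L * ‖e‖ := fun e => D.le_of_opNorm_le hD e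
  have hρ := hW.1
  rw [residual_eq hγ h hr hθ hE hW]
  set w := velocity W - (X z).2.1 with hw
  set R := relEnergy γ W (consOf γ (X z)) with hR
  have hkin : 1 / 2 * W.1 * ‖w‖ ^ 2 ≤ R := by
    have := le_relEnergy hγ (Or.inl hW) hB.physical
    rw [velocity_consOf hr.ne', ← hw] at this
    have n1 : 0 ≤ 1 / (γ - 1) * W.1 * (√(temperature γ W)
      - √(temperature γ (consOf γ (X z)))) ^ 2 := by positivity
    have n2 : 0 ≤ temperature γ (consOf γ (X z)) *
        (√W.1 - √(consOf γ (X z)).1) ^ 2 :=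
      mul_nonneg (temperature_pos hB.physical).le (sq_nonneg _)
    linarith
  have hR0 : 0 ≤ R := relEnergy_nonneg hγ (Or.inl hW) hB.physical
  have hn : ‖((0, w) : SpaceTime d)‖ = ‖w‖ := by simp [Prod.norm_def]
  have t1 : |inner ℝ w (D (0, w)).2.1| ≤ L * ‖w‖ ^ 2 := by
    refine (abs_real_inner_le_norm _ _).trans ?_
    have := ((norm_fst_le (D (0, w)).2).trans (norm_snd_le _)).trans (hDe (0, w))
    rw [hn] at this
    nlinarith [norm_nonneg w]
  have t2 : |(D (0, w)).2.2| ≤ L * ‖w‖ := by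
    have := ((norm_snd_le (D (0, w)).2).trans (norm_snd_le _)).trans (hDe (0, w))
    rwa [hn] at this
  have t3 : |∑ i, (D (spaceDir i)).2.1 i| ≤ d * L := by
    refine (Finset.abs_sum_le_sum_abs _ _).trans ((Finset.sum_le_card_nsmul _ _ L
      fun i _ => ?_).trans (by simp))
    have h6 := ((norm_fst_le (D (spaceDir i)).2).trans (norm_snd_le _)).trans (hDe (spaceDir i))
    have h7 : ‖(spaceDir i : SpaceTime d)‖ = 1 := by
      simp [spaceDir, Prod.norm_def, norm_unitVec]
    rw [h7, mul_one] at h6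
    exact (PiLp.norm_apply_le (D (spaceDir i)).2.1 i).trans h6
  set σ := specEntropy γ W - specEntropy γ (consOf γ (X z)) with hσ
  have hent : entropy γ W - W.1 * ((log (X z).2.2 - (γ - 1) * log (X z).1) / (γ - 1)) =
      1 / (γ - 1) * (W.1 * σ) := by
    rw [hσ, specEntropy_consOf hγ hr hθ, entropy_eq]
    field_simp
  have hσ2 : W.1 * σ ^ 2 ≤ 16 * A * exp (γ * log A) * R := by
    have h0 : 0 ≤ γ * log A := mul_nonneg (by linarith) (Real.log_nonneg hA)
    have := density_mul_specEntropy_sub_sq_le hγ hγ2 (K := 2 * (γ * log A)) (by positivity)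
      hW hB (by linarith [(abs_le.1 (abs_specEntropy_le hγ hA hB)).2])
    rwa [mul_div_cancel_left₀ _ two_ne_zero] at this
  rw [hent]
  have b1 : -(W.1 * inner ℝ w (D (0, w)).2.1) ≤ 2 * L * R := by
    have := mul_le_mul_of_nonneg_left (neg_le_of_abs_le t1) hρ.le
    nlinarith
  have b2 : -(1 / (γ - 1) * (W.1 * σ) * (D (0, w)).2.2) ≤
      L * (1 / (γ - 1) * (8 * A * exp (γ * log A) + 1)) * R := by
    have e1 : -(σ * (D (0, w)).2.2) ≤ L * (σ ^ 2 + ‖w‖ ^ 2) / 2 := by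
      have : |σ * (D (0, w)).2.2| ≤ |σ| * (L * ‖w‖) := by
        rw [abs_mul]; gcongr
      have h8 := neg_le_of_abs_le this
      have h9 : 2 * (|σ| * ‖w‖) ≤ σ ^ 2 + ‖w‖ ^ 2 := by
        rw [← sq_abs σ]; nlinarith [sq_nonneg (|σ| - ‖w‖)]
      nlinarith
    have e2 : W.1 * -(σ * (D (0, w)).2.2) ≤
        L * ((8 * A * exp (γ * log A) + 1) * R) := by
      refine (mul_le_mul_of_nonneg_left e1 hρ.le).trans ?_
      rw [show W.1 * (L * (σ ^ 2 + ‖w‖ ^ 2) / 2) =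
        L * ((W.1 * σ ^ 2 + W.1 * ‖w‖ ^ 2) / 2) by ring]
      refine mul_le_mul_of_nonneg_left ?_ hL
      linarith
    have hcv : 0 ≤ 1 / (γ - 1) := by positivity
    have := mul_le_mul_of_nonneg_left e2 hcv
    calc _ = 1 / (γ - 1) * (W.1 * -(σ * (D (0, w)).2.2)) := by ring
      _ ≤ _ := this
      _ = _ := by ring
  have b3 : -((γ - 1) * (∑ i, (D (spaceDir i)).2.1 i) * (R - 1 / 2 * W.1 * ‖w‖ ^ 2)) ≤
      (γ - 1) * (d * L) * R := by
    have e1 := neg_le_of_abs_le t3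
    have e2 : 0 ≤ R - 1 / 2 * W.1 * ‖w‖ ^ 2 := by linarith
    have e3 : R - 1 / 2 * W.1 * ‖w‖ ^ 2 ≤ R := by
      have : 0 ≤ 1 / 2 * W.1 * ‖w‖ ^ 2 := by positivity
      linarith
    have e4 : -(∑ i, (D (spaceDir i)).2.1 i) * (R - 1 / 2 * W.1 * ‖w‖ ^ 2) ≤
        d * L * R := by
      refine (mul_le_mul_of_nonneg_right (neg_le.1 e1) e2).trans ?_
      exact mul_le_mul_of_nonneg_left e3 (by positivity)
    have := mul_le_mul_of_nonneg_left e4 hg.le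
    linarith
  rw [residualConst]
  linarith

variable {d : ℕ} {γ : ℝ} {Ω : Set (Space d)}

theorem norm_wallNormal (i : Fin d) (s : Bool) : ‖wallNormal i s‖ = 1 := by
  cases s <;> simp [wallNormal, norm_unitVec]

/-- Fluxes `g`, numerical entropy fluxes `Q` and entropy productions `D` on the faces of a mesh for
the cell values `V` with time derivative `V'`. -/
structure IsFaceData (γ : ℝ) (𝒯 : RectMesh d Ω) (V V' : Fin 𝒯.N → State d)
    (g : Fin 𝒯.N → Fin d → Bool → State d) (Q D : Fin 𝒯.N → Fin d → Bool → ℝ) : Prop where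
  evolution : ∀ K, 𝒯.vol K • V' K = -∑ i, ∑ s, 𝒯.area K i • g K i s
  face : ∀ K i s, ∃ L, IsFaceFlux γ (wallNormal i s) (V K) (specEntropy γ (V L)) (g K i s)
    (Q K i s) (D K i s)
  flux_adj : ∀ i K L, 𝒯.Adj i K L → g K i true + g L i false = 0
  entropy_adj : ∀ i K L, 𝒯.Adj i K L → Q K i true + Q L i false ≤ 0
  flux_wall : ∀ K i s, 𝒯.IsWall K i s → ∃ p : ℝ, g K i s = (0, p • wallNormal i s, 0)
  entropy_wall : ∀ K i s, 𝒯.IsWall K i s → Q K i s ≤ 0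

theorem RectMesh.exists_adj_of_not_isWall {𝒯 : RectMesh d Ω} {K : Fin 𝒯.N} {i : Fin d} {s : Bool}
    (h : ¬ 𝒯.IsWall K i s) : ∃ L, if s then 𝒯.Adj i K L else 𝒯.Adj i L K := by
  simpa only [RectMesh.IsWall, not_forall, not_not] using h

open Classical in
theorem IsGodunovSolution.exists_isFaceData (hγ : 1 < γ) (hγ2 : γ ≤ 2) {T : ℝ}
    {𝒯 : RectMesh d Ω} {U₀ : Space d → State d} {U : ℝ → Fin 𝒯.N → State d}
    (h : IsGodunovSolution γ T 𝒯 U₀ U) {t : ℝ} (ht : t ∈ Icc 0 T) :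
    ∃ g Q D, IsFaceData γ 𝒯 (U t) (fun K => derivWithin (fun r => U r K) (Icc 0 T) t) g Q D := by
  obtain ⟨V, Vw, hV, hVw, hsch⟩ := h.scheme t ht
  have hph := h.physical t ht
  choose! Q₁ D₁ Q₂ D₂ hF₁ hF₂ hQ using fun i K L (ha : 𝒯.Adj i K L) =>
    (hV i K L ha).exists_isFaceFlux hγ hγ2 (norm_unitVec i) (hph K) (hph L)
  choose! Qw Dw hFw hQw hgw using fun K i s (ha : 𝒯.IsWall K i s) =>
    (hVw K i s ha).exists_isFaceFlux_wall hγ hγ2 (norm_wallNormal i s) (hph K)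
  -- the neighbour behind a face
  choose nb hnb using fun K i s => show ∃ L, ¬ 𝒯.IsWall K i s →
      if s then 𝒯.Adj i K L else 𝒯.Adj i L K from by
    by_cases hw : 𝒯.IsWall K i s
    · exact ⟨K, fun h => absurd hw h⟩
    · obtain ⟨L, hL⟩ := RectMesh.exists_adj_of_not_isWall hw
      exact ⟨L, fun _ => hL⟩
  have hT : ∀ {i K L}, 𝒯.Adj i K L → ¬ 𝒯.IsWall K i true ∧ nb K i true = L := fun {i K L} ha => by
    have hw : ¬ 𝒯.IsWall K i true := fun hw => hw L (by simpa using ha)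
    exact ⟨hw, 𝒯.adj_unique_right (by simpa using hnb K i true hw) ha⟩
  have hFa : ∀ {i K L}, 𝒯.Adj i K L → ¬ 𝒯.IsWall L i false ∧ nb L i false = K :=
    fun {i K L} ha => by
      have hw : ¬ 𝒯.IsWall L i false := fun hw => hw K (by simpa using ha)
      exact ⟨hw, 𝒯.adj_unique_left (by simpa using hnb L i false hw) ha⟩
  let g : Fin 𝒯.N → Fin d → Bool → State d := fun K i s =>
    if 𝒯.IsWall K i s then flux γ (wallNormal i s) (Vw K i s)
    else if s then flux γ (unitVec i) (V i K (nb K i s))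
    else -flux γ (unitVec i) (V i (nb K i s) K)
  let Q : Fin 𝒯.N → Fin d → Bool → ℝ := fun K i s =>
    if 𝒯.IsWall K i s then Qw K i s
    else if s then Q₁ i K (nb K i s) else Q₂ i (nb K i s) K
  let D : Fin 𝒯.N → Fin d → Bool → ℝ := fun K i s =>
    if 𝒯.IsWall K i s then Dw K i s
    else if s then D₁ i K (nb K i s) else D₂ i (nb K i s) K
  have hgT : ∀ {i K L}, 𝒯.Adj i K L → g K i true = flux γ (unitVec i) (V i K L) :=
    fun {i K L} ha => by simp [g, (hT ha).1, (hT ha).2]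
  have hgF : ∀ {i K L}, 𝒯.Adj i K L → g L i false = -flux γ (unitVec i) (V i K L) :=
    fun {i K L} ha => by simp [g, (hFa ha).1, (hFa ha).2]
  refine ⟨g, Q, D, fun K => ?_, fun K i s => ?_, fun i K L ha => ?_, fun i K L ha => ?_,
    fun K i s hw => ⟨_, (if_pos hw).trans (hgw K i s hw)⟩,
    fun K i s hw => (if_pos hw).trans_le (hQw K i s hw)⟩
  · have h1 := hsch (Pi.single K 1)
    have h2 := 𝒯.sum_faces fun L i s =>
      (𝒯.area L i * (Pi.single K 1 : Fin 𝒯.N → ℝ) L) • g L i s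
    have h3 : ∀ i L L', (if 𝒯.Adj i L L' then
        (𝒯.area L i * (Pi.single K 1 : Fin 𝒯.N → ℝ) L) • g L i true +
          (𝒯.area L' i * (Pi.single K 1 : Fin 𝒯.N → ℝ) L') • g L' i false else 0) =
        -(if 𝒯.Adj i L L' then (𝒯.area L i * ((Pi.single K 1 : Fin 𝒯.N → ℝ) L' -
          (Pi.single K 1 : Fin 𝒯.N → ℝ) L)) • flux γ (unitVec i) (V i L L') else 0) :=
      fun i L L' => by
        split_ifs with ha
        · rw [hgT ha, hgF ha, ← 𝒯.area_adj ha, smul_neg, ← sub_eq_add_neg, ← sub_smul, ← neg_smul]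
          congr 1; ring
        · simp
    have h4 : ∀ L i s, (if 𝒯.IsWall L i s then
        (𝒯.area L i * (Pi.single K 1 : Fin 𝒯.N → ℝ) L) • g L i s else 0) =
        if 𝒯.IsWall L i s then (𝒯.area L i * (Pi.single K 1 : Fin 𝒯.N → ℝ) L) •
          flux γ (wallNormal i s) (Vw L i s) else 0 := fun L i s => by
      split_ifs with hw
      · simp only [g, if_pos hw]
      · rfl
    simp only [h3, h4, Finset.sum_neg_distrib] at h2
    rw [sub_eq_add_neg, add_assoc, ← h2, Finset.sum_eq_single K, Finset.sum_eq_single K] at h1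
    · simp only [Pi.single_eq_same, mul_one] at h1
      exact eq_neg_of_add_eq_zero_left h1
    · intro L _ hL
      simp [hL]
    · simp
    · intro L _ hL
      simp [hL]
    · simp
  · by_cases hw : 𝒯.IsWall K i s
    · refine ⟨K, ?_⟩
      simp only [g, Q, D, if_pos hw]
      exact hFw K i s hw
    · have ha := hnb K i s hw
      refine ⟨nb K i s, ?_⟩
      simp only [g, Q, D, if_neg hw]
      cases s
      · exact hF₂ i _ K (by simpa using ha)
      · exact hF₁ i K _ (by simpa using ha)
  · rw [hgT ha, hgF ha, add_neg_cancel]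
  · have e1 : Q K i true = Q₁ i K L := by simp [Q, (hT ha).1, (hT ha).2]
    have e2 : Q L i false = Q₂ i K L := by simp [Q, (hFa ha).1, (hFa ha).2]
    rw [e1, e2]
    exact hQ i K L ha

variable {d : ℕ} {γ : ℝ} {Ω : Set (Space d)} {𝒯 : RectMesh d Ω}

/-- `pairing` with the coefficients as a variable. -/
noncomputable def dualPair (a G : State d) : ℝ := G.2.2 - inner ℝ a.2.1 G.2.1 + a.1 * G.1

theorem dualPair_add (a G H : State d) : dualPair a (G + H) = dualPair a G + dualPair a H := by
  simp only [dualPair, Prod.fst_add, Prod.snd_add, inner_add_right]; ring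

theorem dualPair_smul (a : State d) (c : ℝ) (G : State d) :
    dualPair a (c • G) = c * dualPair a G := by
  simp only [dualPair, Prod.smul_fst, Prod.smul_snd, inner_smul_right, smul_eq_mul]; ring

theorem dualPair_neg (a G : State d) : dualPair a (-G) = -dualPair a G := by
  rw [← neg_one_smul ℝ G, dualPair_smul]; ring

theorem dualPair_sub (a G H : State d) : dualPair a (G - H) = dualPair a G - dualPair a H := by
  rw [sub_eq_add_neg, dualPair_add, dualPair_neg, ← sub_eq_add_neg]

/-- `dualPair a` as a linear map. -/
noncomputable def dualPairₗ (a : State d) : State d →ₗ[ℝ] ℝ where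
  toFun := dualPair a
  map_add' := dualPair_add a
  map_smul' c G := by rw [dualPair_smul]; rfl

theorem wallNormal_false (i : Fin d) : (wallNormal i false : Space d) = -wallNormal i true := by
  simp [wallNormal]

theorem sum_area_flux (γ : ℝ) (ℓ : State d →ₗ[ℝ] ℝ) (K : Fin 𝒯.N) (U : State d) :
    ∑ i, ∑ s, 𝒯.area K i * ℓ (flux γ (wallNormal i s) U) = 0 :=
  Finset.sum_eq_zero fun i _ => by
    rw [Fintype.sum_bool, wallNormal_false, flux_neg, map_neg]; ring

theorem sum_area_entropyFlux (γ : ℝ) (K : Fin 𝒯.N) (U : State d) :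
    ∑ i, ∑ s, 𝒯.area K i * entropyFlux γ (wallNormal i s) U = 0 :=
  Finset.sum_eq_zero fun i _ => by
    rw [Fintype.sum_bool, wallNormal_false, entropyFlux_neg]; ring

namespace IsFaceData

variable {V V' : Fin 𝒯.N → State d} {g : Fin 𝒯.N → Fin d → Bool → State d}
  {Q D : Fin 𝒯.N → Fin d → Bool → ℝ}

theorem vol_mul_apply (h : IsFaceData γ 𝒯 V V' g Q D) (ℓ : State d →ₗ[ℝ] ℝ) (K : Fin 𝒯.N) :
    𝒯.vol K * ℓ (V' K) = -∑ i, ∑ s, 𝒯.area K i * ℓ (g K i s - flux γ (wallNormal i s) (V K)) := by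
  have h1 := congrArg ℓ (h.evolution K)
  have h2 := sum_area_flux (𝒯 := 𝒯) γ ℓ K (V K)
  simp only [map_smul, map_neg, map_sum, smul_eq_mul] at h1
  simp only [map_sub, mul_sub, Finset.sum_sub_distrib]
  rw [h1, h2, sub_zero]

theorem D_nonneg (h : IsFaceData γ 𝒯 V V' g Q D) (K : Fin 𝒯.N) (i : Fin d) (s : Bool) :
    0 ≤ D K i s := by
  obtain ⟨L, hL⟩ := h.face K i s
  exact hL.nonneg

theorem balance (h : IsFaceData γ 𝒯 V V' g Q D) (hV : ∀ K, IsPhysical γ (V K)) (K : Fin 𝒯.N)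
    (i : Fin d) (s : Bool) :
    pairing γ (V K) (g K i s - flux γ (wallNormal i s) (V K)) / temperature γ (V K) =
      Q K i s - entropyFlux γ (wallNormal i s) (V K) - D K i s := by
  obtain ⟨L, hL⟩ := h.face K i s
  rw [hL.balance, mul_div_cancel_left₀ _ (temperature_pos (hV K)).ne']

/-- The evolution of the total entropy of a cell. -/
theorem vol_mul_entropyRate (h : IsFaceData γ 𝒯 V V' g Q D) (hV : ∀ K, IsPhysical γ (V K))
    (K : Fin 𝒯.N) : 𝒯.vol K * (pairing γ (V K) (V' K) / temperature γ (V K)) =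
      ∑ i, ∑ s, 𝒯.area K i * (D K i s - Q K i s) := by
  have h1 := h.vol_mul_apply (pairing γ (V K)).toLinearMap K
  have h2 := sum_area_entropyFlux (𝒯 := 𝒯) γ K (V K)
  simp only [ContinuousLinearMap.coe_coe] at h1
  rw [← mul_div_assoc, h1, neg_div, Finset.sum_div]
  simp only [Finset.sum_div, mul_div_assoc, h.balance hV]
  rw [← add_zero (∑ i, ∑ s, 𝒯.area K i * (D K i s - Q K i s)), ← h2]
  simp only [← Finset.sum_neg_distrib, ← Finset.sum_add_distrib]
  exact Finset.sum_congr rfl fun i _ => Finset.sum_congr rfl fun s _ => by ring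

/-- The total entropy increases at least by the entropy production on the faces. -/
theorem sum_area_D_le (h : IsFaceData γ 𝒯 V V' g Q D) (hV : ∀ K, IsPhysical γ (V K)) :
    ∑ K, ∑ i, ∑ s, 𝒯.area K i * D K i s ≤
      ∑ K, 𝒯.vol K * (pairing γ (V K) (V' K) / temperature γ (V K)) := by
  have h1 : ∑ K, ∑ i, ∑ s, 𝒯.area K i * Q K i s ≤ 0 :=
    𝒯.sum_faces_nonpos (fun i K L ha => by
      rw [← 𝒯.area_adj ha, ← mul_add]
      exact mul_nonpos_of_nonneg_of_nonpos (𝒯.area_pos K i).le (h.entropy_adj i K L ha))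
      fun K i s hw => mul_nonpos_of_nonneg_of_nonpos (𝒯.area_pos K i).le (h.entropy_wall K i s hw)
  simp only [h.vol_mul_entropyRate hV, mul_sub, Finset.sum_sub_distrib]
  linarith

/-- The specific entropy does not decrease where it is minimal. -/
theorem entropy_min (h : IsFaceData γ 𝒯 V V' g Q D) {K : Fin 𝒯.N}
    (hK : ∀ L, specEntropy γ (V K) ≤ specEntropy γ (V L)) :
    temperature γ (V K) / (γ - 1) * specEntropy γ (V K) * (V' K).1 ≤ pairing γ (V K) (V' K) := by
  have h1 := h.vol_mul_apply ((pairing γ (V K)).toLinearMap -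
    (temperature γ (V K) / (γ - 1) * specEntropy γ (V K)) • LinearMap.fst ℝ ℝ (Space d × ℝ)) K
  have h2 : 0 ≤ 𝒯.vol K * (pairing γ (V K) (V' K) -
      temperature γ (V K) / (γ - 1) * specEntropy γ (V K) * (V' K).1) := by
    simp only [LinearMap.sub_apply, ContinuousLinearMap.coe_coe, LinearMap.smul_apply,
      LinearMap.fst_apply, smul_eq_mul] at h1
    rw [h1, neg_nonneg]
    refine Finset.sum_nonpos fun i _ => Finset.sum_nonpos fun s _ => ?_
    obtain ⟨L, hL⟩ := h.face K i s
    exact mul_nonpos_of_nonneg_of_nonpos (𝒯.area_pos K i).le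
      (sub_nonpos.2 (hL.min_entropy (hK L)))
  linarith [(mul_nonneg_iff_of_pos_left (𝒯.vol_pos K)).1 h2]

/-- The discrete relative energy balance with the cell means `m` and the face means `f` of the
coefficients; the right-hand side has the flux differences as error terms. -/
theorem dual_balance (h : IsFaceData γ 𝒯 V V' g Q D) (hV : ∀ K, IsPhysical γ (V K))
    {m : Fin 𝒯.N → State d} {f : Fin 𝒯.N → Fin d → Bool → State d} {L B : ℝ}
    (hf : ∀ i K K', 𝒯.Adj i K K' → f K i true = f K' i false)
    (hw : ∀ K i s, 𝒯.IsWall K i s → (f K i s).2.1 i = 0) (hθ : ∀ K i s, 0 ≤ (f K i s).2.2)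
    (hL : ∀ K i s G, |dualPair (m K) G - dualPair (f K i s) G| ≤
      L * (𝒯.hi K i - 𝒯.lo K i) * ‖G‖)
    (hLθ : ∀ K i s, |(m K).2.2 - (f K i s).2.2| ≤ L * (𝒯.hi K i - 𝒯.lo K i))
    (hB : ∀ K G, |pairing γ (V K) G / temperature γ (V K)| ≤ B * ‖G‖) :
    ∑ K, 𝒯.vol K * (dualPair (m K) (V' K) -
        (m K).2.2 * (pairing γ (V K) (V' K) / temperature γ (V K))) ≤
      ∑ K, ∑ i, ∑ s, 𝒯.area K i * (dualPair (f K i s) (flux γ (wallNormal i s) (V K)) -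
          (f K i s).2.2 * entropyFlux γ (wallNormal i s) (V K)) +
        L * (1 + B) * ∑ K, ∑ i, ∑ s : Bool, 𝒯.vol K * ‖g K i s - flux γ (wallNormal i s) (V K)‖ := by
  have e1 : ∑ K, 𝒯.vol K * (dualPair (m K) (V' K) -
        (m K).2.2 * (pairing γ (V K) (V' K) / temperature γ (V K))) =
      ∑ K, ∑ i, ∑ s, 𝒯.area K i * (
        -dualPair (m K) (g K i s - flux γ (wallNormal i s) (V K)) + (m K).2.2 *
          (pairing γ (V K) (g K i s - flux γ (wallNormal i s) (V K)) / temperature γ (V K))) := by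
    refine Finset.sum_congr rfl fun K _ => ?_
    have h1 := h.vol_mul_apply (dualPairₗ (m K) -
      ((m K).2.2 / temperature γ (V K)) • (pairing γ (V K)).toLinearMap) K
    simp only [LinearMap.sub_apply, ContinuousLinearMap.coe_coe, LinearMap.smul_apply,
      smul_eq_mul, dualPairₗ, LinearMap.coe_mk, AddHom.coe_mk] at h1
    have hx : ∀ a, (m K).2.2 * (a / temperature γ (V K)) =
      (m K).2.2 / temperature γ (V K) * a := fun a => by ring
    simp only [hx]
    rw [h1]
    simp only [← Finset.sum_neg_distrib]
    exact Finset.sum_congr rfl fun i _ => Finset.sum_congr rfl fun s _ => by ring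
  have e2 : ∑ K, ∑ i, ∑ s, 𝒯.area K i * (-dualPair (f K i s) (g K i s) +
      (f K i s).2.2 * Q K i s) ≤ 0 := by
    refine 𝒯.sum_faces_nonpos (fun i K K' ha => ?_) fun K i s hw' => ?_
    · have h1 := eq_neg_of_add_eq_zero_right (h.flux_adj i K K' ha)
      rw [← 𝒯.area_adj ha, ← hf i K K' ha, h1, dualPair_neg, ← mul_add]
      refine mul_nonpos_of_nonneg_of_nonpos (𝒯.area_pos K i).le ?_
      have := mul_nonpos_of_nonneg_of_nonpos (hθ K i true) (h.entropy_adj i K K' ha)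
      linarith
    · obtain ⟨p, hp⟩ := h.flux_wall K i s hw'
      refine mul_nonpos_of_nonneg_of_nonpos (𝒯.area_pos K i).le ?_
      have h1 : dualPair (f K i s) (g K i s) = 0 := by
        have h2 := hw K i s hw'
        rw [hp]
        simp only [dualPair, inner_smul_right]
        cases s <;> simp [wallNormal, unitVec, EuclideanSpace.inner_single_right, h2]
      rw [h1, neg_zero, zero_add]
      exact mul_nonpos_of_nonneg_of_nonpos (hθ K i s) (h.entropy_wall K i s hw')
  rw [e1, ← add_zero (∑ K, ∑ i, ∑ s, 𝒯.area K i *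
    (dualPair (f K i s) (flux γ (wallNormal i s) (V K)) -
          (f K i s).2.2 * entropyFlux γ (wallNormal i s) (V K)))]
  refine le_trans ?_ (add_le_add_left (add_le_add_right e2 _) _)
  simp only [Finset.mul_sum, ← Finset.sum_add_distrib]
  refine Finset.sum_le_sum fun K _ => Finset.sum_le_sum fun i _ => Finset.sum_le_sum fun s _ => ?_
  set G := g K i s - flux γ (wallNormal i s) (V K) with hG
  have ha := 𝒯.area_pos K i
  have hs : 0 < 𝒯.hi K i - 𝒯.lo K i := sub_pos.2 (𝒯.lo_lt_hi K i)
  have b1 := neg_le_of_abs_le (hL K i s G)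
  have b2 : ((m K).2.2 - (f K i s).2.2) * (pairing γ (V K) G / temperature γ (V K)) ≤
      L * (𝒯.hi K i - 𝒯.lo K i) * (B * ‖G‖) := by
    refine (le_abs_self _).trans ?_
    rw [abs_mul]
    exact mul_le_mul (hLθ K i s) (hB K G) (abs_nonneg _) ((abs_nonneg _).trans (hLθ K i s))
  have b3 := h.balance hV K i s
  have b4 := h.D_nonneg K i s
  have b5 : dualPair (f K i s) G = dualPair (f K i s) (g K i s) -
      dualPair (f K i s) (flux γ (wallNormal i s) (V K)) := dualPair_sub _ _ _
  rw [𝒯.vol_eq K i]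
  rw [show L * (1 + B) * ((𝒯.hi K i - 𝒯.lo K i) * 𝒯.area K i * ‖G‖) = 𝒯.area K i *
    (L * (𝒯.hi K i - 𝒯.lo K i) * ‖G‖ + L * (𝒯.hi K i - 𝒯.lo K i) * (B * ‖G‖)) by ring,
    ← mul_add, ← mul_add]
  refine mul_le_mul_of_nonneg_left ?_ ha.le
  have b6 := mul_nonneg (hθ K i s) b4
  have b7 : (f K i s).2.2 * (pairing γ (V K) G / temperature γ (V K)) =
    (f K i s).2.2 * (Q K i s - entropyFlux γ (wallNormal i s) (V K) - D K i s) := by rw [b3]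
  linarith

end IsFaceData

variable {d : ℕ} {γ : ℝ} {Ω : Set (Space d)}

theorem lipschitzOnWith_comp_le {E : Type*} [PseudoMetricSpace E] {S : Set (SpaceTime d)}
    {L : ℝ≥0} {f : SpaceTime d → E} (hf : LipschitzOnWith L f S) {φ : E → ℝ}
    (hφ : ∀ x y, |φ x - φ y| ≤ dist x y) : LipschitzOnWith L (fun z => φ (f z)) S :=
  LipschitzOnWith.of_dist_le_mul fun z hz w hw =>
    (hφ _ _).trans (hf.dist_le_mul z hz w hw)

/-- The coefficient fields of the relative energy are Lipschitz continuous with constant `L` over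
the cell `K`. -/
structure LipschitzFields (γ : ℝ) (L : ℝ≥0) (S : Set (SpaceTime d))
    (X : SpaceTime d → State d) : Prop where
  velocity : ∀ j, LipschitzOnWith L (fun z => (X z).2.1 j) S
  density : LipschitzOnWith L (fun z => dualDensity γ (X z)) S
  temperature : LipschitzOnWith L (fun z => (X z).2.2) S
  pressure : LipschitzOnWith L (fun z => (X z).1 * (X z).2.2) S
  power : ∀ i, LipschitzOnWith L (fun z => (X z).1 * (X z).2.2 * (X z).2.1 i) S

theorem exists_lipschitzFields (γ : ℝ) {A : ℝ} (hA : 1 ≤ A) (C : ℝ≥0) :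
    ∃ L : ℝ≥0, ∀ (S : Set (SpaceTime d)) (X : SpaceTime d → State d), LipschitzOnWith C X S →
      MapsTo X S (primBox d A) → LipschitzFields γ L S X := by
  have hA0 : 0 < A⁻¹ := inv_pos.2 (by linarith)
  have h1 : ContDiff ℝ 1 fun U : State d => U.1 := contDiff_fst
  have h3 : ContDiff ℝ 1 fun U : State d => U.2.1 := contDiff_fst.comp contDiff_snd
  have h4 : ContDiff ℝ 1 fun U : State d => U.2.2 := contDiff_snd.comp contDiff_snd
  have h5 : ContDiffOn ℝ 1 (dualDensity (d := d) γ) (primBox d A) :=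
    contDiffOn_dualDensity fun U hU => by
      obtain ⟨⟨h1, -⟩, -, h2, -⟩ := mem_primBox.1 hU
      exact ⟨by linarith, by linarith⟩
  obtain ⟨L, hL⟩ := exists_lipschitz_comp (Φ := fun U : State d =>
      (U.2.1, dualDensity γ U, U.2.2, U.1 * U.2.2, (U.1 * U.2.2) • U.2.1))
    (h3.contDiffOn.prodMk (h5.prodMk (h4.contDiffOn.prodMk ((h1.mul h4).contDiffOn.prodMk
      ((h1.mul h4).smul h3).contDiffOn)))) (convex_primBox A) (isCompact_primBox A) C
  refine ⟨L, fun S X hX hS => ?_⟩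
  have h := hL S X hX hS
  have hco : ∀ (j : Fin d) (x y : Space d), |x j - y j| ≤ dist x y := fun j x y => by
    rw [dist_eq_norm]
    exact PiLp.norm_apply_le (x - y) j
  refine ⟨fun j => ?_, ?_, ?_, ?_, fun i => ?_⟩
  · exact lipschitzOnWith_comp_le h (φ := fun x => x.1 j) fun x y =>
      (hco j _ _).trans (le_max_left _ _)
  · exact lipschitzOnWith_comp_le h (φ := fun x => x.2.1) fun x y =>
      (le_max_left _ _).trans (le_max_right _ _)
  · exact lipschitzOnWith_comp_le h (φ := fun x => x.2.2.1) fun x y =>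
      (le_max_left _ _).trans ((le_max_right _ _).trans (le_max_right _ _))
  · exact lipschitzOnWith_comp_le h (φ := fun x => x.2.2.2.1) fun x y =>
      (le_max_left _ _).trans ((le_max_right _ _).trans ((le_max_right _ _).trans
        (le_max_right _ _)))
  · exact lipschitzOnWith_comp_le h (φ := fun x => x.2.2.2.2 i) fun x y =>
      (hco i _ _).trans ((le_max_right _ _).trans ((le_max_right _ _).trans
        ((le_max_right _ _).trans (le_max_right _ _))))

/-- `f` is integrable with integral `a`. -/
def HasIntegral (f : (Fin d → ℝ) → ℝ) (a : ℝ) : Prop :=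
  Integrable f (cubeMeasure d) ∧ ∫ y, f y ∂(cubeMeasure d) = a

namespace HasIntegral

variable {f g : (Fin d → ℝ) → ℝ} {a b : ℝ}

theorem add (hf : HasIntegral f a) (hg : HasIntegral g b) :
    HasIntegral (fun y => f y + g y) (a + b) :=
  ⟨hf.1.add hg.1, by rw [integral_add hf.1 hg.1, hf.2, hg.2]⟩

theorem sub (hf : HasIntegral f a) (hg : HasIntegral g b) :
    HasIntegral (fun y => f y - g y) (a - b) :=
  ⟨hf.1.sub hg.1, by rw [integral_sub hf.1 hg.1, hf.2, hg.2]⟩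

theorem neg (hf : HasIntegral f a) : HasIntegral (fun y => -f y) (-a) :=
  ⟨hf.1.neg, by rw [integral_neg, hf.2]⟩

theorem mul_const (hf : HasIntegral f a) (c : ℝ) : HasIntegral (fun y => f y * c) (a * c) :=
  ⟨hf.1.mul_const c, by rw [integral_mul_const, hf.2]⟩

theorem const (c : ℝ) : HasIntegral (fun _ : Fin d → ℝ => c) c :=
  ⟨integrable_const c, by simp⟩

theorem sum {ι : Type*} [Fintype ι] {F : ι → (Fin d → ℝ) → ℝ} {c : ι → ℝ}
    (h : ∀ i, HasIntegral (F i) (c i)) : HasIntegral (fun y => ∑ i, F i y) (∑ i, c i) :=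
  ⟨integrable_finsetSum _ fun i _ => (h i).1, by
    rw [integral_finsetSum _ fun i _ => (h i).1]
    exact Finset.sum_congr rfl fun i _ => (h i).2⟩

end HasIntegral

namespace RectMesh

variable (𝒯 : RectMesh d Ω)

/-- The means over a cell of the coefficients of the relative energy. -/
noncomputable def cellDual (γ : ℝ) (X : SpaceTime d → State d) (t : ℝ) (K : Fin 𝒯.N) : State d :=
  (𝒯.cellMean K fun x => dualDensity γ (X (t, x)),
    WithLp.toLp 2 fun j => 𝒯.cellMean K fun x => (X (t, x)).2.1 j,
    𝒯.cellMean K fun x => (X (t, x)).2.2)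

/-- The means over a face of the coefficients of the relative energy. -/
noncomputable def faceDual (γ : ℝ) (X : SpaceTime d → State d) (t : ℝ) (K : Fin 𝒯.N) (i : Fin d)
    (s : Bool) : State d :=
  (𝒯.faceMean K i s fun x => dualDensity γ (X (t, x)),
    WithLp.toLp 2 fun j => 𝒯.faceMean K i s fun x => (X (t, x)).2.1 j,
    𝒯.faceMean K i s fun x => (X (t, x)).2.2)

/-- The integral of the relative energy of the piecewise constant function with the values `V`. -/
noncomputable def totalRelEnergy (γ : ℝ) (X : SpaceTime d → State d) (t : ℝ)
    (V : Fin 𝒯.N → State d) : ℝ :=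
  ∑ K, 𝒯.vol K * (dualPair (𝒯.cellDual γ X t K) (V K)
    - (𝒯.cellDual γ X t K).2.2 * entropy γ (V K)
    + 𝒯.cellMean K fun x => (X (t, x)).1 * (X (t, x)).2.2)

variable {𝒯} {T : ℝ} {K : Fin 𝒯.N} {L : ℝ≥0} {X : SpaceTime d → State d} {t : ℝ}

theorem dualPair_eq_sum (a G : State d) :
    dualPair a G = G.2.2 - ∑ j, a.2.1 j * G.2.1 j + a.1 * G.1 := by
  simp only [dualPair, PiLp.inner_apply, RCLike.inner_apply, conj_trivial]
  congr 2
  exact Finset.sum_congr rfl fun j _ => mul_comm _ _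

theorem hasIntegral_map {a : SpaceTime d → ℝ} (ha : LipschitzOnWith L a (𝒯.closedCyl T K))
    (ht : t ∈ Icc 0 T) :
    HasIntegral (fun y => a (t, 𝒯.map K y)) (𝒯.cellMean K fun x => a (t, x)) :=
  ⟨(𝒯.integrable_cube_of_continuousOn (𝒯.slice_lipschitz ha ht).continuousOn).1, rfl⟩

theorem hasIntegral_dualPair (h : LipschitzFields γ L (𝒯.closedCyl T K) X) (ht : t ∈ Icc 0 T)
    (W : State d) : HasIntegral (fun y => W.2.2 - ∑ j, (X (t, 𝒯.map K y)).2.1 j * W.2.1 j +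
        dualDensity γ (X (t, 𝒯.map K y)) * W.1 - (X (t, 𝒯.map K y)).2.2 * entropy γ W +
        (X (t, 𝒯.map K y)).1 * (X (t, 𝒯.map K y)).2.2)
      (dualPair (𝒯.cellDual γ X t K) W - (𝒯.cellDual γ X t K).2.2 * entropy γ W +
        𝒯.cellMean K fun x => (X (t, x)).1 * (X (t, x)).2.2) := by
  rw [dualPair_eq_sum]
  exact (((HasIntegral.const _).sub (HasIntegral.sum fun j =>
    (hasIntegral_map (h.velocity j) ht).mul_const _)).add ((hasIntegral_map h.density ht).mul_const
      _)).sub ((hasIntegral_map h.temperature ht).mul_const _) |>.add (hasIntegral_map h.pressure ht)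

/-- The mean relative energy over a cell. -/
theorem hasIntegral_relEnergy (hγ : 1 < γ) {A : ℝ} (hA : 1 ≤ A)
    (h : LipschitzFields γ L (𝒯.closedCyl T K) X) (hX : MapsTo X (𝒯.closedCyl T K) (primBox d A))
    (ht : t ∈ Icc 0 T) (W : State d) :
    HasIntegral (fun y => relEnergy γ W (consOf γ (X (t, 𝒯.map K y))))
      (dualPair (𝒯.cellDual γ X t K) W - (𝒯.cellDual γ X t K).2.2 * entropy γ W +
        𝒯.cellMean K fun x => (X (t, x)).1 * (X (t, x)).2.2) := by
  have h1 := hasIntegral_dualPair h ht W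
  have h2 : (fun y => W.2.2 - ∑ j, (X (t, 𝒯.map K y)).2.1 j * W.2.1 j +
        dualDensity γ (X (t, 𝒯.map K y)) * W.1 - (X (t, 𝒯.map K y)).2.2 * entropy γ W +
        (X (t, 𝒯.map K y)).1 * (X (t, 𝒯.map K y)).2.2) =ᵐ[cubeMeasure d]
      fun y => relEnergy γ W (consOf γ (X (t, 𝒯.map K y))) := by
    filter_upwards [ae_mem_cube] with y hy
    obtain ⟨⟨h1, -⟩, -, h2, -⟩ := mem_primBox.1 (hX (𝒯.map_mem_closedCyl ht K hy))
    have hA0 : 0 < A⁻¹ := inv_pos.2 (by linarith)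
    rw [relEnergy_consOf hγ (by linarith) (by linarith)]
    simp only [PiLp.inner_apply, RCLike.inner_apply, conj_trivial, mul_comm]
  exact ⟨h1.1.congr h2, by rw [← integral_congr_ae h2]; exact h1.2⟩

theorem abs_dualPair_sub_le {a b G : State d} {c : ℝ} (h1 : |a.1 - b.1| ≤ c)
    (h2 : ∀ j, |a.2.1 j - b.2.1 j| ≤ c) : |dualPair a G - dualPair b G| ≤ (d + 1) * c * ‖G‖ := by
  have e : dualPair a G - dualPair b G =
      (a.1 - b.1) * G.1 - inner ℝ (a.2.1 - b.2.1) G.2.1 := by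
    simp only [dualPair, inner_sub_left]; ring
  have hc : 0 ≤ c := (abs_nonneg _).trans h1
  have e1 : |(a.1 - b.1) * G.1| ≤ c * ‖G‖ := by
    rw [abs_mul]
    exact mul_le_mul h1 (norm_fst_le G) (abs_nonneg _) hc
  have e2 : |inner ℝ (a.2.1 - b.2.1) G.2.1| ≤ d * c * ‖G‖ := by
    refine (abs_real_inner_le_norm _ _).trans (mul_le_mul ?_
      ((norm_fst_le G.2).trans (norm_snd_le G)) (norm_nonneg _) (by positivity))
    exact (norm_le_sum_abs _).trans ((Finset.sum_le_card_nsmul _ _ c fun j _ => h2 j).trans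
      (by simp))
  rw [e]
  refine (abs_sub _ _).trans ?_
  linarith

theorem abs_cellDual_sub_faceDual_le (h : LipschitzFields γ L (𝒯.closedCyl T K) X)
    (ht : t ∈ Icc 0 T) (i : Fin d) (s : Bool) :
    (∀ G, |dualPair (𝒯.cellDual γ X t K) G - dualPair (𝒯.faceDual γ X t K i s) G| ≤
      (d + 1) * L * (𝒯.hi K i - 𝒯.lo K i) * ‖G‖) ∧
    |(𝒯.cellDual γ X t K).2.2 - (𝒯.faceDual γ X t K i s).2.2| ≤
      (d + 1) * L * (𝒯.hi K i - 𝒯.lo K i) := by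
  have hpos := sub_pos.2 (𝒯.lo_lt_hi K i)
  have hle : ∀ {a : SpaceTime d → ℝ}, LipschitzOnWith L a (𝒯.closedCyl T K) →
      |𝒯.cellMean K (fun x => a (t, x)) - 𝒯.faceMean K i s fun x => a (t, x)| ≤
        L * (𝒯.hi K i - 𝒯.lo K i) := fun ha =>
    𝒯.abs_cellMean_sub_faceMean_le K (𝒯.slice_lipschitz ha ht) i s
  refine ⟨fun G => (abs_dualPair_sub_le (hle h.density) fun j => hle (h.velocity j)).trans
    (le_of_eq (by ring)), (hle h.temperature).trans ?_⟩
  have : 0 ≤ d * (L * (𝒯.hi K i - 𝒯.lo K i)) := by positivity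
  linarith

/-- The consequences at time `t` of the Lipschitz continuity of a function. -/
def SliceDeriv (𝒯 : RectMesh d Ω) (t : ℝ) (K : Fin 𝒯.N) (a : SpaceTime d → ℝ) : Prop :=
  (∀ e, Integrable (fun y => fderiv ℝ a (t, 𝒯.map K y) e) (cubeMeasure d)) ∧
    HasDerivAt (fun t => 𝒯.cellMean K fun x => a (t, x))
      (∫ y, fderiv ℝ a (t, 𝒯.map K y) (timeDir d) ∂(cubeMeasure d)) t ∧
    ∀ i, 𝒯.faceMean K i true (fun x => a (t, x)) - 𝒯.faceMean K i false (fun x => a (t, x)) =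
      (𝒯.hi K i - 𝒯.lo K i) * ∫ y, fderiv ℝ a (t, 𝒯.map K y) (spaceDir i) ∂(cubeMeasure d)

theorem SliceDeriv.area_mul {a : SpaceTime d → ℝ} (h : SliceDeriv 𝒯 t K a) (i : Fin d) :
    𝒯.area K i * (𝒯.faceMean K i true (fun x => a (t, x)) -
        𝒯.faceMean K i false (fun x => a (t, x))) =
      𝒯.vol K * ∫ y, fderiv ℝ a (t, 𝒯.map K y) (spaceDir i) ∂(cubeMeasure d) := by
  rw [h.2.2 i, 𝒯.vol_eq K i]; ring

/-- `SliceDeriv` for all coefficients of the relative energy. -/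
structure SliceFields (γ : ℝ) (𝒯 : RectMesh d Ω) (t : ℝ) (K : Fin 𝒯.N)
    (X : SpaceTime d → State d) : Prop where
  velocity : ∀ j, SliceDeriv 𝒯 t K fun z => (X z).2.1 j
  density : SliceDeriv 𝒯 t K fun z => dualDensity γ (X z)
  temperature : SliceDeriv 𝒯 t K fun z => (X z).2.2
  pressure : SliceDeriv 𝒯 t K fun z => (X z).1 * (X z).2.2
  power : ∀ i, SliceDeriv 𝒯 t K fun z => (X z).1 * (X z).2.2 * (X z).2.1 i

theorem ae_sliceFields (h : ∀ K, LipschitzFields γ L (𝒯.closedCyl T K) X) :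
    ∀ᵐ t ∂(volume.restrict (Ioo 0 T)), ∀ K, SliceFields γ 𝒯 t K X := by
  refine ae_all_iff.2 fun K => ?_
  have h1 := ae_all_iff.2 fun j => 𝒯.ae_slice_deriv ((h K).velocity j)
  have h5 := ae_all_iff.2 fun j => 𝒯.ae_slice_deriv ((h K).power j)
  filter_upwards [h1, 𝒯.ae_slice_deriv (h K).density, 𝒯.ae_slice_deriv (h K).temperature,
    𝒯.ae_slice_deriv (h K).pressure, h5] with t t1 t2 t3 t4 t5
  exact ⟨t1, t2, t3, t4, t5⟩

end RectMesh

namespace RectMesh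

variable {𝒯 : RectMesh d Ω} {T : ℝ} {K : Fin 𝒯.N} {L : ℝ≥0} {X : SpaceTime d → State d} {t : ℝ}

/-- The mean over a cell of `dualDeriv`. -/
noncomputable def cellDualDeriv (γ : ℝ) (𝒯 : RectMesh d Ω) (X : SpaceTime d → State d) (t : ℝ)
    (K : Fin 𝒯.N) (e : SpaceTime d) (G : State d) : ℝ :=
  -∑ j, (∫ y, fderiv ℝ (fun w => (X w).2.1 j) (t, 𝒯.map K y) e ∂(cubeMeasure d)) * G.2.1 j +
    (∫ y, fderiv ℝ (fun w => dualDensity γ (X w)) (t, 𝒯.map K y) e ∂(cubeMeasure d)) * G.1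

/-- The contribution of the time derivatives of the coefficients to the rate of change of the
relative energy. -/
noncomputable def timeRate (γ : ℝ) (𝒯 : RectMesh d Ω) (X : SpaceTime d → State d) (t : ℝ)
    (K : Fin 𝒯.N) (W : State d) : ℝ :=
  cellDualDeriv γ 𝒯 X t K (timeDir d) W -
    (∫ y, fderiv ℝ (fun w => (X w).2.2) (t, 𝒯.map K y) (timeDir d) ∂(cubeMeasure d)) *
      entropy γ W +
    ∫ y, fderiv ℝ (fun w => (X w).1 * (X w).2.2) (t, 𝒯.map K y) (timeDir d) ∂(cubeMeasure d)

theorem SliceFields.hasIntegral_dualDeriv (h : SliceFields γ 𝒯 t K X) (e : SpaceTime d)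
    (G : State d) : HasIntegral (fun y => dualDeriv γ X (t, 𝒯.map K y) e G)
      (cellDualDeriv γ 𝒯 X t K e G) :=
  (HasIntegral.sum fun j => HasIntegral.mul_const ⟨(h.velocity j).1 e, rfl⟩ _).neg.add
    (HasIntegral.mul_const ⟨h.density.1 e, rfl⟩ _)

theorem SliceFields.hasIntegral_residual (h : SliceFields γ 𝒯 t K X) (W : State d) :
    HasIntegral (fun y => residual γ W X (t, 𝒯.map K y))
      (timeRate γ 𝒯 X t K W + ∑ i, (cellDualDeriv γ 𝒯 X t K (spaceDir i) (flux γ (unitVec i) W) -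
        (∫ y, fderiv ℝ (fun w => (X w).2.2) (t, 𝒯.map K y) (spaceDir i) ∂(cubeMeasure d)) *
          entropyFlux γ (unitVec i) W +
        ∫ y, fderiv ℝ (fun w => (X w).1 * (X w).2.2 * (X w).2.1 i) (t, 𝒯.map K y) (spaceDir i)
          ∂(cubeMeasure d))) :=
  (((h.hasIntegral_dualDeriv _ _).sub (HasIntegral.mul_const ⟨h.temperature.1 _, rfl⟩ _)).add
    ⟨h.pressure.1 _, rfl⟩).add (HasIntegral.sum fun i =>
      ((h.hasIntegral_dualDeriv _ _).sub (HasIntegral.mul_const ⟨h.temperature.1 _, rfl⟩ _)).add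
        ⟨(h.power i).1 _, rfl⟩)

theorem SliceFields.sum_face_eq (h : SliceFields γ 𝒯 t K X) (W : State d) (i : Fin d) :
    ∑ s, 𝒯.area K i * (dualPair (𝒯.faceDual γ X t K i s) (flux γ (wallNormal i s) W) -
        (𝒯.faceDual γ X t K i s).2.2 * entropyFlux γ (wallNormal i s) W) =
      𝒯.vol K * (cellDualDeriv γ 𝒯 X t K (spaceDir i) (flux γ (unitVec i) W) -
        (∫ y, fderiv ℝ (fun w => (X w).2.2) (t, 𝒯.map K y) (spaceDir i) ∂(cubeMeasure d)) *
          entropyFlux γ (unitVec i) W) := by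
  have h1 : (wallNormal i true : Space d) = unitVec i := by simp [wallNormal]
  rw [Fintype.sum_bool, wallNormal_false, h1, flux_neg, entropyFlux_neg, dualPair_neg,
    dualPair_eq_sum, dualPair_eq_sum]
  set G := flux γ (unitVec i) W
  have e1 : ∀ j, 𝒯.area K i * ((𝒯.faceDual γ X t K i true).2.1 j -
      (𝒯.faceDual γ X t K i false).2.1 j) = _ := fun j => (h.velocity j).area_mul i
  have e2 : 𝒯.area K i * ((𝒯.faceDual γ X t K i true).1 -
      (𝒯.faceDual γ X t K i false).1) = _ := h.density.area_mul i
  have e3 : 𝒯.area K i * ((𝒯.faceDual γ X t K i true).2.2 -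
      (𝒯.faceDual γ X t K i false).2.2) = _ := h.temperature.area_mul i
  have e4 : ∑ j, 𝒯.area K i * ((𝒯.faceDual γ X t K i true).2.1 j -
      (𝒯.faceDual γ X t K i false).2.1 j) * G.2.1 j = 𝒯.vol K * ∑ j, (∫ y,
        fderiv ℝ (fun w => (X w).2.1 j) (t, 𝒯.map K y) (spaceDir i) ∂(cubeMeasure d)) *
          G.2.1 j := by
    rw [Finset.mul_sum]
    exact Finset.sum_congr rfl fun j _ => by rw [e1 j]; ring
  have e5 : ∑ j, 𝒯.area K i * ((𝒯.faceDual γ X t K i true).2.1 j -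
      (𝒯.faceDual γ X t K i false).2.1 j) * G.2.1 j = 𝒯.area K i *
        (∑ j, (𝒯.faceDual γ X t K i true).2.1 j * G.2.1 j -
          ∑ j, (𝒯.faceDual γ X t K i false).2.1 j * G.2.1 j) := by
    rw [← Finset.sum_sub_distrib, Finset.mul_sum]
    exact Finset.sum_congr rfl fun j _ => by ring
  rw [cellDualDeriv]
  linear_combination G.1 * e2 - entropyFlux γ (unitVec i) W * e3 - e4 + e5

end RectMesh

open RectMesh

variable {𝒯 : RectMesh d Ω} {T A : ℝ} {C : ℝ≥0} {X : SpaceTime d → State d} {t : ℝ}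

/-- The pressure does no work at the impermeable boundary. -/
theorem IsPrimitiveSolution.sum_power_eq_zero (h : IsPrimitiveSolution γ A C T 𝒯 X)
    (ht : t ∈ Icc 0 T) :
    ∑ K, ∑ i, 𝒯.area K i *
      (𝒯.faceMean K i true (fun x => (X (t, x)).1 * (X (t, x)).2.2 * (X (t, x)).2.1 i) -
        𝒯.faceMean K i false (fun x => (X (t, x)).1 * (X (t, x)).2.2 * (X (t, x)).2.1 i)) = 0 := by
  have h1 := 𝒯.sum_faces_eq_zero (H := fun K i s => (if s then 1 else -1) * (𝒯.area K i *
      𝒯.faceMean K i s (fun x => (X (t, x)).1 * (X (t, x)).2.2 * (X (t, x)).2.1 i)))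
    (fun i K L ha => by
      simp only [if_true, Bool.false_eq_true, if_false, faceMean, 𝒯.facePoint_adj ha,
        𝒯.area_adj ha]
      ring)
    (fun K i s hw => by
      have : 𝒯.faceMean K i s (fun x => (X (t, x)).1 * (X (t, x)).2.2 * (X (t, x)).2.1 i) = 0 := by
        refine integral_eq_zero_of_ae ?_
        filter_upwards [h.impermeable t ht K i s hw] with y hy
        simp [hy]
      simp [this])
  rw [← h1]
  refine Finset.sum_congr rfl fun K _ => Finset.sum_congr rfl fun i _ => ?_
  rw [Fintype.sum_bool]
  simp only [if_true, Bool.false_eq_true, if_false]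
  ring

/-- The rate of change of the relative energy. -/
theorem IsPrimitiveSolution.rate_le (hγ : 1 < γ) (hA : 1 ≤ A)
    (h : IsPrimitiveSolution γ A C T 𝒯 X)
    {L : ℝ≥0} (hL : ∀ K, LipschitzFields γ L (𝒯.closedCyl T K) X) (ht : t ∈ Icc 0 T)
    (hs : ∀ K, SliceFields γ 𝒯 t K X) {V V' : Fin 𝒯.N → State d}
    {g : Fin 𝒯.N → Fin d → Bool → State d} {Q D : Fin 𝒯.N → Fin d → Bool → ℝ}
    (hF : IsFaceData γ 𝒯 V V' g Q D) (hV : ∀ K, IsPhysical γ (V K)) {c B : ℝ}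
    (hR : ∀ K, ∀ᵐ y ∂(cubeMeasure d), residual γ (V K) X (t, 𝒯.map K y) ≤
      c * relEnergy γ (V K) (consOf γ (X (t, 𝒯.map K y))))
    (hB : ∀ K G, |pairing γ (V K) G / temperature γ (V K)| ≤ B * ‖G‖) :
    ∑ K, 𝒯.vol K * (dualPair (𝒯.cellDual γ X t K) (V' K) - (𝒯.cellDual γ X t K).2.2 *
        (pairing γ (V K) (V' K) / temperature γ (V K)) + timeRate γ 𝒯 X t K (V K)) ≤
      c * 𝒯.totalRelEnergy γ X t V + (d + 1) * L * (1 + B) *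
        ∑ K, ∑ i, ∑ s : Bool, 𝒯.vol K * ‖g K i s - flux γ (wallNormal i s) (V K)‖ := by
  have hA0 : 0 < A⁻¹ := inv_pos.2 (by linarith)
  have h1 := hF.dual_balance hV (m := 𝒯.cellDual γ X t) (f := 𝒯.faceDual γ X t)
    (L := (d + 1) * L) (B := B)
    (fun i K K' ha => by simp only [faceDual, faceMean, 𝒯.facePoint_adj ha])
    (fun K i s hw => by
      refine integral_eq_zero_of_ae ?_
      filter_upwards [h.impermeable t ht K i s hw] with y hy
      simp [hy])
    (fun K i s => by
      refine integral_nonneg_of_ae ?_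
      filter_upwards [ae_mem_cube] with y hy
      have := (mem_primBox.1 (h.mem_box K (𝒯.facePoint_mem_closedCyl ht K i s hy))).2.2.1
      exact hA0.le.trans this)
    (fun K i s G => (abs_cellDual_sub_faceDual_le (hL K) ht i s).1 G)
    (fun K i s => (abs_cellDual_sub_faceDual_le (hL K) ht i s).2) hB
  have h2 : ∀ K, 𝒯.vol K * timeRate γ 𝒯 X t K (V K) + ∑ i, ∑ s, 𝒯.area K i *
      (dualPair (𝒯.faceDual γ X t K i s) (flux γ (wallNormal i s) (V K)) -
        (𝒯.faceDual γ X t K i s).2.2 * entropyFlux γ (wallNormal i s) (V K)) +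
      ∑ i, 𝒯.area K i *
      (𝒯.faceMean K i true (fun x => (X (t, x)).1 * (X (t, x)).2.2 * (X (t, x)).2.1 i) -
        𝒯.faceMean K i false (fun x => (X (t, x)).1 * (X (t, x)).2.2 * (X (t, x)).2.1 i)) ≤
      𝒯.vol K * (c * (dualPair (𝒯.cellDual γ X t K) (V K)
        - (𝒯.cellDual γ X t K).2.2 * entropy γ (V K)
        + 𝒯.cellMean K fun x => (X (t, x)).1 * (X (t, x)).2.2)) := fun K => by
    have e1 := (hs K).hasIntegral_residual (V K)
    have e2 := hasIntegral_relEnergy hγ hA (hL K) (h.mem_box K) ht (V K)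
    have e3 := integral_mono_ae e1.1 (e2.1.const_mul c) (hR K)
    rw [e1.2, integral_const_mul, e2.2] at e3
    refine le_trans (le_of_eq ?_) (mul_le_mul_of_nonneg_left e3 (𝒯.vol_pos K).le)
    simp only [fun i => (hs K).sum_face_eq (V K) i, fun i => ((hs K).power i).area_mul i]
    rw [mul_add, add_assoc, ← Finset.sum_add_distrib, Finset.mul_sum]
    congr 1
    exact Finset.sum_congr rfl fun i _ => by ring
  have h3 := Finset.sum_le_sum fun K (_ : K ∈ Finset.univ) => h2 K
  simp only [Finset.sum_add_distrib] at h3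
  rw [h.sum_power_eq_zero ht, add_zero] at h3
  have h4 : ∑ K, 𝒯.vol K * (c * (dualPair (𝒯.cellDual γ X t K) (V K)
        - (𝒯.cellDual γ X t K).2.2 * entropy γ (V K)
        + 𝒯.cellMean K fun x => (X (t, x)).1 * (X (t, x)).2.2)) =
      c * 𝒯.totalRelEnergy γ X t V := by
    rw [totalRelEnergy, Finset.mul_sum]
    exact Finset.sum_congr rfl fun K _ => by ring
  rw [h4] at h3
  simp only [mul_add (𝒯.vol _) _ (timeRate γ 𝒯 X t _ (V _)), Finset.sum_add_distrib]
  linarith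

variable {d : ℕ} {γ : ℝ} {Ω : Set (Space d)}

theorem hasDerivWithinAt_specEntropy (hγ : 1 < γ) {U : ℝ → State d} {U' : State d} {s : Set ℝ}
    {t : ℝ} (h : HasDerivWithinAt U U' s t) (hU : IsPhysical γ (U t)) :
    HasDerivWithinAt (fun r => specEntropy γ (U r)) ((γ - 1) / ((U t).1 * temperature γ (U t)) *
      (pairing γ (U t) U' - temperature γ (U t) / (γ - 1) * specEntropy γ (U t) * U'.1)) s t := by
  have hg : γ - 1 ≠ 0 := by linarith
  have hρ := hU.1.ne'
  have h1 : HasDerivWithinAt (fun r => (U r).1) U'.1 s t := h.fst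
  have h2 : HasDerivWithinAt (fun r => (U r).2.1) U'.2.1 s t := h.snd.fst
  have h3 : HasDerivWithinAt (fun r => (U r).2.2) U'.2.2 s t := h.snd.snd
  have hp : HasDerivWithinAt (fun r => pressure γ (U r)) _ s t :=
    (h3.sub (h2.norm_sq.div (h1.const_mul 2) (mul_ne_zero two_ne_zero hρ))).const_mul (γ - 1)
  have hr := h1.rpow_const (p := γ) (Or.inl hρ)
  have hrp := (Real.rpow_pos_of_pos hU.1 γ).ne'
  refine ((hp.div hr hrp).log (div_ne_zero hU.2.ne' hrp)).congr_deriv ?_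
  have hP := pressure_eq (Or.inl hU)
  have hθ := (temperature_pos hU).ne'
  simp only [Pi.div_apply]
  rw [pairing_apply, densityCoeff, hP, Real.rpow_sub_one hρ, momentum_eq (Or.inl hU), norm_smul,
    Real.norm_eq_abs, mul_pow, sq_abs, inner_smul_left, conj_trivial]
  field_simp
  ring

theorem hasDerivWithinAt_entropy (hγ : 1 < γ) {U : ℝ → State d} {U' : State d} {s : Set ℝ}
    {t : ℝ} (h : HasDerivWithinAt U U' s t) (hU : IsPhysical γ (U t)) :
    HasDerivWithinAt (fun r => entropy γ (U r))
      (pairing γ (U t) U' / temperature γ (U t)) s t := by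
  have hg : γ - 1 ≠ 0 := by linarith
  have hρ := hU.1.ne'
  have hθ := (temperature_pos hU).ne'
  have h1 : HasDerivWithinAt (fun r => (U r).1) U'.1 s t := h.fst
  refine ((h1.const_mul (1 / (γ - 1))).mul (hasDerivWithinAt_specEntropy hγ h hU)).congr_deriv ?_
  field_simp
  ring

variable {𝒯 : RectMesh d Ω} {T A : ℝ} {C : ℝ≥0} {X : SpaceTime d → State d}

theorem RectMesh.proj_eq (𝒯 : RectMesh d Ω) (U₀ : Space d → State d) (K : Fin 𝒯.N) :
    𝒯.proj U₀ K = ∫ y, U₀ (𝒯.map K y) ∂(cubeMeasure d) := by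
  have h1 := 𝒯.setIntegral_cell K fun _ => (1 : ℝ)
  have h2 := (𝒯.vol_pos K).ne'
  simp only [integral_const, measureReal_restrict_apply_univ, smul_eq_mul, mul_one,
    probReal_univ] at h1
  rw [RectMesh.proj, setAverage_eq, 𝒯.setIntegral_cell, h1, smul_smul, inv_mul_cancel₀ h2,
    one_smul]

/-- The specific entropy of a mean value is at least a lower bound of the specific entropy. -/
theorem le_specEntropy_integral (hγ : 1 < γ) {W : (Fin d → ℝ) → State d} {k : ℝ}
    (hW : Integrable W (cubeMeasure d))
    (hk : ∀ᵐ y ∂(cubeMeasure d), IsPhysical γ (W y) ∧ k ≤ specEntropy γ (W y))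
    (hV : IsPhysical γ (∫ y, W y ∂(cubeMeasure d))) :
    k ≤ specEntropy γ (∫ y, W y ∂(cubeMeasure d)) := by
  have hg : 0 < 1 / (γ - 1) := one_div_pos.2 (by linarith)
  set V := ∫ y, W y ∂(cubeMeasure d) with hVd
  have hθ := temperature_pos hV
  let ℓ : State d →L[ℝ] ℝ := pairing γ V -
    (temperature γ V * (1 / (γ - 1) * k)) • ContinuousLinearMap.fst ℝ ℝ (Space d × ℝ)
  have h1 : -pressure γ V ≤ ∫ y, ℓ (W y) ∂(cubeMeasure d) := by
    have h2 : ∫ _ : Fin d → ℝ, -pressure γ V ∂(cubeMeasure d) = -pressure γ V := by simp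
    rw [← h2]
    refine integral_mono_ae (integrable_const _) (ℓ.integrable_comp hW) ?_
    filter_upwards [hk] with y hy
    have h3 := relEnergy_nonneg hγ (Or.inl hy.1) hV
    rw [relEnergy, entropy_eq] at h3
    have h4 : temperature γ V * (1 / (γ - 1) * k) * (W y).1 ≤
        temperature γ V * (1 / (γ - 1) * (W y).1 * specEntropy γ (W y)) := by
      have := mul_le_mul_of_nonneg_left hy.2 (mul_pos (mul_pos hθ hg) hy.1.1).le
      linarith
    simp only [ℓ, _root_.sub_apply, _root_.smul_apply,
      ContinuousLinearMap.coe_fst', smul_eq_mul]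
    linarith
  rw [ℓ.integral_comp_comm hW, ← hVd] at h1
  have h5 := relEnergy_self hγ hV
  rw [relEnergy, entropy_eq] at h5
  simp only [ℓ, _root_.sub_apply, _root_.smul_apply,
    ContinuousLinearMap.coe_fst', smul_eq_mul] at h1
  have h6 : 0 ≤ temperature γ V * (1 / (γ - 1)) * V.1 * (specEntropy γ V - k) := by linarith
  have := (mul_nonneg_iff_of_pos_left (mul_pos (mul_pos hθ hg) hV.1)).1 h6
  linarith

theorem IsGodunovSolution.hasDerivWithinAt {U₀ : Space d → State d} {U : ℝ → Fin 𝒯.N → State d}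
    (h : IsGodunovSolution γ T 𝒯 U₀ U) {t : ℝ} (ht : t ∈ Icc 0 T) (K : Fin 𝒯.N) :
    HasDerivWithinAt (fun r => U r K) (derivWithin (fun r => U r K) (Icc 0 T) t) (Icc 0 T) t :=
  (h.differentiable K t ht).hasDerivWithinAt

/-- The minimum entropy principle. -/
theorem IsGodunovSolution.le_specEntropy (hγ : 1 < γ) (hγ2 : γ ≤ 2) {U₀ : Space d → State d}
    {U : ℝ → Fin 𝒯.N → State d} (h : IsGodunovSolution γ T 𝒯 U₀ U) {k : ℝ}
    (hk : ∀ K, k ≤ specEntropy γ (U 0 K)) {t : ℝ} (ht : t ∈ Icc 0 T) (K : Fin 𝒯.N) :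
    k ≤ specEntropy γ (U t K) := by
  have hder := fun t (ht : t ∈ Icc 0 T) K =>
    hasDerivWithinAt_specEntropy hγ (h.hasDerivWithinAt ht K) (h.physical t ht K)
  have main : ∀ ε > 0, k ≤ specEntropy γ (U t K) + ε * t := fun ε hε => by
    have h1 : ∀ L, ∃ r ∈ Icc 0 T, ∀ r' ∈ Icc 0 T,
        specEntropy γ (U r L) + ε * r ≤ specEntropy γ (U r' L) + ε * r' := fun L => by
      have hc : ContinuousOn (fun r => specEntropy γ (U r L) + ε * r) (Icc 0 T) :=
        ContinuousOn.add (fun r hr => (hder r hr L).continuousWithinAt) (by fun_prop)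
      exact isCompact_Icc.exists_isMinOn ⟨t, ht⟩ hc
    choose r hr hmin using h1
    have : Nonempty (Fin 𝒯.N) := ⟨K⟩
    obtain ⟨L, hL⟩ := Finite.exists_min fun L => specEntropy γ (U (r L) L) + ε * r L
    refine le_trans ?_ ((hL K).trans (hmin K t ht))
    rcases (hr L).1.eq_or_lt with h0 | h0
    · rw [← h0, mul_zero, add_zero]; exact hk L
    · exfalso
      obtain ⟨g, Q, D, hF⟩ := h.exists_isFaceData hγ hγ2 (hr L)
      have h2 := hF.entropy_min (K := L) fun K' => by
        have := (hL K').trans (hmin K' (r L) (hr L))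
        linarith
      have hd : HasDerivWithinAt (fun r => specEntropy γ (U r L) + ε * r) _ (Icc 0 T) (r L) :=
        (hder _ (hr L) L).add ((hasDerivWithinAt_id _ _).const_mul ε)
      have hm : IsMinOn (fun r => specEntropy γ (U r L) + ε * r) (Icc 0 T) (r L) :=
        fun r' hr' => hmin L r' hr'
      have h3 := hm.localize.hasFDerivWithinAt_nonneg hd.hasFDerivWithinAt
        (sub_mem_posTangentConeAt_of_segment_subset (y := 0)
          ((convex_Icc 0 T).segment_subset (hr L) ⟨le_rfl, h0.le.trans (hr L).2⟩))
      have hph := h.physical _ (hr L) L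
      have h4 := mul_nonneg (div_pos (sub_pos.2 hγ) (mul_pos hph.1 (temperature_pos hph))).le
        (sub_nonneg.2 h2)
      simp only [zero_sub, ContinuousLinearMap.toSpanSingleton_apply, smul_eq_mul, mul_one] at h3
      nlinarith
  refine le_of_forall_pos_le_add fun δ hδ => ?_
  have hpos : 0 < t + 1 := by linarith [ht.1]
  refine (main (δ / (t + 1)) (div_pos hδ hpos)).trans (add_le_add_right ?_ _)
  rw [div_mul_eq_mul_div, div_le_iff₀ hpos]
  nlinarith

theorem IsPrimitiveSolution.continuousOn_consOf (hX : IsPrimitiveSolution γ A C T 𝒯 X)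
    {t : ℝ} (ht : t ∈ Icc 0 T) (K : Fin 𝒯.N) :
    ContinuousOn (fun x => consOf γ (X (t, x))) (𝒯.closedCell K) := by
  have h1 := 𝒯.slice_continuousOn (hX.lipschitz K).continuousOn ht
  exact h1.fst.prodMk ((h1.fst.smul h1.snd.fst).prodMk
    (contDiff_energyOf.continuous.comp_continuousOn h1))

theorem IsPrimitiveSolution.le_specEntropy (hγ : 1 < γ) (hγ2 : γ ≤ 2) (hA : 1 ≤ A) (hT : 0 ≤ T)
    (hX : IsPrimitiveSolution γ A C T 𝒯 X) {U : ℝ → Fin 𝒯.N → State d}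
    (h : IsGodunovSolution γ T 𝒯 (fun x => consOf γ (X (0, x))) U) {t : ℝ} (ht : t ∈ Icc 0 T)
    (K : Fin 𝒯.N) : -(γ * log A) ≤ specEntropy γ (U t K) := by
  refine h.le_specEntropy hγ hγ2 (fun K => ?_) ht K
  have h0 : (0 : ℝ) ∈ Icc 0 T := ⟨le_rfl, hT⟩
  have hph := h.physical 0 h0 K
  rw [h.initial, RectMesh.proj_eq] at hph ⊢
  refine le_specEntropy_integral hγ (𝒯.integrable_cube_of_continuousOn (hX.continuousOn_consOf h0 K)).1 ?_ hph
  filter_upwards [ae_mem_cube] with y hy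
  have hb := stateBdd_consOf hγ hA (hX.mem_box K (𝒯.map_mem_closedCyl h0 K hy))
  exact ⟨hb.physical, (abs_le.1 (abs_specEntropy_le hγ hA hb)).1⟩

/-- Bounds of the numerical solution. -/
theorem exists_stateBdd (hγ : 1 < γ) (hγ2 : γ ≤ 2) (k : ℝ) {ρ_low E_up : ℝ} (hρ : 0 < ρ_low)
    (hE : 0 < E_up) : ∃ A, 1 ≤ A ∧ ∀ V : State d, IsPhysical γ V → k ≤ specEntropy γ V →
      ρ_low ≤ V.1 → V.2.2 ≤ E_up → StateBdd γ A V := by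
  have hg : 0 < γ - 1 := by linarith
  set a := exp (-k - (γ - 1) * log ρ_low) with ha
  have p1 : 0 < ρ_low⁻¹ := inv_pos.2 hρ
  have p2 : 0 < E_up * exp (-k) := by positivity
  have p3 : 0 < a := Real.exp_pos _
  have p4 : 0 < E_up / ρ_low := by positivity
  set A := 1 + ρ_low⁻¹ + E_up * exp (-k) + a + 2 * (E_up / ρ_low) with hA
  refine ⟨A, by linarith, fun V hV hS h1 h2 => ?_⟩
  have hV0 := hV.1
  have hcv : 1 ≤ 1 / (γ - 1) := by rw [le_div_iff₀ hg]; linarith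
  have hen := energy_eq_pressure hγ (Or.inl hV)
  have hkin : 0 ≤ 1 / 2 * V.1 * ‖velocity V‖ ^ 2 := by positivity
  have hp : pressure γ V ≤ E_up := by
    have := le_mul_of_one_le_left hV.2.le hcv
    linarith
  have hθ := temperature_pos hV
  have hSe := specEntropy_eq hV
  refine ⟨hV, (inv_le_of_inv_le₀ hρ (by linarith)).trans h1, ?_, ?_, ?_, ?_⟩
  · by_cases h3 : V.1 ≤ 1
    · linarith
    · push Not at h3
      have h4 : V.1 ≤ V.1 ^ γ := by
        conv_lhs => rw [← Real.rpow_one V.1]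
        exact Real.rpow_le_rpow_of_exponent_le h3.le hγ.le
      have h5 : V.1 ^ γ ≤ E_up * exp (-k) := by
        have h6 := Real.rpow_pos_of_pos hV0 γ
        have h7 := Real.exp_le_exp.2 hS
        rw [specEntropy, Real.exp_log (div_pos hV.2 h6), le_div_iff₀ h6] at h7
        rw [Real.exp_neg, ← div_eq_mul_inv, le_div_iff₀ (Real.exp_pos k)]
        linarith
      linarith
  · have h3 : a⁻¹ ≤ temperature γ V := by
      rw [ha, ← Real.exp_neg, ← Real.le_log_iff_exp_le hθ]
      have := mul_le_mul_of_nonneg_left (Real.log_le_log hρ h1) hg.le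
      linarith
    exact (inv_anti₀ p3 (by linarith)).trans h3
  · have h3 : temperature γ V ≤ E_up / ρ_low := div_le_div₀ hE.le hp hρ h1
    linarith
  · have h3 : ‖velocity V‖ ^ 2 ≤ 2 * (E_up / ρ_low) := by
      rw [← mul_div_assoc, le_div_iff₀ hρ]
      have := mul_le_mul_of_nonneg_right h1 (sq_nonneg ‖velocity V‖)
      have := mul_pos (one_div_pos.2 hg) hV.2
      linarith
    nlinarith [sq_nonneg (‖velocity V‖ - 1)]

/-- The constant bounding the derivative of the entropy. -/
noncomputable def entropyConst (γ A : ℝ) : ℝ :=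
  A * (1 + A + (1 / 2 * A ^ 2 + A / (γ - 1) * (γ + γ * log A)))

theorem abs_pairing_div_le (hγ : 1 < γ) {A : ℝ} (hA : 1 ≤ A) {V : State d} (hV : StateBdd γ A V)
    (G : State d) : |pairing γ V G / temperature γ V| ≤ entropyConst γ A * ‖G‖ := by
  have hg : 0 < γ - 1 := by linarith
  have hA0 : 0 < A := by linarith
  have hθ := temperature_pos hV.physical
  have hlog := Real.log_nonneg hA
  have hS := abs_le.1 (abs_specEntropy_le hγ hA hV)
  have h1 : |densityCoeff γ V| ≤ 1 / 2 * A ^ 2 + A / (γ - 1) * (γ + γ * log A) := by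
    rw [densityCoeff]
    refine (abs_sub _ _).trans (add_le_add ?_ ?_)
    · rw [abs_of_nonneg (by positivity)]
      gcongr
      exact hV.velocity_le
    · rw [abs_mul, abs_of_pos (div_pos hθ hg)]
      gcongr
      · exact hV.temperature_le
      · rw [abs_le]; constructor <;> linarith
  have h2 : |pairing γ V G| ≤
      (1 + A + (1 / 2 * A ^ 2 + A / (γ - 1) * (γ + γ * log A))) * ‖G‖ := by
    rw [pairing_apply]
    have e1 : |G.2.2| ≤ ‖G‖ := (norm_snd_le G.2).trans (norm_snd_le G)
    have e2 : |inner ℝ (velocity V) G.2.1| ≤ A * ‖G‖ := (abs_real_inner_le_norm _ _).trans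
      (mul_le_mul hV.velocity_le ((norm_fst_le G.2).trans (norm_snd_le G)) (norm_nonneg _) hA0.le)
    have e3 : |densityCoeff γ V * G.1| ≤
        (1 / 2 * A ^ 2 + A / (γ - 1) * (γ + γ * log A)) * ‖G‖ := by
      rw [abs_mul]
      exact mul_le_mul h1 (norm_fst_le G) (abs_nonneg _) ((abs_nonneg _).trans h1)
    refine (abs_add_le _ _).trans ((add_le_add_left (abs_sub _ _) _).trans ?_)
    linarith
  rw [abs_div, abs_of_pos hθ, div_le_iff₀ hθ, entropyConst]
  have h3 : 1 ≤ A * temperature γ V := by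
    have := mul_le_mul_of_nonneg_left hV.temperature_ge hA0.le
    rwa [mul_inv_cancel₀ hA0.ne'] at this
  have h4 := (abs_nonneg _).trans h2
  nlinarith [mul_le_mul_of_nonneg_right h3 h4]

variable {d : ℕ} {γ : ℝ} {Ω : Set (Space d)}

theorem _root_.AbsolutelyContinuousOnInterval.congr {f g : ℝ → ℝ} {a b : ℝ}
    (hf : AbsolutelyContinuousOnInterval f a b) (h : EqOn f g (uIcc a b)) :
    AbsolutelyContinuousOnInterval g a b := by
  rw [absolutelyContinuousOnInterval_iff] at hf ⊢
  intro ε hε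
  obtain ⟨δ, hδ, H⟩ := hf ε hε
  refine ⟨δ, hδ, fun E hE hlt => ?_⟩
  rw [← Finset.sum_congr rfl fun i hi => ?_]
  · exact H E hE hlt
  · have := hE.1 i hi
    rw [h this.1, h this.2]

/-- A function with an integrable derivative is absolutely continuous. -/
theorem ac_of_hasDerivAt {f f' G : ℝ → ℝ} {a b : ℝ} (hab : a ≤ b) (hc : ContinuousOn f (Icc a b))
    (hd : ∀ x ∈ Ioo a b, HasDerivAt f (f' x) x) (hG : IntervalIntegrable G volume a b)
    (hb : ∀ x ∈ Ioo a b, |f' x| ≤ G x) : AbsolutelyContinuousOnInterval f a b := by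
  have hint : IntervalIntegrable (deriv f) volume a b := by
    refine hG.mono_fun' (measurable_deriv f).aestronglyMeasurable ?_
    rw [uIoc_of_le hab, EventuallyLE, ae_restrict_iff' measurableSet_Ioc]
    filter_upwards [ae_ne b] with x hx h
    have h1 : x ∈ Ioo a b := ⟨h.1, lt_of_le_of_ne h.2 hx⟩
    rw [(hd x h1).deriv]
    exact hb x h1
  have h1 : AbsolutelyContinuousOnInterval (fun _ : ℝ => f a) a b :=
    (LipschitzWith.const (f a)).lipschitzOnWith.absolutelyContinuousOnInterval (K := 0)
  refine (h1.add (hint.absolutelyContinuousOnInterval_intervalIntegral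
    (left_mem_uIcc))).congr fun x hx => ?_
  rw [uIcc_of_le hab] at hx
  have h2 : uIcc a x ⊆ uIcc a b := by
    rw [uIcc_of_le hab, uIcc_of_le hx.1]; exact Icc_subset_Icc_right hx.2
  have := intervalIntegral.integral_eq_sub_of_hasDerivAt_of_le hx.1
    (hc.mono (Icc_subset_Icc_right hx.2)) (f' := deriv f) (fun y hy => by
      have := hd y ⟨hy.1, hy.2.trans_le hx.2⟩
      rwa [this.deriv]) (hint.mono_set h2)
  simp [this]

variable {𝒯 : RectMesh d Ω} {T B : ℝ} {U₀ : Space d → State d} {U : ℝ → Fin 𝒯.N → State d}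

/-- The time derivative of a numerical solution. -/
noncomputable def cellRate (T : ℝ) (U : ℝ → Fin 𝒯.N → State d) (t : ℝ) (K : Fin 𝒯.N) : State d :=
  derivWithin (fun r => U r K) (Icc 0 T) t

/-- The time derivative of the total entropy. -/
noncomputable def entropyRate (γ T : ℝ) (U : ℝ → Fin 𝒯.N → State d) (t : ℝ) : ℝ :=
  ∑ K, 𝒯.vol K * (pairing γ (U t K) (cellRate T U t K) / temperature γ (U t K))

theorem IsFaceData.norm_sub_le {V V' : Fin 𝒯.N → State d}
    {g : Fin 𝒯.N → Fin d → Bool → State d} {Q D : Fin 𝒯.N → Fin d → Bool → ℝ}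
    (h : IsFaceData γ 𝒯 V V' g Q D) (hB : 1 ≤ B) (hV : ∀ K, StateBdd γ B (V K)) {ε : ℝ}
    (hε : 0 < ε) (K : Fin 𝒯.N) (i : Fin d) (s : Bool) :
    ‖g K i s - flux γ (wallNormal i s) (V K)‖ ≤
      dissipationConst γ B * (ε + (1 + 1 / ε) * (2 * B * D K i s)) := by
  obtain ⟨L, hL⟩ := h.face K i s
  exact hL.norm_sub_le B hB (hV K) ε hε

/-- The flux differences in terms of the entropy production. -/
theorem IsFaceData.sum_norm_sub_le {V V' : Fin 𝒯.N → State d}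
    {g : Fin 𝒯.N → Fin d → Bool → State d} {Q D : Fin 𝒯.N → Fin d → Bool → ℝ} (hγ : 1 < γ)
    (h : IsFaceData γ 𝒯 V V' g Q D) (hB : 1 ≤ B) (hV : ∀ K, StateBdd γ B (V K)) {δ : ℝ}
    (hδ : 0 < δ) (hside : ∀ K i, 𝒯.hi K i - 𝒯.lo K i ≤ δ) :
    ∑ K, ∑ i, ∑ s : Bool, 𝒯.vol K * ‖g K i s - flux γ (wallNormal i s) (V K)‖ ≤
      dissipationConst γ B * √δ * (2 * d * ∑ K, 𝒯.vol K +
        2 * B * (1 + √δ) *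
          ∑ K, 𝒯.vol K * (pairing γ (V K) (V' K) / temperature γ (V K))) := by
  set c := dissipationConst γ B
  have hc : 0 ≤ c := dissipationConst_nonneg hγ hB
  have hq := Real.sqrt_pos.2 hδ
  have hq2 := Real.mul_self_sqrt hδ.le
  have h1 : ∀ K i (s : Bool), 𝒯.vol K * ‖g K i s - flux γ (wallNormal i s) (V K)‖ ≤
      c * √δ * 𝒯.vol K +
        c * √δ * (2 * B * (1 + √δ)) * (𝒯.area K i * D K i s) := fun K i s => by
    have h2 := mul_le_mul_of_nonneg_left (h.norm_sub_le hB hV hq K i s) (𝒯.vol_pos K).le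
    have hD := h.D_nonneg K i s
    have h3 : 𝒯.vol K * D K i s ≤ δ * (𝒯.area K i * D K i s) := by
      rw [𝒯.vol_eq K i, mul_assoc]
      exact mul_le_mul_of_nonneg_right (hside K i) (mul_nonneg (𝒯.area_pos K i).le hD)
    refine h2.trans ?_
    have h4 : (1 + 1 / √δ) * δ = √δ * (1 + √δ) := by
      have : 1 / √δ * δ = √δ := by
        rw [one_div, inv_mul_eq_div, Real.div_sqrt]
      linear_combination this - hq2
    have h5 : 0 ≤ c * (2 * B) * (1 + 1 / √δ) := by positivity
    have h6 := mul_le_mul_of_nonneg_left h3 h5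
    calc _ = c * √δ * 𝒯.vol K +
          c * (2 * B) * (1 + 1 / √δ) * (𝒯.vol K * D K i s) := by ring
      _ ≤ c * √δ * 𝒯.vol K + c * (2 * B) * (1 + 1 / √δ) *
          (δ * (𝒯.area K i * D K i s)) := by gcongr
      _ = _ := by linear_combination c * (2 * B) * (𝒯.area K i * D K i s) * h4
  refine (Finset.sum_le_sum fun K _ => Finset.sum_le_sum fun i _ => Finset.sum_le_sum fun s _ =>
    h1 K i s).trans ?_
  have h7 := mul_le_mul_of_nonneg_left (h.sum_area_D_le fun K => (hV K).physical)
    (show 0 ≤ c * √δ * (2 * B * (1 + √δ)) by positivity)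
  simp only [Finset.sum_add_distrib, ← Finset.mul_sum, Finset.sum_const, Finset.card_univ,
    Fintype.card_bool, Fintype.card_fin, nsmul_eq_mul]
  simp only [← Finset.mul_sum] at h7
  refine (add_le_add_right h7 _).trans (le_of_eq ?_)
  push_cast
  ring

variable {d : ℕ} {γ : ℝ} {Ω : Set (Space d)} {𝒯 : RectMesh d Ω} {T B : ℝ}
  {U₀ : Space d → State d} {U : ℝ → Fin 𝒯.N → State d}

namespace IsGodunovSolution

theorem hasDerivAt (h : IsGodunovSolution γ T 𝒯 U₀ U) {t : ℝ} (ht : t ∈ Ioo 0 T)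
    (K : Fin 𝒯.N) : HasDerivAt (fun r => U r K) (cellRate T U t K) t :=
  (h.hasDerivWithinAt (Ioo_subset_Icc_self ht) K).hasDerivAt (Icc_mem_nhds ht.1 ht.2)

theorem hasDerivAt_entropy (hγ : 1 < γ) (h : IsGodunovSolution γ T 𝒯 U₀ U) {t : ℝ}
    (ht : t ∈ Ioo 0 T) (K : Fin 𝒯.N) : HasDerivAt (fun r => entropy γ (U r K))
      (pairing γ (U t K) (cellRate T U t K) / temperature γ (U t K)) t :=
  (hasDerivWithinAt_entropy hγ (h.hasDerivWithinAt (Ioo_subset_Icc_self ht) K)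
    (h.physical t (Ioo_subset_Icc_self ht) K)).hasDerivAt (Icc_mem_nhds ht.1 ht.2)

theorem continuousOn_entropy (hγ : 1 < γ) (h : IsGodunovSolution γ T 𝒯 U₀ U) (K : Fin 𝒯.N) :
    ContinuousOn (fun r => entropy γ (U r K)) (Icc 0 T) := fun t ht =>
  (hasDerivWithinAt_entropy hγ (h.hasDerivWithinAt ht K) (h.physical t ht K)).continuousWithinAt

theorem hasDerivAt_totalEntropy (hγ : 1 < γ) (h : IsGodunovSolution γ T 𝒯 U₀ U) {t : ℝ}
    (ht : t ∈ Ioo 0 T) : HasDerivAt (fun r => ∑ K, 𝒯.vol K * entropy γ (U r K))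
      (entropyRate γ T U t) t :=
  HasDerivAt.fun_sum fun K _ => (h.hasDerivAt_entropy hγ ht K).const_mul _

theorem entropyRate_nonneg (hγ : 1 < γ) (hγ2 : γ ≤ 2) (h : IsGodunovSolution γ T 𝒯 U₀ U) {t : ℝ}
    (ht : t ∈ Icc 0 T) : 0 ≤ entropyRate γ T U t := by
  obtain ⟨g, Q, D, hF⟩ := h.exists_isFaceData hγ hγ2 ht
  refine le_trans ?_ (hF.sum_area_D_le (h.physical t ht))
  exact Finset.sum_nonneg fun K _ => Finset.sum_nonneg fun i _ => Finset.sum_nonneg fun s _ =>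
    mul_nonneg (𝒯.area_pos K i).le (hF.D_nonneg K i s)

theorem intervalIntegrable_entropyRate (hγ : 1 < γ) (hγ2 : γ ≤ 2) (hT : 0 ≤ T)
    (h : IsGodunovSolution γ T 𝒯 U₀ U) : IntervalIntegrable (entropyRate γ T U) volume 0 T := by
  refine intervalIntegral.intervalIntegrable_deriv_of_nonneg
    (g := fun r => ∑ K, 𝒯.vol K * entropy γ (U r K)) ?_ ?_ ?_
  · rw [uIcc_of_le hT]
    exact continuousOn_finsetSum _ fun K _ =>
      continuousOn_const.mul (h.continuousOn_entropy hγ K)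
  · rw [min_eq_left hT, max_eq_right hT]
    exact fun t ht => h.hasDerivAt_totalEntropy hγ ht
  · rw [min_eq_left hT, max_eq_right hT]
    exact fun t ht => h.entropyRate_nonneg hγ hγ2 (Ioo_subset_Icc_self ht)

/-- Linear functionals of the time derivative are controlled by the entropy production. -/
theorem exists_abs_rate_le (hγ : 1 < γ) (hγ2 : γ ≤ 2) (h : IsGodunovSolution γ T 𝒯 U₀ U)
    (hB : 1 ≤ B) (hb : ∀ t ∈ Icc 0 T, ∀ K, StateBdd γ B (U t K)) {δ : ℝ} (hδ : 0 < δ)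
    (hside : ∀ K i, 𝒯.hi K i - 𝒯.lo K i ≤ δ) (b : ℝ) : ∃ c, ∀ t ∈ Icc 0 T, ∀ K,
      ∀ ℓ : State d →ₗ[ℝ] ℝ, (∀ G, |ℓ G| ≤ b * ‖G‖) →
      |ℓ (cellRate T U t K)| ≤ c * (1 + entropyRate γ T U t) := by
  set D₀ := dissipationConst γ B * √δ with hD₀
  have h0 : 0 ≤ D₀ := mul_nonneg (dissipationConst_nonneg hγ hB) (Real.sqrt_nonneg _)
  have hv : 0 ≤ ∑ K, 𝒯.vol K := Finset.sum_nonneg fun K _ => (𝒯.vol_pos K).le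
  have hw : ∀ K i, 0 < 𝒯.area K i / 𝒯.vol K ^ 2 := fun K i =>
    div_pos (𝒯.area_pos K i) (pow_pos (𝒯.vol_pos K) 2)
  set a := ∑ K, ∑ i, 𝒯.area K i / 𝒯.vol K ^ 2 with ha
  have ha0 : 0 ≤ a := Finset.sum_nonneg fun K _ => Finset.sum_nonneg fun i _ => (hw K i).le
  have haw : ∀ K i, 𝒯.area K i / 𝒯.vol K ^ 2 ≤ a := fun K i =>
    (Finset.single_le_sum (fun i _ => (hw K i).le) (Finset.mem_univ i)).trans
      (Finset.single_le_sum (f := fun K => ∑ i, 𝒯.area K i / 𝒯.vol K ^ 2)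
        (fun K _ => Finset.sum_nonneg fun i _ => (hw K i).le) (Finset.mem_univ K))
  refine ⟨|b| * a * (D₀ * (2 * d * ∑ K, 𝒯.vol K + 2 * B * (1 + √δ))),
    fun t ht K ℓ hℓ => ?_⟩
  obtain ⟨g, Q, D, hF⟩ := h.exists_isFaceData hγ hγ2 ht
  have hE := h.entropyRate_nonneg hγ hγ2 ht
  have h1 := hF.sum_norm_sub_le hγ hB (hb t ht) hδ hside
  set N := fun K i s => ‖g K i s - flux γ (wallNormal i s) (U t K)‖ with hN
  have h2 : ∑ i, ∑ s, 𝒯.vol K * N K i s ≤ ∑ K, ∑ i, ∑ s, 𝒯.vol K * N K i s :=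
    Finset.single_le_sum (f := fun K => ∑ i, ∑ s, 𝒯.vol K * N K i s) (fun K _ =>
      Finset.sum_nonneg fun i _ => Finset.sum_nonneg fun s _ =>
        mul_nonneg (𝒯.vol_pos K).le (norm_nonneg _)) (Finset.mem_univ K)
  have h3 : |ℓ (cellRate T U t K)| ≤ |b| * a * ∑ i, ∑ s, 𝒯.vol K * N K i s := by
    have h4 := hF.vol_mul_apply ℓ K
    have hvK := 𝒯.vol_pos K
    have h5 : ℓ (cellRate T U t K) = -∑ i, ∑ s, 𝒯.area K i / 𝒯.vol K *
        ℓ (g K i s - flux γ (wallNormal i s) (U t K)) := by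
      rw [cellRate, eq_comm, ← mul_right_inj' hvK.ne', h4, mul_neg]
      simp only [Finset.mul_sum]
      congr 1
      refine Finset.sum_congr rfl fun i _ => Finset.sum_congr rfl fun s _ => ?_
      field_simp
    rw [h5, abs_neg]
    simp only [Finset.mul_sum]
    refine (Finset.abs_sum_le_sum_abs _ _).trans (Finset.sum_le_sum fun i _ =>
      (Finset.abs_sum_le_sum_abs _ _).trans (Finset.sum_le_sum fun s _ => ?_))
    have hn : 0 ≤ N K i s := norm_nonneg _
    rw [abs_mul, abs_of_pos (div_pos (𝒯.area_pos K i) hvK)]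
    calc _ ≤ 𝒯.area K i / 𝒯.vol K * (|b| * N K i s) := by
          have := (hℓ (g K i s - flux γ (wallNormal i s) (U t K))).trans
            (mul_le_mul_of_nonneg_right (le_abs_self b) (norm_nonneg _))
          exact mul_le_mul_of_nonneg_left this (div_pos (𝒯.area_pos K i) hvK).le
      _ = 𝒯.area K i / 𝒯.vol K ^ 2 * (|b| * (𝒯.vol K * N K i s)) := by field_simp
      _ ≤ a * (|b| * (𝒯.vol K * N K i s)) := mul_le_mul_of_nonneg_right (haw K i) (by positivity)
      _ = _ := by ring
  have h6 : ∑ K, ∑ i, ∑ s, 𝒯.vol K * N K i s ≤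
      D₀ * (2 * d * ∑ K, 𝒯.vol K + 2 * B * (1 + √δ)) * (1 + entropyRate γ T U t) := by
    refine h1.trans ?_
    rw [← hD₀, mul_assoc D₀]
    refine mul_le_mul_of_nonneg_left ?_ h0
    have e1 : 0 ≤ 2 * d * (∑ K, 𝒯.vol K) * entropyRate γ T U t := by positivity
    have e2 : 0 ≤ 2 * B * (1 + √δ) := by positivity
    change _ + _ * entropyRate γ T U t ≤ _
    linarith
  refine h3.trans ((mul_le_mul_of_nonneg_left (h2.trans h6) (by positivity)).trans
    (le_of_eq (by ring)))

/-- The cell values and their entropies are absolutely continuous functions of time. -/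
theorem ac (hγ : 1 < γ) (hγ2 : γ ≤ 2) (hT : 0 ≤ T) (h : IsGodunovSolution γ T 𝒯 U₀ U)
    (hB : 1 ≤ B) (hb : ∀ t ∈ Icc 0 T, ∀ K, StateBdd γ B (U t K)) {δ : ℝ} (hδ : 0 < δ)
    (hside : ∀ K i, 𝒯.hi K i - 𝒯.lo K i ≤ δ) (K : Fin 𝒯.N) :
    (∀ ℓ : State d →L[ℝ] ℝ, AbsolutelyContinuousOnInterval (fun t => ℓ (U t K)) 0 T) ∧
      AbsolutelyContinuousOnInterval (fun t => entropy γ (U t K)) 0 T := by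
  have hint : ∀ c : ℝ, IntervalIntegrable (fun t => c * (1 + entropyRate γ T U t)) volume 0 T :=
    fun c => (intervalIntegrable_const.add
      (h.intervalIntegrable_entropyRate hγ hγ2 hT)).const_mul c
  refine ⟨fun ℓ => ?_, ?_⟩
  · obtain ⟨c, hc⟩ := h.exists_abs_rate_le hγ hγ2 hB hb hδ hside ‖ℓ‖
    exact ac_of_hasDerivAt hT
      (ℓ.continuous.comp_continuousOn fun t ht => (h.differentiable K t ht).continuousWithinAt)
      (fun t ht => ℓ.hasFDerivAt.comp_hasDerivAt t (h.hasDerivAt ht K)) (hint c)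
      fun t ht => hc t (Ioo_subset_Icc_self ht) K ℓ.toLinearMap fun G => ℓ.le_opNorm G
  · obtain ⟨c, hc⟩ := h.exists_abs_rate_le hγ hγ2 hB hb hδ hside (entropyConst γ B)
    refine ac_of_hasDerivAt hT (h.continuousOn_entropy hγ K)
      (fun t ht => h.hasDerivAt_entropy hγ ht K) (hint c) fun t ht => ?_
    have h1 := hb t (Ioo_subset_Icc_self ht) K
    have h2 := hc t (Ioo_subset_Icc_self ht) K
      ((temperature γ (U t K))⁻¹ • (pairing γ (U t K)).toLinearMap) fun G => by
        have := abs_pairing_div_le hγ hB h1 G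
        rwa [div_eq_inv_mul] at this
    rwa [div_eq_inv_mul]

end IsGodunovSolution

open RectMesh

variable {d : ℕ} {γ : ℝ} {Ω : Set (Space d)} {𝒯 : RectMesh d Ω} {T A B : ℝ} {C L : ℝ≥0}
  {X : SpaceTime d → State d} {U₀ : Space d → State d} {U : ℝ → Fin 𝒯.N → State d} {t : ℝ}

theorem _root_.AbsolutelyContinuousOnInterval.fun_sum {ι : Type*} (s : Finset ι)
    {f : ι → ℝ → ℝ} {a b : ℝ} (h : ∀ i, AbsolutelyContinuousOnInterval (f i) a b) :
    AbsolutelyContinuousOnInterval (fun x => ∑ i ∈ s, f i x) a b := by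
  induction s using Finset.cons_induction with
  | empty =>
    simpa using (LipschitzWith.const (0 : ℝ)).lipschitzOnWith.absolutelyContinuousOnInterval
      (K := 0) (a := a) (b := b)
  | cons i s hi ih => simpa only [Finset.sum_cons] using (h i).fun_add ih

theorem totalRelEnergy_eq (t : ℝ) (V : Fin 𝒯.N → State d) : 𝒯.totalRelEnergy γ X t V =
    ∑ K, 𝒯.vol K * ((V K).2.2 - ∑ j, (𝒯.cellMean K fun x => (X (t, x)).2.1 j) * (V K).2.1 j +
      (𝒯.cellMean K fun x => dualDensity γ (X (t, x))) * (V K).1 -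
      (𝒯.cellMean K fun x => (X (t, x)).2.2) * entropy γ (V K) +
      𝒯.cellMean K fun x => (X (t, x)).1 * (X (t, x)).2.2) := by
  simp only [totalRelEnergy, dualPair_eq_sum, cellDual]

theorem IsGodunovSolution.ac_totalRelEnergy (hγ : 1 < γ) (hγ2 : γ ≤ 2) (hT : 0 ≤ T)
    (h : IsGodunovSolution γ T 𝒯 U₀ U) (hB : 1 ≤ B)
    (hb : ∀ t ∈ Icc 0 T, ∀ K, StateBdd γ B (U t K)) {δ : ℝ} (hδ : 0 < δ)
    (hside : ∀ K i, 𝒯.hi K i - 𝒯.lo K i ≤ δ)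
    (hL : ∀ K, LipschitzFields γ L (𝒯.closedCyl T K) X) :
    AbsolutelyContinuousOnInterval (fun t => 𝒯.totalRelEnergy γ X t (U t)) 0 T := by
  have hm : ∀ K {a : SpaceTime d → ℝ}, LipschitzOnWith L a (𝒯.closedCyl T K) →
      AbsolutelyContinuousOnInterval (fun t => 𝒯.cellMean K fun x => a (t, x)) 0 T := fun K a ha =>
    LipschitzOnWith.absolutelyContinuousOnInterval (K := L) <| by
      rw [uIcc_of_le hT]; exact 𝒯.cellMean_lipschitz ha
  simp only [totalRelEnergy_eq]
  refine AbsolutelyContinuousOnInterval.fun_sum _ fun K =>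
    AbsolutelyContinuousOnInterval.const_mul _ ?_
  obtain ⟨h1, h2⟩ := h.ac hγ hγ2 hT hB hb hδ hside K
  have e1 : AbsolutelyContinuousOnInterval (fun t => (U t K).1) 0 T :=
    h1 (ContinuousLinearMap.fst ℝ ℝ (Space d × ℝ))
  have e2 : ∀ j, AbsolutelyContinuousOnInterval (fun t => (U t K).2.1 j) 0 T := fun j =>
    h1 ((PiLp.proj (𝕜 := ℝ) 2 (fun _ : Fin d => ℝ) j).comp
    ((ContinuousLinearMap.fst ℝ (Space d) ℝ).comp (ContinuousLinearMap.snd ℝ ℝ (Space d × ℝ))))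
  have e3 : AbsolutelyContinuousOnInterval (fun t => (U t K).2.2) 0 T :=
    h1 ((ContinuousLinearMap.snd ℝ (Space d) ℝ).comp
    (ContinuousLinearMap.snd ℝ ℝ (Space d × ℝ)))
  have e4 := AbsolutelyContinuousOnInterval.fun_sum Finset.univ fun j =>
    (hm K ((hL K).velocity j)).fun_mul (e2 j)
  exact ((((e3.fun_sub e4).fun_add ((hm K (hL K).density).fun_mul e1)).fun_sub
    ((hm K (hL K).temperature).fun_mul h2)).fun_add (hm K (hL K).pressure)).congr fun t _ => rfl

theorem IsGodunovSolution.hasDerivAt_totalRelEnergy (hγ : 1 < γ)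
    (h : IsGodunovSolution γ T 𝒯 U₀ U) (ht : t ∈ Ioo 0 T) (hs : ∀ K, SliceFields γ 𝒯 t K X) :
    HasDerivAt (fun t => 𝒯.totalRelEnergy γ X t (U t))
      (∑ K, 𝒯.vol K * (dualPair (𝒯.cellDual γ X t K) (cellRate T U t K) -
        (𝒯.cellDual γ X t K).2.2 * (pairing γ (U t K) (cellRate T U t K) / temperature γ (U t K)) +
        timeRate γ 𝒯 X t K (U t K))) t := by
  simp only [totalRelEnergy_eq]
  refine HasDerivAt.fun_sum fun K _ => HasDerivAt.const_mul _ ?_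
  have h1 := h.hasDerivAt ht K
  have e1 : HasDerivAt (fun r => (U r K).1) _ t :=
    (ContinuousLinearMap.fst ℝ ℝ (Space d × ℝ)).hasFDerivAt.comp_hasDerivAt t h1
  have e2 := fun j => ((PiLp.proj (𝕜 := ℝ) 2 (fun _ : Fin d => ℝ) j).comp
    ((ContinuousLinearMap.fst ℝ (Space d) ℝ).comp
      (ContinuousLinearMap.snd ℝ ℝ (Space d × ℝ)))).hasFDerivAt.comp_hasDerivAt t h1
  have e3 := ((ContinuousLinearMap.snd ℝ (Space d) ℝ).comp
    (ContinuousLinearMap.snd ℝ ℝ (Space d × ℝ))).hasFDerivAt.comp_hasDerivAt t h1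
  refine ((((e3.sub (HasDerivAt.fun_sum fun j _ => ((hs K).velocity j).2.1.mul (e2 j))).add
    ((hs K).density.2.1.mul e1)).sub ((hs K).temperature.2.1.mul
      (h.hasDerivAt_entropy hγ ht K))).add (hs K).pressure.2.1).congr_deriv ?_
  rw [dualPair_eq_sum, timeRate, cellDualDeriv, Finset.sum_add_distrib]
  simp only [cellDual, Function.comp_apply, ContinuousLinearMap.coe_comp,
    ContinuousLinearMap.coe_fst', ContinuousLinearMap.coe_snd', PiLp.proj_apply]
  ring

/-- The residual is controlled by the relative energy at almost every time. -/
theorem IsPrimitiveSolution.ae_residual_le (hγ : 1 < γ) (hγ2 : γ ≤ 2) (hA : 1 ≤ A)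
    (h : IsPrimitiveSolution γ A C T 𝒯 X) {c : ℝ} (hc : residualConst d γ A C ≤ c) :
    ∀ᵐ t ∂(volume.restrict (Ioo 0 T)), ∀ K, ∀ᵐ y ∂(cubeMeasure d), ∀ W : State d,
      IsPhysical γ W → -(γ * log A) ≤ specEntropy γ W →
      residual γ W X (t, 𝒯.map K y) ≤ c * relEnergy γ W (consOf γ (X (t, 𝒯.map K y))) := by
  refine ae_all_iff.2 fun K => ?_
  filter_upwards [𝒯.ae_slice K (h.euler K), ae_restrict_mem measurableSet_Ioo] with t h1 ht
  filter_upwards [h1, ae_mem_cube] with y h2 hy W hW hS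
  have hz := 𝒯.map_mem_openCyl ht K hy
  have hX := h.mem_box K (𝒯.openCyl_subset_closedCyl T K hz)
  refine (residual_le hγ hγ2 hA h2.1.hasFDerivAt hX (norm_fderiv_le_of_lipschitzOn ℝ
    ((𝒯.isOpen_openCyl T K).mem_nhds hz)
    ((h.lipschitz K).mono (𝒯.openCyl_subset_closedCyl T K))) h2.2 hW hS).trans ?_
  exact mul_le_mul_of_nonneg_right hc (relEnergy_nonneg hγ (Or.inl hW)
    (stateBdd_consOf hγ hA hX).physical)

/-- The relative energy inequality in integrated form. -/
theorem IsPrimitiveSolution.totalRelEnergy_le (hγ : 1 < γ) (hγ2 : γ ≤ 2) (hA : 1 ≤ A) (hB : 1 ≤ B)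
    (hX : IsPrimitiveSolution γ A C T 𝒯 X) (hL : ∀ K, LipschitzFields γ L (𝒯.closedCyl T K) X)
    (h : IsGodunovSolution γ T 𝒯 U₀ U) (hb : ∀ t ∈ Icc 0 T, ∀ K, StateBdd γ B (U t K))
    (hS : ∀ t ∈ Icc 0 T, ∀ K, -(γ * log A) ≤ specEntropy γ (U t K)) {δ : ℝ} (hδ : 0 < δ)
    (hside : ∀ K i, 𝒯.hi K i - 𝒯.lo K i ≤ δ) {c : ℝ} (hc0 : 0 < c)
    (hc : residualConst d γ A C ≤ c) {k : ℝ}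
    (hk : (d + 1) * L * (1 + entropyConst γ B) * (dissipationConst γ B *
      √δ * (2 * d * ∑ K, 𝒯.vol K + 2 * B * (1 + √δ))) ≤ k) {τ : ℝ} (hτ : 0 ≤ τ)
    (hτT : τ ≤ T) :
    𝒯.totalRelEnergy γ X τ (U τ) ≤ exp (τ * c) * (𝒯.totalRelEnergy γ X 0 (U 0) +
      k * (1 / c + (∑ K, 𝒯.vol K * entropy γ (U τ K) - ∑ K, 𝒯.vol K * entropy γ (U 0 K)))) := by
  have hT : 0 ≤ T := hτ.trans hτT
  have hv : 0 ≤ ∑ K, 𝒯.vol K := Finset.sum_nonneg fun K _ => (𝒯.vol_pos K).le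
  have hd0 := dissipationConst_nonneg hγ hB
  have hE0 : 0 ≤ entropyConst γ B := by
    have : 0 < γ - 1 := by linarith
    have := Real.log_nonneg hB
    rw [entropyConst]; positivity
  have hk0 : 0 ≤ k := le_trans (by positivity) hk
  have hexp : AbsolutelyContinuousOnInterval (fun t => exp (-c * t)) 0 T :=
    ContDiffOn.absolutelyContinuousOnInterval
      (Real.contDiff_exp.comp (contDiff_const.mul contDiff_id)).contDiffOn
  have hac := ((AbsolutelyContinuousOnInterval.fun_sum Finset.univ fun K =>
    ((h.ac hγ hγ2 hT hB hb hδ hside K).2.const_mul (𝒯.vol K))).sub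
      (hexp.const_mul (1 / c))).const_mul k |>.sub
    (hexp.mul (h.ac_totalRelEnergy hγ hγ2 hT hB hb hδ hside hL))
  have hmono := le_of_ac_of_deriv_nonneg hτ (hac.mono (by
    rw [uIcc_of_le hτ, uIcc_of_le hT]; exact Icc_subset_Icc_right hτT)) (by
    have h1 := ae_sliceFields hL
    have h2 := hX.ae_residual_le hγ hγ2 hA hc
    rw [ae_restrict_iff' measurableSet_Ioo] at h1 h2
    filter_upwards [h1, h2] with t t1 t2 ht
    have ht' : t ∈ Ioo 0 T := ⟨ht.1, ht.2.trans_le hτT⟩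
    have htI := Ioo_subset_Icc_self ht'
    have d1 : HasDerivAt (fun t => exp (-c * t)) (exp (-c * t) * (-c * 1)) t :=
      ((hasDerivAt_id t).const_mul (-c)).exp
    refine ⟨_, (((h.hasDerivAt_totalEntropy hγ ht').sub (d1.const_mul (1 / c))).const_mul k).sub
      (d1.mul (h.hasDerivAt_totalRelEnergy hγ ht' (t1 ht'))), ?_⟩
    obtain ⟨g, Q, D, hF⟩ := h.exists_isFaceData hγ hγ2 htI
    have r1 := hX.rate_le hγ hA hL htI (t1 ht') hF (h.physical t htI)
      (fun K => (t2 ht' K).mono fun y hy => hy _ (h.physical t htI K) (hS t htI K))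
      (fun K G => abs_pairing_div_le hγ hB (hb t htI K) G)
    have r2 := hF.sum_norm_sub_le hγ hB (hb t htI) hδ hside
    have hR := h.entropyRate_nonneg hγ hγ2 htI
    change _ ≤ _ * (_ + _ * entropyRate γ T U t) at r2
    set S := entropyRate γ T U t
    set x := exp (-c * t)
    have hx0 : 0 < x := Real.exp_pos _
    have hx1 : x ≤ 1 := Real.exp_le_one_iff.2 (by nlinarith [ht.1])
    set Y := ∑ K, 𝒯.vol K * (dualPair (𝒯.cellDual γ X t K) (cellRate T U t K) -
        (𝒯.cellDual γ X t K).2.2 * (pairing γ (U t K) (cellRate T U t K) / temperature γ (U t K)) +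
        timeRate γ 𝒯 X t K (U t K)) with hY
    have r3 : Y ≤ c * 𝒯.totalRelEnergy γ X t (U t) + k * (1 + S) := by
      refine r1.trans (add_le_add_right ?_ _)
      refine (mul_le_mul_of_nonneg_left r2 (by positivity)).trans ?_
      refine le_trans ?_ (mul_le_mul_of_nonneg_right hk (by linarith))
      rw [mul_assoc _ _ (1 + S)]
      refine mul_le_mul_of_nonneg_left ?_ (by positivity)
      rw [mul_assoc _ _ (1 + S)]
      refine mul_le_mul_of_nonneg_left ?_ (by positivity)
      have e1 : 0 ≤ 2 * d * (∑ K, 𝒯.vol K) * S := by positivity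
      have e2 : 0 ≤ 2 * B * (1 + √δ) := by positivity
      linarith
    have r4 := mul_le_mul_of_nonneg_left r3 hx0.le
    have r5 : x * (k * S) ≤ k * S := mul_le_of_le_one_left (by positivity) hx1
    have e : k * (S - 1 / c * (x * (-c * 1))) = k * S + k * x := by field_simp; ring
    rw [e]
    linarith)
  simp only [mul_zero, Real.exp_zero, Pi.sub_apply, Pi.mul_apply] at hmono
  have hx0 : 0 < exp (-c * τ) := Real.exp_pos _
  have he : exp (τ * c) * exp (-c * τ) = 1 := by
    rw [← Real.exp_add]; simp [mul_comm]
  have h5 := mul_le_mul_of_nonneg_left hmono (Real.exp_pos (τ * c)).le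
  have h6 : 0 ≤ exp (τ * c) * (k * (1 / c * exp (-c * τ))) := by positivity
  have h7 : exp (τ * c) * (exp (-c * τ) * 𝒯.totalRelEnergy γ X τ (U τ)) =
    𝒯.totalRelEnergy γ X τ (U τ) := by rw [← mul_assoc, he, one_mul]
  linarith

open RectMesh

variable {d : ℕ} {γ : ℝ} {Ω : Set (Space d)} {𝒯 : RectMesh d Ω} {T A B : ℝ} {C L : ℝ≥0}
  {X : SpaceTime d → State d} {U₀ : Space d → State d} {U : ℝ → Fin 𝒯.N → State d} {t : ℝ}

theorem norm_sq_le_stateNormSq (G : State d) : ‖G‖ ^ 2 ≤ stateNormSq G := by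
  have h1 := sq_nonneg G.1
  have h2 := sq_nonneg ‖G.2.1‖
  have h3 := sq_nonneg G.2.2
  rw [stateNormSq, Prod.norm_def, Prod.norm_def]
  rcases max_cases ‖G.1‖ (max ‖G.2.1‖ ‖G.2.2‖) with h | h
  · rw [h.1, Real.norm_eq_abs, sq_abs]; linarith
  · rw [h.1]
    rcases max_cases ‖G.2.1‖ ‖G.2.2‖ with h | h
    · rw [h.1]; linarith
    · rw [h.1, Real.norm_eq_abs, sq_abs]; linarith

theorem StateBdd.mono (hA : 1 ≤ A) (hAB : A ≤ B) {V : State d} (h : StateBdd γ A V) :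
    StateBdd γ B V := by
  have := inv_anti₀ (by linarith) hAB
  exact ⟨h.1, this.trans h.2, h.3.trans hAB, this.trans h.4, h.5.trans hAB, h.6.trans hAB⟩

theorem exists_primOf_sub_le (hγ : 1 < γ) (hB : 1 ≤ B) : ∃ K : ℝ≥0, ∀ W V : State d,
    StateBdd γ B W → StateBdd γ B V → ‖primOf γ W - primOf γ V‖ ≤ K * ‖W - V‖ := by
  have hg : 0 < γ - 1 := by linarith
  have hB0 : 0 < B⁻¹ := inv_pos.2 (by linarith)
  set R := 1 / 2 * B * B ^ 2 + 1 / (γ - 1) * (B * B)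
  let S : Set (State d) := Icc B⁻¹ B ×ˢ (Metric.closedBall 0 (B * B) ×ˢ Icc 0 R)
  obtain ⟨K, hK⟩ := (contDiffOn_primOf (γ := γ) (B := S) fun V hV =>
    (hB0.trans_le hV.1.1).ne').exists_lipschitzOnWith one_ne_zero
      ((convex_Icc _ _).prod ((convex_closedBall _ _).prod (convex_Icc _ _)))
      (isCompact_Icc.prod ((isCompact_closedBall _ _).prod isCompact_Icc))
  have hS : ∀ V : State d, StateBdd γ B V → V ∈ S := fun V hV => by
    have h1 := hV.physical.1
    have hE := energy_eq_pressure hγ (Or.inl hV.physical)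
    have hp : pressure γ V = V.1 * temperature γ V := by
      rw [temperature, mul_div_cancel₀ _ h1.ne']
    have hθ := temperature_pos hV.physical
    rw [hp] at hE
    refine ⟨⟨hV.density_ge, hV.density_le⟩, ?_, ?_, ?_⟩
    · rw [mem_closedBall_zero_iff, momentum_eq (Or.inl hV.physical), norm_smul, Real.norm_eq_abs,
        abs_of_pos h1]
      exact mul_le_mul hV.density_le hV.velocity_le (norm_nonneg _) (by linarith)
    · rw [hE]; positivity
    · change _ ≤ 1 / 2 * B * B ^ 2 + 1 / (γ - 1) * (B * B)
      rw [hE]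
      have := hV.density_le
      have := hV.velocity_le
      have := hV.temperature_le
      gcongr
  exact ⟨K, fun W V hW hV => by simpa only [dist_eq_norm] using hK.dist_le_mul W (hS W hW) V (hS V hV)⟩

/-- The relative energy of bounded states is quadratic. -/
theorem exists_relEnergy_le (hγ : 1 < γ) (hB : 1 ≤ B) : ∃ c, 0 ≤ c ∧ ∀ W V : State d,
    StateBdd γ B W → StateBdd γ B V → relEnergy γ W V ≤ c * stateNormSq (W - V) := by
  have hg : 0 < γ - 1 := by linarith
  have hB0 : 0 < B := by linarith
  obtain ⟨K, hK⟩ := exists_primOf_sub_le (d := d) hγ hB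
  refine ⟨(1 / 2 * B + 1 / (γ - 1) * (B * B) + B * B) * K ^ 2, by positivity,
    fun W V hW hV => ?_⟩
  have h := hK W V hW hV
  set D := K * ‖W - V‖
  have a1 : |W.1 - V.1| ≤ D := (norm_fst_le (primOf γ W - primOf γ V)).trans h
  have a2 : ‖velocity W - velocity V‖ ≤ D :=
    ((norm_fst_le (primOf γ W - primOf γ V).2).trans (norm_snd_le _)).trans h
  have e : ∀ V : State d, (primOf γ V).2.2 = temperature γ V := fun V => by
    simp only [primOf, temperature, pressure, div_eq_mul_inv]
  have a3 : |temperature γ W - temperature γ V| ≤ D := by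
    rw [← e, ← e]
    exact ((norm_snd_le (primOf γ W - primOf γ V).2).trans (norm_snd_le _)).trans h
  have sq_div : ∀ {x y : ℝ}, |x| ≤ D → B⁻¹ ≤ y → x ^ 2 / y ≤ B * D ^ 2 := fun {x y} hx hy => by
    have hy0 := (inv_pos.2 hB0).trans_le hy
    rw [div_eq_inv_mul]
    exact mul_le_mul (inv_le_of_inv_le₀ hB0 hy) (sq_le_sq' (neg_le_of_abs_le hx)
      (le_of_abs_le hx)) (sq_nonneg _) hB0.le
  have hW0 := hW.physical.1
  have hV0 := hV.physical.1
  have hθW := temperature_pos hW.physical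
  have hθV := temperature_pos hV.physical
  have b2 : temperature γ W - temperature γ V -
      temperature γ V * log (temperature γ W / temperature γ V) ≤ B * D ^ 2 := by
    refine le_trans ?_ (sq_div a3 hW.temperature_ge)
    have := mul_le_mul_of_nonneg_left (Real.one_sub_inv_le_log_of_pos (div_pos hθW hθV)) hθV.le
    have e : (temperature γ W - temperature γ V) ^ 2 / temperature γ W = temperature γ W -
        temperature γ V - temperature γ V * (1 - (temperature γ W / temperature γ V)⁻¹) := by
      field_simp
    linarith
  have b3 : W.1 * log (W.1 / V.1) - W.1 + V.1 ≤ B * D ^ 2 := by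
    refine le_trans ?_ (sq_div a1 hV.density_ge)
    have := mul_le_mul_of_nonneg_left (Real.log_le_sub_one_of_pos (div_pos hW0 hV0)) hW0.le
    have e : (W.1 - V.1) ^ 2 / V.1 = W.1 * (W.1 / V.1 - 1) - W.1 + V.1 := by
      field_simp; ring
    linarith
  rw [relEnergy_eq hγ (Or.inl hW.physical) hV.physical]
  calc _ ≤ 1 / 2 * B * D ^ 2 + 1 / (γ - 1) * B * (B * D ^ 2) + B * (B * D ^ 2) := by
        refine add_le_add (add_le_add ?_ ?_) ?_
        · have := hW.density_le
          gcongr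
        · refine (mul_le_mul_of_nonneg_left b2 (by positivity)).trans ?_
          have := hW.density_le
          gcongr
        · refine (mul_le_mul_of_nonneg_left b3 hθV.le).trans ?_
          exact mul_le_mul_of_nonneg_right hV.temperature_le (by positivity)
    _ = (1 / 2 * B + 1 / (γ - 1) * (B * B) + B * B) * K ^ 2 * ‖W - V‖ ^ 2 := by ring
    _ ≤ _ := mul_le_mul_of_nonneg_left (norm_sq_le_stateNormSq _) (by positivity)

theorem abs_entropy_le (hγ : 1 < γ) (hB : 1 ≤ B) {V : State d} (h : StateBdd γ B V) :
    |entropy γ V| ≤ 1 / (γ - 1) * B * (γ * log B) := by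
  have hg : 0 < γ - 1 := by linarith
  have := h.physical.1
  have := h.density_le
  rw [entropy_eq, abs_mul, abs_of_pos (by positivity)]
  gcongr
  exact abs_specEntropy_le hγ hB h

namespace RectMesh

/-- Integration of a function that is continuous on each cell up to the boundary. -/
theorem setIntegral_of_eqOn (hΩ : interior (closure Ω) = Ω) (hb : Bornology.IsBounded Ω)
    {f : Space d → ℝ} {F : Fin 𝒯.N → Space d → ℝ}
    (hF : ∀ K, ContinuousOn (F K) (𝒯.closedCell K)) (h : ∀ K, EqOn f (F K) (𝒯.cell K)) :
    IntegrableOn f Ω ∧ ∫ x in Ω, f x = ∑ K, 𝒯.vol K * 𝒯.cellMean K (F K) := by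
  have h1 : ∀ K, IntegrableOn f (𝒯.cell K) := fun K => by
    have hc := Metric.isCompact_of_isClosed_isBounded (𝒯.isClosed_closedCell K)
      (hb.closure.subset (𝒯.closedCell_subset K))
    exact (((hF K).integrableOn_compact hc).mono_set (𝒯.cell_subset_closedCell K)).congr_fun
      (h K).symm (𝒯.isOpen_cell K).measurableSet
  refine ⟨(𝒯.integrableOn_iff hΩ).2 h1, ?_⟩
  rw [𝒯.setIntegral_eq hΩ h1]
  refine Finset.sum_congr rfl fun K _ => ?_
  congr 1
  refine integral_congr_ae ?_
  filter_upwards [ae_mem_cube] with y hy using h K (𝒯.map_mem_cell K hy)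

theorem sum_vol (hΩ : interior (closure Ω) = Ω) (hb : Bornology.IsBounded Ω) :
    ∑ K, 𝒯.vol K = volume.real Ω := by
  have := (setIntegral_of_eqOn (𝒯 := 𝒯) hΩ hb (f := fun _ => 1) (F := fun _ _ => 1)
    (fun K => continuousOn_const) fun K x _ => rfl).2
  simpa [cellMean] using this.symm

theorem continuousOn_relEnergy (hγ : 1 < γ) (hA : 1 ≤ A) {K : Fin 𝒯.N}
    (hL : LipschitzFields γ L (𝒯.closedCyl T K) X)
    (hc : ContinuousOn X (𝒯.closedCyl T K))
    (hX : MapsTo X (𝒯.closedCyl T K) (primBox d A)) (ht : t ∈ Icc 0 T) (W : State d) :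
    ContinuousOn (fun x => relEnergy γ W (consOf γ (X (t, x)))) (𝒯.closedCell K) := by
  have h1 := 𝒯.slice_continuousOn hc ht
  have h2 := 𝒯.slice_continuousOn hL.density.continuousOn ht
  have h3 : ContinuousOn (fun x => W.2.2 - inner ℝ (X (t, x)).2.1 W.2.1 +
      dualDensity γ (X (t, x)) * W.1 - (X (t, x)).2.2 * entropy γ W +
      (X (t, x)).1 * (X (t, x)).2.2) (𝒯.closedCell K) :=
    (((continuousOn_const.sub (h1.snd.fst.inner (𝕜 := ℝ) continuousOn_const)).add
      (h2.mul continuousOn_const)).sub (h1.snd.snd.mul continuousOn_const)).add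
        (h1.fst.mul h1.snd.snd)
  refine h3.congr fun x hx => ?_
  obtain ⟨⟨h1, -⟩, -, h2, -⟩ := mem_primBox.1 (hX (show (t, x) ∈ _ from ⟨ht, hx⟩))
  have hA0 : 0 < A⁻¹ := inv_pos.2 (by linarith)
  exact relEnergy_consOf hγ (by linarith) (by linarith) W

theorem totalRelEnergy_eq_cellMean (hγ : 1 < γ) (hA : 1 ≤ A)
    (hL : ∀ K, LipschitzFields γ L (𝒯.closedCyl T K) X)
    (hX : ∀ K, MapsTo X (𝒯.closedCyl T K) (primBox d A)) (ht : t ∈ Icc 0 T)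
    (V : Fin 𝒯.N → State d) : 𝒯.totalRelEnergy γ X t V =
      ∑ K, 𝒯.vol K * 𝒯.cellMean K fun x => relEnergy γ (V K) (consOf γ (X (t, x))) :=
  Finset.sum_congr rfl fun K _ => by
    rw [← (hasIntegral_relEnergy hγ hA (hL K) (hX K) ht (V K)).2]; rfl

end RectMesh

/-- The relative energy is controlled by the `L²` error. -/
theorem IsPrimitiveSolution.totalRelEnergy_le_setIntegral (hγ : 1 < γ) (hA : 1 ≤ A) (hAB : A ≤ B)
    (hΩ : interior (closure Ω) = Ω) (hbd : Bornology.IsBounded Ω)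
    (hX : IsPrimitiveSolution γ A C T 𝒯 X) (hL : ∀ K, LipschitzFields γ L (𝒯.closedCyl T K) X)
    (ht : t ∈ Icc 0 T) {V : Fin 𝒯.N → State d} (hV : ∀ K, StateBdd γ B (V K)) {c : ℝ}
    (hc : ∀ W V : State d, StateBdd γ B W → StateBdd γ B V →
      relEnergy γ W V ≤ c * stateNormSq (W - V)) {f : Space d → State d}
    (hf : ∀ K, EqOn f (fun x => consOf γ (X (t, x))) (𝒯.cell K)) :
    𝒯.totalRelEnergy γ X t V ≤ c * ∫ x in Ω, stateNormSq (𝒯.pc V x - f x) := by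
  have hcont : ∀ K, ContinuousOn (fun x => stateNormSq (V K - consOf γ (X (t, x))))
      (𝒯.closedCell K) := fun K => by
    have h1 := (continuousOn_const (c := V K)).sub (hX.continuousOn_consOf ht K)
    exact ((h1.fst.pow 2).add (h1.snd.fst.norm.pow 2)).add (h1.snd.snd.pow 2)
  rw [(setIntegral_of_eqOn hΩ hbd hcont fun K x hx => by rw [𝒯.pc_eq V hx, hf K hx]).2,
    totalRelEnergy_eq_cellMean hγ hA hL hX.mem_box ht, Finset.mul_sum]
  refine Finset.sum_le_sum fun K _ => ?_
  rw [mul_left_comm]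
  refine mul_le_mul_of_nonneg_left ?_ (𝒯.vol_pos K).le
  rw [cellMean, cellMean, ← integral_const_mul]
  refine integral_mono_ae (hasIntegral_relEnergy hγ hA (hL K) (hX.mem_box K) ht (V K)).1
    ((𝒯.integrable_cube_of_continuousOn (hcont K)).1.const_mul c) ?_
  filter_upwards [ae_mem_cube] with y hy
  exact hc _ _ (hV K)
    ((stateBdd_consOf hγ hA (hX.mem_box K (𝒯.map_mem_closedCyl ht K hy))).mono hA hAB)

end EulerGodunov

theorem mainTheorem1 (d : ℕ) (hd : 1 ≤ d ∧ d ≤ 3) (γ : ℝ) (hγ : 1 < γ ∧ γ ≤ 2)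
    (Ω : Set (Space d)) (hΩ_open : IsOpen Ω) (hΩ_conn : IsConnected Ω)
    (hΩ_bdd : Bornology.IsBounded Ω) (hΩ_reg : interior (closure Ω) = Ω)
    -- bound of the norm and lower bounds of density and temperature of the strong solution
    (M r₀ θ₀ : ℝ) (hr₀ : 0 < r₀) (hθ₀ : 0 < θ₀) :
    ∃ c : ℝ, 0 < c ∧
      -- lower density bound and upper energy bound of the numerical solution, initial error
      ∀ ρ_low E_up C₀ : ℝ, 0 < ρ_low → 0 < E_up → 0 ≤ C₀ →
        ∃ C : ℝ, 0 < C ∧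
          ∀ T : ℝ, 0 < T →
          ∀ (ρ : SpaceTime d → ℝ) (u : SpaceTime d → Space d) (η : SpaceTime d → ℝ),
            IsStrongSolution γ Ω T ρ u η →
            StateW1infLE (cylinder Ω T) (fun z => stateOf γ (ρ z) (u z) (η z)) M →
            (∀ z ∈ closedCylinder Ω T, r₀ ≤ ρ z ∧ θ₀ ≤ temperatureOf γ (ρ z) (η z)) →
          ∀ (𝒯 : RectMesh d Ω) (U : ℝ → Fin 𝒯.N → State d),
            IsGodunovSolution γ T 𝒯
              (fun x => stateOf γ (ρ (0, x)) (u (0, x)) (η (0, x))) U →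
            Real.sqrt (∫ x in Ω, stateNormSq
              (𝒯.pc (U 0) x - stateOf γ (ρ (0, x)) (u (0, x)) (η (0, x))))
                ≤ C₀ * Real.sqrt 𝒯.size →
            (∀ t ∈ Icc 0 T, ∀ K, ρ_low ≤ (U t K).1 ∧ 0 < (U t K).2.2 ∧ (U t K).2.2 ≤ E_up) →
          ∀ τ : ℝ, 0 < τ → τ ≤ T →
            IntegrableOn (fun x => relativeEnergy γ (𝒯.pc (U τ) x).1 (𝒯.pc (U τ) x).2.1
              (entropy γ (𝒯.pc (U τ) x)) (ρ (τ, x)) (u (τ, x)) (η (τ, x))) Ω ∧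
            ∫ x in Ω, |relativeEnergy γ (𝒯.pc (U τ) x).1 (𝒯.pc (U τ) x).2.1
              (entropy γ (𝒯.pc (U τ) x)) (ρ (τ, x)) (u (τ, x)) (η (τ, x))|
                ≤ C * Real.exp (τ * c) * Real.sqrt 𝒯.size := by

  obtain ⟨hγ, hγ2⟩ := hγ
  have hg : 0 < γ - 1 := by linarith
  obtain ⟨A, hA, C', hprim⟩ := exists_isPrimitiveSolution hγ hΩ_open hΩ_reg M hr₀ hθ₀
  obtain ⟨L, hLf⟩ := exists_lipschitzFields (d := d) γ hA C'
  have hlogA := Real.log_nonneg hA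
  have hres : 0 ≤ residualConst d γ A C' := by rw [residualConst]; positivity
  refine ⟨residualConst d γ A C' + 1, by linarith, fun ρ_low E_up C₀ hρ_low hE_up hC₀ => ?_⟩
  obtain ⟨B₀, hB₀, hbdd⟩ := exists_stateBdd (d := d) hγ hγ2 (-(γ * log A)) hρ_low hE_up
  set B := max A B₀
  have hAB : A ≤ B := le_max_left _ _
  have hB : 1 ≤ B := hA.trans hAB
  obtain ⟨c₂, hc₂, hquad⟩ := exists_relEnergy_le (d := d) hγ hB
  set c := residualConst d γ A C' + 1
  have hc : 0 < c := by linarith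
  set R := Metric.diam (closure Ω)
  set e := 1 / (γ - 1) * B * (γ * log B)
  set v := volume.real Ω
  have hlogB := Real.log_nonneg hB
  have he : 0 ≤ e := by positivity
  have hv : 0 ≤ v := measureReal_nonneg
  have hE : 0 ≤ entropyConst γ B := by rw [entropyConst]; positivity
  have hD := dissipationConst_nonneg hγ hB
  set k := (d + 1) * L * (1 + entropyConst γ B) * (dissipationConst γ B *
    (2 * d * v + 2 * B * (1 + √R)))
  have hk : 0 ≤ k := by positivity
  refine ⟨c₂ * C₀ ^ 2 * √R + k * (1 / c + 2 * e * v) + 1, by positivity, ?_⟩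
  intro T hT ρ u η hstrong hW1 hlow 𝒯 U hU hinit hUb τ hτ hτT
  set X : SpaceTime d → State d := fun z => (ρ z, u z, temperatureOf γ (ρ z) (η z))
  have hX : IsPrimitiveSolution γ A C' T 𝒯 X := hprim T hT ρ u η hstrong hW1 hlow 𝒯
  have hL := fun K => hLf _ X (hX.lipschitz K) (hX.mem_box K)
  have h0 : (0 : ℝ) ∈ Icc 0 T := ⟨le_rfl, hT.le⟩
  have hτI : τ ∈ Icc 0 T := ⟨hτ.le, hτT⟩
  have hpos : ∀ t ∈ Icc 0 T, ∀ K, ∀ x ∈ 𝒯.cell K, 0 < ρ (t, x) := fun t ht K x hx =>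
    hstrong.density_pos _ ⟨ht, 𝒯.closedCell_subset K (𝒯.cell_subset_closedCell K hx)⟩
  have hst : ∀ t ∈ Icc 0 T, ∀ K, EqOn (fun x => stateOf γ (ρ (t, x)) (u (t, x)) (η (t, x)))
      (fun x => consOf γ (X (t, x))) (𝒯.cell K) := fun t ht K x hx =>
    stateOf_eq_consOf (hpos t ht K x hx).ne' _ _
  have hU' : IsGodunovSolution γ T 𝒯 (fun x => consOf γ (X (0, x))) U :=
    { hU with
      initial := fun K => by
        rw [hU.initial, RectMesh.proj, RectMesh.proj]
        exact setAverage_congr_fun (𝒯.isOpen_cell K).measurableSet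
          (Eventually.of_forall fun x hx => hst 0 h0 K hx) }
  have hS : ∀ t ∈ Icc 0 T, ∀ K, -(γ * log A) ≤ specEntropy γ (U t K) := fun t ht K =>
    hX.le_specEntropy hγ hγ2 hA hT.le hU' ht K
  have hb : ∀ t ∈ Icc 0 T, ∀ K, StateBdd γ B (U t K) := fun t ht K =>
    (hbdd _ (hU.physical t ht K) (hS t ht K) (hUb t ht K).1 (hUb t ht K).2.2).mono hB₀
      (le_max_right _ _)
  set h := 𝒯.size
  have hΩne := hΩ_conn.nonempty
  have hh : 0 < h := 𝒯.size_pos hd.1 hΩ_bdd hΩne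
  have hhR : √h ≤ √R := Real.sqrt_le_sqrt (𝒯.size_le hΩ_bdd hΩne)
  have hsq : √h * √h = h := Real.mul_self_sqrt hh.le
  have hvol : ∑ K, 𝒯.vol K = v := RectMesh.sum_vol hΩ_reg hΩ_bdd
  have hsh := Real.sqrt_nonneg h
  have hmain := hX.totalRelEnergy_le hγ hγ2 hA hB hL hU' hb hS hh
    (𝒯.side_le_size hΩ_bdd) hc (by linarith) (k := k * √h) (by
      rw [hvol]
      calc _ ≤ (d + 1) * L * (1 + entropyConst γ B) * (dissipationConst γ B *
            √h * (2 * d * v + 2 * B * (1 + √R))) := by gcongr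
        _ = _ := by ring) hτ.le hτT
  have hent : ∀ t ∈ Icc 0 T, |∑ K, 𝒯.vol K * entropy γ (U t K)| ≤ e * v := fun t ht => by
    rw [← hvol, Finset.mul_sum]
    refine (Finset.abs_sum_le_sum_abs _ _).trans (Finset.sum_le_sum fun K _ => ?_)
    rw [abs_mul, abs_of_pos (𝒯.vol_pos K), mul_comm]
    exact mul_le_mul_of_nonneg_right (abs_entropy_le hγ hB (hb t ht K)) (𝒯.vol_pos K).le
  have hinit' : 𝒯.totalRelEnergy γ X 0 (U 0) ≤ c₂ * (C₀ ^ 2 * h) := by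
    refine (hX.totalRelEnergy_le_setIntegral hγ hA hAB hΩ_reg hΩ_bdd hL h0 (hb 0 h0) hquad
      (hst 0 h0)).trans (mul_le_mul_of_nonneg_left ?_ hc₂)
    rw [← Real.sq_sqrt hh.le, ← mul_pow]
    exact Real.sqrt_le_left (by positivity) |>.1 hinit
  have hrel : ∀ K, EqOn (fun x => relativeEnergy γ (𝒯.pc (U τ) x).1 (𝒯.pc (U τ) x).2.1
      (entropy γ (𝒯.pc (U τ) x)) (ρ (τ, x)) (u (τ, x)) (η (τ, x)))
      (fun x => relEnergy γ (U τ K) (consOf γ (X (τ, x)))) (𝒯.cell K) := fun K x hx => by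
    simp only [𝒯.pc_eq (U τ) hx]
    rw [relativeEnergy_eq hγ (hU.physical τ hτI K) (hpos τ hτI K x hx)]
    exact congrArg _ (hst τ hτI K hx)
  have hcont := fun K => RectMesh.continuousOn_relEnergy hγ hA (hL K)
    (hX.lipschitz K).continuousOn (hX.mem_box K) hτI (U τ K)
  refine ⟨(RectMesh.setIntegral_of_eqOn hΩ_reg hΩ_bdd hcont hrel).1, ?_⟩
  rw [(RectMesh.setIntegral_of_eqOn hΩ_reg hΩ_bdd hcont fun K x hx => by
    refine (congrArg _ (hrel K hx)).trans ?_
    exact abs_of_nonneg (relEnergy_nonneg hγ (Or.inl (hU.physical τ hτI K)) (stateBdd_consOf hγ hA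
      (hX.mem_box K ⟨hτI, 𝒯.cell_subset_closedCell K hx⟩)).physical)).2,
    ← RectMesh.totalRelEnergy_eq_cellMean hγ hA hL hX.mem_box hτI]
  refine hmain.trans ?_
  rw [mul_comm _ (exp _), mul_assoc (exp _)]
  refine mul_le_mul_of_nonneg_left ?_ (Real.exp_pos _).le
  have t1 := abs_le.1 (hent τ hτI)
  have t2 := abs_le.1 (hent 0 h0)
  have t3 : k * √h * (1 / c + (∑ K, 𝒯.vol K * entropy γ (U τ K) -
      ∑ K, 𝒯.vol K * entropy γ (U 0 K))) ≤ k * √h * (1 / c + 2 * e * v) :=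
    mul_le_mul_of_nonneg_left (by linarith) (by positivity)
  have t4 : c₂ * (C₀ ^ 2 * h) ≤ c₂ * C₀ ^ 2 * √R * √h := by
    have := mul_le_mul_of_nonneg_left (mul_le_mul_of_nonneg_right hhR hsh)
      (show 0 ≤ c₂ * C₀ ^ 2 by positivity)
    rw [hsq] at this
    linarith
  linarith
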